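/- Let $m$ be normalized arclength on the unit circle $\mathbb T$. For a probability measure $\sigma$ on $\mathbb T$ write $d\sigma=\sigma'\,dm+d\sigma_s$ with $\sigma_s\perp m$, and say that $\sigma$ is in the Szegő class if $\int_{\mathbb T}\log\sigma'\,dm>-\infty$. Let $\phi_n$ be the orthonormal polynomials of $\sigma$ (of degree $n$, with positive leading coefficient), and $\phi_n^*(z)=z^n\overline{\phi_n(z)}$ for $z\in\mathbb T$. We say that the pointwise convergence assumption (PCA) holds for $\sigma$ if $\{\phi_n^*(z)\}_{n\ge 0}$ converges for Lebesgue-a.e. $z\in\mathbb T$. Let $$D(z)=\exp\Bigl(\tfrac12\int_{\mathbb T}\frac{w+z}{w-z}\log\sigma'(w)\,dm(w)\Bigr),\quad |z|<1,$$ be the Szegő function, which has boundary values $D(z)$ (radial limits) for $m$-a.e. $z\in\mathbb T$, and put $\Pi=D^{-1}\mathbb 1_{E}$, where $E\subset\mathbb T$ is any Borel set with $m(\mathbb T\setminus E)=0$ and $\sigma_s(E)=0$ (so $\Pi$ is determined $\sigma$-a.e.). Let $h\ge 0$ be a smooth function on $\mathbb R$ supported in $[-2\pi,2\pi]$ such that,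 with $z_j=e^{2\pi i j/\kappa}$, $\omega_0(e^{ix})=h(\kappa x)$ for $x\in(-\pi,\pi]$, and $\omega_j(z)=\omega_0(z/z_j)$, one has $\sum_{j=0}^{\kappa-1}\omega_j=1$ on $\mathbb T$ for all integers $\kappa\ge 2$. **Part 1.** Let $\sigma$ be a probability measure on $\mathbb T$ in the Szegő class for which the PCA holds. Then for every such $h$ and all complex numbers $f_{j,\kappa}$ ($0\le j\le\kappa-1$) with $\sup_{j,\kappa}|f_{j,\kappa}|<\infty$, $$\Bigl\|\sum_{j=0}^{\kappa-1}f_{j,\kappa}\,\phi^*_{\kappa^2+\kappa j}\,\omega_j-\Pi\sum_{j=0}^{\kappa-1}f_{j,\kappa}\,\omega_j\Bigr\|_{L^2(\sigma)}\longrightarrow 0,\qquad \kappa\to\infty.$$ **Part 2.** Let $J$ be a bounded self-adjoint Jacobi matrix on $\ell^2(\mathbb N)$ with off-diagonal entries $b_n>0$ and diagonal entries $v_n\in\mathbb R$, $\{b_n\},\{v_n\}\in\ell^\infty$, and let $\rho$ be its canonical spectral measure (the spectral measure of the first basis vector). Assume that $\rho$ is supported on $[-1,1]$, and let $\sigma$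 be the even measure on $\mathbb T$ with $\int f\,d\sigma=\int f(e^{i\arccos x})\,d\rho(x)$ for all $f\in C(\mathbb T)$ with $f(z)=f(1/z)$. Assume that $\sigma$ is in the Szegő class and that the PCA holds for $\sigma$. Let $J_0$ be the Jacobi matrix with $b_n=\tfrac12$, $v_n=0$. Then the strong limits $$\Omega_\pm=\lim_{T\to\pm\infty}e^{-iTJ}e^{iTJ_0}$$ exist on $\ell^2(\mathbb N)$, and $\mathrm{Ran}(\Omega_\pm)=\ell^2_{\rm ac}(\mathbb N)$, the set of vectors whose spectral measure relative to $J$ is absolutely continuous with respect to Lebesgue measure. -/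

import Mathlib

open MeasureTheory Filter Topology

/-! ### Measures on the unit circle -/

noncomputable instance instMeasurableSpaceCircle : MeasurableSpace Circle := borel Circle

instance instBorelSpaceCircle : BorelSpace Circle := ⟨rfl⟩

namespace WaveOPUC

/-- Normalized arclength measure `m` on the unit circle. -/
noncomputable def arcMeasure : Measure Circle :=
  (ENNReal.ofReal (2 * Real.pi))⁻¹ •
    (volume.restrict (Set.Ioc (-Real.pi) Real.pi)).map Circle.exp

/-- The density `σ'` of the absolutely continuous part of `σ` with respect to `m`. -/
noncomputable def acDensity (σ : Measure Circle) (z : Circle) : ℝ :=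
  (σ.rnDeriv arcMeasure z).toReal

/-- The Szegő condition `∫ log σ' dm > -∞`. Since `log⁺ σ'` is always integrable, this means that
`σ' > 0` almost everywhere (in Lean `log 0` is `0`, not `-∞`) and that `log σ'` is integrable. -/
structure SzegoClass (σ : Measure Circle) : Prop where
  density_pos : ∀ᵐ z ∂arcMeasure, 0 < acDensity σ z
  integrable_log : Integrable (fun z => Real.log (acDensity σ z)) arcMeasure

/-! ### Orthogonal polynomials -/

/-- The inner product `⟨p, q⟩_σ = ∫ p \bar q dσ` of two polynomials in `L²(σ)`. -/
noncomputable def polyInner (σ : Measure Circle) (p q : Polynomial ℂ) : ℂ :=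
  ∫ z : Circle, p.eval (z : ℂ) * (starRingEnd ℂ) (q.eval (z : ℂ)) ∂σ

/-- The monic orthogonal polynomials `Φ_n` of `σ`: Gram-Schmidt applied to `1, z, z², …`. -/
noncomputable def monicOP (σ : Measure Circle) (n : ℕ) : Polynomial ℂ :=
  Polynomial.X ^ n - ∑ k : Fin n,
    Polynomial.C (polyInner σ (Polynomial.X ^ n) (monicOP σ k) /
      polyInner σ (monicOP σ k) (monicOP σ k)) * monicOP σ k
termination_by n
decreasing_by all_goals exact k.2

/-- The orthonormal polynomials `φ_n = Φ_n / ‖Φ_n‖_{2,σ}`. -/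
noncomputable def orthonormalOP (σ : Measure Circle) (n : ℕ) : Polynomial ℂ :=
  Polynomial.C
    (((Real.sqrt (∫ z : Circle, ‖(monicOP σ n).eval (z : ℂ)‖ ^ 2 ∂σ))⁻¹ : ℝ) : ℂ) * monicOP σ n

/-- The reversed orthonormal polynomial `φ_n^*` on the circle: `φ_n^*(z) = z^n \bar{φ_n(z)}`. -/
noncomputable def phiStar (σ : Measure Circle) (n : ℕ) (z : Circle) : ℂ :=
  (z : ℂ) ^ n * (starRingEnd ℂ) ((orthonormalOP σ n).eval (z : ℂ))

/-- The pointwise convergence assumption: `φ_n^*(z)` converges for Lebesgue-a.e. `z` on the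
circle. -/
def PCA (σ : Measure Circle) : Prop :=
  ∀ᵐ z ∂arcMeasure, ∃ l : ℂ, Tendsto (fun n : ℕ => phiStar σ n z) atTop (𝓝 l)

/-! ### The Szegő function and the limit `Π` -/

/-- The Szegő function in the open unit disc. -/
noncomputable def szegoD (σ : Measure Circle) (z : ℂ) : ℂ :=
  Complex.exp ((1 / 2 : ℂ) *
    ∫ w : Circle, (((w : ℂ) + z) / ((w : ℂ) - z)) * ((Real.log (acDensity σ w) : ℝ) : ℂ)
      ∂arcMeasure)

/-- Boundary values of the Szegő function, as radial limits (these agree almost everywhere with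
the nontangential limits). -/
noncomputable def szegoBoundary (σ : Measure Circle) (z : Circle) : ℂ :=
  limUnder (𝓝[<] (1 : ℝ)) (fun r : ℝ => szegoD σ ((r : ℂ) * (z : ℂ)))

/-- `E` is a Borel set of full Lebesgue measure that is null for the singular part of `σ`, i.e. the
complement of a Lebesgue-null set carrying `σ_s`. Any two such sets agree up to a `σ`-null set. -/
structure IsACCarrier (σ : Measure Circle) (E : Set Circle) : Prop where
  measurableSet : MeasurableSet E
  compl_null : arcMeasure Eᶜ = 0
  singularPart_null : (σ.singularPart arcMeasure) E = 0

/-- `Π = D⁻¹ · 1_E`. -/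
noncomputable def szegoLimit (σ : Measure Circle) (E : Set Circle) (z : Circle) : ℂ :=
  E.indicator (fun w => (szegoBoundary σ w)⁻¹) z

/-! ### The partition of unity and the localized sums -/

/-- The bump `ω_j(z) = ω_0(z / z_j)` at scale `1/κ`, where `z_j = exp(2πij/κ)` and
`ω_0(e^{ix}) = h(κx)` for `x ∈ (-π, π]`. -/
noncomputable def bump (h : ℝ → ℝ) (κ j : ℕ) (z : Circle) : ℝ :=
  h (κ * Complex.arg ((z / Circle.exp (2 * Real.pi * j / κ) : Circle) : ℂ))

/-- A smooth nonnegative profile supported in `[-2π, 2π]` for which the bumps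
`ω_0, …, ω_{κ-1}` form a partition of unity on the circle. (For `κ = 1` the interval `[-2π, 2π]`
does not fit on the circle.) -/
structure IsProfile (h : ℝ → ℝ) : Prop where
  smooth : ContDiff ℝ (⊤ : ℕ∞) h
  nonneg : ∀ x, 0 ≤ h x
  support : tsupport h ⊆ Set.Icc (-(2 * Real.pi)) (2 * Real.pi)
  partition : ∀ κ : ℕ, 2 ≤ κ → ∀ z : Circle, ∑ j ∈ Finset.range κ, bump h κ j z = 1

/-- `Σ_κ = ∑_{j<κ} f_{j,κ} φ^*_{κ²+κj} ω_j`. -/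
noncomputable def localizedSum (σ : Measure Circle) (h : ℝ → ℝ) (f : ℕ → ℕ → ℂ) (κ : ℕ)
    (z : Circle) : ℂ :=
  ∑ j ∈ Finset.range κ, f j κ * phiStar σ (κ ^ 2 + κ * j) z * (bump h κ j z : ℂ)

/-- The localized convergence
`‖Σ_κ - Π ∑_{j<κ} f_{j,κ} ω_j‖_{2,σ} → 0` as `κ → ∞`. -/
def LocalizedConvergence (σ : Measure Circle) (E : Set Circle) (h : ℝ → ℝ)
    (f : ℕ → ℕ → ℂ) : Prop :=
  Tendsto (fun κ : ℕ => eLpNorm (fun z : Circle => localizedSum σ h f κ z -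
      szegoLimit σ E z * ∑ j ∈ Finset.range κ, f j κ * (bump h κ j z : ℂ)) 2 σ)
    atTop (𝓝 0)

/-! ### Jacobi matrices on `ℓ²` -/

/-- The Hilbert space `ℓ²`, with coordinates indexed from `0`. -/
abbrev L2Seq : Type := lp (fun _ : ℕ => ℂ) 2

theorem summable_normSq (ψ : L2Seq) : Summable fun n => ‖ψ n‖ ^ 2 := by
  have h := (lp.memℓp ψ).summable (by norm_num)
  simpa using h

theorem norm_sq_eq (ψ : L2Seq) : ‖ψ‖ ^ 2 = ∑' n, ‖ψ n‖ ^ 2 := by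
  have h := lp.norm_rpow_eq_tsum (p := 2) (by norm_num) ψ
  simpa using h

theorem mem_of_summable {x : ℕ → ℂ} (h : Summable fun n => ‖x n‖ ^ 2) :
    Memℓp (E := fun _ : ℕ => ℂ) x 2 := by
  apply memℓp_gen
  simpa using h

/-- The left shift `(Sψ)_n = ψ_{n+1}`. -/
noncomputable def leftShift : L2Seq →L[ℂ] L2Seq :=
  LinearMap.mkContinuous
    { toFun := fun ψ => ⟨fun n => ψ (n + 1),
        mem_of_summable ((summable_nat_add_iff 1).2 (summable_normSq ψ))⟩
      map_add' := fun _ _ => rfl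
      map_smul' := fun _ _ => rfl } 1 (by
    intro ψ
    rw [one_mul]
    refine le_of_sq_le_sq ?_ (norm_nonneg _)
    rw [norm_sq_eq, norm_sq_eq, (summable_normSq ψ).tsum_eq_zero_add]
    exact le_add_of_nonneg_left (by positivity))

@[simp] theorem leftShift_apply (ψ : L2Seq) (n : ℕ) : leftShift ψ n = ψ (n + 1) := rfl

theorem diag_bound {a : ℕ → ℝ} {C : ℝ} (hC : ∀ n, |a n| ≤ C) (ψ : L2Seq) (n : ℕ) :
    ‖(a n : ℂ) * ψ n‖ ^ 2 ≤ C ^ 2 * ‖ψ n‖ ^ 2 := by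
  rw [norm_mul, mul_pow, Complex.norm_real, Real.norm_eq_abs]
  have := hC n
  gcongr

/-- Multiplication by a bounded real sequence. -/
noncomputable def diagOp (a : ℕ → ℝ) (ha : ∃ C, ∀ n, |a n| ≤ C) : L2Seq →L[ℂ] L2Seq :=
  LinearMap.mkContinuousOfExistsBound
    { toFun := fun ψ => ⟨fun n => (a n : ℂ) * ψ n, mem_of_summable (by
        obtain ⟨C, hC⟩ := ha
        exact Summable.of_nonneg_of_le (fun n => by positivity) (diag_bound hC ψ)
          ((summable_normSq ψ).mul_left _))⟩
      map_add' := fun x y => by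
        ext n
        exact mul_add _ _ _
      map_smul' := fun c x => by
        ext n
        exact mul_left_comm _ _ _ } (by
    obtain ⟨C, hC⟩ := ha
    have hC0 : 0 ≤ C := (abs_nonneg _).trans (hC 0)
    refine ⟨C, fun ψ => ?_⟩
    refine le_of_sq_le_sq ?_ (mul_nonneg hC0 (norm_nonneg _))
    rw [mul_pow, norm_sq_eq, norm_sq_eq, ← tsum_mul_left]
    refine Summable.tsum_le_tsum (diag_bound hC ψ) ?_ ((summable_normSq ψ).mul_left _)
    exact Summable.of_nonneg_of_le (fun n => by positivity) (diag_bound hC ψ)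
          ((summable_normSq ψ).mul_left _))

@[simp] theorem diagOp_apply (a : ℕ → ℝ) (ha : ∃ C, ∀ n, |a n| ≤ C) (ψ : L2Seq) (n : ℕ) :
    diagOp a ha ψ n = (a n : ℂ) * ψ n := rfl

theorem inner_single_L2Seq (ψ : L2Seq) (n : ℕ) :
    inner ℂ (lp.single 2 n (1 : ℂ) : L2Seq) ψ = ψ n := by
  rw [lp.inner_single_left]
  simp

theorem adjoint_leftShift_zero (ψ : L2Seq) :
    ContinuousLinearMap.adjoint leftShift ψ 0 = 0 := by
  have h : leftShift (lp.single 2 0 (1 : ℂ) : L2Seq) = 0 := by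
    ext n
    rw [leftShift_apply, lp.single_apply_ne _ _ _ (Nat.succ_ne_zero n)]
    rfl
  rw [← inner_single_L2Seq, ContinuousLinearMap.adjoint_inner_right, h, inner_zero_left]

theorem adjoint_leftShift_succ (ψ : L2Seq) (n : ℕ) :
    ContinuousLinearMap.adjoint leftShift ψ (n + 1) = ψ n := by
  have h : leftShift (lp.single 2 (n + 1) (1 : ℂ) : L2Seq) = lp.single 2 n (1 : ℂ) := by
    ext k
    rw [leftShift_apply]
    by_cases hk : k = n
    · subst hk
      rw [lp.single_apply_self, lp.single_apply_self]
    · rw [lp.single_apply_ne _ _ _ hk, lp.single_apply_ne _ _ _ (by omega)]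
  rw [← inner_single_L2Seq, ContinuousLinearMap.adjoint_inner_right, h, inner_single_L2Seq]

/-- Bounded Jacobi coefficients: `b n`, `v n` here are the entries `b_{n+1}`, `v_{n+1}` of the
matrix whose rows are counted from `1`. -/
structure JacobiParams where
  b : ℕ → ℝ
  v : ℕ → ℝ
  b_pos : ∀ n, 0 < b n
  b_bdd : ∃ C, ∀ n, |b n| ≤ C
  v_bdd : ∃ C, ∀ n, |v n| ≤ C

/-- The bounded operator on `ℓ²` given by the Jacobi matrix,
`(Jψ)_n = b_n ψ_{n+1} + v_n ψ_n + b_{n-1} ψ_{n-1}`. -/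
noncomputable def JacobiParams.op (J : JacobiParams) : L2Seq →L[ℂ] L2Seq :=
  diagOp J.b J.b_bdd ∘L leftShift + diagOp J.v J.v_bdd +
    ContinuousLinearMap.adjoint leftShift ∘L diagOp J.b J.b_bdd

theorem JacobiParams.op_apply_zero (J : JacobiParams) (ψ : L2Seq) :
    J.op ψ 0 = J.b 0 * ψ 1 + J.v 0 * ψ 0 := by
  simp [JacobiParams.op, adjoint_leftShift_zero]

theorem JacobiParams.op_apply_succ (J : JacobiParams) (ψ : L2Seq) (n : ℕ) :
    J.op ψ (n + 1) = J.b (n + 1) * ψ (n + 2) + J.v (n + 1) * ψ (n + 1) + J.b n * ψ n := by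
  simp [JacobiParams.op, adjoint_leftShift_succ]

theorem adjoint_diagOp (a : ℕ → ℝ) (ha : ∃ C, ∀ n, |a n| ≤ C) :
    ContinuousLinearMap.adjoint (diagOp a ha) = diagOp a ha := by
  symm
  rw [ContinuousLinearMap.eq_adjoint_iff]
  intro x y
  rw [lp.inner_eq_tsum, lp.inner_eq_tsum]
  congr 1
  ext n
  simp
  ring

theorem JacobiParams.op_isSelfAdjoint (J : JacobiParams) : IsSelfAdjoint J.op := by
  rw [ContinuousLinearMap.isSelfAdjoint_iff']
  simp only [JacobiParams.op, map_add, ContinuousLinearMap.adjoint_comp, adjoint_diagOp,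
    ContinuousLinearMap.adjoint_adjoint]
  abel

/-- The free Jacobi matrix `J_0`: `b_n = 1/2`, `v_n = 0`. -/
noncomputable def freeJacobi : JacobiParams where
  b := fun _ => 1 / 2
  v := fun _ => 0
  b_pos := fun _ => by norm_num
  b_bdd := ⟨1 / 2, fun _ => by norm_num [abs_of_pos]⟩
  v_bdd := ⟨0, fun _ => by norm_num⟩

/-- The first basis vector of `ℓ²`. -/
noncomputable def firstVector : L2Seq := lp.single 2 0 (1 : ℂ)

/-! ### Spectral measures -/

/-- The positive functional `f ↦ ⟨ψ, f(A)ψ⟩` on `C_c(ℝ)`. -/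
noncomputable def spectralFunctional {H : Type*} [NormedAddCommGroup H] [InnerProductSpace ℂ H] [CompleteSpace H]
    (A : H →L[ℂ] H) (ψ : H) :
    PositiveLinearMap ℝ (CompactlySupportedContinuousMap ℝ ℝ) ℝ :=
  PositiveLinearMap.mk₀
    { toFun := fun f => (inner ℂ ψ (cfc (f : ℝ → ℝ) A ψ)).re
      map_add' := fun f g => by
        have h := cfc_add (R := ℝ) (p := IsSelfAdjoint) A f g
          f.continuous.continuousOn g.continuous.continuousOn
        simp only [CompactlySupportedContinuousMap.coe_add]
        rw [show ((f : ℝ → ℝ) + (g : ℝ → ℝ)) = fun x => f x + g x from rfl, h]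
        simp
      map_smul' := fun c f => by
        have h := cfc_smul (R := ℝ) (p := IsSelfAdjoint) c (f : ℝ → ℝ) A
          f.continuous.continuousOn
        simp only [CompactlySupportedContinuousMap.coe_smul]
        rw [show (c • (f : ℝ → ℝ)) = fun x => c • f x from rfl, h]
        simp [inner_smul_right_eq_smul] }
    (fun f hf => by
      have h : 0 ≤ cfc (f : ℝ → ℝ) A := cfc_nonneg fun x _ => hf x
      rw [ContinuousLinearMap.nonneg_iff_isPositive] at h
      exact (RCLike.nonneg_iff.1 (h.inner_nonneg_right ψ)).1)

/-- The spectral measure `μ_ψ` of the vector `ψ` relative to a bounded self-adjoint operator `A`: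
the measure on `ℝ` with `∫ f dμ_ψ = ⟨ψ, f(A)ψ⟩`. -/
noncomputable def spectralMeasure {H : Type*} [NormedAddCommGroup H] [InnerProductSpace ℂ H] [CompleteSpace H]
    (A : H →L[ℂ] H) (ψ : H) : Measure ℝ :=
  RealRMK.rieszMeasure (spectralFunctional A ψ)

theorem integral_spectralMeasure {H : Type*} [NormedAddCommGroup H] [InnerProductSpace ℂ H] [CompleteSpace H]
    (A : H →L[ℂ] H) (ψ : H)
    (f : CompactlySupportedContinuousMap ℝ ℝ) :
    ∫ x, f x ∂(spectralMeasure A ψ) = (inner ℂ ψ (cfc (f : ℝ → ℝ) A ψ)).re :=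
  RealRMK.integral_rieszMeasure _ f

/-- The canonical spectral measure `ρ` of a Jacobi matrix. -/
noncomputable def JacobiParams.rho (J : JacobiParams) : Measure ℝ :=
  spectralMeasure J.op firstVector

/-- The even measure on the circle related to a measure `ρ` on `[-1,1]` by the Szegő mapping: half
the sum of the images of `ρ` under `x ↦ e^{± i arccos x}`. -/
noncomputable def szegoInv (ρ : Measure ℝ) : Measure Circle :=
  (2 : ENNReal)⁻¹ • (ρ.map (fun x => Circle.exp (Real.arccos x)) +
    ρ.map (fun x => Circle.exp (-Real.arccos x)))

/-- The absolutely continuous subspace of a bounded self-adjoint operator. -/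
def acSubspace (A : L2Seq →L[ℂ] L2Seq) : Set L2Seq :=
  {ψ | spectralMeasure A ψ ≪ (volume : Measure ℝ)}

/-! ### Wave operators -/

/-- The unitary group `e^{itA}`. -/
noncomputable def evolution (A : L2Seq →L[ℂ] L2Seq) (t : ℝ) : L2Seq →L[ℂ] L2Seq :=
  NormedSpace.exp ((Complex.I * (t : ℂ)) • A)

/-- `Ω` is the strong limit of `e^{-iTA} e^{iTA_0}` along the filter `l` (`T → +∞` or
`T → -∞`). -/
def IsWaveOperator (A A₀ : L2Seq →L[ℂ] L2Seq) (l : Filter ℝ) (Ω : L2Seq →L[ℂ] L2Seq) : Prop :=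
  ∀ ψ : L2Seq, Tendsto (fun T : ℝ => evolution A (-T) (evolution A₀ T ψ)) l (𝓝 (Ω ψ))

end WaveOPUC

/-!
# Localized convergence of the reversed polynomials, and wave operators of Jacobi matrices

Write `φ_n^*` for the reversed orthonormal polynomials of `σ` and `λ_n = φ_n^*(0)` for the leading
coefficient of `φ_n`. Everything rests on the monotonicity of `λ_n` and two relations: the
functions `z^k φ_N^*` and `z^l φ_n^*` are orthogonal when `0 < l - k ≤ N - n`, and
`‖φ_N^* - φ_n^*‖² = 2 (1 - λ_n / λ_N)`. In the Szegő class `λ_n` is bounded (`lam_mul_exp_le`), so its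
increments telescope to something small, and `φ_n^*` converges in `L²(σ)` to some `Ψ`; moreover
`|Ψ|² dσ = dm` (`withDensity_limit`), because the moments of `|φ_n|² dσ` tend to those of `dm`.

*Identification of the limit.* `D` has boundary values in `L²(m)` with `|D|² = σ'`
(`exists_outer_boundary`, by Fatou's theorem for the Poisson kernel). On one side, `φ_n^* D` is
analytic with `φ_n^*(0) D(0) = λ_n D(0) ≤ 1`; on the other side `σ' Ψ` pairs with outer functions to
give `lim λ_n D(0) ≥ 1` (`one_le_limit_mul_exp`). Hence `Ψ D` is unimodular with mean `1`, so `Ψ D = 1`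
almost everywhere, and `Ψ` is `Π` (`szegoLimit_ae_eq`).

*Localized convergence.* Let `n_j = κ² + κ j`. The moments of `|φ_n|² dσ - dm` are bounded by
increments of `λ`, and summed over `j` against the rapidly decaying Fourier coefficients of the bumps
these telescope, so `∑_j ∫ ω_j |φ_{n_j}|² dσ → 1` (`tendsto_sum_integral_bump`). Pointwise convergence
and Fatou's lemma give `liminf ∑_j ∫ ω_j |φ_{n_j}^* + Ψ|² dσ ≥ 4`, and the parallelogram law turns the
two facts into `∑_j ∫ ω_j |φ_{n_j}^* - Ψ|² dσ → 0` (`tendsto_integral_bump_sub`). Bounded coefficients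
are then inserted by the Cauchy–Schwarz inequality (`localizedConvergence`).

*The spectral representation.* The polynomials of `J`, read as functions of `Re z`, form an orthonormal
system in `L²(σ)`, which gives an isometry `U` that takes `J` to multiplication by `Re z`. Geronimus'
relation `p_n(Re z) = c_n (h_n + conj h_n)`, with the orthonormal system `h_n = z^{-n} φ_{2n}^*` and
`c_n → 1 / √2`, writes `U = W c + conj W c`, where `W` is the isometry `e_n ↦ h_n`
(`IsTransform.exists_decomposition`). The free evolution is multiplication by `e^{iT Re z}` on odd
functions of `L²(m)`, and tends weakly to zero, so that `c` may be replaced by its limit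
(`tendsto_diagOp_sub`). What remains is the action of `W` on the nonpositive Fourier coefficients of
`e^{iT Re z} F`, and the key fact is that this is asymptotically `Ψ e^{iT Re z} F 1_{T Im z > 0}`
(`HalfModel.tendsto_half_sub`).

*The key fact.* By density, `F` may be a smooth function on an arc on which `Re z` and `Im z` do not
vanish. The coefficients of `e^{iT Re z} F` are `O(|T|^{-1/2})` by the second derivative test, and
concentrate at frequencies between multiples of `|T|` by the first. On the side where the phase
velocity is negative they disappear. On the other side, cut the frequencies into blocks of length about
`|T|^{1/2}` and replace `φ_{2l}^*` in each block by a single `φ_{2kL}^*`. The errors of well separated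
blocks are orthogonal, and each is bounded by an increment of `λ`, so together they are small
(`norm_sum_blockError_sq_le`). Next `φ_{2kL}^*` is replaced by `Ψ`, which is legitimate off a set `A`
of small measure by Egorov's theorem (`exists_uniform_set`) once `∑_k |G_k|`, the sum of the moduli of
the blocks, is bounded in `L²(m)`: this holds because `T Im z - M`, with `M` the position operator,
applied to `e^{iT Re z} F` only differentiates `F`, so that `G_k` lives where `T Im z ≈ kL`
(`integral_sum_norm_blockPoly_sq_le`). On `A` nothing can be gained or lost, since `W` is an isometry
and the target has small norm there (`norm_sub_sq_le_of_indL2`).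

*Existence and completeness.* It follows that `U e^{-iTJ} e^{iTJ₀} ψ` converges
(`HalfModel.tendsto_transform`) to the explicit limit `waveLimit`. The set `{Ψ = 0}` carries the singular
part of `σ`, and a vector belongs to the absolutely continuous subspace exactly when its transform
vanishes there (`HalfModel.mem_acSubspace_iff`); this holds for `waveLimit`. Conversely, an even function
that vanishes on `{Ψ = 0}` and is orthogonal to all the limits is zero, since an odd function is
determined by its restriction to a half circle (`eq_zero_of_inner_waveLimit`).
-/

namespace WaveOPUC

/-! ### The circle: arclength, monomials, uniqueness -/

theorem arg_exp_of_mem {t : ℝ} (ht : t ∈ Set.Ioc (-Real.pi) Real.pi) :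
    Complex.arg (Circle.exp t : ℂ) = t := Circle.arg_exp ht.1 ht.2

instance isProbabilityMeasure_arcMeasure : IsProbabilityMeasure arcMeasure := by
  constructor
  have hpi : (0 : ℝ) < 2 * Real.pi := by positivity
  rw [arcMeasure, Measure.smul_apply, Measure.map_apply Circle.exp.continuous.measurable
    MeasurableSet.univ, Set.preimage_univ, Measure.restrict_apply_univ, Real.volume_Ioc,
    sub_neg_eq_add, ← two_mul, smul_eq_mul]
  exact ENNReal.inv_mul_cancel (by simpa using hpi) ENNReal.ofReal_ne_top

theorem integral_arcMeasure {E : Type*} [NormedAddCommGroup E] [NormedSpace ℝ E] {F : Circle → E}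
    (hF : AEStronglyMeasurable F arcMeasure) :
    ∫ z, F z ∂arcMeasure =
      (2 * Real.pi)⁻¹ • ∫ t in (-Real.pi)..Real.pi, F (Circle.exp t) := by
  have hpi : (0 : ℝ) < 2 * Real.pi := by positivity
  have hF' : AEStronglyMeasurable F
      ((volume.restrict (Set.Ioc (-Real.pi) Real.pi)).map Circle.exp) := by
    obtain ⟨g, hg, hFg⟩ := hF
    exact ⟨g, hg, (Measure.ae_ennreal_smul_measure_iff (by simp [ENNReal.mul_eq_top])).1 hFg⟩
  rw [arcMeasure, integral_smul_measure, integral_map Circle.exp.continuous.measurable.aemeasurable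
    hF', intervalIntegral.integral_of_le (by linarith)]
  congr 1
  rw [ENNReal.toReal_inv, ENNReal.toReal_ofReal hpi.le]

theorem ae_arcMeasure_iff {P : Circle → Prop} :
    (∀ᵐ z ∂arcMeasure, P z) ↔
      ∀ᵐ t ∂(volume.restrict (Set.Ioc (-Real.pi) Real.pi)), P (Circle.exp t) := by
  have h0 : (ENNReal.ofReal (2 * Real.pi))⁻¹ ≠ 0 := by simp [ENNReal.mul_eq_top]
  have hexp := Circle.exp.continuous.measurable
  rw [arcMeasure, Measure.ae_ennreal_smul_measure_iff h0]
  refine ⟨fun h => ae_of_ae_map hexp.aemeasurable h, fun h => ?_⟩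
  obtain ⟨M, hM, hMm, hM0⟩ := exists_measurable_superset_of_null (ae_iff.1 h)
  have harg : Measurable fun z : Circle => Complex.arg (z : ℂ) :=
    Complex.measurable_arg.comp
      (by fun_prop : Continuous fun z : Circle => (z : ℂ)).measurable
  have hset : MeasurableSet {z : Circle | Complex.arg (z : ℂ) ∈ Mᶜ} := harg hMm.compl
  have h1 : ∀ᵐ z : Circle ∂((volume.restrict (Set.Ioc (-Real.pi) Real.pi)).map Circle.exp),
      Complex.arg (z : ℂ) ∈ Mᶜ := by
    rw [ae_map_iff hexp.aemeasurable hset]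
    have h2 : ∀ᵐ t ∂(volume.restrict (Set.Ioc (-Real.pi) Real.pi)), t ∈ Mᶜ := by
      rw [ae_iff]; simpa using hM0
    filter_upwards [h2, ae_restrict_mem measurableSet_Ioc] with t ht ht'
    rw [arg_exp_of_mem ht']
    exact ht
  filter_upwards [h1] with z hz
  by_contra hP
  apply hz
  apply hM
  simpa [Circle.exp_arg] using hP

theorem integrable_arcMeasure_iff {E : Type*} [NormedAddCommGroup E] {F : Circle → E}
    (hF : AEStronglyMeasurable F arcMeasure) :
    Integrable F arcMeasure ↔
      IntervalIntegrable (fun t => F (Circle.exp t)) volume (-Real.pi) Real.pi := by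
  have hpi : (0 : ℝ) < 2 * Real.pi := by positivity
  have hF' : AEStronglyMeasurable F
      ((volume.restrict (Set.Ioc (-Real.pi) Real.pi)).map Circle.exp) := by
    obtain ⟨g, hg, hFg⟩ := hF
    exact ⟨g, hg, (Measure.ae_ennreal_smul_measure_iff (by simp [ENNReal.mul_eq_top])).1 hFg⟩
  rw [arcMeasure, integrable_smul_measure (by simp [ENNReal.mul_eq_top]) (by simpa using hpi),
    integrable_map_measure hF' Circle.exp.continuous.measurable.aemeasurable,
    intervalIntegrable_iff_integrableOn_Ioc_of_le (by linarith)]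
  rfl

/-- The monomial `z ↦ z ^ n`, `n ∈ ℤ`, as a continuous function on the circle. -/
noncomputable def mono (n : ℤ) : C(Circle, ℂ) :=
  ⟨fun z => ((z ^ n : Circle) : ℂ), continuous_induced_dom.comp (continuous_zpow n)⟩

@[simp] theorem mono_apply (n : ℤ) (z : Circle) : mono n z = (z : ℂ) ^ n := by
  simp [mono]

theorem mono_exp (n : ℤ) (t : ℝ) :
    mono n (Circle.exp t) = Complex.exp (n * t * Complex.I) := by
  rw [mono_apply, Circle.coe_exp, ← Complex.exp_int_mul, mul_assoc]

theorem conj_coe_circle (z : Circle) : (starRingEnd ℂ) (z : ℂ) = (z : ℂ)⁻¹ := by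
  rw [← Circle.coe_inv_eq_conj, Circle.coe_inv]

theorem norm_zpow_circle (z : Circle) (n : ℤ) : ‖(z : ℂ) ^ n‖ = 1 := by
  rw [norm_zpow, Circle.norm_coe, one_zpow]

theorem integral_zpow_arcMeasure (n : ℤ) :
    ∫ z : Circle, (z : ℂ) ^ n ∂arcMeasure = if n = 0 then 1 else 0 := by
  have h : ∀ z : Circle, (z : ℂ) ^ n = mono n z := fun z => (mono_apply n z).symm
  simp_rw [h]
  rw [integral_arcMeasure (mono n).continuous.aestronglyMeasurable]
  simp_rw [mono_exp]
  split_ifs with hn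
  · subst hn
    have : (Real.pi : ℂ) ≠ 0 := by exact_mod_cast Real.pi_ne_zero
    simp
    field_simp
    ring
  · have hc : (n : ℂ) * Complex.I ≠ 0 := by simp [hn]
    have := integral_exp_mul_complex (a := -Real.pi) (b := Real.pi) hc
    have e : ∀ t : ℝ, Complex.exp (n * t * Complex.I) = Complex.exp (n * Complex.I * t) := by
      intro t; ring_nf
    simp_rw [e]
    rw [this]
    have e2 : Complex.exp (n * Complex.I * (Real.pi : ℝ)) =
        Complex.exp (n * Complex.I * ((-Real.pi : ℝ) : ℂ)) := by
      rw [Complex.exp_eq_exp_iff_exists_int]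
      exact ⟨n, by push_cast; ring⟩
    rw [e2]; simp

theorem adjoin_mono_eq_span :
    Subalgebra.toSubmodule (Algebra.adjoin ℂ (Set.range mono)) =
      Submodule.span ℂ (Set.range mono) := by
  apply Algebra.adjoin_eq_span_of_subset
  refine Set.Subset.trans ?_ Submodule.subset_span
  intro x hx
  refine Submonoid.closure_induction (fun _ => id) ⟨0, by ext; simp⟩ ?_ hx
  rintro _ _ _ _ ⟨m, rfl⟩ ⟨n, rfl⟩
  refine ⟨m + n, ?_⟩
  ext z
  simp [zpow_add₀ (Circle.coe_ne_zero z)]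

/-- The algebra of trigonometric polynomials. -/
noncomputable def trigAlgebra : StarSubalgebra ℂ C(Circle, ℂ) where
  toSubalgebra := Algebra.adjoin ℂ (Set.range mono)
  star_mem' := by
    change Algebra.adjoin ℂ (Set.range mono) ≤ star (Algebra.adjoin ℂ (Set.range mono))
    refine Algebra.adjoin_le ?_
    rintro - ⟨n, rfl⟩
    refine Algebra.subset_adjoin ⟨-n, ?_⟩
    ext z
    simp [conj_coe_circle]

theorem span_mono_topologicalClosure :
    (Submodule.span ℂ (Set.range mono)).topologicalClosure = ⊤ := by
  rw [← adjoin_mono_eq_span]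
  have h : trigAlgebra.topologicalClosure = ⊤ := by
    apply ContinuousMap.starSubalgebra_topologicalClosure_eq_top_of_separatesPoints
    intro x y hxy
    refine ⟨_, ⟨mono 1, Algebra.subset_adjoin ⟨1, rfl⟩, rfl⟩, ?_⟩
    simpa [Circle.coe_inj] using hxy
  exact congr_arg (fun A : StarSubalgebra ℂ C(Circle, ℂ) => Subalgebra.toSubmodule A.toSubalgebra) h

theorem continuousLinearMap_eq_of_mono {F : Type*} [NormedAddCommGroup F] [NormedSpace ℂ F]
    {Λ Λ' : C(Circle, ℂ) →L[ℂ] F} (h : ∀ n, Λ (mono n) = Λ' (mono n)) : Λ = Λ' := by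
  have hd : Dense ((Submodule.span ℂ (Set.range mono) : Submodule ℂ _) : Set C(Circle, ℂ)) := by
    rw [Submodule.dense_iff_topologicalClosure_eq_top]
    exact span_mono_topologicalClosure
  exact ContinuousLinearMap.ext_on hd (by rintro _ ⟨n, rfl⟩; exact h n)

theorem integrable_of_continuous (μ : Measure Circle) [IsFiniteMeasure μ] {E : Type*}
    [NormedAddCommGroup E] {f : Circle → E} (hf : Continuous f) : Integrable f μ :=
  hf.integrable_of_hasCompactSupport (HasCompactSupport.of_compactSpace f)

/-- Integration against a finite measure, as a bounded functional on continuous functions. -/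
noncomputable def integralCLM (μ : Measure Circle) [IsFiniteMeasure μ] : C(Circle, ℂ) →L[ℂ] ℂ :=
  LinearMap.mkContinuous
    { toFun := fun f => ∫ z, f z ∂μ
      map_add' := fun f g => integral_add (integrable_of_continuous μ f.continuous)
        (integrable_of_continuous μ g.continuous)
      map_smul' := fun c f => integral_const_mul c _ } (μ.real Set.univ) (fun f => by
    rw [mul_comm]
    exact norm_integral_le_of_norm_le_const (.of_forall fun z => f.norm_coe_le_norm z))

/-- A finite measure on the circle is determined by its moments. -/
theorem measure_ext_of_moments {μ ν : Measure Circle} [IsFiniteMeasure μ] [IsFiniteMeasure ν]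
    (h : ∀ n : ℤ, ∫ z : Circle, (z : ℂ) ^ n ∂μ = ∫ z : Circle, (z : ℂ) ^ n ∂ν) : μ = ν := by
  have hΛ : integralCLM μ = integralCLM ν := continuousLinearMap_eq_of_mono fun n => by
    simpa [integralCLM] using h n
  apply ext_of_forall_integral_eq_of_IsFiniteMeasure
  intro f
  have h1 := DFunLike.congr_fun hΛ ⟨fun z => ((f z : ℝ) : ℂ), by fun_prop⟩
  simp only [integralCLM, LinearMap.mkContinuous_apply, LinearMap.coe_mk, AddHom.coe_mk,
    ContinuousMap.coe_mk] at h1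
  have h2 := integral_ofReal (𝕜 := ℂ) (μ := μ) (f := f)
  have h3 := integral_ofReal (𝕜 := ℂ) (μ := ν) (f := f)
  exact Complex.ofReal_injective (h2.symm.trans (h1.trans h3))

/-- The class of a continuous function in `L²(μ)`. -/
noncomputable def cL2 (μ : Measure Circle) [IsFiniteMeasure μ] : C(Circle, ℂ) →L[ℂ] Lp ℂ 2 μ :=
  ContinuousMap.toLp (E := ℂ) 2 μ ℂ

theorem coeFn_cL2 (μ : Measure Circle) [IsFiniteMeasure μ] (f : C(Circle, ℂ)) :
    cL2 μ f =ᵐ[μ] f := ContinuousMap.coeFn_toLp _ _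

theorem inner_cL2 (μ : Measure Circle) [IsFiniteMeasure μ] (f g : C(Circle, ℂ)) :
    inner ℂ (cL2 μ f) (cL2 μ g) = ∫ z, g z * (starRingEnd ℂ) (f z) ∂μ :=
  ContinuousMap.inner_toLp μ f g

theorem inner_cL2_left (μ : Measure Circle) [IsFiniteMeasure μ] (f : C(Circle, ℂ))
    (G : Lp ℂ 2 μ) : inner ℂ (cL2 μ f) G = ∫ z, G z * (starRingEnd ℂ) (f z) ∂μ := by
  rw [L2.inner_def]
  apply integral_congr_ae
  filter_upwards [coeFn_cL2 μ f] with z hz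
  simp [hz]

/-- Trigonometric monomials are complete in `L²(μ)`. -/
theorem L2_eq_zero_of_moments {μ : Measure Circle} [IsFiniteMeasure μ] {G : Lp ℂ 2 μ}
    (h : ∀ n, inner ℂ (cL2 μ (mono n)) G = 0) : G = 0 := by
  have hΛ : (innerSL ℂ G).comp (cL2 μ) = 0 := continuousLinearMap_eq_of_mono fun n => by
    have := h n
    rw [inner_eq_zero_symm] at this
    simpa using this
  have hd : DenseRange (cL2 μ) :=
    ContinuousMap.toLp_denseRange ℂ μ ℂ (p := 2) (by norm_num)
  have h2 : innerSL ℂ G = 0 := by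
    apply DFunLike.coe_injective
    refine hd.equalizer (innerSL ℂ G).continuous continuous_const (funext fun f => ?_)
    simpa using DFunLike.congr_fun hΛ f
  have h3 := DFunLike.congr_fun h2 G
  simpa using h3

theorem orthonormal_mono : Orthonormal ℂ fun n : ℤ => cL2 arcMeasure (mono n) := by
  rw [orthonormal_iff_ite]
  intro i j
  rw [inner_cL2]
  have : ∀ z : Circle, mono j z * (starRingEnd ℂ) (mono i z) = (z : ℂ) ^ (j - i) := by
    intro z
    simp [conj_coe_circle, zpow_sub₀ (Circle.coe_ne_zero z), div_eq_mul_inv]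
  simp_rw [this]
  rw [integral_zpow_arcMeasure]
  simp only [sub_eq_zero, eq_comm]

/-! ### Orthogonal polynomials on the circle -/

/-- A polynomial as a continuous function on the circle. -/
noncomputable def polyC : Polynomial ℂ →ₗ[ℂ] C(Circle, ℂ) where
  toFun p := ⟨fun z => p.eval (z : ℂ), by fun_prop⟩
  map_add' p q := by ext; simp
  map_smul' c p := by ext; simp

@[simp] theorem polyC_apply (p : Polynomial ℂ) (z : Circle) : polyC p z = p.eval (z : ℂ) := rfl

theorem polyC_X_pow (n : ℕ) : polyC (Polynomial.X ^ n) = mono n := by ext; simp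

variable {σ : Measure Circle}

theorem polyInner_eq_inner [IsFiniteMeasure σ] (p q : Polynomial ℂ) :
    polyInner σ p q = inner ℂ (cL2 σ (polyC q)) (cL2 σ (polyC p)) := by
  rw [inner_cL2]; rfl

theorem norm_cL2_sq [IsFiniteMeasure σ] (f : C(Circle, ℂ)) :
    ‖cL2 σ f‖ ^ 2 = ∫ z, ‖f z‖ ^ 2 ∂σ := by
  have h := inner_self_eq_norm_sq_to_K (𝕜 := ℂ) (cL2 σ f)
  rw [inner_cL2] at h
  have h2 : ∀ z, f z * (starRingEnd ℂ) (f z) = ((‖f z‖ ^ 2 : ℝ) : ℂ) := by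
    intro z; rw [Complex.mul_conj, Complex.normSq_eq_norm_sq]
  simp_rw [h2] at h
  have h3 := integral_ofReal (𝕜 := ℂ) (μ := σ) (f := fun z => ‖f z‖ ^ 2)
  have h4 := h3.symm.trans h
  apply Complex.ofReal_injective
  rw [← Complex.coe_algebraMap] at *
  simpa using h4.symm

/-- The measure is not supported on a finite set: nonzero polynomials have nonzero norm. -/
def NonDegenerate (σ : Measure Circle) : Prop :=
  ∀ p : Polynomial ℂ, p ≠ 0 → 0 < ∫ z : Circle, ‖p.eval (z : ℂ)‖ ^ 2 ∂σ

theorem NonDegenerate.inner_self_ne_zero [IsFiniteMeasure σ] (hσ : NonDegenerate σ)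
    {p : Polynomial ℂ} (hp : p ≠ 0) : polyInner σ p p ≠ 0 := by
  rw [polyInner_eq_inner, inner_self_eq_norm_sq_to_K]
  have h := hσ p hp
  have h2 := norm_cL2_sq (σ := σ) (polyC p)
  simp only [polyC_apply] at h2
  rw [← h2] at h
  have h3 : ‖cL2 σ (polyC p)‖ ≠ 0 := by
    intro h0; simp [h0] at h
  exact pow_ne_zero 2 (RCLike.ofReal_ne_zero.2 h3)

theorem monicOP_sub_degree_lt (n : ℕ)
    (h : ∀ k < n, (monicOP σ k).degree = k) :
    (∑ k : Fin n,
    Polynomial.C (polyInner σ (Polynomial.X ^ n) (monicOP σ k) /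
      polyInner σ (monicOP σ k) (monicOP σ k)) * monicOP σ k).degree < n := by
  refine lt_of_le_of_lt (Polynomial.degree_sum_le _ _) ?_
  refine (Finset.sup_lt_iff (WithBot.bot_lt_coe n)).2 ?_
  intro k _
  rw [Polynomial.C_mul']
  refine lt_of_le_of_lt (Polynomial.degree_smul_le _ _) ?_
  rw [h k k.2]
  exact Nat.cast_lt.2 k.2

theorem monicOP_spec (σ : Measure Circle) (n : ℕ) :
    (monicOP σ n).Monic ∧ (monicOP σ n).degree = n := by
  induction n using Nat.strong_induction_on with
  | _ n ih =>
    have h := monicOP_sub_degree_lt (σ := σ) n fun k hk => (ih k hk).2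
    rw [monicOP]
    have h' := h.trans_eq (Polynomial.degree_X_pow (R := ℂ) n).symm
    exact ⟨(Polynomial.monic_X_pow n).sub_of_left h',
      (Polynomial.degree_sub_eq_left_of_degree_lt h').trans (Polynomial.degree_X_pow n)⟩

theorem monicOP_ne_zero (n : ℕ) : monicOP σ n ≠ 0 := (monicOP_spec σ n).1.ne_zero

theorem polyInner_conj [IsFiniteMeasure σ] (p q : Polynomial ℂ) :
    (starRingEnd ℂ) (polyInner σ p q) = polyInner σ q p := by
  rw [polyInner_eq_inner, polyInner_eq_inner, inner_conj_symm]

theorem polyInner_monicOP_of_lt [IsFiniteMeasure σ] (hσ : NonDegenerate σ) (n : ℕ) :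
    ∀ k < n, polyInner σ (monicOP σ n) (monicOP σ k) = 0 := by
  induction n using Nat.strong_induction_on with
  | _ n ih =>
    intro k hk
    have hne : ∀ i < n, i ≠ k → polyInner σ (monicOP σ i) (monicOP σ k) = 0 := by
      intro i hi hik
      rcases lt_or_gt_of_ne hik with h | h
      · rw [← polyInner_conj, ih k hk i h, map_zero]
      · exact ih i hi k h
    have hk0 := hσ.inner_self_ne_zero (monicOP_ne_zero (σ := σ) k)
    rw [monicOP, polyInner_eq_inner, map_sub, map_sub, inner_sub_right, map_sum, map_sum, inner_sum,
      Finset.sum_eq_single (⟨k, hk⟩ : Fin n)]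
    · rw [Polynomial.C_mul', map_smul, map_smul, inner_smul_right, ← polyInner_eq_inner,
        ← polyInner_eq_inner, div_mul_cancel₀ _ hk0, sub_self]
    · intro i _ hi
      rw [Polynomial.C_mul', map_smul, map_smul, inner_smul_right, ← polyInner_eq_inner,
        hne i i.2 (fun h => hi (Fin.ext h)), mul_zero]
    · simp

/-- The monic orthogonal polynomial of degree `n` is orthogonal to all polynomials of lower
degree. -/
theorem polyInner_monicOP_of_degree_lt [IsFiniteMeasure σ] (hσ : NonDegenerate σ) {n : ℕ}
    {q : Polynomial ℂ} (hq : q.degree < n) : polyInner σ (monicOP σ n) q = 0 := by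
  have key : ∀ m ≤ n, ∀ q : Polynomial ℂ, q.degree < m → polyInner σ (monicOP σ n) q = 0 := by
    intro m
    induction m with
    | zero =>
      intro _ q hq
      have : q = 0 := by
        rw [← Polynomial.degree_eq_bot]
        exact Nat.WithBot.lt_zero_iff.1 (by simpa using hq)
      rw [this, polyInner_eq_inner]; simp
    | succ m ih =>
      intro hm q hq
      have h1 : (q - Polynomial.C (q.coeff m) * monicOP σ m).degree < m := by
        have hle : q.degree ≤ m := Polynomial.degree_le_of_natDegree_le
          (Nat.lt_succ_iff.1 (by
            by_cases h0 : q = 0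
            · simp [h0]
            · exact (Polynomial.natDegree_lt_iff_degree_lt h0).2 hq))
        rw [Polynomial.degree_lt_iff_coeff_zero]
        intro k hk
        have hmd := (monicOP_spec σ m).2
        rcases hk.eq_or_lt with rfl | hk
        · have := (monicOP_spec σ m).1.coeff_natDegree
          rw [Polynomial.natDegree_eq_of_degree_eq_some hmd] at this
          simp [this]
        · rw [Polynomial.coeff_sub, Polynomial.coeff_C_mul,
            Polynomial.coeff_eq_zero_of_degree_lt (hle.trans_lt (by exact_mod_cast hk)),
            Polynomial.coeff_eq_zero_of_degree_lt (hmd.trans_lt (by exact_mod_cast hk))]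
          simp
      have h2 := ih (by omega) _ h1
      have h3 := polyInner_monicOP_of_lt hσ n m (by omega)
      rw [polyInner_eq_inner] at h2 h3 ⊢
      rw [map_sub, map_sub, inner_sub_left, Polynomial.C_mul', map_smul, map_smul,
        inner_smul_left, h3, mul_zero, sub_zero] at h2
      exact h2
  exact key n le_rfl q hq

/-- The leading coefficient `‖Φ_n‖⁻¹` of the orthonormal polynomial `φ_n`. -/
noncomputable def lam (σ : Measure Circle) (n : ℕ) : ℝ :=
  (Real.sqrt (∫ z : Circle, ‖(monicOP σ n).eval (z : ℂ)‖ ^ 2 ∂σ))⁻¹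

theorem lam_pos (hσ : NonDegenerate σ) (n : ℕ) : 0 < lam σ n :=
  inv_pos.2 (Real.sqrt_pos.2 (hσ _ (monicOP_ne_zero n)))

theorem orthonormalOP_eq (n : ℕ) :
    orthonormalOP σ n = Polynomial.C ((lam σ n : ℝ) : ℂ) * monicOP σ n := rfl

theorem polyC_orthonormalOP (n : ℕ) :
    polyC (orthonormalOP σ n) = (lam σ n : ℂ) • polyC (monicOP σ n) := by
  rw [orthonormalOP_eq, Polynomial.C_mul', map_smul]

theorem degree_orthonormalOP (hσ : NonDegenerate σ) (n : ℕ) : (orthonormalOP σ n).degree = n := by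
  rw [orthonormalOP_eq, Polynomial.degree_C_mul (by exact_mod_cast (lam_pos hσ n).ne')]
  exact (monicOP_spec σ n).2

theorem coeff_orthonormalOP (n : ℕ) : (orthonormalOP σ n).coeff n = lam σ n := by
  have h := (monicOP_spec σ n).1.coeff_natDegree
  rw [Polynomial.natDegree_eq_of_degree_eq_some (monicOP_spec σ n).2] at h
  rw [orthonormalOP_eq, Polynomial.coeff_C_mul, h, mul_one]

theorem norm_monicOP [IsFiniteMeasure σ] (n : ℕ) :
    ‖cL2 σ (polyC (monicOP σ n))‖ = (lam σ n)⁻¹ := by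
  rw [lam, inv_inv]
  have := norm_cL2_sq (σ := σ) (polyC (monicOP σ n))
  simp only [polyC_apply] at this
  rw [← this, Real.sqrt_sq (norm_nonneg _)]

theorem norm_orthonormalOP [IsFiniteMeasure σ] (hσ : NonDegenerate σ) (n : ℕ) :
    ‖cL2 σ (polyC (orthonormalOP σ n))‖ = 1 := by
  rw [polyC_orthonormalOP, map_smul, norm_smul, norm_monicOP, Complex.norm_real,
    Real.norm_of_nonneg (lam_pos hσ n).le, mul_inv_cancel₀ (lam_pos hσ n).ne']

theorem polyInner_orthonormalOP_of_degree_lt [IsFiniteMeasure σ] (hσ : NonDegenerate σ) {n : ℕ}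
    {q : Polynomial ℂ} (hq : q.degree < n) : polyInner σ (orthonormalOP σ n) q = 0 := by
  have h := polyInner_monicOP_of_degree_lt hσ hq
  rw [polyInner_eq_inner] at h ⊢
  rw [polyC_orthonormalOP, map_smul, inner_smul_right, h, mul_zero]

/-- The inner product of `φ_n` with a polynomial of degree at most `n` reads off its leading
coefficient. -/
theorem polyInner_orthonormalOP_of_degree_le [IsFiniteMeasure σ] (hσ : NonDegenerate σ) {n : ℕ}
    {q : Polynomial ℂ} (hq : q.degree ≤ n) :
    polyInner σ (orthonormalOP σ n) q = (starRingEnd ℂ) (q.coeff n) / lam σ n := by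
  have hl : (lam σ n : ℂ) ≠ 0 := by exact_mod_cast (lam_pos hσ n).ne'
  set c : ℂ := q.coeff n / lam σ n with hc
  have h1 : (q - Polynomial.C c * orthonormalOP σ n).degree < n := by
    rw [Polynomial.degree_lt_iff_coeff_zero]
    intro k hk
    rcases hk.eq_or_lt with rfl | hk
    · rw [Polynomial.coeff_sub, Polynomial.coeff_C_mul, coeff_orthonormalOP, hc,
        div_mul_cancel₀ _ hl, sub_self]
    · rw [Polynomial.coeff_sub, Polynomial.coeff_C_mul,
        Polynomial.coeff_eq_zero_of_degree_lt (hq.trans_lt (by exact_mod_cast hk)),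
        Polynomial.coeff_eq_zero_of_degree_lt
          ((degree_orthonormalOP hσ n).trans_lt (by exact_mod_cast hk))]
      simp
  have h2 := polyInner_orthonormalOP_of_degree_lt hσ h1
  rw [polyInner_eq_inner] at h2 ⊢
  rw [map_sub, map_sub, inner_sub_left, Polynomial.C_mul', map_smul, map_smul, inner_smul_left,
    inner_self_eq_norm_sq_to_K, norm_orthonormalOP hσ, sub_eq_zero] at h2
  rw [h2, hc]
  simp

/-- `φ_n^*` as a continuous function. -/
noncomputable def phiStarC (σ : Measure Circle) (n : ℕ) : C(Circle, ℂ) :=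
  mono n * star (polyC (orthonormalOP σ n))

@[simp] theorem phiStarC_apply (n : ℕ) (z : Circle) : phiStarC σ n z = phiStar σ n z := by
  simp [phiStarC, phiStar]

theorem norm_phiStar (n : ℕ) (z : Circle) :
    ‖phiStar σ n z‖ = ‖(orthonormalOP σ n).eval (z : ℂ)‖ := by
  simp [phiStar, Circle.norm_coe]

theorem continuous_phiStar (n : ℕ) : Continuous (phiStar σ n) := by
  have h : phiStar σ n = phiStarC σ n := by ext z; simp
  rw [h]; exact (phiStarC σ n).continuous

/-- The vector `z^l φ_n^*` of `L²(σ)`. -/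
noncomputable def starVec (σ : Measure Circle) [IsFiniteMeasure σ] (l : ℤ) (n : ℕ) : Lp ℂ 2 σ :=
  cL2 σ (mono l * phiStarC σ n)

theorem inner_starVec [IsFiniteMeasure σ] (k l : ℤ) (N n : ℕ) :
    inner ℂ (starVec σ k N) (starVec σ l n) =
      ∫ z : Circle, (z : ℂ) ^ (l - k) * (phiStar σ n z * (starRingEnd ℂ) (phiStar σ N z)) ∂σ := by
  rw [starVec, starVec, inner_cL2]
  congr 1
  ext z
  simp only [ContinuousMap.mul_apply, mono_apply, phiStarC_apply, map_mul, map_zpow₀,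
    conj_coe_circle, zpow_sub₀ (Circle.coe_ne_zero z), inv_zpow]
  field_simp

theorem norm_starVec [IsFiniteMeasure σ] (hσ : NonDegenerate σ) (l : ℤ) (n : ℕ) :
    ‖starVec σ l n‖ = 1 := by
  rw [← norm_orthonormalOP hσ n]
  have h1 := norm_cL2_sq (σ := σ) (mono l * phiStarC σ n)
  have h2 := norm_cL2_sq (σ := σ) (polyC (orthonormalOP σ n))
  have h3 : ‖starVec σ l n‖ ^ 2 = ‖cL2 σ (polyC (orthonormalOP σ n))‖ ^ 2 := by
    rw [starVec, h1, h2]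
    congr 1
    ext z
    simp [norm_phiStar, Circle.norm_coe]
  exact (sq_eq_sq₀ (norm_nonneg _) (norm_nonneg _)).1 h3

theorem inner_starVec_eq_polyInner [IsFiniteMeasure σ] {l N n : ℕ} (h : n + l ≤ N) :
    inner ℂ (starVec σ 0 N) (starVec σ l n) =
      polyInner σ (orthonormalOP σ N) (Polynomial.X ^ (N - n - l) * orthonormalOP σ n) := by
  rw [inner_starVec, polyInner]
  congr 1
  ext z
  obtain ⟨d, rfl⟩ := Nat.exists_eq_add_of_le h
  have hz := Circle.coe_ne_zero z
  rw [show n + l + d - n - l = d by omega]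
  simp only [phiStar, map_mul, map_pow, Complex.conj_conj, conj_coe_circle, sub_zero, zpow_natCast,
    Polynomial.eval_mul, Polynomial.eval_pow, Polynomial.eval_X, inv_pow]
  field_simp
  ring

/-- `z^l φ_n^*` is orthogonal to `φ_N^*` as long as `1 ≤ l ≤ N - n`. -/
theorem inner_starVec_eq_zero [IsFiniteMeasure σ] (hσ : NonDegenerate σ) {l N n : ℕ} (hl : 1 ≤ l)
    (h : n + l ≤ N) : inner ℂ (starVec σ 0 N) (starVec σ l n) = 0 := by
  rw [inner_starVec_eq_polyInner h]
  apply polyInner_orthonormalOP_of_degree_lt hσ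
  rw [Polynomial.degree_mul, Polynomial.degree_X_pow, degree_orthonormalOP hσ]
  norm_cast
  omega

theorem inner_starVec_zero [IsFiniteMeasure σ] (hσ : NonDegenerate σ) {N n : ℕ} (h : n ≤ N) :
    inner ℂ (starVec σ 0 N) (starVec σ 0 n) = ((lam σ n / lam σ N : ℝ) : ℂ) := by
  have h1 := inner_starVec_eq_polyInner (σ := σ) (l := 0) (by simpa using h)
  rw [Nat.cast_zero] at h1
  rw [h1, polyInner_orthonormalOP_of_degree_le hσ]
  · rw [Nat.sub_zero, Polynomial.coeff_X_pow_mul', if_pos (Nat.sub_le N n), Nat.sub_sub_self h,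
      coeff_orthonormalOP]
    simp
  · rw [Polynomial.degree_mul, Polynomial.degree_X_pow, degree_orthonormalOP hσ]
    norm_cast
    omega

theorem lam_mono [IsFiniteMeasure σ] (hσ : NonDegenerate σ) : Monotone (lam σ) := by
  intro n N h
  have h1 := norm_inner_le_norm (𝕜 := ℂ) (starVec σ 0 N) (starVec σ 0 n)
  rw [inner_starVec_zero hσ h, norm_starVec hσ, norm_starVec hσ, Complex.norm_real, mul_one,
    Real.norm_of_nonneg (div_nonneg (lam_pos hσ n).le (lam_pos hσ N).le),
    div_le_one (lam_pos hσ N)] at h1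
  exact h1

theorem lam_zero [IsProbabilityMeasure σ] : lam σ 0 = 1 := by
  rw [lam, monicOP]
  simp

theorem one_le_lam [IsProbabilityMeasure σ] (hσ : NonDegenerate σ) (n : ℕ) : 1 ≤ lam σ n := by
  rw [← lam_zero (σ := σ)]
  exact lam_mono hσ (Nat.zero_le n)

theorem norm_starVec_sub_sq [IsFiniteMeasure σ] (hσ : NonDegenerate σ) {N n : ℕ} (h : n ≤ N) :
    ‖starVec σ 0 N - starVec σ 0 n‖ ^ 2 = 2 - 2 * (lam σ n / lam σ N) := by
  rw [@norm_sub_sq ℂ, inner_starVec_zero hσ h, norm_starVec hσ, norm_starVec hσ]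
  simp
  ring

theorem norm_starVec_sub_sq_le [IsProbabilityMeasure σ] (hσ : NonDegenerate σ) {a b n N : ℕ}
    (ha : a ≤ n) (hn : n ≤ N) (hb : N ≤ b) :
    ‖starVec σ 0 N - starVec σ 0 n‖ ^ 2 ≤ 2 * (lam σ b - lam σ a) := by
  rw [norm_starVec_sub_sq hσ hn]
  have h1 := lam_mono hσ ha
  have h2 := lam_mono hσ hn
  have h3 := lam_mono hσ hb
  have h4 := one_le_lam hσ N
  have h5 : 1 - lam σ n / lam σ N ≤ lam σ N - lam σ n := by
    rw [one_sub_div (by linarith), div_le_iff₀ (by linarith)]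
    nlinarith
  linarith

theorem starVec_shift_norm [IsFiniteMeasure σ] (l : ℤ) (n m : ℕ) :
    ‖starVec σ l n - starVec σ l m‖ = ‖starVec σ 0 n - starVec σ 0 m‖ := by
  rw [starVec, starVec, starVec, starVec, ← map_sub, ← map_sub]
  have h1 := norm_cL2_sq (σ := σ) (mono l * phiStarC σ n - mono l * phiStarC σ m)
  have h2 := norm_cL2_sq (σ := σ) (mono 0 * phiStarC σ n - mono 0 * phiStarC σ m)
  refine (sq_eq_sq₀ (norm_nonneg _) (norm_nonneg _)).1 ?_
  rw [h1, h2]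
  congr 1
  ext z
  simp [← mul_sub, Circle.norm_coe]

/-- The `l`-th moment of `|φ_n|² dσ` is controlled by the increment of the leading coefficients
over the window `[n - l, n + l]`: with `a = φ_n^*`, `b = φ_{n+l}^*`, `c = φ_{n-l}^*` one has
`⟨z^l a, a⟩ = ⟨z^l (a - c), a - b⟩`. -/
theorem norm_inner_starVec_self_le [IsProbabilityMeasure σ] (hσ : NonDegenerate σ) {l n : ℕ}
    (hl : 1 ≤ l) (hn : l ≤ n) :
    ‖inner ℂ (starVec σ 0 n) (starVec σ l n)‖ ≤ 2 * (lam σ (n + l) - lam σ (n - l)) := by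
  set r := 2 * (lam σ (n + l) - lam σ (n - l)) with hr
  have h1 := inner_starVec_eq_zero hσ (N := n + l) (n := n) hl le_rfl
  have h2 := inner_starVec_eq_zero hσ (N := n) (n := n - l) hl (by omega)
  have h3 := inner_starVec_eq_zero hσ (N := n + l) (n := n - l) hl (by omega)
  have h4 : inner ℂ (starVec σ 0 n) (starVec σ l n) =
      inner ℂ (starVec σ 0 n - starVec σ 0 (n + l)) (starVec σ l n - starVec σ l (n - l)) := by
    rw [inner_sub_left, inner_sub_right, inner_sub_right, h1, h2, h3]
    ring
  rw [h4]
  refine (norm_inner_le_norm _ _).trans ?_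
  rw [starVec_shift_norm (l : ℤ), norm_sub_rev (starVec σ 0 n) (starVec σ 0 (n + l))]
  have h5 := norm_starVec_sub_sq_le hσ (a := n - l) (n := n) (N := n + l) (b := n + l)
    (by omega) (by omega) le_rfl
  have h6 := norm_starVec_sub_sq_le hσ (a := n - l) (n := n - l) (N := n) (b := n + l)
    le_rfl (by omega) (by omega)
  rw [← hr] at h5 h6
  nlinarith [sq_nonneg (‖starVec σ 0 (n + l) - starVec σ 0 n‖ -
    ‖starVec σ 0 n - starVec σ 0 (n - l)‖)]

theorem norm_inner_starVec_self_le_one [IsFiniteMeasure σ] (hσ : NonDegenerate σ) (l : ℤ) (n : ℕ) :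
    ‖inner ℂ (starVec σ 0 n) (starVec σ l n)‖ ≤ 1 := by
  refine (norm_inner_le_norm _ _).trans ?_
  rw [norm_starVec hσ, norm_starVec hσ, mul_one]

theorem inner_mono_starVec [IsFiniteMeasure σ] (k n : ℕ) (h : k ≤ n) :
    inner ℂ (cL2 σ (mono k)) (starVec σ 0 n) =
      (starRingEnd ℂ) (polyInner σ (orthonormalOP σ n) (Polynomial.X ^ (n - k))) := by
  rw [starVec, inner_cL2, polyInner, ← integral_conj]
  congr 1
  ext z
  obtain ⟨d, rfl⟩ := Nat.exists_eq_add_of_le h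
  have hz := Circle.coe_ne_zero z
  simp only [ContinuousMap.mul_apply, mono_apply, phiStarC_apply, phiStar, zpow_zero, one_mul,
    zpow_natCast, map_pow, conj_coe_circle, Nat.add_sub_cancel_left, map_mul,
    Polynomial.eval_pow, Polynomial.eval_X, map_inv₀, inv_inv, inv_pow]
  field_simp
  ring

theorem inner_mono_starVec_eq_zero [IsFiniteMeasure σ] (hσ : NonDegenerate σ) {k n : ℕ}
    (hk : 1 ≤ k) (h : k ≤ n) : inner ℂ (cL2 σ (mono k)) (starVec σ 0 n) = 0 := by
  rw [inner_mono_starVec k n h, polyInner_orthonormalOP_of_degree_lt hσ, map_zero]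
  rw [Polynomial.degree_X_pow]
  norm_cast
  omega

theorem inner_one_starVec [IsFiniteMeasure σ] (hσ : NonDegenerate σ) (n : ℕ) :
    inner ℂ (cL2 σ (mono 0)) (starVec σ 0 n) = ((lam σ n)⁻¹ : ℝ) := by
  have h := inner_mono_starVec (σ := σ) 0 n (Nat.zero_le n)
  rw [Nat.cast_zero] at h
  rw [h, polyInner_orthonormalOP_of_degree_le hσ (by simp)]
  simp

/-! ### The Poisson kernel -/

theorem circle_sub_ne_zero {z : ℂ} (hz : ‖z‖ < 1) (w : Circle) : (w : ℂ) - z ≠ 0 := by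
  intro h
  rw [sub_eq_zero] at h
  rw [← h, Circle.norm_coe] at hz
  exact lt_irrefl _ hz

/-- Moments of the Cauchy kernel `w / (w - z)`. -/
theorem integral_zpow_mul_cauchy {z : ℂ} (hz : ‖z‖ < 1) (n : ℤ) :
    ∫ w : Circle, (w : ℂ) ^ n * ((w : ℂ) / (w - z)) ∂arcMeasure =
      if 0 ≤ n then z ^ n.toNat else 0 := by
  have h1 : ∀ w : Circle, HasSum (fun k : ℕ => z ^ k * (w : ℂ) ^ (n - k))
      ((w : ℂ) ^ n * ((w : ℂ) / (w - z))) := by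
    intro w
    have hw := Circle.coe_ne_zero w
    have h2 : ‖z / (w : ℂ)‖ < 1 := by rwa [norm_div, Circle.norm_coe, div_one]
    have h3 := (hasSum_geometric_of_norm_lt_one h2).mul_left ((w : ℂ) ^ n)
    have h4 := circle_sub_ne_zero hz w
    have h6 : (fun k : ℕ => z ^ k * (w : ℂ) ^ (n - k)) =
        fun k : ℕ => (w : ℂ) ^ n * (z / (w : ℂ)) ^ k := by
      funext k
      rw [zpow_sub₀ hw, div_pow, zpow_natCast]
      ring
    rw [h6, show (w : ℂ) / (w - z) = (1 - z / (w : ℂ))⁻¹ by rw [one_sub_div hw, inv_div]]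
    exact h3
  have h5 : HasSum (fun k : ℕ => ∫ w : Circle, z ^ k * (w : ℂ) ^ (n - k) ∂arcMeasure)
      (∫ w : Circle, (w : ℂ) ^ n * ((w : ℂ) / (w - z)) ∂arcMeasure) := by
    have hi : ∀ k : ℕ, Integrable (fun w : Circle => z ^ k * (w : ℂ) ^ (n - k)) arcMeasure := by
      intro k
      have h7 : Integrable (fun w => mono (n - k) w) arcMeasure :=
        integrable_of_continuous arcMeasure (mono (n - k)).continuous
      simp only [mono_apply] at h7
      exact h7.const_mul _
    have hs : Summable fun k : ℕ => ∫ w : Circle, ‖z ^ k * (w : ℂ) ^ (n - k)‖ ∂arcMeasure := by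
      have : ∀ k : ℕ, ∫ w : Circle, ‖z ^ k * (w : ℂ) ^ (n - k)‖ ∂arcMeasure = ‖z‖ ^ k := by
        intro k
        simp_rw [norm_mul, norm_zpow_circle, norm_pow]
        simp
      simp_rw [this]
      exact summable_geometric_of_lt_one (norm_nonneg _) hz
    have h6 := hasSum_integral_of_summable_integral_norm hi hs
    have h8 : (fun w : Circle => (w : ℂ) ^ n * ((w : ℂ) / (w - z))) =
        fun w : Circle => ∑' k : ℕ, z ^ k * (w : ℂ) ^ (n - k) := funext fun w => (h1 w).tsum_eq.symm
    rw [h8]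
    exact h6
  simp_rw [integral_const_mul, integral_zpow_arcMeasure] at h5
  refine h5.unique ?_
  split_ifs with hn
  · convert hasSum_ite_eq n.toNat (z ^ n.toNat) using 1
    ext k
    by_cases hk : k = n.toNat
    · subst hk
      simp [Int.toNat_of_nonneg hn]
    · rw [if_neg hk, if_neg (by omega), mul_zero]
  · convert hasSum_zero using 1
    ext k
    rw [if_neg (by omega), mul_zero]

/-- The Poisson kernel as the real part of the Herglotz kernel. -/
noncomputable def pker (z : ℂ) (w : Circle) : ℝ := (((w : ℂ) + z) / ((w : ℂ) - z)).re

theorem continuous_herglotz {z : ℂ} (hz : ‖z‖ < 1) :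
    Continuous fun w : Circle => ((w : ℂ) + z) / ((w : ℂ) - z) := by
  apply Continuous.div (by fun_prop) (by fun_prop)
  exact circle_sub_ne_zero hz

theorem continuous_pker {z : ℂ} (hz : ‖z‖ < 1) : Continuous (pker z) :=
  Complex.continuous_re.comp (continuous_herglotz hz)

theorem pker_eq {z : ℂ} (w : Circle) : pker z w = (1 - ‖z‖ ^ 2) / ‖(w : ℂ) - z‖ ^ 2 := by
  have h := congr_fun (poissonKernel_eq_re_herglotzRieszKernel (c := 0) (w := z)) (w : ℂ)
  simp only [Function.comp, herglotzRieszKernel, poissonKernel, sub_zero, Circle.norm_coe] at h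
  rw [pker, ← h, one_pow]

theorem pker_pos {z : ℂ} (hz : ‖z‖ < 1) (w : Circle) : 0 < pker z w := by
  rw [pker_eq]
  have h1 : 0 < ‖(w : ℂ) - z‖ := norm_pos_iff.2 (circle_sub_ne_zero hz w)
  have h2 : ‖z‖ ^ 2 < 1 := by nlinarith [norm_nonneg z]
  exact div_pos (by linarith) (by positivity)

theorem pker_eq_cauchy {z : ℂ} (hz : ‖z‖ < 1) (w : Circle) :
    (pker z w : ℂ) =
      (w : ℂ) / (w - z) + (starRingEnd ℂ) ((w : ℂ) / (w - z)) - 1 := by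
  have h1 : ((w : ℂ) + z) / ((w : ℂ) - z) = 2 * ((w : ℂ) / (w - z)) - 1 := by
    have := circle_sub_ne_zero hz w
    field_simp
    ring
  rw [pker, h1, Complex.add_conj]
  simp

/-- Moments of the Poisson kernel. -/
theorem integral_zpow_mul_pker {z : ℂ} (hz : ‖z‖ < 1) (n : ℕ) :
    ∫ w : Circle, (w : ℂ) ^ n * (pker z w : ℂ) ∂arcMeasure = z ^ n := by
  have hc : Continuous fun w : Circle => (w : ℂ) / ((w : ℂ) - z) :=
    Continuous.div (by fun_prop) (by fun_prop) (circle_sub_ne_zero hz)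
  have e : ∀ w : Circle, (w : ℂ) ^ n * (pker z w : ℂ) =
      (w : ℂ) ^ (n : ℤ) * ((w : ℂ) / (w - z)) +
        (starRingEnd ℂ) ((w : ℂ) ^ (-(n : ℤ)) * ((w : ℂ) / (w - z))) - (w : ℂ) ^ (n : ℤ) := by
    intro w
    rw [pker_eq_cauchy hz, map_mul, map_zpow₀, conj_coe_circle, inv_zpow, zpow_neg, inv_inv,
      zpow_natCast]
    ring
  have hz0 : ∀ k : ℤ, Continuous fun w : Circle => (w : ℂ) ^ k := by
    intro k
    have h : Continuous fun w => mono k w := (mono k).continuous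
    simpa only [mono_apply] using h
  have hz1 := hz0 n
  have hz2 := hz0 (-n)
  simp_rw [e]
  rw [integral_sub, integral_add, integral_conj, integral_zpow_mul_cauchy hz,
    integral_zpow_mul_cauchy hz, integral_zpow_arcMeasure]
  · rcases Nat.eq_zero_or_pos n with rfl | hn
    · simp
    · rw [if_pos (by omega), if_neg (by omega), if_neg (by omega)]
      simp
  · exact integrable_of_continuous _ (hz1.mul hc)
  · exact integrable_of_continuous _ (Complex.continuous_conj.comp (hz2.mul hc))
  · exact integrable_of_continuous _ ((hz1.mul hc).add (Complex.continuous_conj.comp (hz2.mul hc)))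
  · exact integrable_of_continuous _ hz1

theorem integral_pker {z : ℂ} (hz : ‖z‖ < 1) : ∫ w : Circle, pker z w ∂arcMeasure = 1 := by
  have h := integral_zpow_mul_pker hz 0
  simp only [pow_zero, one_mul] at h
  rw [integral_complex_ofReal] at h
  exact_mod_cast h

theorem pker_exp (r s t : ℝ) :
    pker ((r : ℂ) * Circle.exp s) (Circle.exp t) =
      (1 - r ^ 2) / (1 - 2 * r * Real.cos (t - s) + r ^ 2) := by
  rw [pker_eq, norm_mul, Circle.norm_coe, mul_one, Complex.norm_real, Real.norm_eq_abs, sq_abs]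
  congr 1
  rw [← Complex.normSq_eq_norm_sq, Complex.normSq_apply, Circle.coe_exp, Circle.coe_exp,
    Real.cos_sub]
  simp only [Complex.sub_re, Complex.sub_im, Complex.mul_re, Complex.mul_im,
    Complex.exp_ofReal_mul_I_re, Complex.exp_ofReal_mul_I_im, Complex.ofReal_re, Complex.ofReal_im]
  linear_combination Real.sin_sq_add_cos_sq t + r ^ 2 * Real.sin_sq_add_cos_sq s

/-! ### Fatou's theorem on radial limits -/

/-- The Poisson kernel in the angular variable. -/
noncomputable def angKer (r u : ℝ) : ℝ := (1 - r ^ 2) / (1 - 2 * r * Real.cos u + r ^ 2)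

/-- The derivative of `angKer`. -/
noncomputable def angKerDeriv (r u : ℝ) : ℝ :=
  -((1 - r ^ 2) * (2 * r * Real.sin u)) / (1 - 2 * r * Real.cos u + r ^ 2) ^ 2

theorem angKer_denom_pos {r : ℝ} (h0 : 0 < r) (h1 : r < 1) (u : ℝ) :
    0 < 1 - 2 * r * Real.cos u + r ^ 2 := by
  nlinarith [Real.cos_le_one u, sq_nonneg (1 - r), mul_pos h0 (sub_pos.2 h1)]

theorem hasDerivAt_angKer {r : ℝ} (h0 : 0 < r) (h1 : r < 1) (u : ℝ) :
    HasDerivAt (angKer r) (angKerDeriv r u) u := by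
  have h := angKer_denom_pos h0 h1 u
  have h2 : HasDerivAt (fun u => 1 - 2 * r * Real.cos u + r ^ 2) (2 * r * Real.sin u) u := by
    have := (((Real.hasDerivAt_cos u).const_mul (2 * r)).const_sub 1).add_const (r ^ 2)
    exact this.congr_deriv (by ring)
  have h3 := (hasDerivAt_const u (1 - r ^ 2)).div h2 h.ne'
  exact h3.congr_deriv (by rw [angKerDeriv]; ring)

theorem continuous_angKer {r : ℝ} (h0 : 0 < r) (h1 : r < 1) : Continuous (angKer r) :=
  Continuous.div (by fun_prop) (by fun_prop) fun u => (angKer_denom_pos h0 h1 u).ne'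

theorem continuous_angKerDeriv {r : ℝ} (h0 : 0 < r) (h1 : r < 1) : Continuous (angKerDeriv r) :=
  Continuous.div (by fun_prop) (by fun_prop) fun u => pow_ne_zero 2 (angKer_denom_pos h0 h1 u).ne'

theorem integral_angKer {r : ℝ} (h0 : 0 < r) (h1 : r < 1) :
    ∫ u in (-Real.pi)..Real.pi, angKer r u = 2 * Real.pi := by
  have hz : ‖(r : ℂ) * (Circle.exp 0 : ℂ)‖ < 1 := by
    rw [norm_mul, Circle.norm_coe, mul_one, Complex.norm_real, Real.norm_of_nonneg h0.le]
    exact h1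
  have h := integral_pker hz
  rw [integral_arcMeasure (continuous_pker hz).aestronglyMeasurable] at h
  simp_rw [pker_exp, sub_zero, smul_eq_mul] at h
  have hpi : (0 : ℝ) < 2 * Real.pi := by positivity
  rw [inv_mul_eq_div, div_eq_one_iff_eq hpi.ne'] at h
  exact h

theorem mul_sin_nonneg {u : ℝ} (h : u ∈ Set.Icc (-Real.pi) Real.pi) : 0 ≤ u * Real.sin u := by
  rcases le_total 0 u with hu | hu
  · exact mul_nonneg hu (Real.sin_nonneg_of_nonneg_of_le_pi hu h.2)
  · have := Real.sin_nonneg_of_nonneg_of_le_pi (neg_nonneg.2 hu) (by linarith [h.1])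
    rw [Real.sin_neg] at this
    nlinarith

theorem integral_neg_mul_angKerDeriv_le {r : ℝ} (h0 : 0 < r) (h1 : r < 1) :
    ∫ u in (-Real.pi)..Real.pi, -(u * angKerDeriv r u) ≤ 2 * Real.pi := by
  have h2 := intervalIntegral.integral_mul_deriv_eq_deriv_mul (a := -Real.pi) (b := Real.pi)
    (u := fun u => u) (v := angKer r) (u' := fun _ => 1) (v' := angKerDeriv r)
    (fun u _ => hasDerivAt_id u) (fun u _ => hasDerivAt_angKer h0 h1 u) (by simp)
    ((continuous_angKerDeriv h0 h1).intervalIntegrable _ _)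
  rw [intervalIntegral.integral_neg, h2]
  simp_rw [one_mul]
  rw [integral_angKer h0 h1]
  have h3 : ∀ u, 0 ≤ angKer r u := fun u =>
    div_nonneg (by nlinarith) (angKer_denom_pos h0 h1 u).le
  nlinarith [h3 Real.pi, h3 (-Real.pi), Real.pi_pos]

/-- If the primitive of `g` has derivative `0` at `0`, then the Poisson averages of `g` tend to
`0`: integrate by parts, and use that `-u P_r'(u)` is a positive kernel of bounded mass. -/
theorem tendsto_integral_angKer {g : ℝ → ℝ} (hg : IntervalIntegrable g volume (-Real.pi) Real.pi)
    (hd : HasDerivAt (fun u => ∫ v in (0 : ℝ)..u, g v) 0 0) :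
    Tendsto (fun r => ∫ u in (-Real.pi)..Real.pi, angKer r u * g u) (𝓝[<] 1) (𝓝 0) := by
  have hpi := Real.pi_pos
  set G : ℝ → ℝ := fun u => ∫ v in (0 : ℝ)..u, g v with hG
  have h0mem : (0 : ℝ) ∈ Set.uIcc (-Real.pi) Real.pi := by
    rw [Set.uIcc_of_le (by linarith)]; constructor <;> linarith
  have hGac : AbsolutelyContinuousOnInterval G (-Real.pi) Real.pi :=
    hg.absolutelyContinuousOnInterval_intervalIntegral h0mem
  have hGd : ∀ᵐ u, u ∈ Set.uIcc (-Real.pi) Real.pi → deriv G u = g u := by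
    filter_upwards [hg.ae_hasDerivAt_integral] with u hu hu'
    exact (hu hu' 0 h0mem).deriv
  obtain ⟨M, hM⟩ := hGac.exists_bound
  have hM0 : 0 ≤ M := (norm_nonneg _).trans (hM 0 h0mem)
  -- Only the primitive `G` is small near `0`, so the derivative has to be moved to the kernel.
  have hparts : ∀ r : ℝ, 0 < r → r < 1 →
      ∫ u in (-Real.pi)..Real.pi, angKer r u * g u =
        angKer r Real.pi * G Real.pi - angKer r (-Real.pi) * G (-Real.pi) -
          ∫ u in (-Real.pi)..Real.pi, angKerDeriv r u * G u := by
    intro r h0 h1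
    have hac : AbsolutelyContinuousOnInterval (angKer r) (-Real.pi) Real.pi := by
      apply ContDiffOn.absolutelyContinuousOnInterval
      apply ContDiff.contDiffOn
      rw [show angKer r = fun u => (1 - r ^ 2) / (1 - 2 * r * Real.cos u + r ^ 2) from rfl]
      apply ContDiff.div contDiff_const
      · exact (contDiff_const.sub (contDiff_const.mul Real.contDiff_cos)).add contDiff_const
      · exact fun u => (angKer_denom_pos h0 h1 u).ne'
    have h2 := hac.integral_mul_deriv_eq_deriv_mul hGac
    have h3 : ∫ u in (-Real.pi)..Real.pi, angKer r u * deriv G u =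
        ∫ u in (-Real.pi)..Real.pi, angKer r u * g u := by
      apply intervalIntegral.integral_congr_ae
      filter_upwards [hGd] with u hu hu'
      rw [hu (Set.uIoc_subset_uIcc hu')]
    rw [← h3, h2]
    simp_rw [(hasDerivAt_angKer h0 h1 _).deriv]
  rw [Metric.tendsto_nhds]
  intro ε hε
  set ε' := ε / (4 * Real.pi) with hε'
  have hε'0 : 0 < ε' := by positivity
  have hsmall : ∀ᶠ u in 𝓝 (0 : ℝ), ‖G u‖ ≤ ε' * ‖u‖ := by
    have h := hd.isLittleO.bound hε'0
    simpa [hG] using h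
  obtain ⟨δ, hδ, hball⟩ := Metric.eventually_nhds_iff.1 hsmall
  set δ' := min (δ / 2) Real.pi with hδ'
  have hδ'0 : 0 < δ' := lt_min (by linarith) hpi
  set c := 1 - Real.cos δ' with hc
  have hc0 : 0 < c := by
    have : Real.cos δ' < Real.cos 0 :=
      Real.cos_lt_cos_of_nonneg_of_le_pi le_rfl (min_le_right _ _) hδ'0
    rw [Real.cos_zero] at this
    linarith
  -- Near `0` the bound on `G` makes `-u P_r'(u)` appear; away from `0` the kernel is `O(1 - r²)`.
  have hpt : ∀ r : ℝ, 1 / 2 < r → r < 1 → ∀ u ∈ Set.Icc (-Real.pi) Real.pi,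
      ‖angKerDeriv r u * G u‖ ≤ ε' * -(u * angKerDeriv r u) + M * (2 / c ^ 2) * (1 - r ^ 2) := by
    intro r h0 h1 u hu
    have hden := angKer_denom_pos (by linarith : 0 < r) h1 u
    have hr2 : 0 < 1 - r ^ 2 := by nlinarith
    have hneg : -(u * angKerDeriv r u) = |u| * |angKerDeriv r u| := by
      rw [← abs_mul, ← abs_neg, abs_of_nonneg]
      rw [angKerDeriv]
      have := mul_sin_nonneg hu
      have h3 : -(u * (-((1 - r ^ 2) * (2 * r * Real.sin u)) /
          (1 - 2 * r * Real.cos u + r ^ 2) ^ 2)) =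
          (1 - r ^ 2) * (2 * r) * (u * Real.sin u) / (1 - 2 * r * Real.cos u + r ^ 2) ^ 2 := by
        ring
      rw [h3]
      positivity
    rw [hneg, norm_mul, Real.norm_eq_abs, Real.norm_eq_abs]
    rcases lt_or_ge |u| δ' with hul | hul
    · have h4 : ‖G u‖ ≤ ε' * ‖u‖ := by
        apply hball
        rw [Real.dist_eq, sub_zero]
        exact hul.trans_le ((min_le_left _ _).trans (by linarith))
      rw [Real.norm_eq_abs, Real.norm_eq_abs] at h4
      have h5 : 0 ≤ M * (2 / c ^ 2) * (1 - r ^ 2) := by positivity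
      nlinarith [mul_le_mul_of_nonneg_left h4 (abs_nonneg (angKerDeriv r u))]
    · have h6 : |angKerDeriv r u| ≤ 2 / c ^ 2 * (1 - r ^ 2) := by
        have h7 : c ≤ 1 - 2 * r * Real.cos u + r ^ 2 := by
          have : Real.cos u ≤ Real.cos δ' := by
            rw [← Real.cos_abs u]
            exact Real.cos_le_cos_of_nonneg_of_le_pi hδ'0.le (abs_le.2 hu) hul
          nlinarith [sq_nonneg (1 - r), Real.cos_le_one δ']
        rw [angKerDeriv, abs_div, abs_neg, abs_mul, abs_of_pos hr2,
          abs_of_pos (pow_pos hden 2), div_mul_eq_mul_div]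
        have h8 : |2 * r * Real.sin u| ≤ 2 := by
          rw [abs_mul, abs_of_pos (by linarith : 0 < 2 * r)]
          nlinarith [Real.abs_sin_le_one u, abs_nonneg (Real.sin u)]
        have h9 : c ^ 2 ≤ (1 - 2 * r * Real.cos u + r ^ 2) ^ 2 := by gcongr
        calc _ ≤ (1 - r ^ 2) * 2 / c ^ 2 := by gcongr
          _ = _ := by ring
      have h10 : |G u| ≤ M := by
        apply hM; rw [Set.uIcc_of_le (by linarith)]; exact hu
      have h11 : 0 ≤ ε' * (|u| * |angKerDeriv r u|) := by positivity
      have h12 : |angKerDeriv r u| * |G u| ≤ 2 / c ^ 2 * (1 - r ^ 2) * M := by gcongr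
      linarith
  have hbound : ∀ r : ℝ, 1 / 2 < r → r < 1 →
      ‖∫ u in (-Real.pi)..Real.pi, angKer r u * g u‖ ≤
        ε / 2 + (1 - r ^ 2) * (8 * M + 2 * Real.pi * (M * (2 / c ^ 2))) := by
    intro r h0 h1
    have hr0 : 0 < r := by linarith
    have hr2 : 0 < 1 - r ^ 2 := by nlinarith
    rw [hparts r hr0 h1]
    have hk : ∀ u : ℝ, Real.cos u = -1 → 0 ≤ angKer r u ∧ angKer r u ≤ 4 * (1 - r ^ 2) := by
      intro u hu
      rw [angKer, hu]
      have : (1 : ℝ) ≤ 1 - 2 * r * -1 + r ^ 2 := by nlinarith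
      refine ⟨by positivity, ?_⟩
      rw [div_le_iff₀ (by linarith)]
      nlinarith
    have hk1 := hk Real.pi Real.cos_pi
    have hk2 := hk (-Real.pi) (by rw [Real.cos_neg, Real.cos_pi])
    have hG1 := hM Real.pi (by rw [Set.uIcc_of_le (by linarith)]; constructor <;> linarith)
    have hG2 := hM (-Real.pi) (by rw [Set.uIcc_of_le (by linarith)]; constructor <;> linarith)
    have hI : ‖∫ u in (-Real.pi)..Real.pi, angKerDeriv r u * G u‖ ≤
        ∫ u in (-Real.pi)..Real.pi,
          (ε' * -(u * angKerDeriv r u) + M * (2 / c ^ 2) * (1 - r ^ 2)) := by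
      apply intervalIntegral.norm_integral_le_of_norm_le (by linarith)
      · filter_upwards with u hu
        exact hpt r h0 h1 u ⟨hu.1.le, hu.2⟩
      · apply Continuous.intervalIntegrable
        have := continuous_angKerDeriv hr0 h1
        fun_prop
    have hI2 : ∫ u in (-Real.pi)..Real.pi,
          (ε' * -(u * angKerDeriv r u) + M * (2 / c ^ 2) * (1 - r ^ 2)) ≤
        ε' * (2 * Real.pi) + 2 * Real.pi * (M * (2 / c ^ 2) * (1 - r ^ 2)) := by
      have hcd := continuous_angKerDeriv hr0 h1
      rw [intervalIntegral.integral_add, intervalIntegral.integral_const_mul,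
        intervalIntegral.integral_const, smul_eq_mul]
      · have := integral_neg_mul_angKerDeriv_le hr0 h1
        have h13 := mul_le_mul_of_nonneg_left this hε'0.le
        linarith
      · apply Continuous.intervalIntegrable; fun_prop
      · simp
    have hee : ε' * (2 * Real.pi) = ε / 2 := by
      rw [hε']; field_simp; ring
    have hA : ‖angKer r Real.pi * G Real.pi‖ ≤ 4 * (1 - r ^ 2) * M := by
      rw [norm_mul, Real.norm_of_nonneg hk1.1]
      exact mul_le_mul hk1.2 hG1 (norm_nonneg _) (by positivity)
    have hB : ‖angKer r (-Real.pi) * G (-Real.pi)‖ ≤ 4 * (1 - r ^ 2) * M := by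
      rw [norm_mul, Real.norm_of_nonneg hk2.1]
      exact mul_le_mul hk2.2 hG2 (norm_nonneg _) (by positivity)
    have h14 := norm_sub_le (angKer r Real.pi * G Real.pi - angKer r (-Real.pi) * G (-Real.pi))
      (∫ u in (-Real.pi)..Real.pi, angKerDeriv r u * G u)
    have h15 := norm_sub_le (angKer r Real.pi * G Real.pi) (angKer r (-Real.pi) * G (-Real.pi))
    nlinarith
  have hlim : Tendsto (fun r : ℝ => ε / 2 + (1 - r ^ 2) *
      (8 * M + 2 * Real.pi * (M * (2 / c ^ 2)))) (𝓝[<] 1) (𝓝 (ε / 2)) := by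
    have : Continuous fun r : ℝ => ε / 2 + (1 - r ^ 2) *
      (8 * M + 2 * Real.pi * (M * (2 / c ^ 2))) := by fun_prop
    have h := (this.tendsto 1).mono_left (nhdsWithin_le_nhds (s := Set.Iio 1))
    simpa using h
  have hev1 : ∀ᶠ r in 𝓝[<] (1 : ℝ), 1 / 2 < r :=
    nhdsWithin_le_nhds (lt_mem_nhds (by norm_num))
  filter_upwards [hlim.eventually_lt_const (by linarith : ε / 2 < ε), hev1,
    self_mem_nhdsWithin] with r hr h0 h1
  rw [dist_zero_right]
  exact (hbound r h0 h1).trans_lt hr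

theorem norm_radial_lt_one {r : ℝ} (h0 : 0 ≤ r) (h1 : r < 1) (z : Circle) :
    ‖(r : ℂ) * (z : ℂ)‖ < 1 := by
  rw [norm_mul, Circle.norm_coe, mul_one, Complex.norm_real, Real.norm_of_nonneg h0]
  exact h1

theorem eventually_radial : ∀ᶠ r : ℝ in 𝓝[<] (1 : ℝ), 0 < r ∧ r < 1 := by
  have h : ∀ᶠ r : ℝ in 𝓝[<] (1 : ℝ), 0 < r :=
    nhdsWithin_le_nhds (lt_mem_nhds one_pos)
  filter_upwards [h, self_mem_nhdsWithin] with r h0 h1 using ⟨h0, h1⟩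

/-- **Fatou's theorem**: the Poisson integral of an integrable function has radial limits almost
everywhere, equal to the function. -/
theorem ae_tendsto_poisson {f : Circle → ℝ} (hf : Integrable f arcMeasure) :
    ∀ᵐ z : Circle ∂arcMeasure, Tendsto
      (fun r : ℝ => ∫ w, pker ((r : ℂ) * (z : ℂ)) w * f w ∂arcMeasure) (𝓝[<] 1) (𝓝 (f z)) := by
  have hpi := Real.pi_pos
  have hint := (integrable_arcMeasure_iff hf.1).1 hf
  have hper : Function.Periodic (fun t : ℝ => f (Circle.exp t)) (2 * Real.pi) := fun t => by
    simp only [Circle.periodic_exp t]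
  have hint2 : ∀ a b, IntervalIntegrable (fun t : ℝ => f (Circle.exp t)) volume a b := by
    intro a b
    apply hper.intervalIntegrable (t := -Real.pi) (by positivity)
    convert hint using 1
    ring
  rw [ae_arcMeasure_iff]
  rw [ae_restrict_iff' measurableSet_Ioc]
  filter_upwards [(hint2 (-Real.pi) Real.pi).ae_hasDerivAt_integral] with s hs hsm
  have hs0 : s ∈ Set.uIcc (-Real.pi) Real.pi := by
    rw [Set.uIcc_of_le (by linarith)]; exact ⟨hsm.1.le, hsm.2⟩
  have hd := hs hs0 s hs0
  -- At a Lebesgue point `s`, the primitive of `g` is differentiable with derivative `0` at `0`.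
  set g : ℝ → ℝ := fun v => f (Circle.exp (s + v)) - f (Circle.exp s) with hg
  have hgi : ∀ a b, IntervalIntegrable (fun v => f (Circle.exp (s + v))) volume a b := by
    intro a b
    have h := (hint2 (s + a) (s + b)).comp_add_left (c := s)
    simpa using h
  have hgd : HasDerivAt (fun u => ∫ v in (0 : ℝ)..u, g v) 0 0 := by
    have e : (fun u => ∫ v in (0 : ℝ)..u, g v) =
        fun u => (∫ t in s..(s + u), f (Circle.exp t)) - u * f (Circle.exp s) := by
      funext u
      rw [hg, intervalIntegral.integral_sub (hgi _ _) (by simp),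
        intervalIntegral.integral_comp_add_left (fun t => f (Circle.exp t)) s]
      simp
    rw [e]
    have h1 : HasDerivAt (fun u : ℝ => s + u) 1 0 := (hasDerivAt_id 0).const_add s
    have h2 : HasDerivAt (fun x => ∫ t in s..x, f (Circle.exp t)) (f (Circle.exp s)) (s + 0) := by
      rw [add_zero]; exact hd
    have h3 := (h2.comp (0 : ℝ) h1).sub ((hasDerivAt_id (0 : ℝ)).mul_const (f (Circle.exp s)))
    exact h3.congr_deriv (by ring)
  have h4 := tendsto_integral_angKer ((hgi (-Real.pi) Real.pi).sub (by simp)) hgd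
  have h5 := (h4.const_mul (2 * Real.pi)⁻¹).add_const (f (Circle.exp s))
  rw [mul_zero, zero_add] at h5
  refine h5.congr' ?_
  filter_upwards [eventually_radial] with r hr
  have hz := norm_radial_lt_one hr.1.le hr.2 (Circle.exp s)
  rw [integral_arcMeasure (F := fun w => pker ((r : ℂ) * (Circle.exp s : ℂ)) w * f w)
    ((continuous_pker hz).aestronglyMeasurable.mul hf.1)]
  simp_rw [pker_exp]
  change _ = (2 * Real.pi)⁻¹ • ∫ t in (-Real.pi)..Real.pi, angKer r (t - s) * f (Circle.exp t)
  have hper2 : Function.Periodic (fun t => angKer r (t - s) * f (Circle.exp t)) (2 * Real.pi) := by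
    intro t
    have h6 := hper t
    dsimp only at h6 ⊢
    rw [h6, angKer, angKer, show t + 2 * Real.pi - s = t - s + 2 * Real.pi by ring,
      Real.cos_add_two_pi]
  have h7 := hper2.intervalIntegral_add_eq (-Real.pi) (s + -Real.pi)
  rw [show -Real.pi + 2 * Real.pi = Real.pi by ring,
    show s + -Real.pi + 2 * Real.pi = s + Real.pi by ring] at h7
  rw [h7, ← intervalIntegral.integral_comp_add_left
    (fun t => angKer r (t - s) * f (Circle.exp t)) s]
  simp_rw [add_sub_cancel_left, mul_sub]
  have hk := continuous_angKer hr.1 hr.2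
  rw [intervalIntegral.integral_sub ((hgi _ _).continuousOn_mul hk.continuousOn)
    (Continuous.intervalIntegrable (by fun_prop) _ _), intervalIntegral.integral_mul_const,
    integral_angKer hr.1 hr.2, smul_eq_mul]
  field_simp
  ring

theorem ae_tendsto_poisson_complex {f : Circle → ℂ} (hf : Integrable f arcMeasure) :
    ∀ᵐ z : Circle ∂arcMeasure, Tendsto
      (fun r : ℝ => ∫ w, (pker ((r : ℂ) * (z : ℂ)) w : ℂ) * f w ∂arcMeasure)
      (𝓝[<] 1) (𝓝 (f z)) := by
  filter_upwards [ae_tendsto_poisson hf.re, ae_tendsto_poisson hf.im] with z h1 h2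
  have h3 := ((Complex.continuous_ofReal.tendsto _).comp h1).add
    (((Complex.continuous_ofReal.tendsto _).comp h2).mul_const Complex.I)
  have e : (((RCLike.re (f z) : ℝ) : ℂ) + ((RCLike.im (f z) : ℝ) : ℂ) * Complex.I) = f z :=
    Complex.re_add_im (f z)
  rw [e] at h3
  refine h3.congr' ?_
  filter_upwards [eventually_radial] with r hr
  have hz := norm_radial_lt_one hr.1.le hr.2 z
  have hint : Integrable (fun w => (pker ((r : ℂ) * (z : ℂ)) w : ℂ) * f w) arcMeasure := by
    have hc := continuous_pker hz
    obtain ⟨C, hC⟩ := isCompact_univ.exists_bound_of_continuousOn hc.continuousOn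
    refine hf.bdd_mul (c := C) (Complex.continuous_ofReal.comp hc).aestronglyMeasurable ?_
    filter_upwards with w
    simpa using hC w (Set.mem_univ w)
  rw [← integral_re_add_im hint]
  simp only [Function.comp_apply]
  congr 2
  · congr 2
    ext w
    simp
  · congr 3
    ext w
    simp

/-! ### The Szegő function and its boundary values -/

/-- The Herglotz transform `∫ (w + z) / (w - z) L(w) dm(w)`. -/
noncomputable def herglotz (L : Circle → ℝ) (z : ℂ) : ℂ :=
  ∫ w : Circle, (((w : ℂ) + z) / ((w : ℂ) - z)) * ((L w : ℝ) : ℂ) ∂arcMeasure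

/-- The outer function `exp (½ ∫ (w + z) / (w - z) L(w) dm(w))` with `log |·|² = L` on the
circle. -/
noncomputable def outerFn (L : Circle → ℝ) (z : ℂ) : ℂ :=
  Complex.exp ((1 / 2 : ℂ) * herglotz L z)

theorem hasSum_congr_fun {ι E : Type*} [AddCommMonoid E] [TopologicalSpace E] {f g : ι → E} {a : E}
    (h : HasSum f a) (e : ∀ n, g n = f n) : HasSum g a := by
  rwa [show g = f from funext e]

variable {L : Circle → ℝ}

theorem integrable_herglotz (hL : Integrable L arcMeasure) {z : ℂ} (hz : ‖z‖ < 1) :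
    Integrable (fun w : Circle => (((w : ℂ) + z) / ((w : ℂ) - z)) * ((L w : ℝ) : ℂ))
      arcMeasure := by
  have hc := continuous_herglotz hz
  obtain ⟨C, hC⟩ := isCompact_univ.exists_bound_of_continuousOn hc.continuousOn
  exact hL.ofReal.bdd_mul (c := C) hc.aestronglyMeasurable (.of_forall fun w =>
    hC w (Set.mem_univ w))

theorem one_sub_norm_le (z : ℂ) (w : Circle) : 1 - ‖z‖ ≤ ‖(w : ℂ) - z‖ := by
  have := norm_sub_norm_le (w : ℂ) z
  rwa [Circle.norm_coe] at this

theorem differentiableOn_herglotz (hL : Integrable L arcMeasure) :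
    DifferentiableOn ℂ (herglotz L) (Metric.ball 0 1) := by
  intro z₀ hz₀
  rw [mem_ball_zero_iff] at hz₀
  set ε := (1 - ‖z₀‖) / 2 with hε
  have hε0 : 0 < ε := by linarith
  have hb : ∀ z ∈ Metric.ball z₀ ε, ‖z‖ < 1 - ε := by
    intro z hz
    rw [mem_ball_iff_norm] at hz
    have := norm_sub_norm_le z z₀
    linarith
  have hm : ∀ z : ℂ, ‖z‖ < 1 → AEStronglyMeasurable
      (fun w : Circle => (((w : ℂ) + z) / ((w : ℂ) - z)) * ((L w : ℝ) : ℂ)) arcMeasure :=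
    fun z hz => (integrable_herglotz hL hz).1
  have key := hasDerivAt_integral_of_dominated_loc_of_deriv_le (𝕜 := ℂ) (μ := arcMeasure)
    (F := fun z (w : Circle) => (((w : ℂ) + z) / ((w : ℂ) - z)) * ((L w : ℝ) : ℂ))
    (F' := fun z (w : Circle) => (2 * (w : ℂ) / ((w : ℂ) - z) ^ 2) * ((L w : ℝ) : ℂ))
    (bound := fun w => 2 / ε ^ 2 * |L w|) (x₀ := z₀) (s := Metric.ball z₀ ε)
    (Metric.ball_mem_nhds z₀ hε0) ?_ (integrable_herglotz hL hz₀) ?_ ?_ ?_ ?_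
  · exact (key.2.differentiableAt).differentiableWithinAt
  · filter_upwards [Metric.ball_mem_nhds z₀ hε0] with z hz
    exact hm z (by linarith [hb z hz])
  · refine AEStronglyMeasurable.mul ?_ hL.ofReal.1
    apply Continuous.aestronglyMeasurable
    exact Continuous.div (by fun_prop) (by fun_prop)
      fun w => pow_ne_zero 2 (circle_sub_ne_zero hz₀ w)
  · filter_upwards with w z hz
    have h1 : ε ≤ ‖(w : ℂ) - z‖ := by linarith [hb z hz, one_sub_norm_le z w]
    rw [norm_mul, norm_div, norm_mul, Circle.norm_coe, norm_pow, Complex.norm_real,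
      Real.norm_eq_abs]
    simp only [Complex.norm_ofNat, mul_one]
    gcongr
  · exact hL.abs.const_mul _
  · filter_upwards with w z hz
    have h1 := circle_sub_ne_zero (show ‖z‖ < 1 by linarith [hb z hz]) w
    have h2 := ((hasDerivAt_id z).const_add (w : ℂ)).div ((hasDerivAt_id z).const_sub (w : ℂ)) h1
    exact (h2.mul_const _).congr_deriv (by simp; field_simp; ring_nf; tauto)

theorem differentiableOn_outerFn (hL : Integrable L arcMeasure) :
    DifferentiableOn ℂ (outerFn L) (Metric.ball 0 1) :=
  ((differentiableOn_herglotz hL).const_mul _).cexp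

theorem integrable_pker_mul (hL : Integrable L arcMeasure) {z : ℂ} (hz : ‖z‖ < 1) :
    Integrable (fun w : Circle => pker z w * L w) arcMeasure := by
  have hc := continuous_pker hz
  obtain ⟨C, hC⟩ := isCompact_univ.exists_bound_of_continuousOn hc.continuousOn
  exact hL.bdd_mul (c := C) hc.aestronglyMeasurable (.of_forall fun w => hC w (Set.mem_univ w))

theorem norm_outerFn_sq (hL : Integrable L arcMeasure) {z : ℂ} (hz : ‖z‖ < 1) :
    ‖outerFn L z‖ ^ 2 = Real.exp (∫ w, pker z w * L w ∂arcMeasure) := by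
  rw [outerFn, Complex.norm_exp, ← Real.exp_nat_mul]
  congr 1
  have h1 : (herglotz L z).re = ∫ w, pker z w * L w ∂arcMeasure := by
    have := integral_re (integrable_herglotz hL hz)
    rw [herglotz]
    refine Eq.trans this.symm ?_
    congr 1
    ext w
    simp [pker]
  rw [← h1]
  have h2 : ((1 / 2 : ℂ) * herglotz L z).re = (1 / 2 : ℝ) * (herglotz L z).re := by
    rw [show (1 / 2 : ℂ) = ((1 / 2 : ℝ) : ℂ) by push_cast; rfl, Complex.re_ofReal_mul]
  rw [h2]
  push_cast
  ring

variable {W : Circle → ℝ}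

theorem norm_outerFn_sq_le (hpos : ∀ᵐ w ∂arcMeasure, 0 < W w) (hW : Integrable W arcMeasure)
    (hL : Integrable (fun w => Real.log (W w)) arcMeasure) {z : ℂ} (hz : ‖z‖ < 1) :
    ‖outerFn (fun w => Real.log (W w)) z‖ ^ 2 ≤ ∫ w, pker z w * W w ∂arcMeasure := by
  rw [norm_outerFn_sq hL hz]
  set A := ∫ w, pker z w * W w ∂arcMeasure with hA
  have hi := integrable_pker_mul hW hz
  have hp : Integrable (pker z) arcMeasure := integrable_of_continuous _ (continuous_pker hz)
  have hA0 : 0 < A := by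
    rw [hA, integral_pos_iff_support_of_nonneg_ae _ hi]
    · have : ∀ᵐ w ∂arcMeasure, w ∈ Function.support fun w => pker z w * W w := by
        filter_upwards [hpos] with w hw
        exact (mul_pos (pker_pos hz w) hw).ne'
      have h2 : arcMeasure (Function.support fun w => pker z w * W w) = 1 :=
        (measure_eq_measure_of_null_sdiff (Set.subset_univ _) (by
          rw [← Set.compl_eq_univ_sdiff]; exact this)).trans measure_univ
      rw [h2]
      exact one_pos
    · filter_upwards [hpos] with w hw
      exact (mul_pos (pker_pos hz w) hw).le
  -- `log W ≤ log A + W / A - 1`, integrated against the Poisson kernel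
  have h1 : ∫ w, pker z w * Real.log (W w) ∂arcMeasure ≤
      ∫ w, (pker z w * (Real.log A - 1) + pker z w * W w * A⁻¹) ∂arcMeasure := by
    apply integral_mono_ae (integrable_pker_mul hL hz) ((hp.mul_const _).add (hi.mul_const _))
    filter_upwards [hpos] with w hw
    have h2 := Real.log_le_sub_one_of_pos (div_pos hw hA0)
    rw [Real.log_div hw.ne' hA0.ne'] at h2
    have h3 := mul_le_mul_of_nonneg_left h2 (pker_pos hz w).le
    simp only [div_eq_mul_inv] at h3
    change _ ≤ pker z w * (Real.log A - 1) + pker z w * W w * A⁻¹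
    nlinarith
  rw [integral_add (hp.mul_const _) (hi.mul_const _), integral_mul_const, integral_mul_const,
    integral_pker hz, ← hA, mul_inv_cancel₀ hA0.ne'] at h1
  calc _ ≤ Real.exp (Real.log A) := Real.exp_le_exp.2 (by linarith)
    _ = A := Real.exp_log hA0

theorem pker_symm (r : ℝ) (z w : Circle) : pker ((r : ℂ) * z) w = pker ((r : ℂ) * w) z := by
  rw [pker_eq, pker_eq, norm_mul, norm_mul, Circle.norm_coe, Circle.norm_coe]
  congr 1
  rw [← Complex.normSq_eq_norm_sq, ← Complex.normSq_eq_norm_sq]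
  have h1 := Circle.normSq_coe z
  have h2 := Circle.normSq_coe w
  rw [Complex.normSq_apply] at h1 h2
  simp only [Complex.normSq_apply, Complex.sub_re, Complex.sub_im, Complex.re_ofReal_mul,
    Complex.im_ofReal_mul]
  linear_combination (r ^ 2 - 1) * (h1 - h2)

theorem integral_norm_outerFn_sq_le (hpos : ∀ᵐ w ∂arcMeasure, 0 < W w)
    (hW : Integrable W arcMeasure) (hL : Integrable (fun w => Real.log (W w)) arcMeasure)
    {r : ℝ} (h0 : 0 ≤ r) (h1 : r < 1) :
    ∫ z : Circle, ‖outerFn (fun w => Real.log (W w)) ((r : ℂ) * z)‖ ^ 2 ∂arcMeasure ≤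
      ∫ w, W w ∂arcMeasure := by
  have hc : Continuous fun p : Circle × Circle => pker ((r : ℂ) * p.1) p.2 := by
    refine Complex.continuous_re.comp (Continuous.div (by fun_prop) (by fun_prop) fun p => ?_)
    exact circle_sub_ne_zero (norm_radial_lt_one h0 h1 p.1) p.2
  obtain ⟨C, hC⟩ := isCompact_univ.exists_bound_of_continuousOn hc.continuousOn
  have hprod : Integrable (fun p : Circle × Circle => pker ((r : ℂ) * p.1) p.2 * W p.2)
      (arcMeasure.prod arcMeasure) :=
    (hW.comp_snd arcMeasure).bdd_mul (c := C) hc.aestronglyMeasurable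
      (.of_forall fun w => hC w (Set.mem_univ w))
  have hcont : Continuous fun z : Circle => outerFn (fun w => Real.log (W w)) ((r : ℂ) * z) := by
    rw [← continuousOn_univ]
    refine (differentiableOn_outerFn hL).continuousOn.comp (by fun_prop) fun z _ => ?_
    rw [mem_ball_zero_iff]
    exact norm_radial_lt_one h0 h1 z
  calc _ ≤ ∫ z : Circle, ∫ w, pker ((r : ℂ) * z) w * W w ∂arcMeasure ∂arcMeasure := by
        apply integral_mono (integrable_of_continuous _ (hcont.norm.pow 2)) hprod.integral_prod_left
        intro z
        exact norm_outerFn_sq_le hpos hW hL (norm_radial_lt_one h0 h1 z)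
    _ = ∫ w, ∫ z : Circle, pker ((r : ℂ) * z) w * W w ∂arcMeasure ∂arcMeasure :=
        integral_integral_swap hprod
    _ = ∫ w, W w ∂arcMeasure := by
        congr 1
        ext w
        rw [integral_mul_const]
        simp_rw [pker_symm r _ w]
        rw [integral_pker (norm_radial_lt_one h0 h1 w), one_mul]

/-- Boundary values of the outer function with `|D|² = W`: its Taylor coefficients are square
summable, and the resulting `L²` function is the radial limit of `D`. -/
theorem exists_outer_boundary (hpos : ∀ᵐ w ∂arcMeasure, 0 < W w) (hW : Integrable W arcMeasure)
    (hL : Integrable (fun w => Real.log (W w)) arcMeasure) :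
    ∃ G : Lp ℂ 2 arcMeasure,
      (∀ᵐ z : Circle ∂arcMeasure, Tendsto
        (fun r : ℝ => outerFn (fun w => Real.log (W w)) ((r : ℂ) * z)) (𝓝[<] 1) (𝓝 (G z))) ∧
      (∀ᵐ z ∂arcMeasure, ‖G z‖ ^ 2 = W z) ∧
      ∃ d : ℕ → ℂ, d 0 = outerFn (fun w => Real.log (W w)) 0 ∧
        HasSum (fun n : ℕ => d n • cL2 arcMeasure (mono n)) G := by
  set D := outerFn (fun w => Real.log (W w)) with hD
  have hdiff : DifferentiableOn ℂ D (Metric.ball 0 1) := differentiableOn_outerFn hL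
  obtain ⟨d, hd⟩ : ∃ d : ℕ → ℂ, ∀ z : ℂ, ‖z‖ < 1 → HasSum (fun n => d n * z ^ n) (D z) := by
    refine ⟨fun n => (n.factorial : ℂ)⁻¹ * iteratedDeriv n D 0, fun z hz => ?_⟩
    have h := Complex.hasSum_taylorSeries_on_ball (r := 1) (c := 0) (f := D)
      (by simpa using hdiff) (z := z) (by simpa using hz)
    refine hasSum_congr_fun h fun n => ?_
    simp only [smul_eq_mul, sub_zero]
    ring
  have hd0 : d 0 = D 0 := by
    have h := hd 0 (by simp)
    have h2 : HasSum (fun n => d n * (0 : ℂ) ^ n) (d 0 * 0 ^ 0) :=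
      hasSum_single 0 fun n hn => by simp [hn]
    rw [pow_zero, mul_one] at h2
    exact h2.unique h
  -- Parseval on circles of radius `r < 1`
  have hsum : ∀ N : ℕ, ∑ n ∈ Finset.range N, ‖d n‖ ^ 2 ≤ ∫ w, W w ∂arcMeasure := by
    intro N
    have hr : ∀ r : ℝ, 0 ≤ r → r < 1 →
        ∑ n ∈ Finset.range N, ‖d n * (r : ℂ) ^ n‖ ^ 2 ≤ ∫ w, W w ∂arcMeasure := by
      intro r h0 h1
      have hcont : Continuous fun z : Circle => D ((r : ℂ) * z) := by
        rw [← continuousOn_univ]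
        refine hdiff.continuousOn.comp (by fun_prop) fun z _ => ?_
        rw [mem_ball_zero_iff]
        exact norm_radial_lt_one h0 h1 z
      set Dr : C(Circle, ℂ) := ⟨fun z => D ((r : ℂ) * z), hcont⟩ with hDr
      have hs : HasSum (fun n : ℕ => (d n * (r : ℂ) ^ n) • mono n) Dr := by
        have h2 : Summable fun n : ℕ => (d n * (r : ℂ) ^ n) • mono n := by
          have h3 := (hd r (by
            rw [Complex.norm_real, Real.norm_of_nonneg h0]; exact h1)).summable.norm
          refine Summable.of_norm_bounded h3 fun n => ?_
          rw [norm_smul]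
          refine mul_le_of_le_one_right (norm_nonneg _) ?_
          rw [ContinuousMap.norm_le _ zero_le_one]
          intro z
          rw [mono_apply, norm_zpow_circle]
        obtain ⟨f, hf⟩ := h2
        suffices h : Dr = f by rwa [h]
        ext z
        have h4 := hf.mapL (ContinuousMap.evalCLM ℂ z)
        have h5 := hd _ (norm_radial_lt_one h0 h1 z)
        refine h5.unique ?_
        refine hasSum_congr_fun h4 fun n => ?_
        simp [mul_pow, mul_assoc]
      have hin : ∀ n : ℕ, inner ℂ (cL2 arcMeasure (mono n)) (cL2 arcMeasure Dr) =
          d n * (r : ℂ) ^ n := by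
        intro n
        have h6 := (hs.mapL (cL2 arcMeasure)).mapL (innerSL ℂ (cL2 arcMeasure (mono n)))
        refine h6.unique ?_
        refine hasSum_congr_fun (hasSum_ite_eq n (d n * (r : ℂ) ^ n)) fun k => ?_
        rw [map_smul, map_smul, innerSL_apply_apply,
          (orthonormal_iff_ite.1 orthonormal_mono)]
        by_cases hk : k = n
        · subst hk; simp
        · rw [if_neg (by exact_mod_cast (Ne.symm hk)), if_neg hk, smul_zero]
      have hb := (orthonormal_mono.comp (fun n : ℕ => (n : ℤ))
        Nat.cast_injective).sum_inner_products_le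
        (x := cL2 arcMeasure Dr) (s := Finset.range N)
      simp only [Function.comp, hin] at hb
      refine hb.trans ?_
      rw [norm_cL2_sq]
      exact integral_norm_outerFn_sq_le hpos hW hL h0 h1
    have hcont : Continuous fun r : ℝ => ∑ n ∈ Finset.range N, ‖d n * (r : ℂ) ^ n‖ ^ 2 := by
      fun_prop
    have hlim := (hcont.tendsto 1).mono_left (nhdsWithin_le_nhds (s := Set.Iio 1))
    have h7 := le_of_tendsto hlim (by
      filter_upwards [eventually_radial] with r hr'
      exact hr r hr'.1.le hr'.2)
    simpa using h7
  have hsq : Summable fun n => ‖d n‖ ^ 2 :=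
    summable_of_sum_range_le (fun n => by positivity) hsum
  have hon := orthonormal_mono.comp (fun n : ℕ => (n : ℤ)) Nat.cast_injective
  have hG : Summable fun n : ℕ => d n • cL2 arcMeasure (mono n) := by
    have h := (hon.orthogonalFamily.summable_iff_norm_sq_summable d).2 hsq
    simpa using h
  obtain ⟨G, hG⟩ := hG
  have hGint : Integrable G arcMeasure := (Lp.memLp G).integrable (by norm_num)
  -- `D` is the Poisson integral of `G`, so that Fatou's theorem gives the radial limits.
  have hpois : ∀ z : ℂ, ‖z‖ < 1 → ∫ w, (pker z w : ℂ) * G w ∂arcMeasure = D z := by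
    intro z hz
    set p : C(Circle, ℂ) := ⟨fun w => (pker z w : ℂ),
      Complex.continuous_ofReal.comp (continuous_pker hz)⟩ with hp
    have h1 : ∀ F : Lp ℂ 2 arcMeasure, inner ℂ (cL2 arcMeasure p) F =
        ∫ w, (pker z w : ℂ) * F w ∂arcMeasure := by
      intro F
      rw [inner_cL2_left]
      congr 1
      ext w
      simp [hp, mul_comm]
    rw [← h1]
    have h2 := hG.mapL (innerSL ℂ (cL2 arcMeasure p))
    refine h2.unique ?_
    refine hasSum_congr_fun (hd z hz) fun n => ?_
    rw [map_smul, innerSL_apply_apply, smul_eq_mul, inner_cL2, ← integral_zpow_mul_pker hz n]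
    congr 2
    ext w
    simp [hp]
  refine ⟨G, ?_, ?_, ?_⟩
  · filter_upwards [ae_tendsto_poisson_complex hGint] with z hz
    refine hz.congr' ?_
    filter_upwards [eventually_radial] with r hr
    exact hpois _ (norm_radial_lt_one hr.1.le hr.2 z)
  · filter_upwards [ae_tendsto_poisson_complex hGint, ae_tendsto_poisson hL, hpos] with z hz hz2 hz3
    have h3 := (hz.norm.pow 2)
    have h4 := (Real.continuous_exp.tendsto _).comp hz2
    rw [Real.exp_log hz3] at h4
    refine tendsto_nhds_unique h3 (h4.congr' ?_)
    filter_upwards [eventually_radial] with r hr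
    have hr' := norm_radial_lt_one hr.1.le hr.2 z
    rw [hpois _ hr', hD, norm_outerFn_sq hL hr']
    rfl
  exact ⟨d, hd0, hG⟩

theorem inner_mono_of_hasSum {d : ℕ → ℂ} {G : Lp ℂ 2 arcMeasure}
    (hG : HasSum (fun n : ℕ => d n • cL2 arcMeasure (mono n)) G) (k : ℕ) :
    inner ℂ (cL2 arcMeasure (mono (-k))) G = if k = 0 then d 0 else 0 := by
  have h2 := hG.mapL (innerSL ℂ (cL2 arcMeasure (mono (-k))))
  refine h2.unique ?_
  have h5 : ∀ n : ℕ, innerSL ℂ (cL2 arcMeasure (mono (-(k : ℤ)))) (d n • cL2 arcMeasure (mono n)) =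
      if -(k : ℤ) = n then d n else 0 := by
    intro n
    rw [map_smul, innerSL_apply_apply, (orthonormal_iff_ite.1 orthonormal_mono)]
    split_ifs <;> simp
  simp_rw [h5]
  split_ifs with hk
  · subst hk
    refine hasSum_congr_fun (hasSum_ite_eq 0 (d 0)) fun n => ?_
    by_cases hn : n = 0
    · subst hn; simp
    · rw [if_neg (by omega), if_neg hn]
  · refine hasSum_congr_fun hasSum_zero fun n => ?_
    rw [if_neg (by omega)]

/-! ### Tools in `L²` of the circle -/

section L2
variable {μ : Measure Circle}

theorem memLp_mul_of_continuous [IsFiniteMeasure μ] (g : C(Circle, ℂ)) {F : Circle → ℂ}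
    (hF : MemLp F 2 μ) : MemLp (fun z => g z * F z) 2 μ := by
  refine hF.of_le_mul (c := ‖g‖) (g.continuous.aestronglyMeasurable.mul hF.1) ?_
  filter_upwards with z
  rw [norm_mul]
  gcongr
  exact g.norm_coe_le_norm z

theorem lp_norm_sq (F : Lp ℂ 2 μ) : ‖F‖ ^ 2 = ∫ z, ‖F z‖ ^ 2 ∂μ := by
  have h := inner_self_eq_norm_sq_to_K (𝕜 := ℂ) F
  rw [L2.inner_def] at h
  have h2 : ∀ z, inner ℂ (F z) (F z) = ((‖F z‖ ^ 2 : ℝ) : ℂ) := by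
    intro z
    rw [inner_self_eq_norm_sq_to_K]
    norm_cast
  simp_rw [h2] at h
  have h3 := integral_ofReal (𝕜 := ℂ) (μ := μ) (f := fun z => ‖F z‖ ^ 2)
  have h4 := h3.symm.trans h
  apply Complex.ofReal_injective
  rw [← Complex.coe_algebraMap] at *
  simpa using h4.symm

theorem integrable_norm_sq (F : Lp ℂ 2 μ) : Integrable (fun z => ‖F z‖ ^ 2) μ :=
  (Lp.memLp F).integrable_norm_pow (by norm_num)

/-- Multiplication by a continuous function on `L²(μ)`. -/
noncomputable def mulL2 (μ : Measure Circle) [IsFiniteMeasure μ] (g : C(Circle, ℂ)) :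
    Lp ℂ 2 μ →L[ℂ] Lp ℂ 2 μ :=
  LinearMap.mkContinuous
    { toFun := fun F => (memLp_mul_of_continuous g (Lp.memLp F)).toLp _
      map_add' := fun F H => by
        apply Lp.ext
        filter_upwards [MemLp.coeFn_toLp (memLp_mul_of_continuous g (Lp.memLp (F + H))),
          Lp.coeFn_add F H,
          Lp.coeFn_add ((memLp_mul_of_continuous g (Lp.memLp F)).toLp _)
            ((memLp_mul_of_continuous g (Lp.memLp H)).toLp _),
          MemLp.coeFn_toLp (memLp_mul_of_continuous g (Lp.memLp F)),
          MemLp.coeFn_toLp (memLp_mul_of_continuous g (Lp.memLp H))] with z h1 h2 h3 h4 h5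
        rw [h1, h3, Pi.add_apply, h4, h5, h2, Pi.add_apply, mul_add]
      map_smul' := fun c F => by
        apply Lp.ext
        filter_upwards [MemLp.coeFn_toLp (memLp_mul_of_continuous g (Lp.memLp (c • F))),
          Lp.coeFn_smul c F,
          Lp.coeFn_smul c ((memLp_mul_of_continuous g (Lp.memLp F)).toLp _),
          MemLp.coeFn_toLp (memLp_mul_of_continuous g (Lp.memLp F))] with z h1 h2 h3 h4
        rw [h1, RingHom.id_apply, h3, Pi.smul_apply, h4, h2, Pi.smul_apply, smul_eq_mul,
          smul_eq_mul, mul_left_comm] } ‖g‖ (fun F => by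
    refine le_of_sq_le_sq ?_ (by positivity)
    rw [mul_pow, lp_norm_sq, lp_norm_sq, ← integral_const_mul]
    apply integral_mono_ae (integrable_norm_sq _) ((integrable_norm_sq F).const_mul _)
    filter_upwards [MemLp.coeFn_toLp (memLp_mul_of_continuous g (Lp.memLp F))] with z h1
    simp only [LinearMap.coe_mk, AddHom.coe_mk]
    rw [h1, norm_mul, mul_pow]
    gcongr
    exact g.norm_coe_le_norm z)

theorem coeFn_mulL2 [IsFiniteMeasure μ] (g : C(Circle, ℂ)) (F : Lp ℂ 2 μ) :
    mulL2 μ g F =ᵐ[μ] fun z => g z * F z :=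
  MemLp.coeFn_toLp (memLp_mul_of_continuous g (Lp.memLp F))

theorem mulL2_cL2 [IsFiniteMeasure μ] (g f : C(Circle, ℂ)) :
    mulL2 μ g (cL2 μ f) = cL2 μ (g * f) := by
  apply Lp.ext
  filter_upwards [coeFn_mulL2 g (cL2 μ f), coeFn_cL2 μ f, coeFn_cL2 μ (g * f)] with z h1 h2 h3
  rw [h1, h2, h3, ContinuousMap.mul_apply]

/-- The Cauchy–Schwarz inequality against `1` on a probability space. -/
theorem norm_integral_sq_le [IsProbabilityMeasure μ] {f : Circle → ℂ} (hf : MemLp f 2 μ) :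
    ‖∫ z, f z ∂μ‖ ^ 2 ≤ ∫ z, ‖f z‖ ^ 2 ∂μ := by
  have h1 : inner ℂ (cL2 μ 1) (hf.toLp f) = ∫ z, f z ∂μ := by
    rw [inner_cL2_left]
    apply integral_congr_ae
    filter_upwards [hf.coeFn_toLp] with z hz
    simp [hz]
  have h2 : ‖cL2 μ 1‖ = 1 := by
    have h3 := norm_cL2_sq (σ := μ) 1
    simp only [ContinuousMap.one_apply, norm_one, one_pow, integral_const, probReal_univ,
      smul_eq_mul, mul_one] at h3
    exact (sq_eq_sq₀ (norm_nonneg _) zero_le_one).1 (by rw [h3, one_pow])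
  have h4 := norm_inner_le_norm (𝕜 := ℂ) (cL2 μ 1) (hf.toLp f)
  rw [h1, h2, one_mul] at h4
  have h5 : ‖hf.toLp f‖ ^ 2 = ∫ z, ‖f z‖ ^ 2 ∂μ := by
    rw [lp_norm_sq]
    apply integral_congr_ae
    filter_upwards [hf.coeFn_toLp] with z hz
    rw [hz]
  rw [← h5]
  gcongr

end L2

variable {σ : Measure Circle}

/-! ### The `L²` limit of the reversed polynomials -/

theorem mulL2_starVec [IsFiniteMeasure σ] (l : ℤ) (n : ℕ) :
    mulL2 σ (mono l) (starVec σ 0 n) = starVec σ l n := by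
  rw [starVec, starVec, mulL2_cL2]
  congr 1
  ext z
  simp

theorem exists_tendsto_lam [IsFiniteMeasure σ] (hσ : NonDegenerate σ)
    (hb : BddAbove (Set.range (lam σ))) : ∃ l, Tendsto (lam σ) atTop (𝓝 l) :=
  ⟨_, tendsto_atTop_ciSup (lam_mono hσ) hb⟩

theorem exists_tendsto_starVec [IsProbabilityMeasure σ] (hσ : NonDegenerate σ)
    (hb : BddAbove (Set.range (lam σ))) : ∃ Ψ : Lp ℂ 2 σ, Tendsto (starVec σ 0) atTop (𝓝 Ψ) := by
  obtain ⟨l, hl⟩ := exists_tendsto_lam hσ hb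
  have hle : ∀ n, lam σ n ≤ l := (lam_mono hσ).ge_of_tendsto hl
  apply cauchySeq_tendsto_of_complete
  refine cauchySeq_of_le_tendsto_0' (fun n => Real.sqrt (2 * (l - lam σ n))) ?_ ?_
  · intro n N h
    rw [dist_comm, dist_eq_norm]
    apply Real.le_sqrt_of_sq_le
    refine (norm_starVec_sub_sq_le hσ le_rfl h le_rfl).trans ?_
    linarith [hle N]
  · have h1 : Tendsto (fun n => Real.sqrt (2 * (l - lam σ n))) atTop
        (𝓝 (Real.sqrt (2 * (l - l)))) :=
      (Real.continuous_sqrt.tendsto _).comp ((hl.const_sub l).const_mul 2)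
    simpa using h1

variable {Ψ : Lp ℂ 2 σ}

theorem inner_mulL2_mono_limit [IsProbabilityMeasure σ] (hσ : NonDegenerate σ)
    (hb : BddAbove (Set.range (lam σ))) (hΨ : Tendsto (starVec σ 0) atTop (𝓝 Ψ)) (l : ℕ) :
    inner ℂ Ψ (mulL2 σ (mono l) Ψ) = if l = 0 then 1 else 0 := by
  have h1 : Tendsto (fun n => inner ℂ (starVec σ 0 n) (mulL2 σ (mono l) (starVec σ 0 n))) atTop
      (𝓝 (inner ℂ Ψ (mulL2 σ (mono l) Ψ))) :=
    hΨ.inner (((mulL2 σ (mono l)).continuous.tendsto _).comp hΨ)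
  simp_rw [mulL2_starVec] at h1
  refine tendsto_nhds_unique h1 ?_
  split_ifs with hl
  · subst hl
    refine tendsto_const_nhds.congr fun n => ?_
    rw [Nat.cast_zero, inner_self_eq_norm_sq_to_K, norm_starVec hσ]
    simp
  · obtain ⟨a, ha⟩ := exists_tendsto_lam hσ hb
    rw [tendsto_zero_iff_norm_tendsto_zero]
    have h2 : Tendsto (fun n => 2 * (lam σ (n + l) - lam σ (n - l))) atTop (𝓝 0) := by
      have h3 := ((ha.comp (tendsto_add_atTop_nat l)).sub
        (ha.comp (tendsto_sub_atTop_nat l))).const_mul 2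
      simpa using h3
    refine squeeze_zero' (.of_forall fun n => norm_nonneg _) ?_ h2
    filter_upwards [eventually_ge_atTop l] with n hn
    exact norm_inner_starVec_self_le hσ (Nat.one_le_iff_ne_zero.2 hl) hn

theorem integral_zpow_mul_norm_sq [IsFiniteMeasure σ] (Ψ : Lp ℂ 2 σ) (l : ℤ) :
    ∫ z : Circle, (z : ℂ) ^ l * ((‖Ψ z‖ ^ 2 : ℝ) : ℂ) ∂σ = inner ℂ Ψ (mulL2 σ (mono l) Ψ) := by
  rw [L2.inner_def]
  apply integral_congr_ae
  filter_upwards [coeFn_mulL2 (mono l) Ψ] with z hz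
  rw [hz, mono_apply, RCLike.inner_apply, mul_assoc, Complex.mul_conj, Complex.normSq_eq_norm_sq]

/-- `|Ψ|² dσ = dm`, because the moments of `|φ_n|² dσ` tend to those of `m`. -/
theorem withDensity_limit [IsProbabilityMeasure σ] (hσ : NonDegenerate σ)
    (hb : BddAbove (Set.range (lam σ))) (hΨ : Tendsto (starVec σ 0) atTop (𝓝 Ψ)) :
    σ.withDensity (fun z => ENNReal.ofReal (‖Ψ z‖ ^ 2)) = arcMeasure := by
  have hm : Measurable fun z => ENNReal.ofReal (‖Ψ z‖ ^ 2) :=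
    ((Lp.stronglyMeasurable Ψ).measurable.norm.pow_const 2).ennreal_ofReal
  have hfin : IsFiniteMeasure (σ.withDensity fun z => ENNReal.ofReal (‖Ψ z‖ ^ 2)) :=
    isFiniteMeasure_withDensity_ofReal (integrable_norm_sq Ψ).2
  apply measure_ext_of_moments
  intro n
  rw [integral_withDensity_eq_integral_toReal_smul hm (.of_forall fun z => ENNReal.ofReal_lt_top),
    integral_zpow_arcMeasure]
  have e : ∀ z : Circle, (ENNReal.ofReal (‖Ψ z‖ ^ 2)).toReal • (z : ℂ) ^ n =
      (z : ℂ) ^ n * ((‖Ψ z‖ ^ 2 : ℝ) : ℂ) := by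
    intro z
    rw [ENNReal.toReal_ofReal (by positivity), Complex.real_smul, mul_comm]
  simp_rw [e]
  obtain ⟨l, rfl | rfl⟩ := n.eq_nat_or_neg
  · rw [integral_zpow_mul_norm_sq, inner_mulL2_mono_limit hσ hb hΨ]
    simp
  · have h1 : ∀ z : Circle, (z : ℂ) ^ (-(l : ℤ)) * ((‖Ψ z‖ ^ 2 : ℝ) : ℂ) =
        (starRingEnd ℂ) ((z : ℂ) ^ (l : ℤ) * ((‖Ψ z‖ ^ 2 : ℝ) : ℂ)) := by
      intro z
      rw [map_mul, map_zpow₀, conj_coe_circle, inv_zpow, zpow_neg, Complex.conj_ofReal]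
    simp_rw [h1]
    rw [integral_conj, integral_zpow_mul_norm_sq, inner_mulL2_mono_limit hσ hb hΨ]
    split_ifs <;> simp_all

theorem inner_mono_limit [IsFiniteMeasure σ] (hσ : NonDegenerate σ)
    (hΨ : Tendsto (starVec σ 0) atTop (𝓝 Ψ)) {l : ℝ} (hl : Tendsto (lam σ) atTop (𝓝 l))
    (k : ℕ) : inner ℂ (cL2 σ (mono k)) Ψ = if k = 0 then ((l⁻¹ : ℝ) : ℂ) else 0 := by
  have h1 : Tendsto (fun n => inner ℂ (cL2 σ (mono k)) (starVec σ 0 n)) atTop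
      (𝓝 (inner ℂ (cL2 σ (mono k)) Ψ)) := tendsto_const_nhds.inner hΨ
  refine tendsto_nhds_unique h1 ?_
  split_ifs with hk
  · subst hk
    have hl0 : l ≠ 0 := by
      have := (lam_mono hσ).ge_of_tendsto hl 0
      linarith [lam_pos hσ 0] |> fun h : 0 < l => h.ne'
    refine ((Complex.continuous_ofReal.tendsto _).comp (hl.inv₀ hl0)).congr fun n => ?_
    rw [Nat.cast_zero, inner_one_starVec hσ]
    rfl
  · refine tendsto_const_nhds.congr' ?_
    filter_upwards [eventually_ge_atTop k] with n hn
    exact (inner_mono_starVec_eq_zero hσ (Nat.one_le_iff_ne_zero.2 hk) hn).symm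

/-- Under the pointwise convergence assumption the pointwise limit is the `L²` limit. -/
theorem PCA.ae_tendsto [IsFiniteMeasure σ] (hpca : PCA σ)
    (hΨ : Tendsto (starVec σ 0) atTop (𝓝 Ψ)) (hac : arcMeasure ≪ σ) :
    ∀ᵐ z ∂arcMeasure, Tendsto (fun n => phiStar σ n z) atTop (𝓝 (Ψ z)) := by
  have h1 := tendstoInMeasure_of_tendsto_Lp hΨ
  obtain ⟨ns, hns, h2⟩ := h1.exists_seq_tendsto_ae
  have h3 : ∀ᵐ z ∂σ, ∀ n, starVec σ 0 n z = phiStar σ n z := by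
    rw [ae_all_iff]
    intro n
    filter_upwards [coeFn_cL2 σ (mono 0 * phiStarC σ n)] with z hz
    rw [starVec, hz]
    simp
  filter_upwards [hpca, hac.ae_le h2, hac.ae_le h3] with z hz h4 h5
  obtain ⟨l, hl⟩ := hz
  have h6 := hl.comp hns.tendsto_atTop
  simp_rw [h5] at h4
  rwa [tendsto_nhds_unique h4 h6]

/-! ### The Szegő class -/

section Szego
variable {σ : Measure Circle} {E : Set Circle}

theorem IsACCarrier.restrict_eq [IsFiniteMeasure σ] (hE : IsACCarrier σ E) :
    σ.restrict E = arcMeasure.withDensity (σ.rnDeriv arcMeasure) := by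
  have h0 := Measure.haveLebesgueDecomposition_add σ arcMeasure
  conv_lhs => rw [h0]
  rw [Measure.restrict_add, Measure.restrict_eq_zero.2 hE.singularPart_null, zero_add,
    restrict_withDensity hE.measurableSet, Measure.restrict_eq_self_of_ae_mem]
  exact mem_ae_iff.2 hE.compl_null

theorem exists_isACCarrier (σ : Measure Circle) [IsFiniteMeasure σ] : ∃ E, IsACCarrier σ E := by
  obtain ⟨s, hs, h1, h2⟩ := Measure.mutuallySingular_singularPart σ arcMeasure
  exact ⟨s, hs, h2, h1⟩

theorem IsACCarrier.ae_restrict [IsFiniteMeasure σ] (hE : IsACCarrier σ E) {P : Circle → Prop}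
    (h : ∀ᵐ z ∂arcMeasure, P z) : ∀ᵐ z ∂(σ.restrict E), P z := by
  rw [hE.restrict_eq]
  exact (withDensity_absolutelyContinuous _ _).ae_le h

theorem measurable_acDensity (σ : Measure Circle) : Measurable (acDensity σ) :=
  (Measure.measurable_rnDeriv _ _).ennreal_toReal

theorem acDensity_nonneg (z : Circle) : 0 ≤ acDensity σ z := ENNReal.toReal_nonneg

theorem integrable_acDensity [IsFiniteMeasure σ] : Integrable (acDensity σ) arcMeasure :=
  Measure.integrable_toReal_rnDeriv

theorem IsACCarrier.setIntegral [IsFiniteMeasure σ] (hE : IsACCarrier σ E) {V : Type*}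
    [NormedAddCommGroup V] [NormedSpace ℝ V] (F : Circle → V) :
    ∫ z in E, F z ∂σ = ∫ z, acDensity σ z • F z ∂arcMeasure := by
  rw [hE.restrict_eq, integral_withDensity_eq_integral_toReal_smul
    (Measure.measurable_rnDeriv _ _) (Measure.rnDeriv_lt_top _ _)]
  rfl

theorem IsACCarrier.integrable_smul [IsFiniteMeasure σ] (hE : IsACCarrier σ E) {V : Type*}
    [NormedAddCommGroup V] [NormedSpace ℝ V] {F : Circle → V} (hF : Integrable F σ) :
    Integrable (fun z => acDensity σ z • F z) arcMeasure := by
  have h := hF.restrict (s := E)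
  rw [hE.restrict_eq, integrable_withDensity_iff_integrable_smul'
    (Measure.measurable_rnDeriv _ _) (Measure.rnDeriv_lt_top _ _)] at h
  exact h

theorem SzegoClass.arcMeasure_ac [IsFiniteMeasure σ] (hs : SzegoClass σ) : arcMeasure ≪ σ := by
  obtain ⟨E, hE⟩ := exists_isACCarrier σ
  have h1 : arcMeasure ≪ arcMeasure.withDensity (σ.rnDeriv arcMeasure) := by
    apply withDensity_absolutelyContinuous' (Measure.measurable_rnDeriv _ _).aemeasurable
    filter_upwards [hs.density_pos] with z hz h0
    rw [acDensity, h0] at hz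
    simp at hz
  rw [← hE.restrict_eq] at h1
  exact h1.trans Measure.absolutelyContinuous_restrict

theorem polyC_eq_sum (p : Polynomial ℂ) :
    polyC p = ∑ k ∈ Finset.range (p.natDegree + 1), p.coeff k • mono k := by
  conv_lhs => rw [p.as_sum_range]
  rw [map_sum]
  refine Finset.sum_congr rfl fun k _ => ?_
  ext z
  simp

theorem inner_mono_polyC_arcMeasure (p : Polynomial ℂ) (n : ℕ) :
    inner ℂ (cL2 arcMeasure (mono n)) (cL2 arcMeasure (polyC p)) = p.coeff n := by
  rw [polyC_eq_sum, map_sum, inner_sum]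
  simp_rw [map_smul, inner_smul_right, orthonormal_iff_ite.1 orthonormal_mono]
  simp only [Nat.cast_inj, mul_ite, mul_one, mul_zero, Finset.sum_ite_eq, Finset.mem_range]
  split_ifs with h
  · rfl
  · exact (Polynomial.coeff_eq_zero_of_natDegree_lt (by omega)).symm

theorem SzegoClass.nonDegenerate [IsFiniteMeasure σ] (hs : SzegoClass σ) : NonDegenerate σ := by
  intro p hp
  have hcont : Continuous fun z : Circle => ‖p.eval (z : ℂ)‖ ^ 2 := by fun_prop
  rw [integral_pos_iff_support_of_nonneg (fun z => by positivity)
    (integrable_of_continuous σ hcont), pos_iff_ne_zero]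
  intro h0
  have h1 : ∀ᵐ z : Circle ∂arcMeasure, p.eval (z : ℂ) = 0 := by
    have h2 := hs.arcMeasure_ac h0
    filter_upwards [measure_eq_zero_iff_ae_notMem.1 h2] with z hz
    simpa using hz
  apply hp
  ext n
  rw [← inner_mono_polyC_arcMeasure, Polynomial.coeff_zero]
  have h3 : cL2 arcMeasure (polyC p) = 0 := by
    apply Lp.ext
    filter_upwards [coeFn_cL2 arcMeasure (polyC p), h1, Lp.coeFn_zero ℂ 2 arcMeasure]
      with z h4 h5 h6
    rw [h4, h6, polyC_apply, h5]
    rfl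
  rw [h3, inner_zero_right]

theorem outerFn_zero (L : Circle → ℝ) :
    outerFn L 0 = ((Real.exp (1 / 2 * ∫ w, L w ∂arcMeasure) : ℝ) : ℂ) := by
  have h : herglotz L 0 = ((∫ w, L w ∂arcMeasure : ℝ) : ℂ) := by
    have h1 := integral_ofReal (𝕜 := ℂ) (μ := arcMeasure) (f := L)
    refine Eq.trans ?_ h1
    rw [herglotz]
    congr 1
    ext w
    rw [add_zero, sub_zero, div_self (Circle.coe_ne_zero w), one_mul]
    rfl
  rw [outerFn, h, Complex.ofReal_exp]
  push_cast
  rfl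

/-- If `|G|² = σ'`, multiplication by `G` maps `L²(σ)` contractively to `L²(m)`. -/
theorem memLp_mul_boundary [IsFiniteMeasure σ] {G : Lp ℂ 2 arcMeasure}
    (hG : ∀ᵐ z ∂arcMeasure, ‖G z‖ ^ 2 = acDensity σ z) (F : Lp ℂ 2 σ) :
    MemLp (fun z => F z * G z) 2 arcMeasure ∧
      ∫ z, ‖F z * G z‖ ^ 2 ∂arcMeasure ≤ ‖F‖ ^ 2 := by
  obtain ⟨E, hE⟩ := exists_isACCarrier σ
  have hm : AEStronglyMeasurable (fun z => F z * G z) arcMeasure :=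
    (Lp.stronglyMeasurable F).aestronglyMeasurable.mul
      (Lp.stronglyMeasurable G).aestronglyMeasurable
  have e : (fun z => ‖F z * G z‖ ^ 2) =ᵐ[arcMeasure] fun z => acDensity σ z • ‖F z‖ ^ 2 := by
    filter_upwards [hG] with z hz
    rw [norm_mul, mul_pow, hz, smul_eq_mul, mul_comm]
  constructor
  · rw [memLp_two_iff_integrable_sq_norm hm, integrable_congr e]
    exact hE.integrable_smul (integrable_norm_sq F)
  · rw [integral_congr_ae e, ← hE.setIntegral, lp_norm_sq]
    exact setIntegral_le_integral (integrable_norm_sq F) (.of_forall fun z => by positivity)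

theorem star_phiStarC (n : ℕ) : star (phiStarC σ n) =
    ∑ k ∈ Finset.range ((orthonormalOP σ n).natDegree + 1),
      (orthonormalOP σ n).coeff k • mono ((k : ℤ) - n) := by
  have h : star (phiStarC σ n) = mono (-n) * polyC (orthonormalOP σ n) := by
    ext z
    simp [phiStar, conj_coe_circle]
  rw [h, polyC_eq_sum, Finset.mul_sum]
  refine Finset.sum_congr rfl fun k _ => ?_
  ext z
  simp only [ContinuousMap.mul_apply, ContinuousMap.smul_apply, mono_apply, smul_eq_mul]
  rw [mul_left_comm, ← zpow_add₀ (Circle.coe_ne_zero z)]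
  congr 2
  ring

/-- `∫ φ_n^* G dm` is the leading coefficient of `φ_n` times the mean of `G`, for `G` in the Hardy
space. -/
theorem integral_phiStar_mul (hσ : NonDegenerate σ) {d : ℕ → ℂ} {G : Lp ℂ 2 arcMeasure}
    (hG : HasSum (fun n : ℕ => d n • cL2 arcMeasure (mono n)) G) (n : ℕ) :
    ∫ z, phiStar σ n z * G z ∂arcMeasure = lam σ n * d 0 := by
  have h1 : inner ℂ (cL2 arcMeasure (star (phiStarC σ n))) G =
      ∫ z, phiStar σ n z * G z ∂arcMeasure := by
    rw [inner_cL2_left]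
    congr 1
    ext z
    simp [mul_comm]
  rw [← h1, star_phiStarC, map_sum, sum_inner]
  have hdeg : (orthonormalOP σ n).natDegree = n :=
    Polynomial.natDegree_eq_of_degree_eq_some (degree_orthonormalOP hσ n)
  rw [hdeg, Finset.sum_eq_single_of_mem n (by simp)]
  · have h2 := inner_mono_of_hasSum hG 0
    rw [map_smul, inner_smul_left, sub_self, coeff_orthonormalOP]
    simp only [Nat.cast_zero, neg_zero, if_true] at h2
    rw [h2, Complex.conj_ofReal]
  · intro k hk hkn
    have hk' : k < n := by
      have := Finset.mem_range.1 hk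
      omega
    have h2 := inner_mono_of_hasSum hG (n - k)
    rw [if_neg (by omega), Nat.cast_sub hk'.le, neg_sub] at h2
    rw [map_smul, inner_smul_left, h2, mul_zero]

theorem coeFn_starVec_zero [IsFiniteMeasure σ] (n : ℕ) : starVec σ 0 n =ᵐ[σ] phiStar σ n := by
  filter_upwards [coeFn_cL2 σ (mono 0 * phiStarC σ n)] with z hz
  rw [starVec, hz]
  simp

/-- The Szegő class condition bounds the leading coefficients. -/
theorem lam_mul_exp_le [IsProbabilityMeasure σ] (hs : SzegoClass σ) (n : ℕ) :
    lam σ n * Real.exp (1 / 2 * ∫ w, Real.log (acDensity σ w) ∂arcMeasure) ≤ 1 := by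
  obtain ⟨G, -, hG, d, hd0, hd⟩ :=
    exists_outer_boundary hs.density_pos integrable_acDensity hs.integrable_log
  have h1 := integral_phiStar_mul hs.nonDegenerate hd n
  rw [hd0, outerFn_zero, ← Complex.ofReal_mul] at h1
  obtain ⟨h2, h3⟩ := memLp_mul_boundary hG (starVec σ 0 n)
  have h4 := (norm_integral_sq_le h2).trans h3
  rw [norm_starVec hs.nonDegenerate] at h4
  have h5 : ∫ z, starVec σ 0 n z * G z ∂arcMeasure = ∫ z, phiStar σ n z * G z ∂arcMeasure := by
    apply integral_congr_ae
    filter_upwards [hs.arcMeasure_ac.ae_le (coeFn_starVec_zero n)] with z hz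
    rw [hz]
  rw [h5, h1, Complex.norm_real, Real.norm_eq_abs, sq_abs, one_pow] at h4
  nlinarith [Real.exp_pos (1 / 2 * ∫ w, Real.log (acDensity σ w) ∂arcMeasure),
    lam_pos hs.nonDegenerate n]

theorem SzegoClass.bddAbove_lam [IsProbabilityMeasure σ] (hs : SzegoClass σ) :
    BddAbove (Set.range (lam σ)) := by
  refine ⟨(Real.exp (1 / 2 * ∫ w, Real.log (acDensity σ w) ∂arcMeasure))⁻¹, ?_⟩
  rintro _ ⟨n, rfl⟩
  rw [← one_div, le_div_iff₀ (Real.exp_pos _)]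
  exact lam_mul_exp_le hs n

variable {Ψ : Lp ℂ 2 σ}

theorem IsACCarrier.limit_eq_zero [IsProbabilityMeasure σ] (hE : IsACCarrier σ E)
    (h : σ.withDensity (fun z => ENNReal.ofReal (‖Ψ z‖ ^ 2)) = arcMeasure) :
    ∀ᵐ z ∂(σ.restrict Eᶜ), Ψ z = 0 := by
  have h1 := hE.compl_null
  have hm : Measurable fun z => ENNReal.ofReal (‖Ψ z‖ ^ 2) :=
    ((Lp.stronglyMeasurable Ψ).measurable.norm.pow_const 2).ennreal_ofReal
  rw [← h, withDensity_apply _ hE.measurableSet.compl, lintegral_eq_zero_iff hm] at h1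
  filter_upwards [h1] with z hz
  have h2 : ENNReal.ofReal (‖Ψ z‖ ^ 2) = 0 := hz
  rw [ENNReal.ofReal_eq_zero] at h2
  have : ‖Ψ z‖ = 0 := by nlinarith [norm_nonneg (Ψ z)]
  exact norm_eq_zero.1 this

theorem norm_limit_sq_mul_acDensity [IsProbabilityMeasure σ]
    (h : σ.withDensity (fun z => ENNReal.ofReal (‖Ψ z‖ ^ 2)) = arcMeasure) :
    ∀ᵐ z ∂arcMeasure, ‖Ψ z‖ ^ 2 * acDensity σ z = 1 := by
  obtain ⟨E, hE⟩ := exists_isACCarrier σ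
  have hm : Measurable fun z => ENNReal.ofReal (‖Ψ z‖ ^ 2) :=
    ((Lp.stronglyMeasurable Ψ).measurable.norm.pow_const 2).ennreal_ofReal
  have h1 : arcMeasure.restrict E = arcMeasure :=
    Measure.restrict_eq_self_of_ae_mem (mem_ae_iff.2 hE.compl_null)
  have h2 : arcMeasure.withDensity
      (σ.rnDeriv arcMeasure * fun z => ENNReal.ofReal (‖Ψ z‖ ^ 2)) =
      arcMeasure.withDensity 1 := by
    rw [withDensity_mul _ (Measure.measurable_rnDeriv _ _) hm, ← hE.restrict_eq,
      ← restrict_withDensity hE.measurableSet, h, h1, withDensity_one]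
  filter_upwards [(withDensity_eq_iff_of_sigmaFinite
    ((Measure.measurable_rnDeriv _ _).mul hm).aemeasurable aemeasurable_one).1 h2] with z hz
  have h3 : σ.rnDeriv arcMeasure z * ENNReal.ofReal (‖Ψ z‖ ^ 2) = 1 := hz
  have h4 := congrArg ENNReal.toReal h3
  rw [ENNReal.toReal_mul, ENNReal.toReal_ofReal (by positivity), ENNReal.toReal_one] at h4
  rw [mul_comm]
  exact h4

/-- Szegő's theorem, the lower bound for the limit of the leading coefficients. -/
theorem one_le_limit_mul_exp [IsProbabilityMeasure σ] (hs : SzegoClass σ)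
    (hΨ : Tendsto (starVec σ 0) atTop (𝓝 Ψ)) {l : ℝ} (hl : Tendsto (lam σ) atTop (𝓝 l)) :
    1 ≤ l * Real.exp (1 / 2 * ∫ w, Real.log (acDensity σ w) ∂arcMeasure) := by
  have hσ := hs.nonDegenerate
  have hden := withDensity_limit hσ hs.bddAbove_lam hΨ
  obtain ⟨E, hE⟩ := exists_isACCarrier σ
  have hl0 : 0 < l := zero_lt_one.trans_le (ge_of_tendsto' hl (one_le_lam hσ))
  have hone := norm_limit_sq_mul_acDensity hden
  set w := acDensity σ with hw
  have hw0 : ∀ z, 0 ≤ w z := acDensity_nonneg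
  have hQm : AEStronglyMeasurable (fun z => (w z : ℂ) * Ψ z) arcMeasure :=
    (Complex.measurable_ofReal.comp (measurable_acDensity σ)).aestronglyMeasurable.mul
      (Lp.stronglyMeasurable Ψ).aestronglyMeasurable
  -- `σ' Ψ` has no Fourier coefficients of positive index, and its mean is `1 / l`.
  have hQn : ∀ᵐ z ∂arcMeasure, ‖(w z : ℂ) * Ψ z‖ ^ 2 = w z := by
    filter_upwards [hone] with z hz
    rw [norm_mul, mul_pow, Complex.norm_real, Real.norm_eq_abs, sq_abs]
    linear_combination w z * hz
  have hQ : MemLp (fun z => (w z : ℂ) * Ψ z) 2 arcMeasure := by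
    rw [memLp_two_iff_integrable_sq_norm hQm, integrable_congr hQn]
    exact integrable_acDensity
  have hQin : ∀ k : ℕ, inner ℂ (cL2 arcMeasure (mono k)) (hQ.toLp _) =
      if k = 0 then ((l⁻¹ : ℝ) : ℂ) else 0 := by
    intro k
    rw [← inner_mono_limit hσ hΨ hl k, inner_cL2_left, inner_cL2_left]
    have h1 : ∫ z, Ψ z * (starRingEnd ℂ) (mono k z) ∂σ =
        ∫ z in E, Ψ z * (starRingEnd ℂ) (mono k z) ∂σ := by
      symm
      apply setIntegral_eq_integral_of_ae_compl_eq_zero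
      have h2 := hE.limit_eq_zero hden
      rw [ae_restrict_iff' hE.measurableSet.compl] at h2
      filter_upwards [h2] with z hz hzE
      rw [hz hzE, zero_mul]
    rw [h1, hE.setIntegral]
    apply integral_congr_ae
    filter_upwards [hQ.coeFn_toLp] with z hz
    rw [hz, Complex.real_smul, mul_assoc]
  -- Pair `σ' Ψ` with the outer function `G` such that `|G|² = (σ' + ε)⁻¹`: the product has modulus
  -- at most `1`, and its integral is `G(0) / l`.
  have key : ∀ ε : ℝ, 0 < ε →
      Real.exp (1 / 2 * ∫ z, Real.log (w z + ε)⁻¹ ∂arcMeasure) ≤ l := by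
    intro ε hε
    have hpos : ∀ z, 0 < w z + ε := fun z => by linarith [hw0 z]
    have hwm : Measurable fun z => (w z + ε)⁻¹ := ((measurable_acDensity σ).add_const ε).inv
    have hW : Integrable (fun z => (w z + ε)⁻¹) arcMeasure := by
      refine (integrable_const ε⁻¹).mono' hwm.aestronglyMeasurable (.of_forall fun z => ?_)
      rw [Real.norm_of_nonneg (inv_pos.2 (hpos z)).le]
      exact inv_anti₀ hε (by linarith [hw0 z])
    have hL : Integrable (fun z => Real.log (w z + ε)⁻¹) arcMeasure := by
      have hdom : Integrable (fun z => w z + ε + |Real.log ε|) arcMeasure :=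
        (integrable_acDensity.add (integrable_const ε)).add (integrable_const _)
      refine hdom.mono' hwm.log.aestronglyMeasurable (.of_forall fun z => ?_)
      rw [Real.log_inv, norm_neg, Real.norm_eq_abs, abs_le]
      have h1 := Real.log_le_sub_one_of_pos (hpos z)
      have h2 := Real.log_le_log hε (by linarith [hw0 z] : ε ≤ w z + ε)
      have h3 := neg_abs_le (Real.log ε)
      have h4 := hw0 z
      have h5 := abs_nonneg (Real.log ε)
      constructor <;> linarith
    obtain ⟨G, -, hG, d, hd0, hd⟩ :=
      exists_outer_boundary (.of_forall fun z => inv_pos.2 (hpos z)) hW hL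
    rw [outerFn_zero] at hd0
    have h1 : inner ℂ (hQ.toLp _) G = d 0 * ((l⁻¹ : ℝ) : ℂ) := by
      have h2 := hd.mapL (innerSL ℂ (hQ.toLp _))
      refine h2.unique ?_
      refine hasSum_congr_fun (hasSum_ite_eq 0 (d 0 * ((l⁻¹ : ℝ) : ℂ))) fun n => ?_
      rw [map_smul, innerSL_apply_apply, ← inner_conj_symm, hQin, smul_eq_mul]
      split_ifs with h
      · rw [Complex.conj_ofReal, h]
      · rw [map_zero, mul_zero]
    have h2 : ‖inner ℂ (hQ.toLp _) G‖ ≤ 1 := by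
      rw [L2.inner_def]
      have h3 : ∀ᵐ z ∂arcMeasure, ‖inner ℂ (hQ.toLp _ z) (G z)‖ ≤ 1 := by
        filter_upwards [hQ.coeFn_toLp, hQn, hG] with z h4 h5 h6
        rw [h4, RCLike.inner_apply, norm_mul, RCLike.norm_conj]
        have h7 : ‖G z‖ ^ 2 * ‖(w z : ℂ) * Ψ z‖ ^ 2 ≤ 1 := by
          rw [h5, h6, inv_mul_le_iff₀ (hpos z)]
          linarith
        rw [← mul_pow] at h7
        exact (sq_le_one_iff₀ (by positivity)).1 h7
      have h8 := norm_integral_le_of_norm_le_const h3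
      simpa using h8
    rw [h1, hd0, ← Complex.ofReal_mul, Complex.norm_real, Real.norm_of_nonneg
      (mul_nonneg (Real.exp_pos _).le (inv_pos.2 hl0).le), ← div_eq_mul_inv,
      div_le_one hl0] at h2
    exact h2
  have hlim : Tendsto (fun ε : ℝ => ∫ z, Real.log (w z + ε)⁻¹ ∂arcMeasure) (𝓝[>] 0)
      (𝓝 (∫ z, -Real.log (w z) ∂arcMeasure)) := by
    apply tendsto_integral_filter_of_dominated_convergence
      (fun z => |Real.log (w z)| + w z)
    · exact .of_forall fun ε =>
        ((measurable_acDensity σ).add_const ε).inv.log.aestronglyMeasurable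
    · filter_upwards [Ioo_mem_nhdsGT (zero_lt_one (α := ℝ))] with ε hε
      filter_upwards [hs.density_pos] with z hz
      have h1 := Real.log_le_sub_one_of_pos (by linarith [hε.1] : 0 < w z + ε)
      have h2 := Real.log_le_log hz (by linarith [hε.1] : w z ≤ w z + ε)
      have h3 := neg_abs_le (Real.log (w z))
      have h4 := hw0 z
      have h5 := abs_nonneg (Real.log (w z))
      have h6 := hε.2
      rw [Real.log_inv, norm_neg, Real.norm_eq_abs, abs_le]
      constructor <;> linarith
    · exact hs.integrable_log.abs.add integrable_acDensity
    · filter_upwards [hs.density_pos] with z hz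
      have h1 : Tendsto (fun ε : ℝ => w z + ε) (𝓝[>] 0) (𝓝 (w z + 0)) :=
        ((continuous_const.add continuous_id).tendsto 0).mono_left nhdsWithin_le_nhds
      rw [add_zero] at h1
      have h2 := (h1.log hz.ne').neg
      refine h2.congr fun ε => ?_
      rw [Real.log_inv]
  have h1 := (Real.continuous_exp.tendsto _).comp (hlim.const_mul (1 / 2))
  have h2 := le_of_tendsto h1 (by
    filter_upwards [self_mem_nhdsWithin] with ε hε
    exact key ε hε)
  rw [integral_neg, mul_neg, Real.exp_neg] at h2
  rw [← div_le_iff₀ (Real.exp_pos _), one_div]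
  exact h2

/-- Szegő's asymptotics: the `L²(σ)` limit of `φ_n^*` is `Π`. -/
theorem szegoLimit_ae_eq [IsProbabilityMeasure σ] (hs : SzegoClass σ)
    (hΨ : Tendsto (starVec σ 0) atTop (𝓝 Ψ)) (hE : IsACCarrier σ E) :
    szegoLimit σ E =ᵐ[σ] Ψ := by
  have hσ := hs.nonDegenerate
  have hden := withDensity_limit hσ hs.bddAbove_lam hΨ
  obtain ⟨l, hl⟩ := exists_tendsto_lam hσ hs.bddAbove_lam
  obtain ⟨G, hGlim, hG, d, hd0, hd⟩ :=
    exists_outer_boundary hs.density_pos integrable_acDensity hs.integrable_log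
  rw [outerFn_zero] at hd0
  set D0 := Real.exp (1 / 2 * ∫ w, Real.log (acDensity σ w) ∂arcMeasure) with hD0
  have hlD : l * D0 = 1 := by
    refine le_antisymm ?_ (one_le_limit_mul_exp hs hΨ hl)
    exact le_of_tendsto' (hl.mul_const D0) (lam_mul_exp_le hs)
  -- `Ψ G` is unimodular and its integral, the limit of `φ_n^*(0) D(0)`, is `1`: so `Ψ G = 1`.
  have hnorm : ∀ᵐ z ∂arcMeasure, ‖Ψ z * G z‖ = 1 := by
    filter_upwards [norm_limit_sq_mul_acDensity hden, hG] with z h1 h2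
    have h3 : ‖Ψ z * G z‖ ^ 2 = 1 := by rw [norm_mul, mul_pow, h2, h1]
    exact (pow_eq_one_iff_of_nonneg (norm_nonneg _) two_ne_zero).1 h3
  have hint : Integrable (fun z => Ψ z * G z) arcMeasure :=
    (memLp_mul_boundary hG Ψ).1.integrable (by norm_num)
  have hval : ∫ z, Ψ z * G z ∂arcMeasure = 1 := by
    have h1 : Tendsto (fun n => ∫ z, phiStar σ n z * G z ∂arcMeasure) atTop
        (𝓝 (∫ z, Ψ z * G z ∂arcMeasure)) := by
      rw [tendsto_iff_norm_sub_tendsto_zero]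
      refine squeeze_zero (fun n => norm_nonneg _) (fun n => ?_)
        (tendsto_iff_norm_sub_tendsto_zero.1 hΨ)
      obtain ⟨h2, h3⟩ := memLp_mul_boundary hG (starVec σ 0 n - Ψ)
      have h4 := (norm_integral_sq_le h2).trans h3
      have h5 := abs_le_of_sq_le_sq h4 (norm_nonneg _)
      refine le_trans (le_of_eq ?_) ((le_abs_self _).trans h5)
      have h6 : Integrable (fun z => phiStar σ n z * G z) arcMeasure := by
        refine ((memLp_mul_boundary hG (starVec σ 0 n)).1.integrable (by norm_num)).congr ?_
        filter_upwards [hs.arcMeasure_ac.ae_le (coeFn_starVec_zero n)] with z hz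
        rw [hz]
      rw [← integral_sub h6 hint]
      congr 1
      apply integral_congr_ae
      filter_upwards [hs.arcMeasure_ac.ae_le (coeFn_starVec_zero n),
        hs.arcMeasure_ac.ae_le (Lp.coeFn_sub (starVec σ 0 n) Ψ)] with z hz hz2
      rw [hz2, Pi.sub_apply, hz, sub_mul]
    refine tendsto_nhds_unique h1 ?_
    have h2 : Tendsto (fun n => ((lam σ n * D0 : ℝ) : ℂ)) atTop (𝓝 ((l * D0 : ℝ) : ℂ)) :=
      (Complex.continuous_ofReal.tendsto _).comp (hl.mul_const D0)
    rw [hlD, Complex.ofReal_one] at h2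
    refine h2.congr fun n => ?_
    rw [integral_phiStar_mul hσ hd, hd0, Complex.ofReal_mul]
  have hintre : Integrable (fun z => (Ψ z * G z).re) arcMeasure := hint.re
  have hintsub : Integrable (fun z => 1 - (Ψ z * G z).re) arcMeasure :=
    (integrable_const _).sub hintre
  have hre : ∀ᵐ z ∂arcMeasure, (Ψ z * G z).re = 1 := by
    have h1 : ∫ z, (1 - (Ψ z * G z).re) ∂arcMeasure = 0 := by
      rw [integral_sub (integrable_const _) hintre]
      have h2 := integral_re hint
      have h3 : ∫ z, (Ψ z * G z).re ∂arcMeasure = 1 := by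
        have h4 : ∫ z, (Ψ z * G z).re ∂arcMeasure = (∫ z, Ψ z * G z ∂arcMeasure).re := h2
        rw [h4, hval, Complex.one_re]
      rw [h3]
      simp
    rw [integral_eq_zero_iff_of_nonneg_ae ?_ hintsub] at h1
    · filter_upwards [h1] with z hz
      have : 1 - (Ψ z * G z).re = 0 := hz
      linarith
    · filter_upwards [hnorm] with z hz
      have := (Complex.re_le_norm (Ψ z * G z))
      simp only [Pi.zero_apply]
      linarith
  have hmul : ∀ᵐ z ∂arcMeasure, Ψ z = (szegoBoundary σ z)⁻¹ := by
    filter_upwards [hre, hnorm, hGlim] with z h1 h2 h3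
    have h4 : szegoBoundary σ z = G z := h3.limUnder_eq
    have h5 : Ψ z * G z = 1 := by
      have h6 := Complex.sq_norm_sub_sq_re (Ψ z * G z)
      rw [h2, h1] at h6
      apply Complex.ext
      · rw [h1, Complex.one_re]
      · have : (Ψ z * G z).im ^ 2 = 0 := by linarith
        rw [Complex.one_im]
        exact pow_eq_zero_iff two_ne_zero |>.1 this
    rw [h4]
    exact eq_inv_of_mul_eq_one_left h5
  have h1 := hE.ae_restrict hmul
  have h2 := hE.limit_eq_zero hden
  rw [ae_restrict_iff' hE.measurableSet] at h1
  rw [ae_restrict_iff' hE.measurableSet.compl] at h2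
  filter_upwards [h1, h2] with z h3 h4
  by_cases hz : z ∈ E
  · rw [szegoLimit, Set.indicator_of_mem hz, h3 hz]
  · rw [szegoLimit, Set.indicator_of_notMem hz, h4 hz]

end Szego

/-! ### Fourier series of the bumps -/

/-- Comparison with `∫ dx / (1 + x²) = π`. -/
theorem lorentz_le_arctan {κ : ℝ} (hκ : 1 ≤ κ) (a : ℝ) :
    κ⁻¹ / (1 + a ^ 2) ≤ 3 * (Real.arctan (a + κ⁻¹) - Real.arctan a) := by
  have hκ0 : 0 < κ⁻¹ := inv_pos.2 (by linarith)
  have hκ1 : κ⁻¹ ≤ 1 := inv_le_one_of_one_le₀ hκ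
  have hlt : a < a + κ⁻¹ := by linarith
  obtain ⟨c, hc, h⟩ := exists_deriv_eq_slope Real.arctan hlt
    Real.continuous_arctan.continuousOn Real.differentiable_arctan.differentiableOn
  rw [Real.deriv_arctan, add_sub_cancel_left] at h
  rw [eq_div_iff hκ0.ne'] at h
  rw [← h, div_le_iff₀ (by positivity)]
  have h1 : 1 + c ^ 2 ≤ 3 * (1 + a ^ 2) := by
    nlinarith [hc.1, hc.2, sq_nonneg (2 * a - c), sq_nonneg (c - a)]
  have h2 : 1 ≤ 3 * (1 / (1 + c ^ 2)) * (1 + a ^ 2) := by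
    rw [mul_one_div, div_mul_eq_mul_div, le_div_iff₀ (by positivity)]
    linarith
  nlinarith

theorem sum_lorentz_le {κ : ℝ} (hκ : 1 ≤ κ) (s : ℝ) (F : Finset ℤ) :
    ∑ m ∈ F, κ⁻¹ / (1 + ((m - s) / κ) ^ 2) ≤ 3 * Real.pi := by
  have hκ0 : 0 < κ := by linarith
  obtain ⟨N, hN⟩ : ∃ N : ℕ, ∀ m ∈ F, m.natAbs < N := by
    refine ⟨F.sup Int.natAbs + 1, fun m hm => Nat.lt_succ_of_le ?_⟩
    exact Finset.le_sup (f := Int.natAbs) hm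
  have hinj : Function.Injective fun i : ℕ => (i : ℤ) - N := fun i j h => by
    simp only at h
    omega
  have hsub : F ⊆ (Finset.range (2 * N)).map ⟨fun i : ℕ => (i : ℤ) - N, hinj⟩ := by
    intro m hm
    have := hN m hm
    rw [Finset.mem_map]
    refine ⟨(m + N).toNat, ?_, ?_⟩
    · rw [Finset.mem_range]; omega
    · simp only [Function.Embedding.coeFn_mk]; omega
  have h1 : ∑ m ∈ F, κ⁻¹ / (1 + ((m - s) / κ) ^ 2) ≤
      ∑ m ∈ (Finset.range (2 * N)).map ⟨fun i : ℕ => (i : ℤ) - N, hinj⟩,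
        κ⁻¹ / (1 + ((m - s) / κ) ^ 2) :=
    Finset.sum_le_sum_of_subset_of_nonneg hsub fun m _ _ => by positivity
  refine h1.trans ?_
  rw [Finset.sum_map]
  simp only [Function.Embedding.coeFn_mk]
  have h2 : ∀ i ∈ Finset.range (2 * N), κ⁻¹ / (1 + ((((i : ℤ) - N : ℤ) - s) / κ) ^ 2) ≤
      3 * Real.arctan ((((i + 1 : ℕ) : ℝ) - N - s) / κ) -
        3 * Real.arctan (((i : ℝ) - N - s) / κ) := by
    intro i _
    have h3 := lorentz_le_arctan hκ (((i : ℝ) - N - s) / κ)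
    have h4 : (((i + 1 : ℕ) : ℝ) - N - s) / κ = ((i : ℝ) - N - s) / κ + κ⁻¹ := by
      push_cast
      field_simp
      ring
    rw [h4]
    push_cast
    linarith
  refine (Finset.sum_le_sum h2).trans ?_
  rw [Finset.sum_range_sub (fun i : ℕ => 3 * Real.arctan (((i : ℝ) - N - s) / κ))]
  have h5 := (Real.arctan_lt_pi_div_two ((((2 * N : ℕ) : ℝ) - N - s) / κ))
  have h6 := (Real.neg_pi_div_two_lt_arctan ((((0 : ℕ) : ℝ) - N - s) / κ))
  linarith

theorem summable_lorentz {κ : ℝ} (hκ : 1 ≤ κ) (s : ℝ) :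
    Summable fun m : ℤ => κ⁻¹ / (1 + ((m - s) / κ) ^ 2) :=
  summable_of_sum_le (fun m => by have : 0 < κ := by linarith
                                  positivity) (sum_lorentz_le hκ s)

theorem tsum_lorentz_le {κ : ℝ} (hκ : 1 ≤ κ) (s : ℝ) :
    ∑' m : ℤ, κ⁻¹ / (1 + ((m - s) / κ) ^ 2) ≤ 3 * Real.pi :=
  (summable_lorentz hκ s).tsum_le_of_sum_le (sum_lorentz_le hκ s)

open scoped FourierTransform SchwartzMap in
/-- The Fourier coefficients of `ω_0`, from Poisson summation: they are the samples at `l / κ` of a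
Schwartz function, divided by `κ`, and so decay like `κ⁻¹ (1 + (l / κ)²)⁻²`. -/
theorem exists_bump_hasSum {h : ℝ → ℝ} (hh : IsProfile h) :
    ∃ (c : ℕ → ℤ → ℂ) (C : ℝ), 0 ≤ C ∧
      (∀ κ : ℕ, 1 ≤ κ → ∀ l : ℤ,
        ‖c κ l‖ ≤ C * ((κ : ℝ)⁻¹ / (1 + ((l : ℝ) / κ) ^ 2)) / (1 + ((l : ℝ) / κ) ^ 2)) ∧
      ∀ κ : ℕ, 3 ≤ κ → ∀ z : Circle,
        HasSum (fun l : ℤ => c κ l * (z : ℂ) ^ l) ((bump h κ 0 z : ℝ) : ℂ) := by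
  have hzero : ∀ x : ℝ, 2 * Real.pi < |x| → h x = 0 := by
    intro x hx
    by_contra hne
    have := hh.support (subset_tsupport h (Function.mem_support.2 hne))
    have := abs_le.2 ⟨this.1, this.2⟩
    linarith
  -- the rescaled profile as a Schwartz function
  have hcs : ∀ a : ℝ, a ≠ 0 → HasCompactSupport fun x : ℝ => ((h (a * x) : ℝ) : ℂ) := by
    intro a ha
    have h0 : HasCompactSupport h :=
      IsCompact.of_isClosed_subset isCompact_Icc (isClosed_tsupport h) hh.support
    have h1 : HasCompactSupport fun x : ℝ => h (a * x) :=
      h0.comp_homeomorph (Homeomorph.mulLeft₀ a ha)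
    exact h1.comp_left (g := fun x : ℝ => (x : ℂ)) Complex.ofReal_zero
  have hsm : ∀ a : ℝ, ContDiff ℝ (⊤ : ℕ∞) fun x : ℝ => ((h (a * x) : ℝ) : ℂ) := by
    intro a
    exact Complex.ofRealCLM.contDiff.comp (hh.smooth.comp (contDiff_const.mul contDiff_id))
  have hpi := Real.pi_pos
  set g : 𝓢(ℝ, ℂ) := (hcs (2 * Real.pi) (by positivity)).toSchwartzMap (hsm _) with hg
  have hgx : ∀ x, g x = ((h (2 * Real.pi * x) : ℝ) : ℂ) := fun x => rfl
  obtain ⟨C0, hC0⟩ := (𝓕 g).decay 0 0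
  obtain ⟨C4, hC4⟩ := (𝓕 g).decay 4 0
  simp only [norm_iteratedFDeriv_zero, pow_zero, one_mul] at hC0 hC4
  refine ⟨fun κ l => ((κ : ℝ)⁻¹ : ℝ) * 𝓕 g ((l : ℝ) / κ), 2 * (C0 + C4), ?_, ?_, ?_⟩
  · have h1 := (norm_nonneg _).trans (hC0.2 0)
    have h2 := hC4.1.le
    linarith
  · intro κ hκ l
    have hκ0 : (0 : ℝ) < κ := by exact_mod_cast hκ
    set ξ := (l : ℝ) / κ
    rw [norm_mul, Complex.norm_real, Real.norm_of_nonneg (inv_pos.2 hκ0).le, mul_div_assoc',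
      mul_comm _ ((κ : ℝ)⁻¹), div_div, mul_div_assoc]
    gcongr
    rw [le_div_iff₀ (by positivity)]
    have h1 := hC0.2 ξ
    have h2 := hC4.2 ξ
    rw [Real.norm_eq_abs, Even.pow_abs (by decide)] at h2
    have h3 := norm_nonneg (𝓕 g ξ)
    nlinarith [mul_nonneg h3 (sq_nonneg (ξ ^ 2 - 1))]
  · intro κ hκ z
    have hκ0 : (0 : ℝ) < κ := by exact_mod_cast (by omega : 0 < κ)
    have hκ3 : (3 : ℝ) ≤ κ := by exact_mod_cast hκ
    set f : 𝓢(ℝ, ℂ) := (hcs (2 * Real.pi * κ) (by positivity)).toSchwartzMap (hsm _) with hf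
    have hfx : ∀ x, f x = ((h (2 * Real.pi * κ * x) : ℝ) : ℂ) := fun x => rfl
    have hFf : ∀ l : ℤ, 𝓕 f (l : ℝ) = ((κ : ℝ)⁻¹ : ℝ) * 𝓕 g ((l : ℝ) / κ) := by
      intro l
      rw [SchwartzMap.fourier_coe, SchwartzMap.fourier_coe, Real.fourier_real_eq,
        Real.fourier_real_eq]
      have h1 := Measure.integral_comp_mul_left
        (fun v : ℝ => Real.fourierChar (-(v * ((l : ℝ) / κ))) • g v) (κ : ℝ)
      rw [abs_of_pos (inv_pos.2 hκ0), Complex.real_smul] at h1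
      rw [← h1]
      congr 1
      ext v
      rw [show f v = g (κ * v) by rw [hfx, hgx, mul_assoc],
        show -(κ * v * ((l : ℝ) / κ)) = -(v * (l : ℝ)) by field_simp]
    have hsum : Summable fun l : ℤ => 𝓕 f (l : ℝ) * (z : ℂ) ^ l := by
      have h1 := summable_of_isBigO (Real.summable_abs_int_rpow one_lt_two)
        (((𝓕 f).isBigO_cocompact_rpow (-2)).comp_tendsto Int.tendsto_coe_cofinite)
      refine .of_norm ?_
      refine h1.norm.congr fun l => ?_
      rw [norm_mul, norm_zpow_circle, mul_one]
      rfl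
    have hx := SchwartzMap.tsum_eq_tsum_fourier f (Complex.arg z / (2 * Real.pi))
    have hz : ∀ l : ℤ, fourier l ((Complex.arg z / (2 * Real.pi) : ℝ) : UnitAddCircle) =
        (z : ℂ) ^ l := by
      intro l
      have h1 : (z : ℂ) = Complex.exp (Complex.arg z * Complex.I) := by
        have h2 := Complex.norm_mul_exp_arg_mul_I (z : ℂ)
        rw [Circle.norm_coe, Complex.ofReal_one, one_mul] at h2
        exact h2.symm
      have h3 : (z : ℂ) ^ l = Complex.exp (l * (Complex.arg z * Complex.I)) := by
        rw [Complex.exp_int_mul, ← h1]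
      rw [fourier_coe_apply, h3]
      congr 1
      push_cast
      have : (Real.pi : ℂ) ≠ 0 := by exact_mod_cast hpi.ne'
      field_simp
    -- Only the term `n = 0` survives, since `κ |arg z + 2 π n| ≥ 3 π` otherwise.
    have hL : ∑' n : ℤ, f (Complex.arg z / (2 * Real.pi) + n) = ((bump h κ 0 z : ℝ) : ℂ) := by
      rw [tsum_eq_single 0]
      · rw [hfx, bump]
        congr 2
        simp only [Int.cast_zero, add_zero, CharP.cast_eq_zero, mul_zero, zero_div,
          Circle.exp_zero, div_one]
        field_simp
      · intro n hn
        rw [hfx, hzero, Complex.ofReal_zero]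
        have h1 : 2 * Real.pi * κ * (Complex.arg z / (2 * Real.pi) + n) =
            κ * (Complex.arg z + 2 * Real.pi * n) := by
          field_simp
        rw [h1, abs_mul, abs_of_pos hκ0]
        have h2 : Real.pi ≤ |Complex.arg z + 2 * Real.pi * n| := by
          have h3 := Complex.arg_le_pi z
          have h4 := Complex.neg_pi_lt_arg z
          rcases lt_or_gt_of_ne hn with h5 | h5
          · have h6 : (n : ℝ) ≤ -1 := by exact_mod_cast (by omega : n ≤ -1)
            rw [le_abs]
            right
            nlinarith
          · have h6 : (1 : ℝ) ≤ n := by exact_mod_cast (by omega : 1 ≤ n)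
            rw [le_abs]
            left
            nlinarith
        nlinarith
    rw [hL] at hx
    simp_rw [hz] at hx
    rw [hx]
    simp_rw [← hFf]
    exact hsum.hasSum

theorem bump_eq_bump_zero (h : ℝ → ℝ) (κ j : ℕ) (z : Circle) :
    bump h κ j z = bump h κ 0 (z / Circle.exp (2 * Real.pi * j / κ)) := by
  simp [bump]

theorem IsProfile.bump_nonneg {h : ℝ → ℝ} (hh : IsProfile h) (κ j : ℕ) (z : Circle) :
    0 ≤ bump h κ j z := hh.nonneg _

theorem measurable_bump {h : ℝ → ℝ} (hh : IsProfile h) (κ j : ℕ) : Measurable (bump h κ j) := by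
  have h1 : Measurable fun z : Circle =>
      ((z / Circle.exp (2 * Real.pi * j / κ) : Circle) : ℂ) := by
    have : Continuous fun z : Circle => ((z / Circle.exp (2 * Real.pi * j / κ) : Circle) : ℂ) := by
      fun_prop
    exact this.measurable
  exact hh.smooth.continuous.measurable.comp ((Complex.measurable_arg.comp h1).const_mul _)

/-! ### Localized convergence -/

section Localized
variable {σ : Measure Circle} {h : ℝ → ℝ}

/-- The modulus of the `l`-th moment of `|φ_n|² dσ - dm`. -/
noncomputable def momentDefect (σ : Measure Circle) [IsFiniteMeasure σ] (n : ℕ) (l : ℤ) : ℝ :=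
  if l = 0 then 0 else ‖inner ℂ (starVec σ 0 n) (starVec σ l n)‖

theorem momentDefect_nonneg [IsFiniteMeasure σ] (n : ℕ) (l : ℤ) : 0 ≤ momentDefect σ n l := by
  rw [momentDefect]; split_ifs <;> positivity

theorem momentDefect_le_one [IsFiniteMeasure σ] (hσ : NonDegenerate σ) (n : ℕ) (l : ℤ) :
    momentDefect σ n l ≤ 1 := by
  rw [momentDefect]
  split_ifs
  · exact zero_le_one
  · exact norm_inner_starVec_self_le_one hσ l n

theorem inner_starVec_self_neg [IsFiniteMeasure σ] (n : ℕ) (l : ℤ) :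
    inner ℂ (starVec σ 0 n) (starVec σ (-l) n) =
      (starRingEnd ℂ) (inner ℂ (starVec σ 0 n) (starVec σ l n)) := by
  rw [inner_starVec, inner_starVec, ← integral_conj]
  congr 1
  ext z
  rw [map_mul, map_mul, map_zpow₀, conj_coe_circle, Complex.conj_conj, inv_zpow, ← zpow_neg]
  ring_nf

theorem momentDefect_le [IsProbabilityMeasure σ] (hσ : NonDegenerate σ) {n : ℕ} {l : ℤ}
    (hn : l.natAbs ≤ n) :
    momentDefect σ n l ≤ 2 * (lam σ (n + l.natAbs) - lam σ (n - l.natAbs)) := by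
  rw [momentDefect]
  split_ifs with h0
  · have := lam_mono hσ (show n - l.natAbs ≤ n + l.natAbs by omega)
    linarith
  · have h1 := norm_inner_starVec_self_le hσ (Nat.one_le_iff_ne_zero.2 (Int.natAbs_ne_zero.2 h0)) hn
    rcases Int.natAbs_eq l with h2 | h2
    · rwa [← h2] at h1
    · rw [show starVec σ l n = starVec σ (-(l.natAbs : ℤ)) n by rw [← h2],
        inner_starVec_self_neg, RCLike.norm_conj]
      exact h1

/-- A telescoping bound for the sum of the increments of length `q` of a bounded monotone
sequence. -/
theorem sum_shift_sub_le {u : ℕ → ℝ} (hu : Monotone u) {B : ℝ} (hB : ∀ n, u n ≤ B) (k q : ℕ) :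
    ∑ j ∈ Finset.range k, (u (j + q) - u j) ≤ q * (B - u 0) := by
  induction q with
  | zero => simp
  | succ q ih =>
    have h1 : ∑ j ∈ Finset.range k, (u (j + (q + 1)) - u j) =
        ∑ j ∈ Finset.range k, (u (j + q) - u j) +
          ∑ j ∈ Finset.range k, (u (j + 1 + q) - u (j + q)) := by
      rw [← Finset.sum_add_distrib]
      refine Finset.sum_congr rfl fun j _ => ?_
      rw [show j + (q + 1) = j + 1 + q by ring]
      ring
    rw [h1, Finset.sum_range_sub (fun j => u (j + q))]
    have h2 := hB (k + q)
    have h3 := hu (Nat.zero_le (0 + q))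
    push_cast
    linarith

/-- The `l`-th moment defects, summed over the scales `n_j = κ² + κ j`, cost `1 + (l / κ)²` times a
quantity that tends to zero. -/
theorem sum_momentDefect_le [IsProbabilityMeasure σ] (hσ : NonDegenerate σ) {B : ℝ}
    (hB : ∀ n, lam σ n ≤ B) {κ : ℕ} (hκ : 2 ≤ κ) (l : ℤ) :
    ∑ j ∈ Finset.range κ, momentDefect σ (κ ^ 2 + κ * j) l ≤
      (4 * (B - lam σ κ) + 4 / κ) * (1 + ((l : ℝ) / κ) ^ 2) := by
  have hκ0 : (0 : ℝ) < κ := by exact_mod_cast (by omega : 0 < κ)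
  have hδ : 0 ≤ B - lam σ κ := by linarith [hB κ]
  set L := l.natAbs with hL
  have hlL : ((l : ℝ) / κ) ^ 2 = ((L : ℝ) / κ) ^ 2 := by
    rw [div_pow, div_pow, hL, Nat.cast_natAbs, Int.cast_abs, sq_abs]
  rw [hlL]
  -- If `|l| ≤ κ² - κ`, all the indices `n_j - |l|` are at least `κ` and the sum telescopes; the
  -- remaining `l` have `(l / κ)²` of order `κ²`, and each defect is at most `1`.
  rcases le_or_gt (L + κ) (κ ^ 2) with hc | hc
  · set u : ℕ → ℝ := fun i => lam σ (κ ^ 2 - L + κ * i) with hu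
    have humono : Monotone u := fun i j hij =>
      lam_mono hσ (Nat.add_le_add_left (Nat.mul_le_mul_left κ hij) _)
    set q := 2 * L / κ + 1 with hq
    have h1 : ∀ j ∈ Finset.range κ, momentDefect σ (κ ^ 2 + κ * j) l ≤
        2 * (u (j + q) - u j) := by
      intro j _
      refine (momentDefect_le hσ (by omega)).trans ?_
      have e1 : κ ^ 2 + κ * j - l.natAbs = κ ^ 2 - L + κ * j := by omega
      have e2 : lam σ (κ ^ 2 + κ * j + l.natAbs) ≤ u (j + q) := by
        apply lam_mono hσ
        have h2 : 2 * L < κ * q := by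
          rw [hq]
          exact Nat.lt_mul_div_succ _ (by omega)
        rw [mul_add]
        omega
      rw [e1]
      have e3 : u j = lam σ (κ ^ 2 - L + κ * j) := rfl
      linarith
    refine (Finset.sum_le_sum h1).trans ?_
    rw [← Finset.mul_sum]
    have h2 := sum_shift_sub_le humono (fun n => hB _) κ q
    have h3 : lam σ κ ≤ u 0 := lam_mono hσ (by omega)
    have h4 : (q : ℝ) ≤ 2 * (L / κ) + 1 := by
      rw [hq]
      push_cast
      have := Nat.cast_div_le (α := ℝ) (m := 2 * L) (n := κ)
      push_cast at this
      rw [mul_div_assoc] at this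
      linarith
    have h5 : (q : ℝ) * (B - u 0) ≤ (2 * (L / κ) + 1) * (B - lam σ κ) := by
      apply mul_le_mul h4 (by linarith) (by linarith [hB (κ ^ 2 - L + κ * 0)]) (by positivity)
    have h6 : 2 * (2 * ((L : ℝ) / κ) + 1) ≤ 4 * (1 + ((L : ℝ) / κ) ^ 2) := by
      nlinarith [sq_nonneg (2 * ((L : ℝ) / κ) - 1)]
    have h7 : 0 ≤ 4 / (κ : ℝ) * (1 + ((L : ℝ) / κ) ^ 2) := by positivity
    nlinarith [mul_le_mul_of_nonneg_right h6 hδ]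
  · have h1 : ∑ j ∈ Finset.range κ, momentDefect σ (κ ^ 2 + κ * j) l ≤ κ := by
      refine (Finset.sum_le_sum fun j _ => momentDefect_le_one hσ _ _).trans ?_
      simp
    refine h1.trans ?_
    have h2 : κ ^ 2 ≤ 2 * L := by nlinarith
    have h3 : (κ : ℝ) ^ 2 ≤ 2 * L := by exact_mod_cast h2
    have h4 : (κ : ℝ) ≤ 4 / κ * ((L : ℝ) / κ) ^ 2 := by
      rw [div_pow, div_mul_div_comm, le_div_iff₀ (by positivity)]
      nlinarith [mul_le_mul h3 h3 (by positivity) (by positivity)]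
    have h5 : 0 ≤ 4 / (κ : ℝ) := by positivity
    have h6 : 0 ≤ 4 * (B - lam σ κ) * (1 + ((L : ℝ) / κ) ^ 2) := by positivity
    nlinarith

theorem integral_phiStar_zpow [IsFiniteMeasure σ] (n : ℕ) (l : ℤ) :
    ∫ z : Circle, (z : ℂ) ^ l * ((‖phiStar σ n z‖ ^ 2 : ℝ) : ℂ) ∂σ =
      inner ℂ (starVec σ 0 n) (starVec σ l n) := by
  rw [inner_starVec, sub_zero]
  congr 1
  ext z
  rw [Complex.mul_conj, Complex.normSq_eq_norm_sq]

/-- Termwise integration of an absolutely convergent Fourier series. -/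
theorem hasSum_integral_fourier {μ : Measure Circle} [IsFiniteMeasure μ] {c : ℤ → ℂ}
    (hc : Summable c) {b F : Circle → ℝ}
    (hb : ∀ z : Circle, HasSum (fun l => c l * (z : ℂ) ^ l) (b z))
    (hF : Continuous F) :
    HasSum (fun l => c l * ∫ z : Circle, (z : ℂ) ^ l * (F z : ℂ) ∂μ)
      ((∫ z, b z * F z ∂μ : ℝ) : ℂ) := by
  have hFc : Continuous fun z => (F z : ℂ) := Complex.continuous_ofReal.comp hF
  have hcont : ∀ l : ℤ, Continuous fun z : Circle => c l * (z : ℂ) ^ l * (F z : ℂ) := by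
    intro l
    have h1 : Continuous fun z : Circle => mono l z := (mono l).continuous
    simp only [mono_apply] at h1
    exact (continuous_const.mul h1).mul hFc
  have h1 := hasSum_integral_of_summable_integral_norm
    (F := fun (l : ℤ) (z : Circle) => c l * (z : ℂ) ^ l * (F z : ℂ)) (μ := μ)
    (fun l => integrable_of_continuous μ (hcont l)) ?_
  · have h2 : ∫ z : Circle, ∑' l : ℤ, c l * (z : ℂ) ^ l * (F z : ℂ) ∂μ =
        ((∫ z, b z * F z ∂μ : ℝ) : ℂ) := by
      have h3 := integral_ofReal (𝕜 := ℂ) (μ := μ) (f := fun z => b z * F z)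
      refine Eq.trans ?_ h3
      congr 1
      ext z
      rw [((hb z).mul_right (F z : ℂ)).tsum_eq]
      simp
    rw [h2] at h1
    refine hasSum_congr_fun h1 fun l => ?_
    rw [← integral_const_mul]
    congr 1
    ext z
    ring
  · have h2 : ∀ l : ℤ, ∫ z : Circle, ‖c l * (z : ℂ) ^ l * (F z : ℂ)‖ ∂μ =
        ‖c l‖ * ∫ z, ‖F z‖ ∂μ := by
      intro l
      rw [← integral_const_mul]
      congr 1
      ext z
      rw [norm_mul, norm_mul, norm_zpow_circle, mul_one, Complex.norm_real]
    simp_rw [h2]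
    exact hc.norm.mul_right _

/-- `∑_j ∫ ω_j |φ_{n_j}|² dσ - 1 → 0`: the moments of `|φ_n|² dσ - dm` are controlled by
increments of the leading coefficients, which telescope over the scales `n_j = κ² + κj`. -/
theorem tendsto_sum_integral_bump [IsProbabilityMeasure σ] (hσ : NonDegenerate σ)
    (hb : BddAbove (Set.range (lam σ))) (hh : IsProfile h) :
    Tendsto (fun κ : ℕ => ∑ j ∈ Finset.range κ,
      ∫ z, bump h κ j z * ‖phiStar σ (κ ^ 2 + κ * j) z‖ ^ 2 ∂σ) atTop (𝓝 1) := by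
  obtain ⟨B, hB⟩ := exists_tendsto_lam hσ hb
  have hle : ∀ n, lam σ n ≤ B := (lam_mono hσ).ge_of_tendsto hB
  obtain ⟨c, C, hC, hcb, hcs⟩ := exists_bump_hasSum hh
  rw [tendsto_iff_dist_tendsto_zero]
  have hbound : Tendsto (fun κ : ℕ => C * (4 * (B - lam σ κ) + 4 / κ) * (3 * Real.pi)) atTop
      (𝓝 0) := by
    have h1 : Tendsto (fun κ : ℕ => (4 : ℝ) / κ) atTop (𝓝 0) :=
      tendsto_const_div_atTop_nhds_zero_nat 4
    have h2 := (((((hB.const_sub B).const_mul 4).add h1).const_mul C).mul_const (3 * Real.pi))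
    simpa using h2
  refine squeeze_zero' (.of_forall fun κ => dist_nonneg) ?_ hbound
  filter_upwards [eventually_ge_atTop 3] with κ hκ
  have hκ1 : (1 : ℝ) ≤ κ := by exact_mod_cast (by omega : 1 ≤ κ)
  set N : ℕ → ℕ := fun j => κ ^ 2 + κ * j with hN
  set ξ : ℤ → ℝ := fun l => (l : ℝ) / κ with hξ
  have hlor := summable_lorentz hκ1 0
  have hlor2 := tsum_lorentz_le hκ1 0
  simp only [sub_zero] at hlor hlor2
  have hsumm : Summable fun l => ‖c κ l‖ := by
    refine Summable.of_nonneg_of_le (fun l => norm_nonneg _) (fun l => ?_) (hlor.mul_left C)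
    refine (hcb κ (by omega) l).trans ?_
    apply div_le_self (by positivity)
    linarith [sq_nonneg ((l : ℝ) / κ)]
  -- the Fourier series of `ω_j`
  set cj : ℕ → ℤ → ℂ := fun j l =>
    c κ l * ((Circle.exp (2 * Real.pi * j / κ) : Circle) : ℂ) ^ (-l) with hcj
  have hcjn : ∀ j l, ‖cj j l‖ = ‖c κ l‖ := by
    intro j l
    rw [hcj, norm_mul, norm_zpow_circle, mul_one]
  have hcjs : ∀ j, Summable (cj j) := fun j => .of_norm (by simpa only [hcjn] using hsumm)
  have hbj : ∀ (j : ℕ) (z : Circle),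
      HasSum (fun l => cj j l * (z : ℂ) ^ l) ((bump h κ j z : ℝ) : ℂ) := by
    intro j z
    rw [bump_eq_bump_zero]
    refine hasSum_congr_fun (hcs κ hκ _) fun l => ?_
    rw [Circle.coe_div, div_zpow]
    simp only [hcj, zpow_neg]
    ring
  have hone : ∑ j ∈ Finset.range κ, ∫ z, bump h κ j z ∂arcMeasure = 1 := by
    rw [← integral_finsetSum]
    · simp_rw [hh.partition κ (by omega)]
      simp
    · intro j hj
      refine Integrable.mono' (integrable_const (1 : ℝ))
        (measurable_bump hh κ j).aestronglyMeasurable (.of_forall fun z => ?_)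
      rw [Real.norm_of_nonneg (hh.bump_nonneg κ j z), ← hh.partition κ (by omega) z]
      exact Finset.single_le_sum (f := fun j => bump h κ j z)
        (fun i _ => hh.bump_nonneg κ i z) hj
  have hsd : ∀ j, Summable fun l => ‖c κ l‖ * momentDefect σ (N j) l := by
    intro j
    refine Summable.of_nonneg_of_le (fun l => mul_nonneg (norm_nonneg _) (momentDefect_nonneg _ _))
      (fun l => ?_) hsumm
    exact mul_le_of_le_one_right (norm_nonneg _) (momentDefect_le_one hσ _ _)
  have hj : ∀ j, |(∫ z, bump h κ j z * ‖phiStar σ (N j) z‖ ^ 2 ∂σ) -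
      ∫ z, bump h κ j z ∂arcMeasure| ≤ ∑' l, ‖c κ l‖ * momentDefect σ (N j) l := by
    intro j
    have h1 := hasSum_integral_fourier (μ := σ) (hcjs j) (hbj j)
      ((continuous_phiStar (σ := σ) (N j)).norm.pow 2)
    have h2 := hasSum_integral_fourier (μ := arcMeasure) (hcjs j) (hbj j)
      (continuous_const (y := (1 : ℝ)))
    simp only [mul_one, Complex.ofReal_one] at h2
    have h3 := h1.sub h2
    rw [← Complex.ofReal_sub] at h3
    have h4 : ∀ l, ‖cj j l * (∫ z : Circle, (z : ℂ) ^ l * ((‖phiStar σ (N j) z‖ ^ 2 : ℝ) : ℂ) ∂σ) -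
        cj j l * ∫ z : Circle, (z : ℂ) ^ l ∂arcMeasure‖ ≤ ‖c κ l‖ * momentDefect σ (N j) l := by
      intro l
      rw [integral_phiStar_zpow, integral_zpow_arcMeasure, ← mul_sub, norm_mul, hcjn]
      gcongr
      rw [momentDefect]
      split_ifs with h0
      · subst h0
        rw [inner_self_eq_norm_sq_to_K, norm_starVec hσ]
        simp
      · rw [sub_zero]
    have h5 := h3.norm_le_of_bounded (hsd j).hasSum h4
    rwa [Complex.norm_real, Real.norm_eq_abs] at h5
  rw [Real.dist_eq, ← hone, ← Finset.sum_sub_distrib]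
  refine (Finset.abs_sum_le_sum_abs _ _).trans ((Finset.sum_le_sum fun j _ => hj j).trans ?_)
  rw [← Summable.tsum_finsetSum fun j _ => hsd j]
  have h6 : ∀ l : ℤ, ∑ j ∈ Finset.range κ, ‖c κ l‖ * momentDefect σ (N j) l ≤
      C * (4 * (B - lam σ κ) + 4 / κ) * ((κ : ℝ)⁻¹ / (1 + ((l : ℝ) / κ) ^ 2)) := by
    intro l
    rw [← Finset.mul_sum]
    have h7 := mul_le_mul (hcb κ (by omega) l) (sum_momentDefect_le hσ hle (κ := κ) (by omega) l)
      (Finset.sum_nonneg fun j _ => momentDefect_nonneg _ _) (by positivity)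
    refine h7.trans (le_of_eq ?_)
    field_simp
  have hsl := hlor.mul_left (C * (4 * (B - lam σ κ) + 4 / κ))
  refine (Summable.tsum_le_tsum h6 (summable_sum fun j _ => hsd j) hsl).trans ?_
  rw [tsum_mul_left]
  have h8 : 0 ≤ C * (4 * (B - lam σ κ) + 4 / κ) := by
    have := hle κ
    have h9 : 0 ≤ B - lam σ κ := by linarith
    positivity
  gcongr

theorem integrable_bump_mul [IsFiniteMeasure σ] (hh : IsProfile h) {κ : ℕ} (hκ : 2 ≤ κ) {j : ℕ}
    (hj : j ∈ Finset.range κ) {F : Circle → ℝ} (hF : Integrable F σ) :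
    Integrable (fun z => bump h κ j z * F z) σ := by
  refine hF.bdd_mul (c := 1) (measurable_bump hh κ j).aestronglyMeasurable
    (.of_forall fun z => ?_)
  rw [Real.norm_of_nonneg (hh.bump_nonneg κ j z), ← hh.partition κ hκ z]
  exact Finset.single_le_sum (f := fun j => bump h κ j z) (fun i _ => hh.bump_nonneg κ i z) hj

/-- Weighted averages of a convergent sequence over the scales `n_j` converge. -/
theorem tendsto_sum_bump_mul (hh : IsProfile h) {a : ℕ → ℝ} {A : ℝ} (ha : Tendsto a atTop (𝓝 A))
    (z : Circle) :
    Tendsto (fun κ : ℕ => ∑ j ∈ Finset.range κ, bump h κ j z * a (κ ^ 2 + κ * j)) atTop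
      (𝓝 A) := by
  rw [Metric.tendsto_atTop] at ha ⊢
  intro ε hε
  obtain ⟨N, hN⟩ := ha (ε / 2) (half_pos hε)
  refine ⟨max N 2, fun κ hκ => ?_⟩
  have hκ2 : 2 ≤ κ := (le_max_right _ _).trans hκ
  have hp := hh.partition κ hκ2 z
  have h1 : ∑ j ∈ Finset.range κ, bump h κ j z * a (κ ^ 2 + κ * j) - A =
      ∑ j ∈ Finset.range κ, bump h κ j z * (a (κ ^ 2 + κ * j) - A) := by
    simp_rw [mul_sub]
    rw [Finset.sum_sub_distrib, ← Finset.sum_mul, hp, one_mul]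
  rw [Real.dist_eq, h1]
  refine lt_of_le_of_lt (Finset.abs_sum_le_sum_abs _ _) (lt_of_le_of_lt ?_ (half_lt_self hε))
  have h2 : ∀ j ∈ Finset.range κ, |bump h κ j z * (a (κ ^ 2 + κ * j) - A)| ≤
      bump h κ j z * (ε / 2) := by
    intro j _
    rw [abs_mul, abs_of_nonneg (hh.bump_nonneg κ j z)]
    have h3 := hN (κ ^ 2 + κ * j) (by
      have : N ≤ κ := (le_max_left _ _).trans hκ
      nlinarith [Nat.zero_le (κ * j)])
    rw [Real.dist_eq] at h3
    exact mul_le_mul_of_nonneg_left h3.le (hh.bump_nonneg κ j z)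
  refine (Finset.sum_le_sum h2).trans ?_
  rw [← Finset.sum_mul, hp, one_mul]

end Localized

section Localized
variable {σ : Measure Circle} {h : ℝ → ℝ} {Ψ : Lp ℂ 2 σ}

theorem integral_norm_limit_sq [IsProbabilityMeasure σ] (hσ : NonDegenerate σ)
    (hΨ : Tendsto (starVec σ 0) atTop (𝓝 Ψ)) : ∫ z, ‖Ψ z‖ ^ 2 ∂σ = 1 := by
  rw [← lp_norm_sq]
  have h1 := hΨ.norm
  simp_rw [norm_starVec hσ] at h1
  rw [tendsto_nhds_unique h1 tendsto_const_nhds, one_pow]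

/-- The weighted sums `∑_j ω_j |φ_{n_j}^* + Ψ|²` keep their mass in the limit: Fatou's lemma, with
pointwise convergence on the absolutely continuous part and `Ψ = 0` elsewhere. -/
theorem eventually_lt_integral_bump_add [IsProbabilityMeasure σ] (hs : SzegoClass σ)
    (hpca : PCA σ) (hh : IsProfile h) (hΨ : Tendsto (starVec σ 0) atTop (𝓝 Ψ)) {a : ℝ}
    (ha : a < 4) : ∀ᶠ κ : ℕ in atTop, a < ∫ z, ∑ j ∈ Finset.range κ,
      bump h κ j z * ‖phiStar σ (κ ^ 2 + κ * j) z + Ψ z‖ ^ 2 ∂σ := by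
  have hσ := hs.nonDegenerate
  have hden := withDensity_limit hσ hs.bddAbove_lam hΨ
  obtain ⟨E, hE⟩ := exists_isACCarrier σ
  set Y : ℕ → Circle → ℝ := fun κ z => ∑ j ∈ Finset.range κ,
    bump h κ j z * ‖phiStar σ (κ ^ 2 + κ * j) z + Ψ z‖ ^ 2 with hY
  have hY0 : ∀ κ z, 0 ≤ Y κ z := fun κ z =>
    Finset.sum_nonneg fun j _ => mul_nonneg (hh.bump_nonneg κ j z) (by positivity)
  have hYm : ∀ κ, Measurable (Y κ) := fun κ =>
    Finset.measurable_sum _ fun j _ => (measurable_bump hh κ j).mul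
      (((continuous_phiStar _).measurable.add
        (Lp.stronglyMeasurable Ψ).measurable).norm.pow_const 2)
  have hpt : ∀ᵐ z ∂σ, ENNReal.ofReal (4 * ‖Ψ z‖ ^ 2) ≤
      liminf (fun κ => ENNReal.ofReal (Y κ z)) atTop := by
    have h1 := hE.ae_restrict (hpca.ae_tendsto hΨ hs.arcMeasure_ac)
    have h2 := hE.limit_eq_zero hden
    rw [ae_restrict_iff' hE.measurableSet] at h1
    rw [ae_restrict_iff' hE.measurableSet.compl] at h2
    filter_upwards [h1, h2] with z h3 h4
    by_cases hz : z ∈ E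
    · have h5 : Tendsto (fun n => ‖phiStar σ n z + Ψ z‖ ^ 2) atTop (𝓝 (‖Ψ z + Ψ z‖ ^ 2)) :=
        (((h3 hz).add_const (Ψ z)).norm).pow 2
      have h6 : ‖Ψ z + Ψ z‖ ^ 2 = 4 * ‖Ψ z‖ ^ 2 := by
        rw [← two_mul, norm_mul, mul_pow]
        norm_num
      rw [h6] at h5
      have h7 := (ENNReal.continuous_ofReal.tendsto _).comp (tendsto_sum_bump_mul hh h5 z)
      exact h7.liminf_eq.ge
    · rw [h4 hz]
      simp
  have hfatou : ENNReal.ofReal 4 ≤ liminf (fun κ => ∫⁻ z, ENNReal.ofReal (Y κ z) ∂σ) atTop := by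
    refine le_trans ?_ (lintegral_liminf_le fun κ => (hYm κ).ennreal_ofReal)
    refine le_trans (le_of_eq ?_) (lintegral_mono_ae hpt)
    rw [← ofReal_integral_eq_lintegral_ofReal ((integrable_norm_sq Ψ).const_mul 4)
      (.of_forall fun z => by positivity), integral_const_mul, integral_norm_limit_sq hσ hΨ,
        mul_one]
  rcases lt_or_ge a 0 with h0 | h0
  · exact .of_forall fun κ => h0.trans_le (integral_nonneg (hY0 κ))
  have hlt : ENNReal.ofReal a < liminf (fun κ => ∫⁻ z, ENNReal.ofReal (Y κ z) ∂σ) atTop :=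
    lt_of_lt_of_le ((ENNReal.ofReal_lt_ofReal_iff (by norm_num)).2 ha) hfatou
  filter_upwards [eventually_lt_of_lt_liminf hlt, eventually_ge_atTop 2] with κ hκ hκ2
  have hint : Integrable (Y κ) σ := by
    refine integrable_finsetSum _ fun j hj => integrable_bump_mul hh hκ2 hj ?_
    have h1 : MemLp (fun z => phiStar σ (κ ^ 2 + κ * j) z + Ψ z) 2 σ :=
      MemLp.add ((Lp.memLp (starVec σ 0 _)).ae_eq (coeFn_starVec_zero _)) (Lp.memLp Ψ)
    exact h1.integrable_norm_pow (by norm_num)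
  rw [← ofReal_integral_eq_lintegral_ofReal hint (.of_forall (hY0 κ))] at hκ
  exact (ENNReal.ofReal_lt_ofReal_iff_of_nonneg h0).1 hκ

/-- The weighted square deviations tend to zero: by the parallelogram law they are
`2 ∑_j ω_j |φ_{n_j}^*|² + 2 |Ψ|² - ∑_j ω_j |φ_{n_j}^* + Ψ|²`, with masses `2`, `2` and at least
`4` in the limit. -/
theorem tendsto_integral_bump_sub [IsProbabilityMeasure σ] (hs : SzegoClass σ)
    (hpca : PCA σ) (hh : IsProfile h) (hΨ : Tendsto (starVec σ 0) atTop (𝓝 Ψ)) :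
    Tendsto (fun κ : ℕ => ∫ z, ∑ j ∈ Finset.range κ,
      bump h κ j z * ‖phiStar σ (κ ^ 2 + κ * j) z - Ψ z‖ ^ 2 ∂σ) atTop (𝓝 0) := by
  have hσ := hs.nonDegenerate
  have hS := tendsto_sum_integral_bump hσ hs.bddAbove_lam hh
  rw [Metric.tendsto_atTop'] at hS
  refine tendsto_order.2 ⟨fun a ha => ?_, fun ε hε => ?_⟩
  · refine .of_forall fun κ => ha.trans_le (integral_nonneg fun z => ?_)
    exact Finset.sum_nonneg fun j _ => mul_nonneg (hh.bump_nonneg κ j z) (by positivity)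
  obtain ⟨N, hN⟩ := hS (ε / 4) (by positivity)
  filter_upwards [eventually_lt_integral_bump_add hs hpca hh hΨ (by linarith : 4 - ε / 2 < 4),
    eventually_gt_atTop N, eventually_ge_atTop 2] with κ h1 h2 h3
  have h4 := hN κ h2
  rw [Real.dist_eq] at h4
  have h5 := (abs_lt.1 h4).2
  have hi : ∀ n, MemLp (phiStar σ n) 2 σ := fun n =>
    (Lp.memLp (starVec σ 0 n)).ae_eq (coeFn_starVec_zero n)
  have i1 : ∀ j ∈ Finset.range κ, Integrable
      (fun z => bump h κ j z * ‖phiStar σ (κ ^ 2 + κ * j) z‖ ^ 2) σ := fun j hj =>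
    integrable_bump_mul hh h3 hj ((hi _).integrable_norm_pow (by norm_num))
  have i2 : Integrable (fun z => ∑ j ∈ Finset.range κ,
      bump h κ j z * ‖phiStar σ (κ ^ 2 + κ * j) z + Ψ z‖ ^ 2) σ :=
    integrable_finsetSum _ fun j hj => integrable_bump_mul hh h3 hj
      (((hi _).add (Lp.memLp Ψ)).integrable_norm_pow (by norm_num))
  have e : ∀ z, ∑ j ∈ Finset.range κ, bump h κ j z * ‖phiStar σ (κ ^ 2 + κ * j) z - Ψ z‖ ^ 2 =
      2 * ∑ j ∈ Finset.range κ, bump h κ j z * ‖phiStar σ (κ ^ 2 + κ * j) z‖ ^ 2 +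
        2 * ‖Ψ z‖ ^ 2 -
        ∑ j ∈ Finset.range κ, bump h κ j z * ‖phiStar σ (κ ^ 2 + κ * j) z + Ψ z‖ ^ 2 := by
    intro z
    have h6 : 2 * ‖Ψ z‖ ^ 2 = ∑ j ∈ Finset.range κ, bump h κ j z * (2 * ‖Ψ z‖ ^ 2) := by
      rw [← Finset.sum_mul, hh.partition κ h3, one_mul]
    rw [h6, Finset.mul_sum, ← Finset.sum_add_distrib, ← Finset.sum_sub_distrib]
    refine Finset.sum_congr rfl fun j _ => ?_
    have h7 := parallelogram_law_with_norm ℝ (phiStar σ (κ ^ 2 + κ * j) z) (Ψ z)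
    linear_combination bump h κ j z * h7
  simp_rw [e]
  have i3 : Integrable (fun z => 2 * ∑ j ∈ Finset.range κ,
      bump h κ j z * ‖phiStar σ (κ ^ 2 + κ * j) z‖ ^ 2) σ :=
    (integrable_finsetSum _ i1).const_mul 2
  have i4 : Integrable (fun z => 2 * ∑ j ∈ Finset.range κ,
      bump h κ j z * ‖phiStar σ (κ ^ 2 + κ * j) z‖ ^ 2 + 2 * ‖Ψ z‖ ^ 2) σ :=
    i3.add ((integrable_norm_sq Ψ).const_mul 2)
  rw [integral_sub i4 i2,
    integral_add i3 ((integrable_norm_sq Ψ).const_mul 2), integral_const_mul,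
    integral_const_mul, integral_norm_limit_sq hσ hΨ, integral_finsetSum _ i1]
  linarith

theorem localizedConvergence [IsProbabilityMeasure σ] (hs : SzegoClass σ) (hpca : PCA σ)
    {E : Set Circle} (hE : IsACCarrier σ E) (hh : IsProfile h) {f : ℕ → ℕ → ℂ}
    (hf : ∃ C : ℝ, ∀ κ j : ℕ, j < κ → ‖f j κ‖ ≤ C) : LocalizedConvergence σ E h f := by
  obtain ⟨C, hC⟩ := hf
  have hC0 : 0 ≤ C := (norm_nonneg _).trans (hC 1 0 one_pos)
  obtain ⟨Ψ, hΨ⟩ := exists_tendsto_starVec hs.nonDegenerate hs.bddAbove_lam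
  have hlim := (tendsto_integral_bump_sub hs hpca hh hΨ).const_mul (C ^ 2)
  rw [mul_zero] at hlim
  have hlim2 := ((Real.continuous_sqrt.tendsto _).comp hlim)
  have hlim3 := (ENNReal.continuous_ofReal.tendsto _).comp hlim2
  rw [Real.sqrt_zero, ENNReal.ofReal_zero] at hlim3
  refine tendsto_of_tendsto_of_tendsto_of_le_of_le' tendsto_const_nhds hlim3
    (.of_forall fun κ => zero_le) ?_
  filter_upwards [eventually_ge_atTop 2] with κ hκ
  have hae : (fun z : Circle => localizedSum σ h f κ z -
      szegoLimit σ E z * ∑ j ∈ Finset.range κ, f j κ * (bump h κ j z : ℂ)) =ᵐ[σ]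
      fun z => ∑ j ∈ Finset.range κ,
        f j κ * (bump h κ j z : ℂ) * (phiStar σ (κ ^ 2 + κ * j) z - Ψ z) := by
    filter_upwards [szegoLimit_ae_eq hs hΨ hE] with z hz
    rw [hz, localizedSum, Finset.mul_sum, ← Finset.sum_sub_distrib]
    exact Finset.sum_congr rfl fun j _ => by ring
  rw [eLpNorm_congr_ae hae]
  -- Cauchy–Schwarz with the weights `ω_j`
  have hcs : ∀ z, ‖∑ j ∈ Finset.range κ,
        f j κ * (bump h κ j z : ℂ) * (phiStar σ (κ ^ 2 + κ * j) z - Ψ z)‖ ^ 2 ≤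
      C ^ 2 * ∑ j ∈ Finset.range κ,
        bump h κ j z * ‖phiStar σ (κ ^ 2 + κ * j) z - Ψ z‖ ^ 2 := by
    intro z
    have h1 : ‖∑ j ∈ Finset.range κ,
        f j κ * (bump h κ j z : ℂ) * (phiStar σ (κ ^ 2 + κ * j) z - Ψ z)‖ ≤
        C * ∑ j ∈ Finset.range κ, bump h κ j z * ‖phiStar σ (κ ^ 2 + κ * j) z - Ψ z‖ := by
      rw [Finset.mul_sum]
      refine (norm_sum_le _ _).trans (Finset.sum_le_sum fun j hj => ?_)
      rw [norm_mul, norm_mul, Complex.norm_real, Real.norm_of_nonneg (hh.bump_nonneg κ j z),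
        mul_assoc]
      have := hh.bump_nonneg κ j z
      exact mul_le_mul_of_nonneg_right (hC κ j (Finset.mem_range.1 hj)) (by positivity)
    have h2 : (∑ j ∈ Finset.range κ, bump h κ j z * ‖phiStar σ (κ ^ 2 + κ * j) z - Ψ z‖) ^ 2 ≤
        ∑ j ∈ Finset.range κ, bump h κ j z * ‖phiStar σ (κ ^ 2 + κ * j) z - Ψ z‖ ^ 2 :=
      Real.pow_arith_mean_le_arith_mean_pow _ _ _ (fun j _ => hh.bump_nonneg κ j z)
        (hh.partition κ hκ z) (fun j _ => norm_nonneg _) 2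
    calc _ ≤ (C * ∑ j ∈ Finset.range κ,
          bump h κ j z * ‖phiStar σ (κ ^ 2 + κ * j) z - Ψ z‖) ^ 2 := by gcongr
      _ ≤ _ := by rw [mul_pow]; gcongr
  have hi : ∀ n, MemLp (fun z => phiStar σ n z - Ψ z) 2 σ := fun n =>
    ((Lp.memLp (starVec σ 0 n)).ae_eq (coeFn_starVec_zero n)).sub (Lp.memLp Ψ)
  have hint : Integrable (fun z => C ^ 2 * ∑ j ∈ Finset.range κ,
      bump h κ j z * ‖phiStar σ (κ ^ 2 + κ * j) z - Ψ z‖ ^ 2) σ :=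
    (integrable_finsetSum _ fun j hj => integrable_bump_mul hh hκ hj
      ((hi _).integrable_norm_pow (by norm_num))).const_mul _
  rw [eLpNorm_eq_lintegral_rpow_enorm_toReal (by norm_num) (by norm_num), Function.comp_apply,
    Function.comp_apply, ← integral_const_mul, Real.sqrt_eq_rpow,
    ← ENNReal.ofReal_rpow_of_nonneg (integral_nonneg fun z => by
      exact mul_nonneg (sq_nonneg C) (Finset.sum_nonneg fun j _ =>
        mul_nonneg (hh.bump_nonneg κ j z) (by positivity))) (by norm_num),
    ofReal_integral_eq_lintegral_ofReal hint (.of_forall fun z =>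
      mul_nonneg (sq_nonneg C) (Finset.sum_nonneg fun j _ =>
        mul_nonneg (hh.bump_nonneg κ j z) (by positivity)))]
  simp only [ENNReal.toReal_ofNat]
  refine ENNReal.rpow_le_rpow (lintegral_mono fun z => ?_) (by norm_num)
  rw [← ofReal_norm, ENNReal.ofReal_rpow_of_nonneg (norm_nonneg _) (by norm_num)]
  apply ENNReal.ofReal_le_ofReal
  have := hcs z
  simpa using this

end Localized

/-! ### Multiplication operators and exponentials -/

section Mul
variable {μ : Measure Circle} [IsFiniteMeasure μ]

theorem norm_mulL2_le (g : C(Circle, ℂ)) : ‖mulL2 μ g‖ ≤ ‖g‖ :=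
  LinearMap.mkContinuous_norm_le _ (norm_nonneg _) _

/-- `g ↦` multiplication by `g`, as a bounded linear map. -/
noncomputable def mulL2CLM (μ : Measure Circle) [IsFiniteMeasure μ] :
    C(Circle, ℂ) →L[ℂ] (Lp ℂ 2 μ →L[ℂ] Lp ℂ 2 μ) :=
  LinearMap.mkContinuous
    { toFun := mulL2 μ
      map_add' := fun f g => by
        ext1 F
        apply Lp.ext
        filter_upwards [coeFn_mulL2 (f + g) F, coeFn_mulL2 f F, coeFn_mulL2 g F,
          Lp.coeFn_add (mulL2 μ f F) (mulL2 μ g F)] with z h1 h2 h3 h4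
        rw [add_apply, h1, h4, Pi.add_apply, h2, h3, ContinuousMap.add_apply,
          add_mul]
      map_smul' := fun c g => by
        ext1 F
        apply Lp.ext
        filter_upwards [coeFn_mulL2 (c • g) F, coeFn_mulL2 g F,
          Lp.coeFn_smul c (mulL2 μ g F)] with z h1 h2 h3
        rw [RingHom.id_apply, smul_apply, h1, h3, Pi.smul_apply, h2,
          ContinuousMap.smul_apply, smul_eq_mul, smul_eq_mul, mul_assoc] } 1 (fun g => by
    rw [one_mul]
    exact norm_mulL2_le g)

@[simp] theorem mulL2CLM_apply (g : C(Circle, ℂ)) : mulL2CLM μ g = mulL2 μ g := rfl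

theorem mulL2_mul (f g : C(Circle, ℂ)) (F : Lp ℂ 2 μ) :
    mulL2 μ (f * g) F = mulL2 μ f (mulL2 μ g F) := by
  apply Lp.ext
  filter_upwards [coeFn_mulL2 (f * g) F, coeFn_mulL2 g F, coeFn_mulL2 f (mulL2 μ g F)]
    with z h1 h2 h3
  rw [h1, h3, h2, ContinuousMap.mul_apply, mul_assoc]

theorem mulL2_one (F : Lp ℂ 2 μ) : mulL2 μ 1 F = F := by
  apply Lp.ext
  filter_upwards [coeFn_mulL2 1 F] with z h1
  rw [h1, ContinuousMap.one_apply, one_mul]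

theorem inner_mulL2_left (g : C(Circle, ℂ)) (F G : Lp ℂ 2 μ) :
    inner ℂ (mulL2 μ g F) G = inner ℂ F (mulL2 μ (star g) G) := by
  rw [L2.inner_def, L2.inner_def]
  apply integral_congr_ae
  filter_upwards [coeFn_mulL2 g F, coeFn_mulL2 (star g) G] with z h1 h2
  rw [h1, h2, RCLike.inner_apply, RCLike.inner_apply, map_mul, ContinuousMap.star_apply,
    Complex.star_def]
  ring

theorem exp_apply_circle (g : C(Circle, ℂ)) (z : Circle) :
    NormedSpace.exp g z = Complex.exp (g z) := by
  have h1 := (NormedSpace.exp_series_hasSum_exp' (𝕂 := ℂ) g).mapL (ContinuousMap.evalCLM ℂ z)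
  have h2 := NormedSpace.exp_series_hasSum_exp' (𝕂 := ℂ) (g z)
  rw [Complex.exp_eq_exp_ℂ]
  refine h1.unique (hasSum_congr_fun h2 fun n => ?_)
  simp

/-- An operator which is intertwined with multiplication by `g` has its exponential intertwined
with multiplication by `exp g`. -/
theorem intertwine_exp {H : Type*} [NormedAddCommGroup H] [NormedSpace ℂ H] [CompleteSpace H]
    {U : H →L[ℂ] Lp ℂ 2 μ} {A : H →L[ℂ] H} {g : C(Circle, ℂ)}
    (h : ∀ ψ, U (A ψ) = mulL2 μ g (U ψ)) (c : ℂ) (ψ : H) :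
    U (NormedSpace.exp (c • A) ψ) = mulL2 μ (NormedSpace.exp (c • g)) (U ψ) := by
  have h1 := ((NormedSpace.exp_series_hasSum_exp' (𝕂 := ℂ) (c • A)).mapL
    (ContinuousLinearMap.apply ℂ H ψ)).mapL U
  have h2 := ((NormedSpace.exp_series_hasSum_exp' (𝕂 := ℂ) (c • g)).mapL (mulL2CLM μ)).mapL
    (ContinuousLinearMap.apply ℂ (Lp ℂ 2 μ) (U ψ))
  refine h1.unique (hasSum_congr_fun h2 fun n => ?_)
  have h3 : ∀ n : ℕ, U ((A ^ n) ψ) = mulL2 μ (g ^ n) (U ψ) := by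
    intro n
    induction n with
    | zero => rw [pow_zero, pow_zero, mulL2_one]; rfl
    | succ n ih => rw [pow_succ', pow_succ', mulL2_mul, ← ih, ← h]; rfl
  simp only [ContinuousLinearMap.apply_apply, map_smul, smul_pow, mulL2CLM_apply, h3]

end Mul

/-! ### Jacobi matrices and orthogonal polynomials -/

/-- The standard basis of `ℓ²`. -/
noncomputable def bas (n : ℕ) : L2Seq := lp.single 2 n (1 : ℂ)

theorem bas_apply (n k : ℕ) : bas n k = if k = n then 1 else 0 := by
  rw [bas]
  split_ifs with h
  · subst h; exact lp.single_apply_self _ _ _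
  · exact lp.single_apply_ne _ _ _ h

theorem inner_bas (n : ℕ) (ψ : L2Seq) : inner ℂ (bas n) ψ = ψ n := inner_single_L2Seq ψ n

theorem firstVector_eq : firstVector = bas 0 := rfl

theorem clm_ext_bas {F : Type*} [NormedAddCommGroup F] [NormedSpace ℂ F] {S T : L2Seq →L[ℂ] F}
    (h : ∀ n, S (bas n) = T (bas n)) : S = T := by
  ext1 ψ
  have h1 := lp.hasSum_single (p := 2) (by norm_num) ψ
  refine (h1.mapL S).unique (hasSum_congr_fun (h1.mapL T) fun n => ?_)
  have h2 : (lp.single 2 n (ψ n) : L2Seq) = ψ n • bas n := by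
    rw [bas, ← lp.single_smul, smul_eq_mul, mul_one]
  rw [h2, map_smul, map_smul, h]

theorem L2Seq_add_apply (φ ψ : L2Seq) (n : ℕ) : (φ + ψ) n = φ n + ψ n := rfl

theorem L2Seq_smul_apply (c : ℂ) (ψ : L2Seq) (n : ℕ) : (c • ψ) n = c * ψ n := rfl

theorem JacobiParams.op_bas_zero (J : JacobiParams) :
    J.op (bas 0) = (J.b 0 : ℂ) • bas 1 + (J.v 0 : ℂ) • bas 0 := by
  ext n
  rcases n with _ | _ | n <;>
    simp [J.op_apply_zero, J.op_apply_succ, bas_apply, L2Seq_add_apply, L2Seq_smul_apply,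
      -Complex.coe_smul, -lp.coeFn_add, -lp.coeFn_smul]

theorem JacobiParams.op_bas_succ (J : JacobiParams) (n : ℕ) :
    J.op (bas (n + 1)) = (J.b (n + 1) : ℂ) • bas (n + 2) + (J.v (n + 1) : ℂ) • bas (n + 1) +
      (J.b n : ℂ) • bas n := by
  ext k
  rcases k with _ | k
  · rw [J.op_apply_zero]
    rcases n with _ | n <;> simp [bas_apply, L2Seq_add_apply, L2Seq_smul_apply,
      -Complex.coe_smul, -lp.coeFn_add, -lp.coeFn_smul]
  · rw [J.op_apply_succ]
    simp only [bas_apply, L2Seq_add_apply, L2Seq_smul_apply, Nat.add_right_cancel_iff]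
    rcases lt_trichotomy k n with h1 | h1 | h1
    · by_cases h3 : k + 1 = n
      · subst h3
        simp [show k ≠ k + 1 + 1 by omega]
      · simp [show k ≠ n + 1 by omega, show k ≠ n by omega, h3]
    · subst h1; simp
    · by_cases h3 : k = n + 1
      · subst h3
        simp [show n + 1 + 1 ≠ n by omega]
      · simp [show k ≠ n by omega, show k + 1 ≠ n by omega, h3]

/-- The orthonormal polynomials of the canonical spectral measure, by the three-term recursion. -/
noncomputable def JacobiParams.poly (J : JacobiParams) : ℕ → Polynomial ℝ
  | 0 => 1
  | 1 => Polynomial.C (J.b 0)⁻¹ *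
      ((Polynomial.X - Polynomial.C (J.v 0)) * 1 - Polynomial.C 0 * 0)
  | n + 2 => Polynomial.C (J.b (n + 1))⁻¹ *
      ((Polynomial.X - Polynomial.C (J.v (n + 1))) * J.poly (n + 1) -
        Polynomial.C (J.b n) * J.poly n)

section Hilbert
variable {H : Type*} [NormedAddCommGroup H] [InnerProductSpace ℂ H]

/-- The operator `p(A)`. -/
noncomputable def polyOp (A : H →L[ℂ] H) (p : Polynomial ℝ) : H →L[ℂ] H := Polynomial.aeval A p

theorem polyOp_one (A : H →L[ℂ] H) (ψ : H) : polyOp A 1 ψ = ψ := by simp [polyOp]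

theorem polyOp_zero (A : H →L[ℂ] H) (ψ : H) : polyOp A 0 ψ = 0 := by simp [polyOp]

theorem polyOp_mul (A : H →L[ℂ] H) (p q : Polynomial ℝ) (ψ : H) :
    polyOp A (p * q) ψ = polyOp A p (polyOp A q ψ) := by simp [polyOp]

theorem polyOp_X (A : H →L[ℂ] H) (ψ : H) : polyOp A Polynomial.X ψ = A ψ := by simp [polyOp]

theorem polyOp_C (A : H →L[ℂ] H) (r : ℝ) (ψ : H) :
    polyOp A (Polynomial.C r) ψ = (r : ℂ) • ψ := by
  simp [polyOp, Algebra.algebraMap_eq_smul_one]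

theorem polyOp_add (A : H →L[ℂ] H) (p q : Polynomial ℝ) (ψ : H) :
    polyOp A (p + q) ψ = polyOp A p ψ + polyOp A q ψ := by simp [polyOp]

theorem polyOp_sub (A : H →L[ℂ] H) (p q : Polynomial ℝ) (ψ : H) :
    polyOp A (p - q) ψ = polyOp A p ψ - polyOp A q ψ := by simp [polyOp]

theorem polyOp_three_term {A : H →L[ℂ] H} {b v c : ℝ} (hb : b ≠ 0) {p q : Polynomial ℝ}
    {e φ ψ χ : H} (hp : polyOp A p e = ψ) (hq : polyOp A q e = χ)
    (hA : A ψ = (b : ℂ) • φ + (v : ℂ) • ψ + (c : ℂ) • χ) :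
    polyOp A (Polynomial.C b⁻¹ * ((Polynomial.X - Polynomial.C v) * p - Polynomial.C c * q)) e =
      φ := by
  rw [polyOp_mul, polyOp_C, polyOp_sub, polyOp_mul, polyOp_mul, polyOp_sub, polyOp_X, polyOp_C,
    polyOp_C, hp, hq, hA, add_sub_right_comm, add_sub_cancel_right, add_sub_cancel_right, smul_smul,
    ← Complex.ofReal_mul, inv_mul_cancel₀ hb, Complex.ofReal_one, one_smul]

variable [CompleteSpace H]

/-- A compactly supported cutoff equal to `1` on `[-M, M]`. -/
noncomputable def cutoffMul (M : ℝ) (f : C(ℝ, ℝ)) : CompactlySupportedContinuousMap ℝ ℝ where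
  toFun x := max 0 (min 1 (M + 1 - |x|)) * f x
  continuous_toFun := by fun_prop
  hasCompactSupport' := by
    refine HasCompactSupport.intro (isCompact_Icc (a := -(M + 1)) (b := M + 1)) fun x hx => ?_
    have h : M + 1 < |x| := by
      by_contra h
      exact hx (abs_le.1 (not_lt.1 h))
    rw [max_eq_left ((min_le_right _ _).trans (by linarith)), zero_mul]

theorem cutoffMul_apply {M : ℝ} (f : C(ℝ, ℝ)) {x : ℝ} (hx : |x| ≤ M) :
    cutoffMul M f x = f x := by
  change max 0 (min 1 (M + 1 - |x|)) * f x = f x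
  rw [min_eq_left (by linarith), max_eq_right zero_le_one, one_mul]

/-- A number bounding the spectrum of `A`. -/
noncomputable def spectrumBound (A : H →L[ℂ] H) : ℝ := max 1 (‖A‖ * ‖(1 : H →L[ℂ] H)‖)

theorem abs_le_of_mem_spectrum {A : H →L[ℂ] H} {x : ℝ} (hx : x ∈ spectrum ℝ A) :
    |x| ≤ spectrumBound A :=
  (spectrum.norm_le_norm_mul_of_mem hx).trans (le_max_right _ _)

theorem integral_cutoff_polynomial {A : H →L[ℂ] H} (hA : IsSelfAdjoint A) (ψ : H)
    (p : Polynomial ℝ) :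
    ∫ x, cutoffMul (spectrumBound A) ⟨fun x => p.eval x, p.continuous⟩ x ∂(spectralMeasure A ψ) =
      (inner ℂ ψ (polyOp A p ψ)).re := by
  rw [integral_spectralMeasure, polyOp, ← cfc_polynomial p A hA]
  congr 3
  apply cfc_congr
  intro x hx
  exact cutoffMul_apply _ (abs_le_of_mem_spectrum hx)

theorem inner_polyOp_left {A : H →L[ℂ] H} (hA : IsSelfAdjoint A) (p : Polynomial ℝ) (φ ψ : H) :
    inner ℂ (polyOp A p φ) ψ = inner ℂ φ (polyOp A p ψ) := by
  have h1 : IsSelfAdjoint (polyOp A p) := by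
    rw [polyOp, ← cfc_polynomial p A hA]
    exact cfc_predicate _ _
  rw [← ContinuousLinearMap.adjoint_inner_right, h1.adjoint_eq]

instance isFiniteMeasureOnCompacts_spectralMeasure (A : H →L[ℂ] H) (ψ : H) :
    IsFiniteMeasureOnCompacts (spectralMeasure A ψ) := by
  unfold spectralMeasure
  infer_instance

end Hilbert

theorem JacobiParams.polyOp_poly (J : JacobiParams) (n : ℕ) :
    polyOp J.op (J.poly n) (bas 0) = bas n := by
  have key : ∀ n, polyOp J.op (J.poly n) (bas 0) = bas n ∧
      polyOp J.op (J.poly (n + 1)) (bas 0) = bas (n + 1) := by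
    intro n
    induction n with
    | zero =>
      have h0 : polyOp J.op (J.poly 0) (bas 0) = bas 0 := by
        rw [JacobiParams.poly, polyOp_one]
      refine ⟨h0, ?_⟩
      refine polyOp_three_term (J.b_pos 0).ne' (polyOp_one _ _) (polyOp_zero _ _) ?_
      rw [J.op_bas_zero, smul_zero, add_zero]
    | succ n ih =>
      exact ⟨ih.2, polyOp_three_term (J.b_pos (n + 1)).ne' ih.2 ih.1 (J.op_bas_succ n)⟩
  exact (key n).1

section Rho
variable {J : JacobiParams}

theorem ae_rho_mem (hJ : J.rho (Set.Icc (-1) 1)ᶜ = 0) : ∀ᵐ x ∂J.rho, x ∈ Set.Icc (-1 : ℝ) 1 := hJ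

theorem isFiniteMeasure_rho (hJ : J.rho (Set.Icc (-1) 1)ᶜ = 0) : IsFiniteMeasure J.rho := by
  constructor
  have h1 : J.rho Set.univ ≤ J.rho (Set.Icc (-1) 1) + J.rho (Set.Icc (-1) 1)ᶜ := by
    rw [← Set.union_compl_self (Set.Icc (-1 : ℝ) 1)]
    exact measure_union_le _ _
  rw [hJ, add_zero] at h1
  refine h1.trans_lt ?_
  have : IsFiniteMeasureOnCompacts J.rho := isFiniteMeasureOnCompacts_spectralMeasure _ _
  exact isCompact_Icc.measure_lt_top

theorem integral_rho_polynomial (hJ : J.rho (Set.Icc (-1) 1)ᶜ = 0) (p : Polynomial ℝ) :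
    ∫ x, p.eval x ∂J.rho = (inner ℂ (bas 0) (polyOp J.op p (bas 0))).re := by
  rw [← firstVector_eq, ← integral_cutoff_polynomial J.op_isSelfAdjoint firstVector p]
  apply integral_congr_ae
  filter_upwards [ae_rho_mem hJ] with x hx
  rw [cutoffMul_apply _ ((abs_le.2 ⟨hx.1, hx.2⟩).trans
    (show (1 : ℝ) ≤ spectrumBound J.op from le_max_left _ _))]
  rfl

theorem integral_rho_poly_mul (hJ : J.rho (Set.Icc (-1) 1)ᶜ = 0) (m n : ℕ) :
    ∫ x, (J.poly m).eval x * (J.poly n).eval x ∂J.rho = if m = n then 1 else 0 := by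
  have h1 := integral_rho_polynomial hJ (J.poly m * J.poly n)
  simp only [Polynomial.eval_mul] at h1
  rw [h1, polyOp_mul, J.polyOp_poly, ← inner_polyOp_left J.op_isSelfAdjoint,
    J.polyOp_poly, inner_bas, bas_apply]
  split_ifs <;> simp

theorem isProbabilityMeasure_rho (hJ : J.rho (Set.Icc (-1) 1)ᶜ = 0) :
    IsProbabilityMeasure J.rho := by
  have := isFiniteMeasure_rho hJ
  have h1 := integral_rho_poly_mul hJ 0 0
  simp only [JacobiParams.poly, Polynomial.eval_one, mul_one, integral_const, smul_eq_mul,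
    if_true] at h1
  constructor
  rw [measureReal_def] at h1
  exact (ENNReal.toReal_eq_one_iff _).1 h1

end Rho

/-! ### The Szegő mapping -/

section SzegoMap

theorem measurable_circleExp : Measurable Circle.exp := Circle.exp.continuous.measurable

theorem measurable_exp_arccos : Measurable fun x : ℝ => Circle.exp (Real.arccos x) :=
  measurable_circleExp.comp Real.continuous_arccos.measurable

theorem measurable_exp_neg_arccos : Measurable fun x : ℝ => Circle.exp (-Real.arccos x) :=
  measurable_circleExp.comp Real.continuous_arccos.measurable.neg

theorem re_circleExp (t : ℝ) : ((Circle.exp t : Circle) : ℂ).re = Real.cos t := by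
  rw [Circle.coe_exp, Complex.exp_ofReal_mul_I_re]

theorem isProbabilityMeasure_szegoInv {ρ : Measure ℝ} [IsProbabilityMeasure ρ] :
    IsProbabilityMeasure (szegoInv ρ) := by
  constructor
  rw [szegoInv, Measure.smul_apply, Measure.add_apply,
    Measure.map_apply measurable_exp_arccos MeasurableSet.univ,
    Measure.map_apply measurable_exp_neg_arccos MeasurableSet.univ]
  simp only [Set.preimage_univ, measure_univ, smul_eq_mul]
  rw [one_add_one_eq_two, ENNReal.inv_mul_cancel (by norm_num) (by norm_num)]

theorem map_inv_szegoInv (ρ : Measure ℝ) : (szegoInv ρ).map (fun z => z⁻¹) = szegoInv ρ := by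
  have hinv : Measurable fun z : Circle => z⁻¹ := continuous_inv.measurable
  have e1 : (fun z : Circle => z⁻¹) ∘ (fun x : ℝ => Circle.exp (Real.arccos x)) =
      fun x => Circle.exp (-Real.arccos x) := by
    ext x
    simp [Circle.exp_neg]
  have e2 : (fun z : Circle => z⁻¹) ∘ (fun x : ℝ => Circle.exp (-Real.arccos x)) =
      fun x => Circle.exp (Real.arccos x) := by
    ext x
    simp [Circle.exp_neg]
  rw [szegoInv, Measure.map_smul, Measure.map_add _ _ hinv,
    Measure.map_map hinv measurable_exp_arccos, Measure.map_map hinv measurable_exp_neg_arccos,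
    e1, e2, add_comm]

theorem map_inv_arcMeasure : arcMeasure.map (fun z => z⁻¹) = arcMeasure := by
  have hinv : Measurable fun z : Circle => z⁻¹ := continuous_inv.measurable
  have : IsFiniteMeasure (arcMeasure.map fun z => z⁻¹) := Measure.isFiniteMeasure_map _ _
  apply measure_ext_of_moments
  intro n
  have hc : Continuous fun z : Circle => mono n z := (mono n).continuous
  simp only [mono_apply] at hc
  rw [integral_map hinv.aemeasurable hc.aestronglyMeasurable]
  have h2 := integral_zpow_arcMeasure (-n)
  rw [integral_zpow_arcMeasure]
  simp only [zpow_neg, neg_eq_zero] at h2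
  rw [← h2]
  congr 1
  ext z
  rw [Circle.coe_inv, inv_zpow]

theorem integral_szegoInv {ρ : Measure ℝ} [IsFiniteMeasure ρ] (h1 : ρ (Set.Icc (-1) 1)ᶜ = 0)
    {f : ℝ → ℂ} (hf : Continuous f) :
    ∫ z : Circle, f (z : ℂ).re ∂(szegoInv ρ) = ∫ x, f x ∂ρ := by
  have hc : Continuous fun z : Circle => f (z : ℂ).re :=
    hf.comp (Complex.continuous_re.comp continuous_subtype_val)
  have i1 : IsFiniteMeasure (ρ.map fun x => Circle.exp (Real.arccos x)) :=
    Measure.isFiniteMeasure_map _ _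
  have i2 : IsFiniteMeasure (ρ.map fun x => Circle.exp (-Real.arccos x)) :=
    Measure.isFiniteMeasure_map _ _
  have hae : ∀ᵐ x ∂ρ, x ∈ Set.Icc (-1 : ℝ) 1 := h1
  have e1 : ∫ x, f ((Circle.exp (Real.arccos x) : Circle) : ℂ).re ∂ρ = ∫ x, f x ∂ρ := by
    apply integral_congr_ae
    filter_upwards [hae] with x hx
    rw [re_circleExp, Real.cos_arccos hx.1 hx.2]
  have e2 : ∫ x, f ((Circle.exp (-Real.arccos x) : Circle) : ℂ).re ∂ρ = ∫ x, f x ∂ρ := by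
    apply integral_congr_ae
    filter_upwards [hae] with x hx
    rw [re_circleExp, Real.cos_neg, Real.cos_arccos hx.1 hx.2]
  rw [szegoInv, integral_smul_measure, integral_add_measure
    (integrable_of_continuous _ hc) (integrable_of_continuous _ hc),
    integral_map measurable_exp_arccos.aemeasurable hc.aestronglyMeasurable,
    integral_map measurable_exp_neg_arccos.aemeasurable hc.aestronglyMeasurable, e1, e2]
  rw [← two_smul ℝ, smul_smul]
  simp

end SzegoMap

/-- The coordinate function `Re z` on the circle. -/
noncomputable def reC : C(Circle, ℂ) := ⟨fun z => (((z : ℂ).re : ℝ) : ℂ), by fun_prop⟩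

@[simp] theorem reC_apply (z : Circle) : reC z = (((z : ℂ).re : ℝ) : ℂ) := rfl

/-- The function `p(Re z)` on the circle. -/
noncomputable def polyRe (p : Polynomial ℝ) : C(Circle, ℂ) :=
  ⟨fun z => ((p.eval (z : ℂ).re : ℝ) : ℂ), by fun_prop⟩

@[simp] theorem polyRe_apply (p : Polynomial ℝ) (z : Circle) :
    polyRe p z = ((p.eval (z : ℂ).re : ℝ) : ℂ) := rfl

section Transform
variable {J : JacobiParams} {σ : Measure Circle}

theorem JacobiParams.polyRe_zero (J : JacobiParams) : polyRe (J.poly 0) = 1 := by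
  ext z
  simp [JacobiParams.poly]

theorem JacobiParams.reC_mul_zero (J : JacobiParams) : reC * polyRe (J.poly 0) =
    (J.b 0 : ℂ) • polyRe (J.poly 1) + (J.v 0 : ℂ) • polyRe (J.poly 0) := by
  have hb : (J.b 0 : ℂ) ≠ 0 := by exact_mod_cast (J.b_pos 0).ne'
  ext z
  simp only [ContinuousMap.mul_apply, reC_apply, ContinuousMap.add_apply, ContinuousMap.smul_apply,
    polyRe_apply, smul_eq_mul]
  rw [show J.poly 1 = Polynomial.C (J.b 0)⁻¹ *
      ((Polynomial.X - Polynomial.C (J.v 0)) * 1 - Polynomial.C 0 * 0) by rw [JacobiParams.poly],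
    show J.poly 0 = 1 by rw [JacobiParams.poly]]
  simp
  field_simp
  ring

theorem JacobiParams.reC_mul_succ (J : JacobiParams) (n : ℕ) : reC * polyRe (J.poly (n + 1)) =
    (J.b (n + 1) : ℂ) • polyRe (J.poly (n + 2)) + (J.v (n + 1) : ℂ) • polyRe (J.poly (n + 1)) +
      (J.b n : ℂ) • polyRe (J.poly n) := by
  have hb : (J.b (n + 1) : ℂ) ≠ 0 := by exact_mod_cast (J.b_pos _).ne'
  ext z
  simp only [ContinuousMap.mul_apply, reC_apply, ContinuousMap.add_apply, ContinuousMap.smul_apply,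
    polyRe_apply, smul_eq_mul]
  rw [show J.poly (n + 2) = Polynomial.C (J.b (n + 1))⁻¹ *
      ((Polynomial.X - Polynomial.C (J.v (n + 1))) * J.poly (n + 1) -
        Polynomial.C (J.b n) * J.poly n) by rw [JacobiParams.poly]]
  simp
  field_simp
  ring

/-- `U` is the spectral transform of `J` in `L²(σ)`: an isometry sending `e_n` to
`p_n(Re z)`. -/
def IsTransform (J : JacobiParams) (σ : Measure Circle) [IsFiniteMeasure σ]
    (U : L2Seq →ₗᵢ[ℂ] Lp ℂ 2 σ) : Prop :=
  ∀ n, U (bas n) = cL2 σ (polyRe (J.poly n))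

theorem exists_isometry_of_orthonormal {F : Type*} [NormedAddCommGroup F] [InnerProductSpace ℂ F]
    [CompleteSpace F] {v : ℕ → F} (hv : Orthonormal ℂ v) :
    ∃ U : L2Seq →ₗᵢ[ℂ] F, ∀ n, U (bas n) = v n := by
  refine ⟨hv.orthogonalFamily.linearIsometry, fun n => ?_⟩
  rw [bas, OrthogonalFamily.linearIsometry_apply_single]
  simp

theorem exists_isTransform (hJ : J.rho (Set.Icc (-1) 1)ᶜ = 0) [IsFiniteMeasure (szegoInv J.rho)] :
    ∃ U : L2Seq →ₗᵢ[ℂ] Lp ℂ 2 (szegoInv J.rho), IsTransform J (szegoInv J.rho) U := by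
  have := isFiniteMeasure_rho hJ
  apply exists_isometry_of_orthonormal
  rw [orthonormal_iff_ite]
  intro m n
  rw [inner_cL2]
  have h1 := integral_szegoInv hJ
    (f := fun x => (((J.poly m).eval x * (J.poly n).eval x : ℝ) : ℂ)) (by fun_prop)
  have h2 := integral_ofReal (𝕜 := ℂ) (μ := J.rho)
    (f := fun x => (J.poly m).eval x * (J.poly n).eval x)
  have h3 := h1.trans h2
  rw [integral_rho_poly_mul hJ] at h3
  refine Eq.trans ?_ (h3.trans ?_)
  · congr 1
    ext z
    simp [mul_comm]
  · split_ifs <;> simp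

variable [IsFiniteMeasure σ] {U : L2Seq →ₗᵢ[ℂ] Lp ℂ 2 σ}

theorem IsTransform.op_apply (hU : IsTransform J σ U) (ψ : L2Seq) :
    U (J.op ψ) = mulL2 σ reC (U ψ) := by
  have h : U.toContinuousLinearMap ∘L J.op = mulL2 σ reC ∘L U.toContinuousLinearMap := by
    apply clm_ext_bas
    intro n
    simp only [ContinuousLinearMap.comp_apply, LinearIsometry.coe_toContinuousLinearMap]
    rcases n with _ | n
    · rw [J.op_bas_zero, map_add, map_smul, map_smul, hU, hU, mulL2_cL2, J.reC_mul_zero, map_add,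
        map_smul, map_smul]
    · rw [J.op_bas_succ, map_add, map_add, map_smul, map_smul, map_smul, hU, hU, hU, mulL2_cL2,
        J.reC_mul_succ, map_add, map_add, map_smul, map_smul, map_smul]
  exact DFunLike.congr_fun h ψ

theorem IsTransform.evolution_apply (hU : IsTransform J σ U) (t : ℝ) (ψ : L2Seq) :
    U (evolution J.op t ψ) = mulL2 σ (NormedSpace.exp ((Complex.I * (t : ℂ)) • reC)) (U ψ) :=
  intertwine_exp (U := U.toContinuousLinearMap) hU.op_apply _ ψ

theorem polyOp_intertwine {H : Type*} [NormedAddCommGroup H] [InnerProductSpace ℂ H]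
    {A : H →L[ℂ] H} {U : H →ₗᵢ[ℂ] Lp ℂ 2 σ} (h : ∀ ψ, U (A ψ) = mulL2 σ reC (U ψ))
    (p : Polynomial ℝ) (ψ : H) : U (polyOp A p ψ) = mulL2 σ (polyRe p) (U ψ) := by
  induction p using Polynomial.induction_on generalizing ψ with
  | C a =>
    rw [polyOp_C, map_smul, show polyRe (Polynomial.C a) = (a : ℂ) • 1 by ext z; simp,
      ← mulL2CLM_apply, map_smul, smul_apply, mulL2CLM_apply, mulL2_one]
  | add p q hp hq =>
    rw [polyOp_add, map_add, hp, hq, show polyRe (p + q) = polyRe p + polyRe q by ext z; simp,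
      ← mulL2CLM_apply (polyRe p + polyRe q), map_add, add_apply, mulL2CLM_apply, mulL2CLM_apply]
  | monomial n a ih =>
    rw [pow_succ, ← mul_assoc, polyOp_mul, polyOp_X, ih, h, ← mulL2_mul]
    congr 2
    ext z
    simp

theorem integral_mul_norm_sq (f : C(Circle, ℂ)) {r : Circle → ℝ} (hr : ∀ z, f z = (r z : ℂ))
    (F : Lp ℂ 2 σ) : (inner ℂ F (mulL2 σ f F)).re = ∫ z, r z * ‖F z‖ ^ 2 ∂σ := by
  have h1 : inner ℂ F (mulL2 σ f F) = ((∫ z, r z * ‖F z‖ ^ 2 ∂σ : ℝ) : ℂ) := by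
    rw [L2.inner_def]
    refine Eq.trans ?_ (integral_ofReal (𝕜 := ℂ) (μ := σ) (f := fun z => r z * ‖F z‖ ^ 2))
    apply integral_congr_ae
    filter_upwards [coeFn_mulL2 f F] with z hz
    rw [hz, hr, RCLike.inner_apply, mul_assoc, Complex.mul_conj, Complex.normSq_eq_norm_sq]
    norm_cast
  rw [h1, Complex.ofReal_re]

theorem abs_re_circle_le (z : Circle) : |(z : ℂ).re| ≤ 1 := by
  have := Complex.abs_re_le_norm (z : ℂ)
  rwa [Circle.norm_coe] at this

theorem abs_inner_cfc_sub_le {H : Type*} [NormedAddCommGroup H] [InnerProductSpace ℂ H]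
    [CompleteSpace H] {A : H →L[ℂ] H} (hA : IsSelfAdjoint A) {f : ℝ → ℝ} (hf : Continuous f)
    {p : Polynomial ℝ} {ε : ℝ} (hε : 0 ≤ ε)
    (h : ∀ x, |x| ≤ spectrumBound A → |f x - p.eval x| ≤ ε) (ψ : H) :
    |(inner ℂ ψ (cfc f A ψ)).re - (inner ℂ ψ (polyOp A p ψ)).re| ≤ ε * ‖ψ‖ ^ 2 := by
  have h1 : cfc f A - polyOp A p = cfc (fun x => f x - p.eval x) A := by
    rw [cfc_sub (R := ℝ) f (fun x => p.eval x) A hf.continuousOn p.continuous.continuousOn,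
      polyOp, ← cfc_polynomial p A hA]
  have h2 : ‖cfc f A - polyOp A p‖ ≤ ε := by
    rw [h1]
    exact norm_cfc_le hε fun x hx => h x (abs_le_of_mem_spectrum hx)
  rw [← Complex.sub_re, ← inner_sub_right, ← sub_apply]
  calc _ ≤ ‖inner ℂ ψ ((cfc f A - polyOp A p) ψ)‖ := Complex.abs_re_le_norm _
    _ ≤ ‖ψ‖ * ‖(cfc f A - polyOp A p) ψ‖ := norm_inner_le_norm _ _
    _ ≤ ‖ψ‖ * (ε * ‖ψ‖) := by
        gcongr
        exact ((cfc f A - polyOp A p).le_opNorm ψ).trans (by gcongr)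
    _ = ε * ‖ψ‖ ^ 2 := by ring

/-- The spectral measure of `ψ` is the image under `Re` of the measure `|Uψ|² σ`. -/
theorem spectralMeasure_eq_map {H : Type*} [NormedAddCommGroup H] [InnerProductSpace ℂ H]
    [CompleteSpace H] {A : H →L[ℂ] H} (hA : IsSelfAdjoint A) {U : H →ₗᵢ[ℂ] Lp ℂ 2 σ}
    (h : ∀ ψ, U (A ψ) = mulL2 σ reC (U ψ)) (ψ : H) :
    spectralMeasure A ψ = (σ.withDensity fun z => ENNReal.ofReal (‖U ψ z‖ ^ 2)).map
      fun z : Circle => (z : ℂ).re := by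
  have hm : Measurable fun z => ENNReal.ofReal (‖U ψ z‖ ^ 2) :=
    ((Lp.stronglyMeasurable (U ψ)).measurable.norm.pow_const 2).ennreal_ofReal
  have hre : Measurable fun z : Circle => (z : ℂ).re := by
    have : Continuous fun z : Circle => (z : ℂ).re := by fun_prop
    exact this.measurable
  have i1 : IsFiniteMeasure (σ.withDensity fun z => ENNReal.ofReal (‖U ψ z‖ ^ 2)) :=
    isFiniteMeasure_withDensity_ofReal (integrable_norm_sq (U ψ)).2
  have i2 : IsFiniteMeasure ((σ.withDensity fun z => ENNReal.ofReal (‖U ψ z‖ ^ 2)).map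
      fun z : Circle => (z : ℂ).re) := Measure.isFiniteMeasure_map _ _
  have i3 : (spectralMeasure A ψ).Regular := by unfold spectralMeasure; infer_instance
  apply Measure.ext_of_integral_eq_on_compactlySupported
  intro f
  have hfc : Continuous fun x : ℝ => f x := f.continuous
  rw [integral_spectralMeasure, integral_map (f := fun x : ℝ => f x) hre.aemeasurable
    hfc.aestronglyMeasurable, integral_withDensity_eq_integral_toReal_smul hm
    (.of_forall fun z => ENNReal.ofReal_lt_top)]
  have e : ∀ z : Circle, (ENNReal.ofReal (‖U ψ z‖ ^ 2)).toReal • f (z : ℂ).re =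
      f (z : ℂ).re * ‖U ψ z‖ ^ 2 := by
    intro z
    rw [ENNReal.toReal_ofReal (by positivity), smul_eq_mul, mul_comm]
  simp_rw [e]
  have hb : (1 : ℝ) ≤ spectrumBound A := le_max_left _ _
  -- approximate `f` by polynomials
  have key : ∀ ε : ℝ, 0 < ε → |(inner ℂ ψ (cfc f A ψ)).re -
      ∫ z : Circle, f (z : ℂ).re * ‖U ψ z‖ ^ 2 ∂σ| ≤ ε * (2 * ‖ψ‖ ^ 2) := by
    intro ε hε
    obtain ⟨p, hp⟩ := exists_polynomial_near_of_continuousOn (-spectrumBound A) (spectrumBound A)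
      f f.continuous.continuousOn ε hε
    have hp' : ∀ x, |x| ≤ spectrumBound A → |f x - p.eval x| ≤ ε := fun x hx => by
      rw [abs_sub_comm]
      exact (hp x ⟨(abs_le.1 hx).1, (abs_le.1 hx).2⟩).le
    have h1 := abs_inner_cfc_sub_le hA hfc hε.le hp' ψ
    have h2 : (inner ℂ ψ (polyOp A p ψ)).re =
        ∫ z : Circle, p.eval (z : ℂ).re * ‖U ψ z‖ ^ 2 ∂σ := by
      rw [← U.inner_map_map, polyOp_intertwine h]
      exact integral_mul_norm_sq (polyRe p) (fun z => rfl) (U ψ)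
    have hint : ∀ g : ℝ → ℝ, Continuous g →
        Integrable (fun z : Circle => g (z : ℂ).re * ‖U ψ z‖ ^ 2) σ := by
      intro g hg
      have hgc : Continuous fun z : Circle => g (z : ℂ).re :=
        hg.comp (Complex.continuous_re.comp continuous_subtype_val)
      obtain ⟨C, hC⟩ := isCompact_univ.exists_bound_of_continuousOn hgc.continuousOn
      exact (integrable_norm_sq (U ψ)).bdd_mul hgc.aestronglyMeasurable
        (.of_forall fun z => hC z trivial)
    have h3 : |∫ z : Circle, p.eval (z : ℂ).re * ‖U ψ z‖ ^ 2 ∂σ -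
        ∫ z : Circle, f (z : ℂ).re * ‖U ψ z‖ ^ 2 ∂σ| ≤ ε * ‖ψ‖ ^ 2 := by
      rw [← integral_sub (hint _ p.continuous) (hint f hfc), ← U.norm_map ψ, lp_norm_sq,
        ← integral_const_mul]
      refine abs_integral_le_integral_abs.trans ?_
      apply integral_mono_ae
      · exact ((hint _ p.continuous).sub (hint f hfc)).abs
      · exact (integrable_norm_sq (U ψ)).const_mul ε
      filter_upwards with z
      change |p.eval (z : ℂ).re * ‖U ψ z‖ ^ 2 - f (z : ℂ).re * ‖U ψ z‖ ^ 2| ≤ ε * ‖U ψ z‖ ^ 2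
      rw [← sub_mul, abs_mul, abs_of_nonneg (sq_nonneg ‖U ψ z‖), abs_sub_comm]
      gcongr
      exact hp' _ ((abs_re_circle_le z).trans hb)
    rw [← h2] at h3
    have h4 := abs_sub_le (inner ℂ ψ (cfc f A ψ)).re (inner ℂ ψ (polyOp A p ψ)).re
      (∫ z : Circle, f (z : ℂ).re * ‖U ψ z‖ ^ 2 ∂σ)
    linarith
  by_contra hne
  have hpos := abs_pos.2 (sub_ne_zero.2 hne)
  have h5 := key (|(inner ℂ ψ (cfc f A ψ)).re - ∫ z : Circle, f (z : ℂ).re * ‖U ψ z‖ ^ 2 ∂σ| /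
    (4 * (‖ψ‖ ^ 2 + 1))) (by positivity)
  rw [div_mul_eq_mul_div, le_div_iff₀ (by positivity)] at h5
  nlinarith [sq_nonneg ‖ψ‖]

end Transform

/-! ### The free Jacobi matrix -/

section Free

/-- The function `√2 Im z^{n+1}` on the circle. -/
noncomputable def sinC (n : ℕ) : C(Circle, ℂ) :=
  (-(Real.sqrt 2 / 2 : ℝ) * Complex.I : ℂ) • (mono (n + 1) - mono (-(n + 1)))

theorem reC_eq : reC = (1 / 2 : ℂ) • (mono 1 + mono (-1)) := by
  ext z
  have h := Complex.re_eq_add_conj (z : ℂ)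
  rw [reC_apply, h, conj_coe_circle]
  simp
  ring

theorem mono_mul_mono (k l : ℤ) : mono k * mono l = mono (k + l) := by
  ext z
  simp [zpow_add₀ (Circle.coe_ne_zero z)]

theorem mono_zero : mono 0 = 1 := by
  ext z
  simp

theorem star_mono (k : ℤ) : star (mono k) = mono (-k) := by
  ext z
  simp [conj_coe_circle]

theorem orthonormal_sinC : Orthonormal ℂ fun n : ℕ => cL2 arcMeasure (sinC n) := by
  rw [orthonormal_iff_ite]
  intro i j
  have h := orthonormal_iff_ite.1 orthonormal_mono
  simp only [sinC, map_smul, map_sub, inner_smul_left, inner_smul_right, inner_sub_left,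
    inner_sub_right, h]
  have e1 : ((i : ℤ) + 1 = j + 1) ↔ i = j := by omega
  have e2 : (-((i : ℤ) + 1) = -(j + 1)) ↔ i = j := by omega
  have e3 : ¬ ((i : ℤ) + 1 = -(j + 1)) := by omega
  have e4 : ¬ (-((i : ℤ) + 1) = (j + 1)) := by omega
  simp only [e1, e2, e3, e4, if_false]
  have h2 : ((Real.sqrt 2 : ℝ) : ℂ) * (Real.sqrt 2 : ℝ) = 2 := by
    rw [← Complex.ofReal_mul, Real.mul_self_sqrt (by norm_num)]
    norm_num
  have h3 : (starRingEnd ℂ) 2 = 2 := map_ofNat _ 2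
  split_ifs
  · simp [h3]
    linear_combination (-(1 / 2) * Complex.I ^ 2) * h2 - Complex.I_sq
  · simp

/-- The spectral transform of the free Jacobi matrix in `L²(m)`. -/
noncomputable def freeU : L2Seq →ₗᵢ[ℂ] Lp ℂ 2 arcMeasure :=
  (exists_isometry_of_orthonormal orthonormal_sinC).choose

theorem freeU_bas (n : ℕ) : freeU (bas n) = cL2 arcMeasure (sinC n) :=
  (exists_isometry_of_orthonormal orthonormal_sinC).choose_spec n

theorem reC_mul_sinC_zero : reC * sinC 0 = (1 / 2 : ℂ) • sinC 1 := by
  ext z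
  have hz := Circle.coe_ne_zero z
  simp only [reC_eq, sinC, ContinuousMap.mul_apply, ContinuousMap.smul_apply,
    ContinuousMap.add_apply, ContinuousMap.sub_apply, mono_apply, smul_eq_mul]
  norm_num
  field_simp
  ring

theorem reC_mul_sinC_succ (n : ℕ) :
    reC * sinC (n + 1) = (1 / 2 : ℂ) • sinC (n + 2) + (1 / 2 : ℂ) • sinC n := by
  rw [reC_eq, sinC, sinC, sinC, mul_smul_comm, smul_mul_assoc, mul_sub, add_mul, add_mul,
    mono_mul_mono, mono_mul_mono, mono_mul_mono, mono_mul_mono]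
  push_cast
  rw [show (1 : ℤ) + (n + 1 + 1) = n + 2 + 1 by ring, show (-1 : ℤ) + (n + 1 + 1) = n + 1 by ring,
    show (1 : ℤ) + -(n + 1 + 1) = -(n + 1) by ring,
    show (-1 : ℤ) + -(n + 1 + 1) = -(n + 2 + 1) by ring]
  module

theorem freeU_op (ψ : L2Seq) : freeU (freeJacobi.op ψ) = mulL2 arcMeasure reC (freeU ψ) := by
  have h : freeU.toContinuousLinearMap ∘L freeJacobi.op =
      mulL2 arcMeasure reC ∘L freeU.toContinuousLinearMap := by
    apply clm_ext_bas
    intro n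
    simp only [ContinuousLinearMap.comp_apply, LinearIsometry.coe_toContinuousLinearMap]
    have hb : ∀ k, ((freeJacobi.b k : ℝ) : ℂ) = 1 / 2 := fun k => by simp [freeJacobi]
    have hv : ∀ k, ((freeJacobi.v k : ℝ) : ℂ) = 0 := fun k => by simp [freeJacobi]
    rcases n with _ | n
    · rw [freeJacobi.op_bas_zero, hb, hv, zero_smul, add_zero, map_smul, freeU_bas, freeU_bas,
        mulL2_cL2, reC_mul_sinC_zero, map_smul]
    · rw [freeJacobi.op_bas_succ, hb, hb, hv, zero_smul, add_zero, map_add, map_smul, map_smul,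
        freeU_bas, freeU_bas, freeU_bas, mulL2_cL2, reC_mul_sinC_succ, map_add, map_smul, map_smul]
  exact DFunLike.congr_fun h ψ

/-- The adjoint of the free spectral transform. -/
noncomputable def freeS : Lp ℂ 2 arcMeasure →L[ℂ] L2Seq :=
  ContinuousLinearMap.adjoint freeU.toContinuousLinearMap

theorem inner_freeS (φ : L2Seq) (F : Lp ℂ 2 arcMeasure) :
    inner ℂ φ (freeS F) = inner ℂ (freeU φ) F :=
  ContinuousLinearMap.adjoint_inner_right _ _ _

theorem freeS_apply (F : Lp ℂ 2 arcMeasure) (n : ℕ) :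
    freeS F n = inner ℂ (cL2 arcMeasure (sinC n)) F := by
  rw [← inner_bas, inner_freeS, freeU_bas]

theorem norm_adjoint_isometry_le {H K : Type*} [NormedAddCommGroup H] [InnerProductSpace ℂ H]
    [CompleteSpace H] [NormedAddCommGroup K] [InnerProductSpace ℂ K] [CompleteSpace K]
    (V : H →ₗᵢ[ℂ] K) (F : K) :
    ‖ContinuousLinearMap.adjoint V.toContinuousLinearMap F‖ ≤ ‖F‖ := by
  refine (ContinuousLinearMap.le_of_opNorm_le (c := 1) _ ?_ F).trans_eq (one_mul _)
  rw [LinearIsometryEquiv.norm_map]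
  exact V.norm_toContinuousLinearMap_le

theorem norm_freeS_le (F : Lp ℂ 2 arcMeasure) : ‖freeS F‖ ≤ ‖F‖ := norm_adjoint_isometry_le _ F

theorem star_reC : star reC = reC := by
  ext z
  simp

theorem op_freeS (F : Lp ℂ 2 arcMeasure) :
    freeJacobi.op (freeS F) = freeS (mulL2 arcMeasure reC F) := by
  apply ext_inner_left ℂ
  intro φ
  have h1 := ContinuousLinearMap.adjoint_inner_left freeJacobi.op (freeS F) φ
  rw [freeJacobi.op_isSelfAdjoint.adjoint_eq] at h1
  rw [← h1, inner_freeS, inner_freeS, freeU_op, inner_mulL2_left, star_reC]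

theorem evolution_freeS (t : ℝ) (F : Lp ℂ 2 arcMeasure) :
    evolution freeJacobi.op t (freeS F) =
      freeS (mulL2 arcMeasure (NormedSpace.exp ((Complex.I * (t : ℂ)) • reC)) F) := by
  have h1 := (NormedSpace.exp_series_hasSum_exp' (𝕂 := ℂ)
    ((Complex.I * (t : ℂ)) • freeJacobi.op)).mapL (ContinuousLinearMap.apply ℂ L2Seq (freeS F))
  have h2 := (((NormedSpace.exp_series_hasSum_exp' (𝕂 := ℂ)
    ((Complex.I * (t : ℂ)) • reC)).mapL (mulL2CLM arcMeasure)).mapL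
    (ContinuousLinearMap.apply ℂ (Lp ℂ 2 arcMeasure) F)).mapL freeS
  refine h1.unique (hasSum_congr_fun h2 fun n => ?_)
  have h3 : ∀ n : ℕ, (freeJacobi.op ^ n) (freeS F) = freeS (mulL2 arcMeasure (reC ^ n) F) := by
    intro n
    induction n with
    | zero => rw [pow_zero, pow_zero, mulL2_one]; rfl
    | succ n ih =>
      rw [pow_succ', pow_succ', mulL2_mul, ← op_freeS, ← ih]
      rfl
  simp only [ContinuousLinearMap.apply_apply, map_smul, smul_pow, mulL2CLM_apply, h3]

end Free

/-! ### The relation between the two families of orthogonal polynomials -/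

section Geronimus
variable {J : JacobiParams} {σ : Measure Circle}

/-- The function `Re z^k` on the circle. -/
noncomputable def cosC (k : ℤ) : C(Circle, ℂ) := (1 / 2 : ℂ) • (mono k + mono (-k))

theorem reC_mul_cosC (k : ℤ) : (2 : ℂ) • (reC * cosC (k + 1)) - cosC k = cosC (k + 2) := by
  rw [reC_eq, cosC, cosC, cosC, mul_smul_comm, smul_mul_assoc, mul_add, add_mul, add_mul,
    mono_mul_mono, mono_mul_mono, mono_mul_mono, mono_mul_mono,
    show (1 : ℤ) + (k + 1) = k + 2 by ring, show (-1 : ℤ) + (k + 1) = k by ring,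
    show (1 : ℤ) + -(k + 1) = -k by ring, show (-1 : ℤ) + -(k + 1) = -(k + 2) by ring]
  module

/-- The vectors `T_k(J) e_0` for the Chebyshev polynomials `T_k`. -/
noncomputable def JacobiParams.cheb (J : JacobiParams) : ℕ → L2Seq
  | 0 => bas 0
  | 1 => J.op (bas 0)
  | n + 2 => (2 : ℂ) • J.op (J.cheb (n + 1)) - J.cheb n

theorem L2Seq_sub_apply (φ ψ : L2Seq) (n : ℕ) : (φ - ψ) n = φ n - ψ n := rfl

theorem JacobiParams.cheb_spec (J : JacobiParams) (k : ℕ) :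
    (∀ i, k < i → J.cheb k i = 0) ∧ ∃ r : ℝ, 0 < r ∧ J.cheb k k = r := by
  have key : ∀ k, ((∀ i, k < i → J.cheb k i = 0) ∧ ∃ r : ℝ, 0 < r ∧ J.cheb k k = r) ∧
      ((∀ i, k + 1 < i → J.cheb (k + 1) i = 0) ∧
        ∃ r : ℝ, 0 < r ∧ J.cheb (k + 1) (k + 1) = r) := by
    intro k
    induction k with
    | zero =>
      refine ⟨⟨fun i hi => ?_, 1, one_pos, ?_⟩, fun i hi => ?_, J.b 0, J.b_pos 0, ?_⟩
      · rw [JacobiParams.cheb, bas_apply, if_neg (by omega)]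
      · rw [JacobiParams.cheb, bas_apply, if_pos rfl, Complex.ofReal_one]
      · obtain ⟨j, rfl⟩ : ∃ j, i = j + 2 := ⟨i - 2, by omega⟩
        rw [JacobiParams.cheb, J.op_apply_succ]
        simp [bas_apply]
      · rw [JacobiParams.cheb, J.op_apply_succ]
        simp [bas_apply]
    | succ k ih =>
      obtain ⟨⟨h1, -⟩, h2, r, hr, h3⟩ := ih
      refine ⟨⟨h2, r, hr, h3⟩, fun i hi => ?_, 2 * (J.b (k + 1) * r), ?_, ?_⟩
      · obtain ⟨j, rfl⟩ : ∃ j, i = j + 1 := ⟨i - 1, by omega⟩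
        rw [show k + 1 + 1 = k + 2 from rfl, JacobiParams.cheb, L2Seq_sub_apply, L2Seq_smul_apply,
          J.op_apply_succ, h2 _ (by omega), h2 _ (by omega), h2 _ (by omega), h1 _ (by omega)]
        simp
      · have := J.b_pos (k + 1)
        positivity
      · rw [show k + 1 + 1 = k + 2 from rfl, JacobiParams.cheb, L2Seq_sub_apply, L2Seq_smul_apply,
          J.op_apply_succ, h2 _ (by omega), h2 _ (by omega), h1 _ (by omega), h3]
        push_cast
        ring
  exact (key k).1

/-- Trigonometric polynomials of degree at most `n`. -/
noncomputable def trigSpan (n : ℕ) : Submodule ℂ C(Circle, ℂ) :=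
  Submodule.span ℂ (mono '' {k : ℤ | k.natAbs ≤ n})

theorem mono_mem_trigSpan {k : ℤ} {n : ℕ} (h : k.natAbs ≤ n) : mono k ∈ trigSpan n :=
  Submodule.subset_span ⟨k, h, rfl⟩

theorem trigSpan_mono {m n : ℕ} (h : m ≤ n) : trigSpan m ≤ trigSpan n :=
  Submodule.span_mono (Set.image_mono fun _ hk => le_trans hk h)

theorem reC_mul_mem_trigSpan {n : ℕ} {f : C(Circle, ℂ)} (hf : f ∈ trigSpan n) :
    reC * f ∈ trigSpan (n + 1) := by
  induction hf using Submodule.span_induction with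
  | mem x hx =>
    obtain ⟨k, hk, rfl⟩ := hx
    have hk' : k.natAbs ≤ n := hk
    rw [reC_eq, smul_mul_assoc, add_mul, mono_mul_mono, mono_mul_mono]
    exact Submodule.smul_mem _ _ (Submodule.add_mem _ (mono_mem_trigSpan (by omega))
      (mono_mem_trigSpan (by omega)))
  | zero => rw [mul_zero]; exact Submodule.zero_mem _
  | add x y _ _ hx hy => rw [mul_add]; exact Submodule.add_mem _ hx hy
  | smul c x _ hx => rw [mul_smul_comm]; exact Submodule.smul_mem _ _ hx

theorem star_mem_trigSpan {n : ℕ} {f : C(Circle, ℂ)} (hf : f ∈ trigSpan n) :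
    star f ∈ trigSpan n := by
  induction hf using Submodule.span_induction with
  | mem x hx =>
    obtain ⟨k, hk, rfl⟩ := hx
    have hk' : k.natAbs ≤ n := hk
    rw [star_mono]
    exact mono_mem_trigSpan (by omega)
  | zero => rw [star_zero]; exact Submodule.zero_mem _
  | add x y _ _ hx hy => rw [star_add]; exact Submodule.add_mem _ hx hy
  | smul c x _ hx => rw [star_smul]; exact Submodule.smul_mem _ _ hx

theorem JacobiParams.polyRe_mem_trigSpan (J : JacobiParams) (n : ℕ) :
    polyRe (J.poly n) ∈ trigSpan n := by
  have h0 : polyRe (J.poly 0) ∈ trigSpan 0 := by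
    rw [J.polyRe_zero, ← mono_zero]
    exact mono_mem_trigSpan (by simp)
  have hb : ∀ n, (J.b n : ℂ) ≠ 0 := fun n => by exact_mod_cast (J.b_pos n).ne'
  have key : ∀ n, polyRe (J.poly n) ∈ trigSpan n ∧
      polyRe (J.poly (n + 1)) ∈ trigSpan (n + 1) := by
    intro n
    induction n with
    | zero =>
      refine ⟨h0, ?_⟩
      have h1 := J.reC_mul_zero
      have h2 : polyRe (J.poly 1) =
          (J.b 0 : ℂ)⁻¹ • (reC * polyRe (J.poly 0) - (J.v 0 : ℂ) • polyRe (J.poly 0)) := by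
        rw [h1, add_sub_cancel_right, smul_smul, inv_mul_cancel₀ (hb 0), one_smul]
      rw [zero_add, h2]
      exact Submodule.smul_mem _ _ (Submodule.sub_mem _ (reC_mul_mem_trigSpan h0)
        (Submodule.smul_mem _ _ (trigSpan_mono (by omega) h0)))
    | succ n ih =>
      refine ⟨ih.2, ?_⟩
      have h1 := J.reC_mul_succ n
      have h2 : polyRe (J.poly (n + 2)) =
          (J.b (n + 1) : ℂ)⁻¹ • (reC * polyRe (J.poly (n + 1)) -
            (J.v (n + 1) : ℂ) • polyRe (J.poly (n + 1)) - (J.b n : ℂ) • polyRe (J.poly n)) := by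
        rw [h1, add_sub_right_comm, add_sub_cancel_right, add_sub_cancel_right, smul_smul,
          inv_mul_cancel₀ (hb _), one_smul]
      rw [show n + 1 + 1 = n + 2 from rfl, h2]
      exact Submodule.smul_mem _ _ (Submodule.sub_mem _ (Submodule.sub_mem _
        (reC_mul_mem_trigSpan ih.2)
        (Submodule.smul_mem _ _ (trigSpan_mono (by omega) ih.2)))
        (Submodule.smul_mem _ _ (trigSpan_mono (by omega) ih.1)))
  exact (key n).1

/-- The function `z^{-n} φ_{2n}^*`. -/
noncomputable def halfStar (σ : Measure Circle) (n : ℕ) : C(Circle, ℂ) :=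
  mono (-n) * phiStarC σ (2 * n)

theorem star_halfStar (n : ℕ) :
    star (halfStar σ n) = mono (-n) * polyC (orthonormalOP σ (2 * n)) := by
  ext z
  have hz := Circle.coe_ne_zero z
  simp only [halfStar, ContinuousMap.star_apply, ContinuousMap.mul_apply, mono_apply,
    phiStarC_apply, phiStar, Complex.star_def, map_mul, map_pow, map_zpow₀, conj_coe_circle,
    Complex.conj_conj, polyC_apply]
  rw [← mul_assoc]
  congr 1
  rw [← zpow_natCast, inv_zpow, inv_zpow, ← zpow_neg, ← zpow_neg, ← zpow_add₀ hz]
  congr 1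
  push_cast
  ring

theorem star_halfStar_mem (hσ : NonDegenerate σ) (n : ℕ) :
    star (halfStar σ n) ∈ trigSpan n := by
  have hdeg : (orthonormalOP σ (2 * n)).natDegree = 2 * n :=
    Polynomial.natDegree_eq_of_degree_eq_some (degree_orthonormalOP hσ _)
  rw [star_halfStar, polyC_eq_sum, hdeg, Finset.mul_sum]
  refine Submodule.sum_mem _ fun k hk => ?_
  rw [mul_smul_comm, mono_mul_mono]
  have := Finset.mem_range.1 hk
  exact Submodule.smul_mem _ _ (mono_mem_trigSpan (by omega))

variable [IsFiniteMeasure σ] {U : L2Seq →ₗᵢ[ℂ] Lp ℂ 2 σ}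

theorem IsTransform.map_cheb (hU : IsTransform J σ U) (k : ℕ) :
    U (J.cheb k) = cL2 σ (cosC k) := by
  have h1 : cL2 σ (polyRe (J.poly 0)) = cL2 σ (cosC 0) := by
    rw [J.polyRe_zero, cosC, neg_zero, mono_zero]
    congr 1
    module
  have key : ∀ k : ℕ, U (J.cheb k) = cL2 σ (cosC k) ∧
      U (J.cheb (k + 1)) = cL2 σ (cosC (k + 1 : ℕ)) := by
    intro k
    induction k with
    | zero =>
      refine ⟨by rw [JacobiParams.cheb, hU, h1]; rfl, ?_⟩
      rw [JacobiParams.cheb, hU.op_apply, hU, mulL2_cL2, J.polyRe_zero, mul_one, reC_eq]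
      rfl
    | succ k ih =>
      refine ⟨ih.2, ?_⟩
      rw [show k + 1 + 1 = k + 2 from rfl, JacobiParams.cheb, map_sub, map_smul, hU.op_apply, ih.1,
        ih.2, mulL2_cL2, ← map_smul, ← map_sub]
      congr 1
      have := reC_mul_cosC k
      push_cast
      exact this
  exact (key k).1

theorem inner_mono_neg_polyRe (hev : σ.map (fun z => z⁻¹) = σ) (k : ℤ) (p : Polynomial ℝ) :
    inner ℂ (cL2 σ (mono (-k))) (cL2 σ (polyRe p)) =
      inner ℂ (cL2 σ (mono k)) (cL2 σ (polyRe p)) := by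
  rw [inner_cL2, inner_cL2]
  have hinv : Measurable fun z : Circle => z⁻¹ := continuous_inv.measurable
  have hc : Continuous fun z : Circle => polyRe p z * (starRingEnd ℂ) (mono k z) :=
    (polyRe p).continuous.mul (Complex.continuous_conj.comp (mono k).continuous)
  have h1 := integral_map (μ := σ) hinv.aemeasurable
    (f := fun z : Circle => polyRe p z * (starRingEnd ℂ) (mono k z)) hc.aestronglyMeasurable
  rw [hev] at h1
  rw [h1]
  congr 1
  ext z
  have h2 : ((z⁻¹ : Circle) : ℂ).re = (z : ℂ).re := by
    rw [Circle.coe_inv_eq_conj, Complex.conj_re]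
  rw [polyRe_apply, polyRe_apply, h2, mono_apply, mono_apply, Circle.coe_inv, inv_zpow, zpow_neg]

theorem IsTransform.inner_mono (hU : IsTransform J σ U) (hev : σ.map (fun z => z⁻¹) = σ)
    (k n : ℕ) : inner ℂ (cL2 σ (mono k)) (cL2 σ (polyRe (J.poly n))) =
      (starRingEnd ℂ) (J.cheb k n) := by
  have h1 : inner ℂ (cL2 σ (cosC k)) (cL2 σ (polyRe (J.poly n))) =
      (starRingEnd ℂ) (J.cheb k n) := by
    rw [← hU.map_cheb, ← hU n, U.inner_map_map, ← inner_bas n, inner_conj_symm]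
  rw [← h1, cosC, map_smul, map_add, inner_smul_left, inner_add_left, inner_mono_neg_polyRe hev]
  have h2 : (starRingEnd ℂ) 2 = 2 := map_ofNat _ 2
  simp [h2]
  ring

/-- A trigonometric polynomial orthogonal to the monomials that span it vanishes. -/
theorem cL2_eq_zero_of_trigSpan {n : ℕ} {f : C(Circle, ℂ)} (hf : f ∈ trigSpan n)
    (h : ∀ k : ℤ, k.natAbs ≤ n → inner ℂ (cL2 σ (mono k)) (cL2 σ f) = 0) : cL2 σ f = 0 := by
  have key : ∀ g ∈ trigSpan n, inner ℂ (cL2 σ g) (cL2 σ f) = 0 := by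
    intro g hg
    induction hg using Submodule.span_induction with
    | mem x hx =>
      obtain ⟨k, hk, rfl⟩ := hx
      exact h k hk
    | zero => rw [map_zero, inner_zero_left]
    | add x y _ _ hx hy => rw [map_add, inner_add_left, hx, hy, add_zero]
    | smul c x _ hx => rw [map_smul, inner_smul_left, hx, mul_zero]
  exact inner_self_eq_zero.1 (key f hf)

theorem inner_mono_halfStar (hσ : NonDegenerate σ) {n : ℕ} {k : ℤ} (hk : k.natAbs ≤ n) :
    inner ℂ (cL2 σ (mono k)) (cL2 σ (halfStar σ n)) =
      if k = -n then (((lam σ (2 * n))⁻¹ : ℝ) : ℂ) else 0 := by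
  have h1 : inner ℂ (cL2 σ (mono k)) (cL2 σ (halfStar σ n)) =
      inner ℂ (cL2 σ (mono ((k + n).toNat : ℤ))) (starVec σ 0 (2 * n)) := by
    rw [starVec, inner_cL2, inner_cL2]
    congr 1
    ext z
    have hz := Circle.coe_ne_zero z
    have h2 : ((k + n).toNat : ℤ) = k + n := Int.toNat_of_nonneg (by omega)
    simp only [halfStar, ContinuousMap.mul_apply, mono_apply, map_zpow₀, conj_coe_circle, h2,
      zpow_zero, one_mul, inv_zpow]
    rw [← zpow_neg, ← zpow_neg, neg_add, zpow_add₀ hz]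
    ring
  rw [h1]
  split_ifs with h
  · subst h
    rw [neg_add_cancel]
    exact inner_one_starVec hσ _
  · exact inner_mono_starVec_eq_zero hσ (by omega) (by omega)

theorem inner_mono_star_halfStar (hσ : NonDegenerate σ) {n : ℕ} {k : ℤ} (hk : k.natAbs ≤ n) :
    inner ℂ (cL2 σ (mono k)) (cL2 σ (star (halfStar σ n))) =
      if k = n then (((lam σ (2 * n))⁻¹ : ℝ) : ℂ) else 0 := by
  have h1 : inner ℂ (cL2 σ (mono k)) (cL2 σ (star (halfStar σ n))) =
      polyInner σ (orthonormalOP σ (2 * n)) (Polynomial.X ^ (k + n).toNat) := by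
    rw [star_halfStar, polyInner_eq_inner, polyC_X_pow, inner_cL2, inner_cL2]
    congr 1
    ext z
    have hz := Circle.coe_ne_zero z
    have h2 : ((k + n).toNat : ℤ) = k + n := Int.toNat_of_nonneg (by omega)
    simp only [ContinuousMap.mul_apply, mono_apply, map_zpow₀, conj_coe_circle, h2, inv_zpow]
    rw [← zpow_neg, ← zpow_neg, neg_add, zpow_add₀ hz]
    ring
  have hdeg : (Polynomial.X ^ (k + n).toNat : Polynomial ℂ).degree ≤ (2 * n : ℕ) := by
    rw [Polynomial.degree_X_pow]
    exact_mod_cast (by omega : (k + n).toNat ≤ 2 * n)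
  rw [h1, polyInner_orthonormalOP_of_degree_le hσ hdeg, Polynomial.coeff_X_pow]
  by_cases h : k = n
  · subst h
    rw [if_pos (by omega), if_pos rfl]
    simp
  · rw [if_neg (by omega), if_neg h]
    simp

/-- Geronimus' relation `z^n p_n(Re z) = c_n (φ_{2n} + φ_{2n}^*)`. -/
theorem IsTransform.exists_geronimus [IsProbabilityMeasure σ] (hU : IsTransform J σ U)
    (hev : σ.map (fun z => z⁻¹) = σ) (hσ : NonDegenerate σ) :
    ∃ c : ℕ → ℝ, (∀ n, 0 < c n) ∧ ∀ n, cL2 σ (polyRe (J.poly n)) =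
      (c n : ℂ) • cL2 σ (halfStar σ n) + (c n : ℂ) • cL2 σ (star (halfStar σ n)) := by
  have key : ∀ n, ∃ c : ℝ, 0 < c ∧ cL2 σ (polyRe (J.poly n)) =
      (c : ℂ) • cL2 σ (halfStar σ n) + (c : ℂ) • cL2 σ (star (halfStar σ n)) := by
    intro n
    have hlam := lam_pos hσ (2 * n)
    have hlamc : (lam σ (2 * n) : ℂ) ≠ 0 := by exact_mod_cast hlam.ne'
    obtain ⟨h1, r, hr, h2⟩ := J.cheb_spec n
    -- For `n = 0` both terms on the right are constants, hence the factor `1 / 2`.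
    set c : ℝ := if n = 0 then r * lam σ (2 * n) / 2 else r * lam σ (2 * n) with hc
    have hc0 : 0 < c := by
      rw [hc]
      split_ifs <;> positivity
    refine ⟨c, hc0, ?_⟩
    rw [← map_smul, ← map_smul, ← map_add, ← sub_eq_zero, ← map_sub]
    have hmem := star_halfStar_mem hσ n
    have hmem2 : halfStar σ n ∈ trigSpan n := by
      have := star_mem_trigSpan hmem
      rwa [star_star] at this
    -- Both sides have the same moments `⟨z^k, ·⟩` for `|k| ≤ n`, which determine them.
    refine cL2_eq_zero_of_trigSpan (n := n) (Submodule.sub_mem _ (J.polyRe_mem_trigSpan n)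
      (Submodule.add_mem _ (Submodule.smul_mem _ _ hmem2) (Submodule.smul_mem _ _ hmem))) ?_
    intro k hk
    have h3 : inner ℂ (cL2 σ (mono k)) (cL2 σ (polyRe (J.poly n))) =
        (starRingEnd ℂ) (J.cheb k.natAbs n) := by
      rw [← hU.inner_mono hev]
      rcases Int.natAbs_eq k with h4 | h4
      · rw [← h4]
      · conv_lhs => rw [h4]
        exact inner_mono_neg_polyRe hev _ _
    rw [map_sub, map_add, map_smul, map_smul, inner_sub_right, inner_add_right, inner_smul_right,
      inner_smul_right, h3, inner_mono_halfStar hσ hk, inner_mono_star_halfStar hσ hk]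
    by_cases hkn : k.natAbs = n
    · rw [hkn, h2, Complex.conj_ofReal]
      by_cases hn : n = 0
      · subst hn
        have hk0 : k = 0 := by omega
        subst hk0
        rw [mul_zero] at hlamc
        simp [hc]
        field_simp
        ring
      · have hc' : c = r * lam σ (2 * n) := by rw [hc, if_neg hn]
        rw [hc']
        rcases Int.natAbs_eq k with h4 | h4
        · rw [if_neg (by omega), if_pos (by omega)]
          push_cast
          field_simp
          ring
        · rw [if_pos (by omega), if_neg (by omega)]
          push_cast
          field_simp
          ring
    · rw [JacobiParams.cheb_spec J k.natAbs |>.1 n (by omega), if_neg (by omega),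
        if_neg (by omega)]
      simp
  choose c hc1 hc2 using key
  exact ⟨c, hc1, hc2⟩

end Geronimus

/-! ### The half-step orthonormal system -/

section HalfStep
variable {J : JacobiParams} {σ : Measure Circle} [IsProbabilityMeasure σ]

theorem halfStar_eq_starVec (n : ℕ) : cL2 σ (halfStar σ n) = starVec σ (-n) (2 * n) := rfl

/-- The vectors `z^k φ_N^*` and `z^l φ_n^*` are orthogonal as soon as `0 < l - k ≤ N - n`. -/
theorem inner_starVec_eq_zero_of_lt (hσ : NonDegenerate σ) {k l : ℤ} {n N : ℕ} (hkl : k < l)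
    (h : n + (l - k) ≤ N) : inner ℂ (starVec σ k N) (starVec σ l n) = 0 := by
  have h1 := inner_starVec_eq_zero hσ (l := (l - k).toNat) (n := n) (N := N) (by omega) (by omega)
  rw [inner_starVec, Int.toNat_of_nonneg (by omega), sub_zero] at h1
  rw [inner_starVec, h1]

theorem norm_starVec_sub_sq_le' (hσ : NonDegenerate σ) (l : ℤ) {a b n N : ℕ}
    (ha : a ≤ n) (hn : n ≤ N) (hb : N ≤ b) :
    ‖starVec σ l N - starVec σ l n‖ ^ 2 ≤ 2 * (lam σ b - lam σ a) := by
  rw [starVec_shift_norm]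
  exact norm_starVec_sub_sq_le hσ ha hn hb

theorem orthonormal_halfStar (hσ : NonDegenerate σ) :
    Orthonormal ℂ fun n : ℕ => cL2 σ (halfStar σ n) := by
  refine ⟨fun n => ?_, fun i j hij => ?_⟩
  · change ‖cL2 σ (halfStar σ n)‖ = 1
    rw [halfStar_eq_starVec, norm_starVec hσ]
  change inner ℂ (cL2 σ (halfStar σ i)) (cL2 σ (halfStar σ j)) = 0
  rw [halfStar_eq_starVec, halfStar_eq_starVec]
  rcases lt_or_gt_of_ne hij with h | h
  · rw [inner_eq_zero_symm]
    exact inner_starVec_eq_zero_of_lt hσ (by omega) (by push_cast; omega)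
  · exact inner_starVec_eq_zero_of_lt hσ (by omega) (by push_cast; omega)

theorem inner_star (f g : C(Circle, ℂ)) :
    inner ℂ (cL2 σ (star f)) (cL2 σ (star g)) = (starRingEnd ℂ) (inner ℂ (cL2 σ f) (cL2 σ g)) := by
  rw [inner_cL2, inner_cL2, ← integral_conj]
  congr 1
  ext z
  simp

theorem orthonormal_star_halfStar (hσ : NonDegenerate σ) :
    Orthonormal ℂ fun n : ℕ => cL2 σ (star (halfStar σ n)) := by
  have h := orthonormal_iff_ite.1 (orthonormal_halfStar hσ)
  rw [orthonormal_iff_ite]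
  intro i j
  rw [inner_star, h]
  split_ifs <;> simp

/-- The reversed polynomial `φ_{N-1}^*` has degree below `N`, so the overlap of `φ_N^*` with `φ_N`
is controlled by `φ_N^* - φ_{N-1}^*`. -/
theorem norm_inner_star_halfStar_le (hσ : NonDegenerate σ) {n : ℕ} (hn : 1 ≤ n) :
    ‖inner ℂ (cL2 σ (star (halfStar σ n))) (cL2 σ (halfStar σ n))‖ ≤
      ‖starVec σ 0 (2 * n) - starVec σ 0 (2 * n - 1)‖ := by
  set φ := cL2 σ (polyC (orthonormalOP σ (2 * n))) with hφ
  have h1 : inner ℂ (cL2 σ (star (halfStar σ n))) (cL2 σ (halfStar σ n)) =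
      inner ℂ φ (starVec σ 0 (2 * n)) := by
    rw [star_halfStar, hφ, starVec, inner_cL2, inner_cL2]
    congr 1
    ext z
    have hz := Circle.coe_ne_zero z
    have h0 : (z : ℂ) ^ (-n : ℤ) * (z : ℂ) ^ (n : ℤ) = 1 := by
      rw [← zpow_add₀ hz, neg_add_cancel, zpow_zero]
    simp only [halfStar, ContinuousMap.mul_apply, mono_apply, map_mul, map_zpow₀, conj_coe_circle,
      zpow_zero, inv_zpow', neg_neg]
    linear_combination (phiStarC σ (2 * n) z *
      (starRingEnd ℂ) (polyC (orthonormalOP σ (2 * n)) z)) * h0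
  have h2 : inner ℂ φ (starVec σ 0 (2 * n - 1)) = 0 := by
    have h3 : starVec σ 0 (2 * n - 1) =
        ∑ k ∈ Finset.range (2 * n), (starRingEnd ℂ) ((orthonormalOP σ (2 * n - 1)).coeff k) •
          cL2 σ (polyC (Polynomial.X ^ (2 * n - 1 - k))) := by
      have hdeg : (orthonormalOP σ (2 * n - 1)).natDegree + 1 = 2 * n := by
        rw [Polynomial.natDegree_eq_of_degree_eq_some (degree_orthonormalOP hσ _)]
        omega
      have h4 := star_phiStarC (σ := σ) (2 * n - 1)
      have h5 : phiStarC σ (2 * n - 1) = star (∑ k ∈ Finset.range (2 * n),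
          (orthonormalOP σ (2 * n - 1)).coeff k • mono ((k : ℤ) - (2 * n - 1 : ℕ))) := by
        rw [hdeg] at h4
        rw [← h4, star_star]
      rw [starVec, mono_zero, one_mul, h5, star_sum, map_sum]
      refine Finset.sum_congr rfl fun k hk => ?_
      have := Finset.mem_range.1 hk
      rw [star_smul, star_mono, map_smul, polyC_X_pow, neg_sub, ← Nat.cast_sub (by omega)]
      rfl
    rw [h3, inner_sum]
    refine Finset.sum_eq_zero fun k hk => ?_
    rw [inner_smul_right, inner_eq_zero_symm.1, mul_zero]
    rw [hφ, ← polyInner_eq_inner]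
    apply polyInner_orthonormalOP_of_degree_lt hσ
    rw [Polynomial.degree_X_pow]
    exact_mod_cast (by omega : 2 * n - 1 - k < 2 * n)
  have h6 : inner ℂ φ (starVec σ 0 (2 * n)) =
      inner ℂ φ (starVec σ 0 (2 * n) - starVec σ 0 (2 * n - 1)) := by
    rw [inner_sub_right, h2, sub_zero]
  rw [h1, h6]
  refine (norm_inner_le_norm _ _).trans ?_
  rw [hφ, norm_orthonormalOP hσ, one_mul]

theorem tendsto_inner_star_halfStar (hσ : NonDegenerate σ) {Ψ : Lp ℂ 2 σ}
    (hΨ : Tendsto (starVec σ 0) atTop (𝓝 Ψ)) :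
    Tendsto (fun n => inner ℂ (cL2 σ (star (halfStar σ n))) (cL2 σ (halfStar σ n))) atTop
      (𝓝 0) := by
  have h1 : Tendsto (fun n : ℕ => 2 * n) atTop atTop :=
    tendsto_id.const_mul_atTop' (by norm_num)
  have h2 : Tendsto (fun n : ℕ => 2 * n - 1) atTop atTop :=
    (tendsto_sub_atTop_nat 1).comp h1
  have h3 := ((hΨ.comp h1).sub (hΨ.comp h2)).norm
  rw [sub_self, norm_zero] at h3
  refine squeeze_zero_norm' ?_ h3
  filter_upwards [eventually_ge_atTop 1] with n hn
  exact norm_inner_star_halfStar_le hσ hn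

/-- The constants in Geronimus' relation tend to `1/√2`. -/
theorem tendsto_geronimus_const {U : L2Seq →ₗᵢ[ℂ] Lp ℂ 2 σ} (hU : IsTransform J σ U)
    (hσ : NonDegenerate σ) {Ψ : Lp ℂ 2 σ} (hΨ : Tendsto (starVec σ 0) atTop (𝓝 Ψ))
    {c : ℕ → ℝ} (hc : ∀ n, 0 < c n) (h : ∀ n, cL2 σ (polyRe (J.poly n)) =
      (c n : ℂ) • cL2 σ (halfStar σ n) + (c n : ℂ) • cL2 σ (star (halfStar σ n))) :
    Tendsto c atTop (𝓝 (Real.sqrt 2)⁻¹) := by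
  set γ : ℕ → ℂ := fun n => inner ℂ (cL2 σ (star (halfStar σ n))) (cL2 σ (halfStar σ n)) with hγ
  have h1 : ∀ n, c n ^ 2 * (2 + 2 * (γ n).re) = 1 := by
    intro n
    have h2 : ‖cL2 σ (polyRe (J.poly n))‖ = 1 := by
      rw [← hU n, U.norm_map, bas, lp.norm_single (by norm_num), norm_one]
    have h3 : ‖cL2 σ (star (halfStar σ n)) + cL2 σ (halfStar σ n)‖ ^ 2 = 2 + 2 * (γ n).re := by
      rw [@norm_add_sq ℂ, (orthonormal_halfStar hσ).1, (orthonormal_star_halfStar hσ).1]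
      simp only [hγ, RCLike.re_to_complex]
      ring
    rw [h, ← smul_add, add_comm, norm_smul, Complex.norm_real, Real.norm_of_nonneg (hc n).le] at h2
    rw [← h3, ← mul_pow, h2, one_pow]
  have h4 : Tendsto (fun n => (Real.sqrt (2 + 2 * (γ n).re))⁻¹) atTop (𝓝 (Real.sqrt 2)⁻¹) := by
    have h5 : Tendsto (fun n => (γ n).re) atTop (𝓝 0) := by
      have := (Complex.continuous_re.tendsto 0).comp (tendsto_inner_star_halfStar hσ hΨ)
      rwa [Complex.zero_re] at this
    have h6 : Tendsto (fun n => 2 + 2 * (γ n).re) atTop (𝓝 2) := by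
      simpa using (h5.const_mul 2).const_add 2
    exact ((Real.continuous_sqrt.tendsto 2).comp h6).inv₀ (by positivity)
  refine h4.congr fun n => ?_
  have h7 : 0 < 2 + 2 * (γ n).re := by
    have := h1 n
    by_contra h8
    have := mul_nonpos_of_nonneg_of_nonpos (sq_nonneg (c n)) (not_lt.1 h8)
    linarith
  have h9 : c n * Real.sqrt (2 + 2 * (γ n).re) = 1 := by
    refine (pow_left_inj₀ (by have := hc n; positivity) zero_le_one two_ne_zero).1 ?_
    rw [mul_pow, Real.sq_sqrt h7.le, h1, one_pow]
  exact (eq_inv_of_mul_eq_one_left h9).symm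

/-- The isometry `e_n ↦ z^{-n} φ_{2n}^*`. -/
theorem exists_halfTransform (hσ : NonDegenerate σ) :
    ∃ W : L2Seq →ₗᵢ[ℂ] Lp ℂ 2 σ, ∀ n, W (bas n) = cL2 σ (halfStar σ n) :=
  exists_isometry_of_orthonormal (orthonormal_halfStar hσ)

theorem star_cL2 (f : C(Circle, ℂ)) : star (cL2 σ f) = cL2 σ (star f) := by
  apply Lp.ext
  filter_upwards [Lp.coeFn_star (cL2 σ f), coeFn_cL2 σ f, coeFn_cL2 σ (star f)] with z h1 h2 h3
  rw [h1, h3, Pi.star_apply, h2]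
  rfl

/-- Complex conjugation on `L²(μ)`. -/
noncomputable def conjL2 (μ : Measure Circle) : Lp ℂ 2 μ →ₗᵢ⋆[ℂ] Lp ℂ 2 μ where
  toFun := star
  map_add' F G := by
    apply Lp.ext
    filter_upwards [Lp.coeFn_star (F + G), Lp.coeFn_star F, Lp.coeFn_star G, Lp.coeFn_add F G,
      Lp.coeFn_add (star F) (star G)] with z h1 h2 h3 h4 h5
    rw [h1, h5, Pi.star_apply, h4, Pi.add_apply, Pi.add_apply, h2, h3, star_add]
    rfl
  map_smul' c F := by
    apply Lp.ext
    filter_upwards [Lp.coeFn_star (c • F), Lp.coeFn_star F, Lp.coeFn_smul c F,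
      Lp.coeFn_smul ((starRingEnd ℂ) c) (star F)] with z h1 h2 h3 h4
    rw [h1, h4, Pi.star_apply, h3, Pi.smul_apply, Pi.smul_apply, h2, Pi.star_apply, star_smul]
    rfl
  norm_map' F := by
    have h : ∀ᵐ z ∂μ, ‖star F z‖ = ‖F z‖ := by
      filter_upwards [Lp.coeFn_star F] with z h1
      rw [h1, Pi.star_apply, norm_star]
    exact le_antisymm (Lp.norm_le_norm_of_ae_le (h.mono fun _ hz => hz.le))
      (Lp.norm_le_norm_of_ae_le (h.mono fun _ hz => hz.ge))

/-- The complex conjugate `ψ ↦ conj (W (conj ψ))` of an isometry into `L²(σ)`. -/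
noncomputable def conjIsometry (W : L2Seq →ₗᵢ[ℂ] Lp ℂ 2 σ) : L2Seq →ₗᵢ[ℂ] Lp ℂ 2 σ where
  toFun ψ := conjL2 σ (W (star ψ))
  map_add' φ ψ := by rw [star_add, map_add, map_add]
  map_smul' c ψ := by
    rw [star_smul, map_smul, map_smulₛₗ, RingHom.id_apply]
    simp
  norm_map' ψ := by
    change ‖conjL2 σ (W (star ψ))‖ = ‖ψ‖
    rw [(conjL2 σ).norm_map, W.norm_map, norm_star]

theorem conjIsometry_apply {σ : Measure Circle} (W : L2Seq →ₗᵢ[ℂ] Lp ℂ 2 σ) (ψ : L2Seq) :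
    conjIsometry W ψ = star (W (star ψ)) := rfl

theorem star_bas (n : ℕ) : star (bas n) = bas n := by
  ext k
  rw [lp.star_apply, bas_apply]
  split_ifs <;> simp

/-- The transform `U` is a sum of two conjugate isometries composed with a diagonal operator whose
entries tend to `1/√2`. -/
theorem IsTransform.exists_decomposition {U : L2Seq →ₗᵢ[ℂ] Lp ℂ 2 σ} (hU : IsTransform J σ U)
    (hev : σ.map (fun z => z⁻¹) = σ) (hσ : NonDegenerate σ) {Ψ : Lp ℂ 2 σ}
    (hΨ : Tendsto (starVec σ 0) atTop (𝓝 Ψ)) {W : L2Seq →ₗᵢ[ℂ] Lp ℂ 2 σ}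
    (hW : ∀ n, W (bas n) = cL2 σ (halfStar σ n)) :
    ∃ (c : ℕ → ℝ) (hc : ∃ C, ∀ n, |c n| ≤ C), Tendsto c atTop (𝓝 (Real.sqrt 2)⁻¹) ∧
      ∀ ψ, U ψ = W (diagOp c hc ψ) + conjIsometry W (diagOp c hc ψ) := by
  obtain ⟨c, hc0, hg⟩ := hU.exists_geronimus hev hσ
  have ht := tendsto_geronimus_const hU hσ hΨ hc0 hg
  obtain ⟨C, hC⟩ := ht.bddAbove_range
  have hb : ∃ C, ∀ n, |c n| ≤ C :=
    ⟨C, fun n => by rw [abs_of_pos (hc0 n)]; exact hC ⟨n, rfl⟩⟩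
  refine ⟨c, hb, ht, ?_⟩
  have h : U.toContinuousLinearMap = W.toContinuousLinearMap ∘L diagOp c hb +
      (conjIsometry W).toContinuousLinearMap ∘L diagOp c hb := by
    apply clm_ext_bas
    intro n
    have h1 : diagOp c hb (bas n) = (c n : ℂ) • bas n := by
      ext k
      rw [diagOp_apply, L2Seq_smul_apply, bas_apply]
      split_ifs with hk
      · rw [hk]
      · simp
    simp only [add_apply, ContinuousLinearMap.comp_apply,
      LinearIsometry.coe_toContinuousLinearMap, h1, map_smul]
    rw [conjIsometry_apply, star_bas, hU, hW, star_cL2, hg]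
  exact fun ψ => DFunLike.congr_fun h ψ

end HalfStep

/-- A diagonal operator with convergent entries acts asymptotically as a scalar on bounded, weakly
null families. -/
theorem tendsto_diagOp_sub {ι : Type*} {l : Filter ι} {a : ι → L2Seq} {B : ℝ}
    (hB : ∀ i, ‖a i‖ ≤ B) (ha : ∀ n, Tendsto (fun i => a i n) l (𝓝 0)) {c : ℕ → ℝ}
    (hc : ∃ C, ∀ n, |c n| ≤ C) {r : ℝ} (hr : Tendsto c atTop (𝓝 r)) :
    Tendsto (fun i => diagOp c hc (a i) - (r : ℂ) • a i) l (𝓝 0) := by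
  obtain ⟨C, hC⟩ := id hc
  have hsq : ∀ i, ‖diagOp c hc (a i) - (r : ℂ) • a i‖ ^ 2 = ∑' n, (c n - r) ^ 2 * ‖a i n‖ ^ 2 := by
    intro i
    rw [norm_sq_eq]
    congr 1
    ext n
    rw [L2Seq_sub_apply, L2Seq_smul_apply, diagOp_apply, ← sub_mul, norm_mul, mul_pow,
      ← Complex.ofReal_sub, Complex.norm_real, Real.norm_eq_abs, sq_abs]
  rw [tendsto_zero_iff_norm_tendsto_zero]
  have hmain : Tendsto (fun i => ‖diagOp c hc (a i) - (r : ℂ) • a i‖ ^ 2) l (𝓝 0) := by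
    rw [Metric.tendsto_nhds]
    intro ε hε
    have hB2 : 0 < ε / (2 * (B ^ 2 + 1)) := by positivity
    have h1 : ∀ᶠ n in atTop, (c n - r) ^ 2 ≤ ε / (2 * (B ^ 2 + 1)) := by
      have h2 : Tendsto (fun n => (c n - r) ^ 2) atTop (𝓝 0) := by
        simpa using (hr.sub_const r).pow 2
      exact (h2.eventually (gt_mem_nhds hB2)).mono fun _ h => h.le
    -- The entries from `N` on are within the tolerance of `r`; on the first `N` coordinates weak
    -- convergence is convergence.
    obtain ⟨N, hN⟩ := eventually_atTop.1 h1
    have h3 : Tendsto (fun i => ∑ n ∈ Finset.range N, (c n - r) ^ 2 * ‖a i n‖ ^ 2) l (𝓝 0) := by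
      have h4 : ∀ n ∈ Finset.range N,
          Tendsto (fun i => (c n - r) ^ 2 * ‖a i n‖ ^ 2) l (𝓝 0) := fun n _ => by
        simpa using ((ha n).norm.pow 2).const_mul ((c n - r) ^ 2)
      simpa using tendsto_finsetSum _ h4
    filter_upwards [h3.eventually (gt_mem_nhds (half_pos hε))] with i hi
    have hs := summable_normSq (a i)
    have hle : ∀ n, (c n - r) ^ 2 * ‖a i n‖ ^ 2 ≤ (C + |r|) ^ 2 * ‖a i n‖ ^ 2 := by
      intro n
      gcongr ?_ * _
      rw [← sq_abs]
      have h5 := abs_sub (c n) r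
      have h6 := hC n
      gcongr
      linarith
    have hsum : Summable fun n => (c n - r) ^ 2 * ‖a i n‖ ^ 2 :=
      Summable.of_nonneg_of_le (fun n => by positivity) hle (hs.mul_left _)
    have h7 : ∑' n, (c (n + N) - r) ^ 2 * ‖a i (n + N)‖ ^ 2 ≤ ε / 2 := by
      have h8 : ∑' n, (c (n + N) - r) ^ 2 * ‖a i (n + N)‖ ^ 2 ≤
          ∑' n, ε / (2 * (B ^ 2 + 1)) * ‖a i (n + N)‖ ^ 2 := by
        refine Summable.tsum_le_tsum (fun n => ?_) ((summable_nat_add_iff N).2 hsum)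
          (((summable_nat_add_iff N).2 hs).mul_left _)
        gcongr
        exact hN _ (Nat.le_add_left N n)
      have h9 : ∑' n, ‖a i (n + N)‖ ^ 2 ≤ B ^ 2 := by
        have h10 := hs.sum_add_tsum_nat_add N
        have h11 : 0 ≤ ∑ n ∈ Finset.range N, ‖a i n‖ ^ 2 := Finset.sum_nonneg fun _ _ =>
          by positivity
        have h12 : ‖a i‖ ^ 2 ≤ B ^ 2 := by
          have := hB i
          gcongr
        rw [norm_sq_eq] at h12
        linarith
      rw [tsum_mul_left] at h8
      refine h8.trans ?_
      calc ε / (2 * (B ^ 2 + 1)) * ∑' n, ‖a i (n + N)‖ ^ 2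
          ≤ ε / (2 * (B ^ 2 + 1)) * (B ^ 2 + 1) := by
            gcongr
            linarith
        _ = ε / 2 := by field_simp
    rw [Real.dist_eq, sub_zero, abs_of_nonneg (by positivity), hsq, ← hsum.sum_add_tsum_nat_add N]
    linarith
  have h := (Real.continuous_sqrt.tendsto 0).comp hmain
  rw [Real.sqrt_zero] at h
  exact h.congr fun i => Real.sqrt_sq (norm_nonneg _)

/-! ### Oscillatory integrals -/

section Oscillatory
variable {ψ ψ' ψ'' : ℝ → ℝ} {a b lo μ : ℝ}

theorem norm_exp_I_mul (x : ℝ) : ‖Complex.exp (Complex.I * x)‖ = 1 := by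
  rw [mul_comm]
  exact Complex.norm_exp_ofReal_mul_I x

theorem hasDerivAt_exp_I (h1 : ∀ t, HasDerivAt ψ (ψ' t) t) (t : ℝ) :
    HasDerivAt (fun t => Complex.exp (Complex.I * ψ t))
      (Complex.exp (Complex.I * ψ t) * (Complex.I * ψ' t)) t :=
  ((h1 t).ofReal_comp.const_mul Complex.I).cexp

theorem continuous_exp_I (h1 : ∀ t, HasDerivAt ψ (ψ' t) t) :
    Continuous fun t => Complex.exp (Complex.I * ψ t) :=
  continuous_iff_continuousAt.2 fun t => (hasDerivAt_exp_I h1 t).continuousAt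

/-- The first derivative test for oscillatory integrals whose phase is convex or concave. -/
theorem norm_integral_exp_le_of_deriv (h1 : ∀ t, HasDerivAt ψ (ψ' t) t)
    (h2 : ∀ t, HasDerivAt ψ' (ψ'' t) t) (hc : Continuous ψ'') (hab : a ≤ b) (hlo : 0 < lo)
    (hl : ∀ t ∈ Set.Icc a b, lo ≤ |ψ' t|)
    (hs : (∀ t ∈ Set.Icc a b, 0 ≤ ψ'' t) ∨ (∀ t ∈ Set.Icc a b, ψ'' t ≤ 0)) :
    ‖∫ t in a..b, Complex.exp (Complex.I * ψ t)‖ ≤ 4 / lo := by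
  have hcψ' : Continuous ψ' := continuous_iff_continuousAt.2 fun t => (h2 t).continuousAt
  have hne : ∀ t ∈ Set.Icc a b, ψ' t ≠ 0 := fun t ht h0 => by
    have := hl t ht
    rw [h0, abs_zero] at this
    linarith
  have hu : ∀ t ∈ Set.Icc a b, HasDerivAt (fun t => (ψ' t)⁻¹) (-ψ'' t / ψ' t ^ 2) t :=
    fun t ht => (h2 t).inv (hne t ht)
  have hu1 : ∀ t ∈ Set.Icc a b, |(ψ' t)⁻¹| ≤ 1 / lo := fun t ht => by
    rw [abs_inv, one_div]
    exact inv_anti₀ hlo (hl t ht)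
  have hcu : ContinuousOn (fun t => -ψ'' t / ψ' t ^ 2) (Set.uIcc a b) := by
    rw [Set.uIcc_of_le hab]
    exact hc.neg.continuousOn.div (hcψ'.pow 2).continuousOn fun t ht => pow_ne_zero 2 (hne t ht)
  have hv : ∀ t, HasDerivAt (fun t => -Complex.I * Complex.exp (Complex.I * ψ t))
      (ψ' t * Complex.exp (Complex.I * ψ t)) t := fun t => by
    refine ((hasDerivAt_exp_I h1 t).const_mul (-Complex.I)).congr_deriv ?_
    linear_combination (-(ψ' t : ℂ) * Complex.exp (Complex.I * ψ t)) * Complex.I_sq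
  have hvc : Continuous fun t => (ψ' t : ℂ) * Complex.exp (Complex.I * ψ t) :=
    (Complex.continuous_ofReal.comp hcψ').mul (continuous_exp_I h1)
  -- Integrate `(1 / ψ') (ψ' e^{iψ})` by parts; the monotonicity of `ψ'` bounds the variation of
  -- `1 / ψ'`.
  have hparts := intervalIntegral.integral_mul_deriv_eq_deriv_mul
    (u := fun t => (((ψ' t)⁻¹ : ℝ) : ℂ)) (v := fun t => -Complex.I * Complex.exp (Complex.I * ψ t))
    (u' := fun t => ((-ψ'' t / ψ' t ^ 2 : ℝ) : ℂ))
    (v' := fun t => (ψ' t : ℂ) * Complex.exp (Complex.I * ψ t)) (a := a) (b := b)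
    (fun t ht => by
      rw [Set.uIcc_of_le hab] at ht
      exact (hu t ht).ofReal_comp)
    (fun t _ => hv t)
    (Complex.continuous_ofReal.comp_continuousOn hcu).intervalIntegrable
    (hvc.intervalIntegrable _ _)
  have hleft : ∫ t in a..b, (((ψ' t)⁻¹ : ℝ) : ℂ) * ((ψ' t : ℂ) * Complex.exp (Complex.I * ψ t)) =
      ∫ t in a..b, Complex.exp (Complex.I * ψ t) := by
    apply intervalIntegral.integral_congr
    intro t ht
    rw [Set.uIcc_of_le hab] at ht
    have h0 : (ψ' t : ℂ) ≠ 0 := by exact_mod_cast hne t ht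
    simp only
    push_cast
    field_simp
  have hFTC : ∫ t in a..b, -ψ'' t / ψ' t ^ 2 = (ψ' b)⁻¹ - (ψ' a)⁻¹ :=
    intervalIntegral.integral_eq_sub_of_hasDerivAt
      (fun t ht => by
        rw [Set.uIcc_of_le hab] at ht
        exact hu t ht) hcu.intervalIntegrable
  have hb2 : |(ψ' b)⁻¹ - (ψ' a)⁻¹| ≤ 2 / lo := by
    have h3 := abs_sub (ψ' b)⁻¹ (ψ' a)⁻¹
    have h4 := hu1 b (Set.right_mem_Icc.2 hab)
    have h5 := hu1 a (Set.left_mem_Icc.2 hab)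
    have h6 : (2 : ℝ) / lo = 1 / lo + 1 / lo := by ring
    linarith
  have hint : ‖∫ t in a..b, ((-ψ'' t / ψ' t ^ 2 : ℝ) : ℂ) *
      (-Complex.I * Complex.exp (Complex.I * ψ t))‖ ≤ 2 / lo := by
    have h3 : ‖∫ t in a..b, ((-ψ'' t / ψ' t ^ 2 : ℝ) : ℂ) *
        (-Complex.I * Complex.exp (Complex.I * ψ t))‖ ≤ ∫ t in a..b, |-ψ'' t / ψ' t ^ 2| := by
      refine (intervalIntegral.norm_integral_le_integral_norm hab).trans_eq ?_
      congr 1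
      ext t
      rw [norm_mul, norm_mul, norm_exp_I_mul, norm_neg, Complex.norm_I, Complex.norm_real,
        Real.norm_eq_abs, mul_one, mul_one]
    refine h3.trans (le_trans ?_ hb2)
    rcases hs with hs | hs
    · have h4 : ∫ t in a..b, |-ψ'' t / ψ' t ^ 2| = ∫ t in a..b, -(-ψ'' t / ψ' t ^ 2) := by
        apply intervalIntegral.integral_congr
        intro t ht
        rw [Set.uIcc_of_le hab] at ht
        exact abs_of_nonpos (div_nonpos_of_nonpos_of_nonneg (neg_nonpos.2 (hs t ht)) (sq_nonneg _))
      rw [h4, intervalIntegral.integral_neg, hFTC]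
      exact neg_le_abs _
    · have h4 : ∫ t in a..b, |-ψ'' t / ψ' t ^ 2| = ∫ t in a..b, -ψ'' t / ψ' t ^ 2 := by
        apply intervalIntegral.integral_congr
        intro t ht
        rw [Set.uIcc_of_le hab] at ht
        exact abs_of_nonneg (div_nonneg (neg_nonneg.2 (hs t ht)) (sq_nonneg _))
      rw [h4, hFTC]
      exact le_abs_self _
  rw [hleft] at hparts
  rw [hparts]
  have h7 : ∀ t ∈ Set.Icc a b, ‖(((ψ' t)⁻¹ : ℝ) : ℂ) * (-Complex.I * Complex.exp (Complex.I * ψ t))‖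
      ≤ 1 / lo := fun t ht => by
    rw [norm_mul, norm_mul, norm_exp_I_mul, norm_neg, Complex.norm_I, Complex.norm_real,
      Real.norm_eq_abs, mul_one, mul_one]
    exact hu1 t ht
  refine (norm_sub_le _ _).trans ?_
  have h8 := norm_sub_le ((((ψ' b)⁻¹ : ℝ) : ℂ) * (-Complex.I * Complex.exp (Complex.I * ψ b)))
    ((((ψ' a)⁻¹ : ℝ) : ℂ) * (-Complex.I * Complex.exp (Complex.I * ψ a)))
  have h9 := h7 b (Set.right_mem_Icc.2 hab)
  have h10 := h7 a (Set.left_mem_Icc.2 hab)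
  have h11 : (4 : ℝ) / lo = 1 / lo + 1 / lo + 2 / lo := by ring
  linarith

theorem norm_integral_exp_neg (ψ : ℝ → ℝ) (a b : ℝ) :
    ‖∫ t in a..b, Complex.exp (Complex.I * ((-ψ t : ℝ) : ℂ))‖ =
      ‖∫ t in a..b, Complex.exp (Complex.I * ψ t)‖ := by
  have h : ∫ t in a..b, Complex.exp (Complex.I * ((-ψ t : ℝ) : ℂ)) =
      (starRingEnd ℂ) (∫ t in a..b, Complex.exp (Complex.I * ψ t)) := by
    rw [← intervalIntegral.intervalIntegral_conj]
    congr 1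
    ext t
    rw [← Complex.exp_conj]
    simp
  rw [h, RCLike.norm_conj]

/-- A function with derivative at least `μ` stays away from zero linearly in the distance to a
suitable point. -/
theorem exists_abs_ge_of_deriv_ge (h2 : ∀ t, HasDerivAt ψ' (ψ'' t) t) (hab : a ≤ b)
    (hμ : ∀ t ∈ Set.Icc a b, μ ≤ ψ'' t) :
    ∃ p ∈ Set.Icc a b, ∀ t ∈ Set.Icc a b, μ * |t - p| ≤ |ψ' t| := by
  have hcψ' : Continuous ψ' := continuous_iff_continuousAt.2 fun t => (h2 t).continuousAt
  have hmv : ∀ s ∈ Set.Icc a b, ∀ t ∈ Set.Icc a b, s ≤ t → μ * (t - s) ≤ ψ' t - ψ' s :=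
    fun s hs t ht hst => Convex.mul_sub_le_image_sub_of_le_deriv (convex_Icc a b)
      hcψ'.continuousOn (fun x _ => (h2 x).differentiableAt.differentiableWithinAt)
      (fun x hx => by
        rw [interior_Icc] at hx
        rw [(h2 x).deriv]
        exact hμ x (Set.Ioo_subset_Icc_self hx)) s hs t ht hst
  rcases le_total 0 (ψ' a) with h | h
  · refine ⟨a, Set.left_mem_Icc.2 hab, fun t ht => ?_⟩
    have := hmv a (Set.left_mem_Icc.2 hab) t ht ht.1
    rw [abs_of_nonneg (sub_nonneg.2 ht.1)]
    exact le_trans (by linarith) (le_abs_self _)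
  rcases le_total (ψ' b) 0 with h' | h'
  · refine ⟨b, Set.right_mem_Icc.2 hab, fun t ht => ?_⟩
    have := hmv t ht b (Set.right_mem_Icc.2 hab) ht.2
    rw [abs_of_nonpos (sub_nonpos.2 ht.2)]
    exact le_trans (by linarith) (neg_le_abs _)
  obtain ⟨p, hp, hp0⟩ := intermediate_value_Icc hab hcψ'.continuousOn ⟨h, h'⟩
  refine ⟨p, hp, fun t ht => ?_⟩
  rcases le_total p t with h3 | h3
  · have := hmv p hp t ht h3
    rw [abs_of_nonneg (sub_nonneg.2 h3)]
    exact le_trans (by linarith) (le_abs_self _)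
  · have := hmv t ht p hp h3
    rw [abs_of_nonpos (sub_nonpos.2 h3)]
    exact le_trans (by linarith) (neg_le_abs _)

/-- The second derivative test for oscillatory integrals. -/
theorem norm_integral_exp_le_of_deriv2 (h1 : ∀ t, HasDerivAt ψ (ψ' t) t)
    (h2 : ∀ t, HasDerivAt ψ' (ψ'' t) t) (hc : Continuous ψ'') (hab : a ≤ b) (hμ0 : 0 < μ)
    (hμ : ∀ t ∈ Set.Icc a b, μ ≤ ψ'' t) :
    ‖∫ t in a..b, Complex.exp (Complex.I * ψ t)‖ ≤ 10 / Real.sqrt μ := by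
  obtain ⟨p, hp, hp'⟩ := exists_abs_ge_of_deriv_ge h2 hab hμ
  have hs := Real.sqrt_pos.2 hμ0
  -- At distance `δ` from `p` the derivative is at least `μ δ = √μ`; the interval of radius `δ`
  -- around `p` is estimated trivially.
  set δ := 1 / Real.sqrt μ with hδ
  have hδ0 : 0 < δ := by positivity
  have hμδ : μ * δ = Real.sqrt μ := by
    rw [hδ, mul_one_div, div_eq_iff hs.ne', Real.mul_self_sqrt hμ0.le]
  have hint : ∀ x y, IntervalIntegrable (fun t => Complex.exp (Complex.I * ψ t)) volume x y :=
    fun x y => (continuous_exp_I h1).intervalIntegrable x y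
  set a' := max a (p - δ) with ha'
  set b' := min b (p + δ) with hb'
  have haa' : a ≤ a' := le_max_left _ _
  have hbb' : b' ≤ b := min_le_left _ _
  have ha'p : a' ≤ p := max_le hp.1 (by linarith)
  have hpb' : p ≤ b' := le_min hp.2 (by linarith)
  have hpos : ∀ t ∈ Set.Icc a b, 0 ≤ ψ'' t := fun t ht => hμ0.le.trans (hμ t ht)
  have hL : ‖∫ t in a..a', Complex.exp (Complex.I * ψ t)‖ ≤ 4 / Real.sqrt μ := by
    rcases le_total a (p - δ) with h | h
    · have ha'' : a' = p - δ := max_eq_right h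
      refine norm_integral_exp_le_of_deriv h1 h2 hc haa' hs (fun t ht => ?_)
        (Or.inl fun t ht => hpos t ⟨ht.1, ht.2.trans (ha'p.trans hp.2)⟩)
      refine le_trans ?_ (hp' t ⟨ht.1, ht.2.trans (ha'p.trans hp.2)⟩)
      rw [← hμδ]
      have := ht.2
      gcongr
      rw [abs_of_nonpos (by linarith)]
      linarith
    · have ha'' : a' = a := max_eq_left h
      rw [ha'', intervalIntegral.integral_same, norm_zero]
      positivity
  have hR : ‖∫ t in b'..b, Complex.exp (Complex.I * ψ t)‖ ≤ 4 / Real.sqrt μ := by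
    rcases le_total (p + δ) b with h | h
    · have hb'' : b' = p + δ := min_eq_right h
      refine norm_integral_exp_le_of_deriv h1 h2 hc hbb' hs (fun t ht => ?_)
        (Or.inl fun t ht => hpos t ⟨(hp.1.trans hpb').trans ht.1, ht.2⟩)
      refine le_trans ?_ (hp' t ⟨(hp.1.trans hpb').trans ht.1, ht.2⟩)
      rw [← hμδ]
      have := ht.1
      gcongr
      rw [abs_of_nonneg (by linarith)]
      linarith
    · have hb'' : b' = b := min_eq_left h
      rw [hb'', intervalIntegral.integral_same, norm_zero]
      positivity
  have hM : ‖∫ t in a'..b', Complex.exp (Complex.I * ψ t)‖ ≤ 2 / Real.sqrt μ := by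
    refine (intervalIntegral.norm_integral_le_of_norm_le_const (C := 1) fun t _ =>
      (norm_exp_I_mul _).le).trans ?_
    rw [one_mul, abs_of_nonneg (by linarith)]
    have h3 : b' ≤ p + δ := min_le_right _ _
    have h4 : p - δ ≤ a' := le_max_right _ _
    have h5 : 2 / Real.sqrt μ = 2 * δ := by rw [hδ]; ring
    linarith
  rw [← intervalIntegral.integral_add_adjacent_intervals (hint a a') (hint a' b),
    ← intervalIntegral.integral_add_adjacent_intervals (hint a' b') (hint b' b)]
  refine (norm_add_le _ _).trans ?_
  have h6 := norm_add_le (∫ t in a'..b', Complex.exp (Complex.I * ψ t))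
    (∫ t in b'..b, Complex.exp (Complex.I * ψ t))
  have h7 : 10 / Real.sqrt μ = 4 / Real.sqrt μ + (2 / Real.sqrt μ + 4 / Real.sqrt μ) := by ring
  linarith

/-- Inserting an amplitude that vanishes at the right end point. -/
theorem norm_integral_exp_mul_le (h1 : ∀ t, HasDerivAt ψ (ψ' t) t) {φ φ' : ℝ → ℂ}
    (hφ : ∀ t, HasDerivAt φ (φ' t) t) (hφ' : Continuous φ') (hab : a ≤ b) (hb : φ b = 0) {M : ℝ}
    (hM : ∀ x ∈ Set.Icc a b, ‖∫ t in a..x, Complex.exp (Complex.I * ψ t)‖ ≤ M) :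
    ‖∫ t in a..b, Complex.exp (Complex.I * ψ t) * φ t‖ ≤ M * ∫ t in a..b, ‖φ' t‖ := by
  have hce := continuous_exp_I h1
  have hP : ∀ x, HasDerivAt (fun x => ∫ t in a..x, Complex.exp (Complex.I * ψ t))
      (Complex.exp (Complex.I * ψ x)) x := fun x =>
    intervalIntegral.integral_hasDerivAt_right (hce.intervalIntegrable _ _)
      hce.stronglyMeasurable.stronglyMeasurableAtFilter hce.continuousAt
  have hparts := intervalIntegral.integral_deriv_mul_eq_sub
    (a := a) (b := b) (fun x _ => hP x) (fun x _ => hφ x) (hce.intervalIntegrable a b)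
      (hφ'.intervalIntegrable a b)
  have hPc : Continuous fun x => ∫ t in a..x, Complex.exp (Complex.I * ψ t) :=
    continuous_iff_continuousAt.2 fun t => (hP t).continuousAt
  have hφc : Continuous φ := continuous_iff_continuousAt.2 fun t => (hφ t).continuousAt
  have i1 : IntervalIntegrable (fun t => Complex.exp (Complex.I * ψ t) * φ t) volume a b :=
    (hce.mul hφc).intervalIntegrable _ _
  have i2 : IntervalIntegrable
      (fun x => (∫ t in a..x, Complex.exp (Complex.I * ψ t)) * φ' x) volume a b :=
    (hPc.mul hφ').intervalIntegrable _ _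
  rw [hb, mul_zero, intervalIntegral.integral_same, zero_mul, sub_zero,
    intervalIntegral.integral_add i1 i2, add_eq_zero_iff_eq_neg] at hparts
  rw [hparts, norm_neg, ← intervalIntegral.integral_const_mul]
  refine (intervalIntegral.norm_integral_le_integral_norm hab).trans
    (intervalIntegral.integral_mono_on hab ((hPc.mul hφ').norm.intervalIntegrable _ _)
      ((hφ'.norm.const_mul M).intervalIntegrable _ _) fun x hx => ?_)
  rw [norm_mul]
  gcongr
  exact hM x hx

end Oscillatory

/-! ### Fourier coefficients of freely evolving wave functions -/

/-- Multiplication by `e^{iT Re z}` on `L²(μ)`. -/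
noncomputable def waveOp (μ : Measure Circle) [IsFiniteMeasure μ] (T : ℝ) :
    Lp ℂ 2 μ →L[ℂ] Lp ℂ 2 μ := mulL2 μ (NormedSpace.exp ((Complex.I * (T : ℂ)) • reC))

section WaveOp
variable {μ : Measure Circle} [IsFiniteMeasure μ]

theorem coeFn_waveOp (T : ℝ) (F : Lp ℂ 2 μ) :
    waveOp μ T F =ᵐ[μ] fun z => Complex.exp (Complex.I * ((T * (z : ℂ).re : ℝ) : ℂ)) * F z := by
  filter_upwards [coeFn_mulL2 (NormedSpace.exp ((Complex.I * (T : ℂ)) • reC)) F] with z hz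
  rw [waveOp, hz, exp_apply_circle, ContinuousMap.smul_apply, reC_apply, smul_eq_mul]
  push_cast
  rw [mul_assoc]

theorem norm_waveOp (T : ℝ) (F : Lp ℂ 2 μ) : ‖waveOp μ T F‖ = ‖F‖ := by
  have h : ∀ᵐ z ∂μ, ‖waveOp μ T F z‖ = ‖F z‖ := by
    filter_upwards [coeFn_waveOp T F] with z hz
    rw [hz, norm_mul, norm_exp_I_mul, one_mul]
  exact le_antisymm (Lp.norm_le_norm_of_ae_le (h.mono fun _ hz => hz.le))
    (Lp.norm_le_norm_of_ae_le (h.mono fun _ hz => hz.ge))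

theorem waveOp_neg_waveOp (T : ℝ) (F : Lp ℂ 2 μ) : waveOp μ (-T) (waveOp μ T F) = F := by
  apply Lp.ext
  filter_upwards [coeFn_waveOp (-T) (waveOp μ T F), coeFn_waveOp T F] with z h1 h2
  rw [h1, h2, ← mul_assoc, ← Complex.exp_add]
  push_cast
  rw [show Complex.I * (-(T : ℂ) * ((z : ℂ).re : ℂ)) + Complex.I * (T * ((z : ℂ).re : ℂ)) = 0 by
    ring,
    Complex.exp_zero, one_mul]

end WaveOp

theorem memLp_comp_arg {φ : ℝ → ℂ} (hφ : Continuous φ) :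
    MemLp (fun z : Circle => φ (Complex.arg (z : ℂ))) 2 arcMeasure := by
  obtain ⟨C, hC⟩ := (isCompact_Icc (a := -Real.pi) (b := Real.pi)).exists_bound_of_continuousOn
    hφ.continuousOn
  refine MemLp.of_bound (C := C) ?_ (.of_forall fun z =>
    hC _ ⟨(Complex.neg_pi_lt_arg _).le, Complex.arg_le_pi _⟩)
  have h1 : Measurable fun z : Circle => (z : ℂ) := Continuous.measurable (by fun_prop)
  exact (hφ.measurable.comp (Complex.measurable_arg.comp h1)).aestronglyMeasurable

/-- The function `φ (arg z)` in `L²(m)`. -/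
noncomputable def arcLp {φ : ℝ → ℂ} (hφ : Continuous φ) : Lp ℂ 2 arcMeasure :=
  (memLp_comp_arg hφ).toLp _

theorem coeFn_arcLp {φ : ℝ → ℂ} (hφ : Continuous φ) :
    arcLp hφ =ᵐ[arcMeasure] fun z : Circle => φ (Complex.arg (z : ℂ)) := MemLp.coeFn_toLp _

/-- The Fourier coefficient `∫ e^{iT Re z} φ(arg z) z^m dm`. -/
noncomputable def waveCoeff (φ : ℝ → ℂ) (T : ℝ) (m : ℤ) : ℂ :=
  ((2 * Real.pi)⁻¹ : ℝ) *
    ∫ t in (-Real.pi)..Real.pi, Complex.exp (Complex.I * ((T * Real.cos t + m * t : ℝ) : ℂ)) * φ t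

theorem inner_mono_waveOp {φ : ℝ → ℂ} (hφ : Continuous φ) (T : ℝ) (m : ℤ) :
    inner ℂ (cL2 arcMeasure (mono (-m))) (waveOp arcMeasure T (arcLp hφ)) = waveCoeff φ T m := by
  rw [inner_cL2_left]
  have h1 : ∫ z, waveOp arcMeasure T (arcLp hφ) z * (starRingEnd ℂ) (mono (-m) z) ∂arcMeasure =
      ∫ z : Circle, Complex.exp (Complex.I * ((T * (z : ℂ).re : ℝ) : ℂ)) *
        φ (Complex.arg (z : ℂ)) * mono m z ∂arcMeasure := by
    apply integral_congr_ae
    filter_upwards [coeFn_waveOp T (arcLp hφ), coeFn_arcLp hφ] with z h1 h2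
    rw [h1, h2, mono_apply, mono_apply, map_zpow₀, conj_coe_circle, inv_zpow', neg_neg]
  rw [h1, integral_arcMeasure, waveCoeff, Complex.real_smul]
  · congr 1
    apply intervalIntegral.integral_congr_ae
    filter_upwards with t ht
    rw [Set.uIoc_of_le (by linarith [Real.pi_pos])] at ht
    rw [arg_exp_of_mem ht, re_circleExp, mono_exp]
    push_cast
    rw [mul_add, Complex.exp_add, mul_right_comm]
    congr 2
    ring_nf
  · refine (AEStronglyMeasurable.mul ?_ (memLp_comp_arg hφ).1).mul
      (mono m).continuous.aestronglyMeasurable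
    exact Continuous.aestronglyMeasurable (by fun_prop)

/-- A continuously differentiable amplitude supported in an arc of the circle. -/
structure ArcAmplitude (φ φ' : ℝ → ℂ) (α β : ℝ) : Prop where
  le : α ≤ β
  left : -Real.pi < α
  right : β < Real.pi
  deriv : ∀ t, HasDerivAt φ (φ' t) t
  continuous_deriv : Continuous φ'
  supp : ∀ t, t ∉ Set.Ioo α β → φ t = 0

section Coefficients
variable {φ φ' : ℝ → ℂ} {α β : ℝ}

theorem ArcAmplitude.continuous (h : ArcAmplitude φ φ' α β) : Continuous φ :=
  continuous_iff_continuousAt.2 fun t => (h.deriv t).continuousAt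

theorem ArcAmplitude.waveCoeff_eq (h : ArcAmplitude φ φ' α β) (T : ℝ) (m : ℤ) :
    waveCoeff φ T m = ((2 * Real.pi)⁻¹ : ℝ) *
      ∫ t in α..β, Complex.exp (Complex.I * ((T * Real.cos t + m * t : ℝ) : ℂ)) * φ t := by
  have hc : Continuous fun t : ℝ =>
      Complex.exp (Complex.I * ((T * Real.cos t + m * t : ℝ) : ℂ)) * φ t := by
    have := h.continuous
    fun_prop
  have hi : ∀ x y, IntervalIntegrable (fun t : ℝ =>
      Complex.exp (Complex.I * ((T * Real.cos t + m * t : ℝ) : ℂ)) * φ t) volume x y :=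
    fun x y => hc.intervalIntegrable x y
  have h1 := h.le
  have hz1 : ∫ t in (-Real.pi)..α, Complex.exp (Complex.I * ((T * Real.cos t + m * t : ℝ) : ℂ)) *
      φ t = 0 := by
    rw [intervalIntegral.integral_congr (g := fun _ => 0), intervalIntegral.integral_zero]
    intro t ht
    rw [Set.uIcc_of_le h.left.le] at ht
    simp only
    rw [h.supp t fun h2 => absurd h2.1 (not_lt.2 ht.2), mul_zero]
  have hz2 : ∫ t in β..Real.pi, Complex.exp (Complex.I * ((T * Real.cos t + m * t : ℝ) : ℂ)) *
      φ t = 0 := by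
    rw [intervalIntegral.integral_congr (g := fun _ => 0), intervalIntegral.integral_zero]
    intro t ht
    rw [Set.uIcc_of_le h.right.le] at ht
    simp only
    rw [h.supp t fun h2 => absurd h2.2 (not_lt.2 ht.1), mul_zero]
  rw [waveCoeff, ← intervalIntegral.integral_add_adjacent_intervals (hi (-Real.pi) α) (hi α _), hz1,
    ← intervalIntegral.integral_add_adjacent_intervals (hi α β) (hi β _), hz2, zero_add, add_zero]

theorem hasDerivAt_phase (T : ℝ) (m : ℤ) (t : ℝ) :
    HasDerivAt (fun t => T * Real.cos t + m * t) (m - T * Real.sin t) t := by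
  refine (((Real.hasDerivAt_cos t).const_mul T).add
    ((hasDerivAt_id t).const_mul (m : ℝ))).congr_deriv
    ?_
  ring

theorem hasDerivAt_phase' (T : ℝ) (m : ℤ) (t : ℝ) :
    HasDerivAt (fun t => (m : ℝ) - T * Real.sin t) (-(T * Real.cos t)) t :=
  ((Real.hasDerivAt_sin t).const_mul T).const_sub (m : ℝ)

theorem continuous_phase'' (T : ℝ) : Continuous fun t => -(T * Real.cos t) := by fun_prop

theorem ArcAmplitude.norm_waveCoeff_le (h : ArcAmplitude φ φ' α β) {T : ℝ} {m : ℤ} {M : ℝ}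
    (hM : ∀ x ∈ Set.Icc α β,
      ‖∫ t in α..x, Complex.exp (Complex.I * ((T * Real.cos t + m * t : ℝ) : ℂ))‖ ≤ M) :
    ‖waveCoeff φ T m‖ ≤ M * ∫ t in α..β, ‖φ' t‖ := by
  have h1 := norm_integral_exp_mul_le (hasDerivAt_phase T m) h.deriv h.continuous_deriv h.le
    (h.supp β fun h2 => lt_irrefl _ h2.2) hM
  have h2 : ‖(((2 * Real.pi)⁻¹ : ℝ) : ℂ)‖ ≤ 1 := by
    rw [Complex.norm_real, Real.norm_of_nonneg (by positivity)]
    exact inv_le_one_of_one_le₀ (by linarith [Real.pi_gt_three])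
  rw [h.waveCoeff_eq, norm_mul]
  exact (mul_le_of_le_one_left (norm_nonneg _) h2).trans h1

/-- The stationary phase bound for the Fourier coefficients. -/
theorem ArcAmplitude.norm_waveCoeff_le_sqrt (h : ArcAmplitude φ φ' α β) {c : ℝ} (hc : 0 < c)
    (hcos : (∀ t ∈ Set.Icc α β, c ≤ Real.cos t) ∨ (∀ t ∈ Set.Icc α β, Real.cos t ≤ -c)) {T : ℝ}
    (hT : T ≠ 0) (m : ℤ) :
    ‖waveCoeff φ T m‖ ≤ 10 / Real.sqrt (c * |T|) * ∫ t in α..β, ‖φ' t‖ := by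
  have hμ : 0 < c * |T| := mul_pos hc (abs_pos.2 hT)
  refine h.norm_waveCoeff_le fun x hx => ?_
  have key : (∀ t ∈ Set.Icc α x, c * |T| ≤ -(T * Real.cos t)) ∨
      (∀ t ∈ Set.Icc α x, c * |T| ≤ -(-(T * Real.cos t))) := by
    have hsub : ∀ t ∈ Set.Icc α x, t ∈ Set.Icc α β := fun t ht => ⟨ht.1, ht.2.trans hx.2⟩
    rcases lt_or_gt_of_ne hT with hT' | hT' <;> rcases hcos with hcos | hcos
    · left; intro t ht
      have := hcos t (hsub t ht)
      rw [abs_of_neg hT']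
      nlinarith
    · right; intro t ht
      have := hcos t (hsub t ht)
      rw [abs_of_neg hT']
      nlinarith
    · right; intro t ht
      have := hcos t (hsub t ht)
      rw [abs_of_pos hT']
      nlinarith
    · left; intro t ht
      have := hcos t (hsub t ht)
      rw [abs_of_pos hT']
      nlinarith
  rcases key with key | key
  · exact norm_integral_exp_le_of_deriv2 (hasDerivAt_phase T m) (hasDerivAt_phase' T m)
      (continuous_phase'' T) hx.1 hμ key
  · rw [← norm_integral_exp_neg]
    exact norm_integral_exp_le_of_deriv2 (fun t => (hasDerivAt_phase T m t).neg)
      (fun t => (hasDerivAt_phase' T m t).neg) (continuous_phase'' T).neg hx.1 hμ key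

/-- The nonstationary bound for the Fourier coefficients. -/
theorem ArcAmplitude.norm_waveCoeff_le_div (h : ArcAmplitude φ φ' α β)
    (hcos : (∀ t ∈ Set.Icc α β, 0 ≤ Real.cos t) ∨ (∀ t ∈ Set.Icc α β, Real.cos t ≤ 0)) {T : ℝ}
    {m : ℤ} {lo : ℝ} (hlo : 0 < lo) (hl : ∀ t ∈ Set.Icc α β, lo ≤ |m - T * Real.sin t|) :
    ‖waveCoeff φ T m‖ ≤ 4 / lo * ∫ t in α..β, ‖φ' t‖ := by
  refine h.norm_waveCoeff_le fun x hx => ?_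
  have hsub : ∀ t ∈ Set.Icc α x, t ∈ Set.Icc α β := fun t ht => ⟨ht.1, ht.2.trans hx.2⟩
  refine norm_integral_exp_le_of_deriv (hasDerivAt_phase T m) (hasDerivAt_phase' T m)
    (continuous_phase'' T) hx.1 hlo (fun t ht => hl t (hsub t ht)) ?_
  rcases le_total 0 T with hT | hT <;> rcases hcos with hcos | hcos
  · exact Or.inr fun t ht => neg_nonpos.2 (mul_nonneg hT (hcos t (hsub t ht)))
  · exact Or.inl fun t ht => neg_nonneg.2 (mul_nonpos_of_nonneg_of_nonpos hT (hcos t (hsub t ht)))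
  · exact Or.inl fun t ht => neg_nonneg.2 (mul_nonpos_of_nonpos_of_nonneg hT (hcos t (hsub t ht)))
  · exact Or.inr fun t ht => neg_nonpos.2 (mul_nonneg_of_nonpos_of_nonpos hT (hcos t (hsub t ht)))

/-- The position operator evolves linearly in time: `T sin - M` applied to the evolved wave function
only differentiates the amplitude. -/
theorem ArcAmplitude.waveCoeff_identity (h : ArcAmplitude φ φ' α β) (T : ℝ) (m : ℤ) :
    (T / 2 : ℝ) * (waveCoeff φ T (m + 1) - waveCoeff φ T (m - 1)) =
      Complex.I * m * waveCoeff φ T m + waveCoeff φ' T m := by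
  have hφ := h.continuous
  have hφ' := h.continuous_deriv
  set e : ℤ → ℝ → ℂ := fun m t => Complex.exp (Complex.I * ((T * Real.cos t + m * t : ℝ) : ℂ))
    with he
  have hi : ∀ m, IntervalIntegrable (fun t => e m t * φ t) volume (-Real.pi) Real.pi := fun m =>
    Continuous.intervalIntegrable (by simp only [he]; fun_prop) _ _
  have hi' : ∀ m, IntervalIntegrable (fun t => e m t * φ' t) volume (-Real.pi) Real.pi := fun m =>
    Continuous.intervalIntegrable (by simp only [he]; fun_prop) _ _
  have hd : ∀ t, HasDerivAt (fun t => e m t * φ t)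
      (e m t * (Complex.I * ((m - T * Real.sin t : ℝ) : ℂ)) * φ t + e m t * φ' t) t := fun t =>
    (hasDerivAt_exp_I (hasDerivAt_phase T m) t).mul (h.deriv t)
  have h0 : ∀ t, t ∉ Set.Ioo α β → φ t = 0 := h.supp
  have hFTC := intervalIntegral.integral_eq_sub_of_hasDerivAt (a := -Real.pi) (b := Real.pi)
    (fun t _ => hd t) (Continuous.intervalIntegrable (by simp only [he]; fun_prop) _ _)
  rw [h0 _ fun h2 => by linarith [h2.2, h.right], h0 _ fun h2 => by linarith [h2.1, h.left],
    mul_zero, mul_zero, sub_zero] at hFTC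
  have halg : ∀ t, e m t * (Complex.I * ((m - T * Real.sin t : ℝ) : ℂ)) * φ t + e m t * φ' t =
      (Complex.I * m * (e m t * φ t) - (T / 2 : ℝ) * (e (m + 1) t * φ t - e (m - 1) t * φ t)) +
        e m t * φ' t := by
    intro t
    have e1 : e (m + 1) t = e m t * Complex.exp (t * Complex.I) := by
      simp only [he]
      rw [← Complex.exp_add]
      push_cast
      congr 1
      ring
    have e2 : e (m - 1) t = e m t * Complex.exp (-t * Complex.I) := by
      simp only [he]
      rw [← Complex.exp_add]
      push_cast
      congr 1
      ring
    have e3 : Complex.sin t = (Complex.exp (-t * Complex.I) - Complex.exp (t * Complex.I)) *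
      Complex.I / 2 := rfl
    rw [e1, e2]
    push_cast
    rw [e3]
    linear_combination (-(e m t * φ t * T * (Complex.exp (-t * Complex.I) -
      Complex.exp (t * Complex.I)) / 2)) * Complex.I_sq
  have i1 : IntervalIntegrable (fun t => Complex.I * m * (e m t * φ t)) volume (-Real.pi) Real.pi :=
    (hi m).const_mul _
  have i2 : IntervalIntegrable (fun t => e (m + 1) t * φ t - e (m - 1) t * φ t) volume
      (-Real.pi) Real.pi := (hi _).sub (hi _)
  have i3 : IntervalIntegrable
      (fun t => ((T / 2 : ℝ) : ℂ) * (e (m + 1) t * φ t - e (m - 1) t * φ t))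
      volume (-Real.pi) Real.pi := i2.const_mul _
  have i4 : IntervalIntegrable (fun t => Complex.I * m * (e m t * φ t) -
      ((T / 2 : ℝ) : ℂ) * (e (m + 1) t * φ t - e (m - 1) t * φ t)) volume (-Real.pi) Real.pi :=
    i1.sub i3
  simp only [halg] at hFTC
  rw [intervalIntegral.integral_add i4 (hi' m), intervalIntegral.integral_sub i1 i3,
    intervalIntegral.integral_const_mul, intervalIntegral.integral_const_mul,
    intervalIntegral.integral_sub (hi _) (hi _)] at hFTC
  simp only [waveCoeff]
  simp only [he] at hFTC
  linear_combination (-(((2 * Real.pi)⁻¹ : ℝ) : ℂ)) * hFTC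

end Coefficients

/-! ### Blocks of frequencies -/

theorem hasSum_norm_inner_mono_sq (F : Lp ℂ 2 arcMeasure) :
    HasSum (fun l : ℤ => ‖inner ℂ (cL2 arcMeasure (mono (-l))) F‖ ^ 2) (‖F‖ ^ 2) := by
  have hsp : (Submodule.span ℂ (Set.range fun n : ℤ => cL2 arcMeasure (mono n)))ᗮ = ⊥ := by
    rw [Submodule.eq_bot_iff]
    intro G hG
    refine L2_eq_zero_of_moments fun n => ?_
    exact Submodule.mem_orthogonal _ _ |>.1 hG _ (Submodule.subset_span ⟨n, rfl⟩)
  set B := HilbertBasis.mkOfOrthogonalEqBot orthonormal_mono hsp with hB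
  have h1 := B.hasSum_inner_mul_inner F F
  have h2 : ∀ n : ℤ, B n = cL2 arcMeasure (mono n) := fun n => by
    rw [hB, HilbertBasis.coe_mkOfOrthogonalEqBot]
  have h3 := (Complex.hasSum_re h1)
  rw [inner_self_eq_norm_sq_to_K] at h3
  have h4 : HasSum (fun n : ℤ => ‖inner ℂ (cL2 arcMeasure (mono n)) F‖ ^ 2) (‖F‖ ^ 2) := by
    convert h3 using 1
    · ext n
      rw [h2, ← inner_conj_symm F, ← Complex.normSq_eq_conj_mul_self, Complex.ofReal_re,
        Complex.normSq_eq_norm_sq]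
    · norm_cast
  exact (Equiv.neg ℤ).hasSum_iff.2 h4

/-- The tent function. -/
noncomputable def tent (u : ℝ) : ℝ := max (1 - |u|) 0

/-- The ramp function, whose differences are tents. -/
noncomputable def ramp (u : ℝ) : ℝ := min 1 (max 0 (u + 1))

theorem tent_nonneg (u : ℝ) : 0 ≤ tent u := le_max_right _ _

theorem tent_le_one (u : ℝ) : tent u ≤ 1 := max_le (by linarith [abs_nonneg u]) zero_le_one

theorem tent_eq_zero {u : ℝ} (h : 1 ≤ |u|) : tent u = 0 := max_eq_right (by linarith)

theorem abs_tent_sub_le (u v : ℝ) : |tent u - tent v| ≤ |u - v| := by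
  unfold tent
  refine (abs_max_sub_max_le_abs _ _ _).trans ?_
  rw [show (1 - |u|) - (1 - |v|) = -(|u| - |v|) by ring, abs_neg]
  exact abs_abs_sub_abs_le _ _

theorem ramp_nonneg (u : ℝ) : 0 ≤ ramp u := le_min zero_le_one (le_max_left _ _)

theorem ramp_le_one (u : ℝ) : ramp u ≤ 1 := min_le_left _ _

theorem ramp_eq_one {u : ℝ} (h : 0 ≤ u) : ramp u = 1 :=
  min_eq_left (le_max_of_le_right (by linarith))

theorem ramp_eq_zero {u : ℝ} (h : u ≤ -1) : ramp u = 0 := by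
  rw [ramp, max_eq_left (by linarith), min_eq_right zero_le_one]

theorem ramp_eq_add {u : ℝ} (h1 : -1 ≤ u) (h2 : u ≤ 0) : ramp u = u + 1 := by
  rw [ramp, max_eq_right (by linarith), min_eq_right (by linarith)]

theorem tent_eq_ramp_sub (u : ℝ) : tent u = ramp u - ramp (u - 1) := by
  rcases le_total u (-1) with h1 | h1
  · rw [tent_eq_zero (by rw [abs_of_neg (by linarith)]; linarith), ramp_eq_zero h1,
      ramp_eq_zero (by linarith), sub_zero]
  rcases le_total u 0 with h2 | h2
  · rw [tent, abs_of_nonpos h2, max_eq_left (by linarith), ramp_eq_add h1 h2,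
      ramp_eq_zero (by linarith)]
    ring
  rcases le_total u 1 with h3 | h3
  · rw [tent, abs_of_nonneg h2, max_eq_left (by linarith), ramp_eq_one h2,
      ramp_eq_add (by linarith) (by linarith)]
    ring
  · rw [tent_eq_zero (by rw [abs_of_nonneg h2]; exact h3), ramp_eq_one h2,
      ramp_eq_one (by linarith), sub_self]

theorem sum_tent (u : ℝ) (n : ℕ) :
    ∑ i ∈ Finset.range n, tent (u - i) = ramp u - ramp (u - n) := by
  induction n with
  | zero => simp
  | succ n ih =>
    rw [Finset.sum_range_succ, ih, tent_eq_ramp_sub]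
    push_cast
    rw [show u - n - 1 = u - (n + 1) by ring]
    ring

theorem sum_tent_le_one (u : ℝ) (n : ℕ) : ∑ i ∈ Finset.range n, tent (u - i) ≤ 1 := by
  rw [sum_tent]
  linarith [ramp_le_one u, ramp_nonneg (u - n)]

/-- Each point lies within distance `1` of at most three integers. -/
theorem sum_indicator_le (u : ℝ) (n : ℕ) :
    ∑ i ∈ Finset.range n, (if |u - i| ≤ 1 then (1 : ℝ) else 0) ≤ 3 := by
  have h1 : ∀ i ∈ Finset.range n, (if |u - i| ≤ 1 then (1 : ℝ) else 0) ≤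
      tent (u + 1 - i) + tent (u - i) + tent (u - 1 - i) := by
    intro i _
    split_ifs with h
    · have h2 := abs_le.1 h
      rw [tent_eq_ramp_sub (u + 1 - i), tent_eq_ramp_sub (u - i), tent_eq_ramp_sub (u - 1 - i),
        ramp_eq_one (u := u + 1 - i) (by linarith [h2.1]),
        ramp_eq_zero (u := u - 1 - i - 1) (by linarith [h2.2]),
        show u + 1 - i - 1 = u - i by ring, show u - i - 1 = u - 1 - (i : ℝ) by ring]
      linarith
    · have := tent_nonneg (u + 1 - i)
      have := tent_nonneg (u - i)
      have := tent_nonneg (u - 1 - i)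
      positivity
  refine (Finset.sum_le_sum h1).trans ?_
  rw [Finset.sum_add_distrib, Finset.sum_add_distrib]
  linarith [sum_tent_le_one (u + 1) n, sum_tent_le_one u n, sum_tent_le_one (u - 1) n]

/-- The tent of width `L` centred at `k L`. -/
noncomputable def blockTent (L k : ℕ) (l : ℤ) : ℝ := tent (l / L - k)

/-- The part of the trigonometric series `∑ b_l z^{-l}` in the block of frequencies around
`k L`, cut out by a tent. -/
noncomputable def blockPoly (b : ℤ → ℂ) (L k : ℕ) : C(Circle, ℂ) :=
  ∑ l ∈ Finset.Icc (((k : ℤ) - 1) * L) ((k + 1) * L), ((blockTent L k l : ℂ) * b l) • mono (-l)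

theorem blockTent_eq_zero {L k : ℕ} (hL : 1 ≤ L) {l : ℤ} (h : (L : ℤ) ≤ |l - k * L|) :
    blockTent L k l = 0 := by
  have hL' : (0 : ℝ) < L := by exact_mod_cast hL
  apply tent_eq_zero
  rw [show (l : ℝ) / L - k = (l - k * L) / L by field_simp, abs_div, abs_of_pos hL',
    le_div_iff₀ hL',
    one_mul]
  exact_mod_cast h

theorem inner_mono_blockPoly (b : ℤ → ℂ) {L k : ℕ} (hL : 1 ≤ L) (l : ℤ) :
    inner ℂ (cL2 arcMeasure (mono (-l))) (cL2 arcMeasure (blockPoly b L k)) =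
      (blockTent L k l : ℂ) * b l := by
  have h := orthonormal_iff_ite.1 orthonormal_mono
  simp only [blockPoly, map_sum, map_smul, inner_sum, inner_smul_right, h, neg_inj, mul_ite,
    mul_one,
    mul_zero]
  rw [Finset.sum_ite_eq]
  split_ifs with hl
  · rfl
  · rw [blockTent_eq_zero hL, Complex.ofReal_zero, zero_mul]
    rw [Finset.mem_Icc, not_and_or, not_le, not_le] at hl
    rcases hl with hl | hl
    · exact le_trans (by linarith) (neg_le_abs _)
    · exact le_trans (by linarith) (le_abs_self _)

/-- The function `Im z` on the circle. -/
noncomputable def imC : C(Circle, ℂ) := (-(1 / 2) * Complex.I : ℂ) • (mono 1 - mono (-1))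

theorem imC_apply (z : Circle) : imC z = (((z : ℂ).im : ℝ) : ℂ) := by
  have h := Complex.im_eq_sub_conj (z : ℂ)
  rw [h, conj_coe_circle]
  simp only [imC, ContinuousMap.smul_apply, ContinuousMap.sub_apply, mono_apply, zpow_one,
    zpow_neg_one, smul_eq_mul]
  rw [eq_div_iff (by simp)]
  linear_combination (-((z : ℂ) - (z : ℂ)⁻¹)) * Complex.I_sq

theorem inner_mono_imC_mul (f : C(Circle, ℂ)) (l : ℤ) :
    inner ℂ (cL2 arcMeasure (mono (-l))) (cL2 arcMeasure (imC * f)) =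
      (-(1 / 2) * Complex.I) * (inner ℂ (cL2 arcMeasure (mono (-(l + 1)))) (cL2 arcMeasure f) -
        inner ℂ (cL2 arcMeasure (mono (-(l - 1)))) (cL2 arcMeasure f)) := by
  have h1 : ∀ k : ℤ, inner ℂ (cL2 arcMeasure (mono (-l))) (cL2 arcMeasure (mono k * f)) =
      inner ℂ (cL2 arcMeasure (mono (-(l + k)))) (cL2 arcMeasure f) := by
    intro k
    rw [← mulL2_cL2, ← star_star (mono k), ← inner_mulL2_left, mulL2_cL2, star_mono, mono_mul_mono]
    congr 3
    ring
  rw [imC, smul_mul_assoc, sub_mul, map_smul, map_sub, inner_smul_right, inner_sub_right, h1, h1]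
  rfl

/-- Up to scaling, the tent commutes with `Im z` and localizes it: `((T Im z - k L) / L)` applied to
a block is controlled by the coefficients in the block, once `(T Im z - M) b` is. -/
theorem norm_inner_mono_weight_blockPoly_le {b d : ℤ → ℂ} {T : ℝ} {L k : ℕ} (hL : 1 ≤ L)
    (hT : |T| ≤ (L : ℝ) ^ 2)
    (hd : ∀ l : ℤ, (T / 2 : ℝ) * (b (l + 1) - b (l - 1)) = Complex.I * l * b l + d l) (l : ℤ) :
    ‖inner ℂ (cL2 arcMeasure (mono (-l))) (cL2 arcMeasure
      (((T / L : ℝ) : ℂ) • (imC * blockPoly b L k) - (k : ℂ) • blockPoly b L k))‖ ^ 2 ≤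
      (if |(l : ℝ) / L - k| ≤ 1 then 1 else 0) *
        (4 * (‖d l‖ ^ 2 + ‖b l‖ ^ 2 + ‖b (l + 1)‖ ^ 2 + ‖b (l - 1)‖ ^ 2)) := by
  have hL' : (0 : ℝ) < L := by exact_mod_cast hL
  have hL1 : (1 : ℝ) ≤ L := by exact_mod_cast hL
  have hLc : (L : ℂ) ≠ 0 := by exact_mod_cast hL'.ne'
  set χ := blockTent L k with hχ
  rw [map_sub, map_smul, map_smul, inner_sub_right, inner_smul_right, inner_smul_right,
    inner_mono_imC_mul, inner_mono_blockPoly b hL, inner_mono_blockPoly b hL,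
    inner_mono_blockPoly b hL]
  have hu : ∀ l : ℤ, (l : ℝ) / L - k = (l - k * L) / L := fun l => by field_simp
  split_ifs with hl
  · rw [one_mul]
    -- `T Im z - l` applied to `b` is `-i d`, and moving `Im z` past the tent costs increments of
    -- the tent, of size `1 / L`, times `T / L ≤ L`.
    have key : ((T / L : ℝ) : ℂ) * (-(1 / 2) * Complex.I * ((χ (l + 1) : ℂ) * b (l + 1) -
        (χ (l - 1) : ℂ) * b (l - 1))) - k * ((χ l : ℂ) * b l) =
        ((χ l / L : ℝ) : ℂ) * (-Complex.I * d l) + ((((l : ℝ) / L - k) * χ l : ℝ) : ℂ) * b l +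
        ((T / (2 * L) * (χ (l + 1) - χ l) : ℝ) : ℂ) * (-Complex.I * b (l + 1)) +
        ((T / (2 * L) * (χ (l - 1) - χ l) : ℝ) : ℂ) * (Complex.I * b (l - 1)) := by
      have h1 := hd l
      push_cast at h1 ⊢
      have h2 : d l = T / 2 * (b (l + 1) - b (l - 1)) - Complex.I * l * b l := by rw [h1]; ring
      rw [h2]
      field_simp
      ring_nf
      simp only [Complex.I_sq]
      ring
    rw [key]
    have hχ0 : 0 ≤ χ l := tent_nonneg _
    have hχ1 : χ l ≤ 1 := tent_le_one _
    have hdiff : ∀ l' : ℤ, |(l' : ℝ) - l| ≤ 1 → |T / (2 * L) * (χ l' - χ l)| ≤ 1 := by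
      intro l' h'
      have h3 : |χ l' - χ l| ≤ 1 / L := by
        refine (abs_tent_sub_le _ _).trans ?_
        rw [show (l' : ℝ) / L - k - (l / L - k) = (l' - l) / L by ring, abs_div, abs_of_pos hL']
        gcongr
      rw [abs_mul, abs_div, abs_of_pos (show (0 : ℝ) < 2 * L by positivity)]
      calc |T| / (2 * L) * |χ l' - χ l| ≤ (L : ℝ) ^ 2 / (2 * L) * (1 / L) := by gcongr
        _ = 1 / 2 := by field_simp
        _ ≤ 1 := by norm_num
    have a1 : ‖((χ l / L : ℝ) : ℂ) * (-Complex.I * d l)‖ ≤ ‖d l‖ := by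
      rw [norm_mul, norm_mul, norm_neg, Complex.norm_I, one_mul, Complex.norm_real,
        Real.norm_of_nonneg (by positivity)]
      exact mul_le_of_le_one_left (norm_nonneg _) ((div_le_one hL').2 (hχ1.trans hL1))
    have a2 : ‖((((l : ℝ) / L - k) * χ l : ℝ) : ℂ) * b l‖ ≤ ‖b l‖ := by
      rw [norm_mul, Complex.norm_real, Real.norm_eq_abs, abs_mul, abs_of_nonneg hχ0]
      exact mul_le_of_le_one_left (norm_nonneg _) (mul_le_one₀ hl hχ0 hχ1)
    have a3 : ‖((T / (2 * L) * (χ (l + 1) - χ l) : ℝ) : ℂ) * (-Complex.I * b (l + 1))‖ ≤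
        ‖b (l + 1)‖ := by
      rw [norm_mul, norm_mul, norm_neg, Complex.norm_I, one_mul, Complex.norm_real,
        Real.norm_eq_abs]
      exact mul_le_of_le_one_left (norm_nonneg _) (hdiff _ (by push_cast; simp))
    have a4 : ‖((T / (2 * L) * (χ (l - 1) - χ l) : ℝ) : ℂ) * (Complex.I * b (l - 1))‖ ≤
        ‖b (l - 1)‖ := by
      rw [norm_mul, norm_mul, Complex.norm_I, one_mul, Complex.norm_real, Real.norm_eq_abs]
      exact mul_le_of_le_one_left (norm_nonneg _) (hdiff _ (by push_cast; simp))
    have a5 : ∀ x y u v : ℂ, ‖x + y + u + v‖ ≤ ‖x‖ + ‖y‖ + ‖u‖ + ‖v‖ := fun x y u v =>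
      (norm_add_le _ _).trans (add_le_add_left ((norm_add_le _ _).trans
        (add_le_add_left (norm_add_le _ _) _)) _)
    refine (pow_le_pow_left₀ (norm_nonneg _) ((a5 _ _ _ _).trans
      (add_le_add (add_le_add (add_le_add a1 a2) a3) a4)) 2).trans ?_
    nlinarith [sq_nonneg (‖d l‖ - ‖b l‖), sq_nonneg (‖d l‖ - ‖b (l + 1)‖),
      sq_nonneg (‖d l‖ - ‖b (l - 1)‖), sq_nonneg (‖b l‖ - ‖b (l + 1)‖),
      sq_nonneg (‖b l‖ - ‖b (l - 1)‖), sq_nonneg (‖b (l + 1)‖ - ‖b (l - 1)‖)]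
  · have h1 : (L : ℤ) < |l - k * L| := by
      rw [not_le, hu, abs_div, abs_of_pos hL', lt_div_iff₀ hL', one_mul] at hl
      exact_mod_cast hl
    have h2 : ∀ l' : ℤ, |l' - l| ≤ 1 → blockTent L k l' = 0 := by
      intro l' h'
      apply blockTent_eq_zero hL
      have h3 := abs_sub_abs_le_abs_sub (l - k * L) (l' - k * L)
      rw [show l - k * L - (l' - k * L) = -(l' - l) by ring, abs_neg] at h3
      omega
    rw [h2 (l + 1) (by simp), h2 (l - 1) (by simp), h2 l (by simp)]
    simp

section Blocks
variable {b d : ℤ → ℂ} {F D : Lp ℂ 2 arcMeasure} {T : ℝ} {L : ℕ}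

theorem hasSum_norm_coeff_sq (hb : ∀ l, b l = inner ℂ (cL2 arcMeasure (mono (-l))) F) :
    HasSum (fun l => ‖b l‖ ^ 2) (‖F‖ ^ 2) := by
  simp only [hb]
  exact hasSum_norm_inner_mono_sq F

theorem sum_blockTent_eq (L a n : ℕ) (l : ℤ) : ∑ i ∈ Finset.range n, blockTent L (a + i + 1) l =
    ramp ((l : ℝ) / L - (a + 1)) - ramp ((l : ℝ) / L - (a + 1) - n) := by
  rw [← sum_tent]
  refine Finset.sum_congr rfl fun i _ => ?_
  rw [blockTent]
  push_cast
  congr 1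
  ring

theorem sum_block_indicator_le (L a n : ℕ) (l : ℤ) :
    ∑ i ∈ Finset.range n, (if |(l : ℝ) / L - (a + i + 1 : ℕ)| ≤ 1 then (1 : ℝ) else 0) ≤ 3 := by
  refine le_trans (le_of_eq (Finset.sum_congr rfl fun i _ => ?_))
    (sum_indicator_le ((l : ℝ) / L - (a + 1)) n)
  push_cast
  rw [show (l : ℝ) / L - (a + i + 1) = (l : ℝ) / L - (a + 1) - i by ring]

theorem sum_norm_blockPoly_sq_le (hL : 1 ≤ L)
    (hb : ∀ l, b l = inner ℂ (cL2 arcMeasure (mono (-l))) F) (a n : ℕ) :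
    ∑ i ∈ Finset.range n, ‖cL2 arcMeasure (blockPoly b L (a + i + 1))‖ ^ 2 ≤ ‖F‖ ^ 2 := by
  have h1 := hasSum_sum (f := fun (i : ℕ) (l : ℤ) => ‖inner ℂ (cL2 arcMeasure (mono (-l)))
    (cL2 arcMeasure (blockPoly b L (a + i + 1)))‖ ^ 2) (s := Finset.range n)
    fun i _ => hasSum_norm_inner_mono_sq (cL2 arcMeasure (blockPoly b L (a + i + 1)))
  refine hasSum_le (fun l => ?_) h1 (hasSum_norm_coeff_sq hb)
  have h2 : ∀ i ∈ Finset.range n, ‖inner ℂ (cL2 arcMeasure (mono (-l)))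
      (cL2 arcMeasure (blockPoly b L (a + i + 1)))‖ ^ 2 ≤
        blockTent L (a + i + 1) l * ‖b l‖ ^ 2 := by
    intro i _
    have h3 : 0 ≤ blockTent L (a + i + 1) l := tent_nonneg _
    have h4 : blockTent L (a + i + 1) l ≤ 1 := tent_le_one _
    rw [inner_mono_blockPoly b hL, norm_mul, mul_pow, Complex.norm_real, Real.norm_of_nonneg h3]
    gcongr
    nlinarith
  refine (Finset.sum_le_sum h2).trans ?_
  rw [← Finset.sum_mul, sum_blockTent_eq]
  refine mul_le_of_le_one_left (sq_nonneg _) ?_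
  linarith [ramp_le_one ((l : ℝ) / L - (a + 1)), ramp_nonneg ((l : ℝ) / L - (a + 1) - n)]

/-- The weight `((T Im z - k L) / L)` times the block around `k L`. -/
noncomputable def weightedBlock (b : ℤ → ℂ) (T : ℝ) (L k : ℕ) : C(Circle, ℂ) :=
  ((T / L : ℝ) : ℂ) • (imC * blockPoly b L k) - (k : ℂ) • blockPoly b L k

theorem weightedBlock_apply (b : ℤ → ℂ) (T : ℝ) (L k : ℕ) (z : Circle) :
    weightedBlock b T L k z = ((T / L * (z : ℂ).im - k : ℝ) : ℂ) * blockPoly b L k z := by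
  simp only [weightedBlock, ContinuousMap.sub_apply, ContinuousMap.smul_apply,
    ContinuousMap.mul_apply, imC_apply, smul_eq_mul]
  push_cast
  ring

theorem sum_norm_weightedBlock_sq_le (hL : 1 ≤ L) (hT : |T| ≤ (L : ℝ) ^ 2)
    (hb : ∀ l, b l = inner ℂ (cL2 arcMeasure (mono (-l))) F)
    (hd : ∀ l, d l = inner ℂ (cL2 arcMeasure (mono (-l))) D)
    (hid : ∀ l : ℤ, (T / 2 : ℝ) * (b (l + 1) - b (l - 1)) = Complex.I * l * b l + d l) (a n : ℕ) :
    ∑ i ∈ Finset.range n, ‖cL2 arcMeasure (weightedBlock b T L (a + i + 1))‖ ^ 2 ≤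
      12 * (‖D‖ ^ 2 + 3 * ‖F‖ ^ 2) := by
  have h1 := hasSum_sum (f := fun (i : ℕ) (l : ℤ) => ‖inner ℂ (cL2 arcMeasure (mono (-l)))
    (cL2 arcMeasure (weightedBlock b T L (a + i + 1)))‖ ^ 2) (s := Finset.range n)
    fun i _ => hasSum_norm_inner_mono_sq (cL2 arcMeasure (weightedBlock b T L (a + i + 1)))
  have hbs := hasSum_norm_coeff_sq hb
  have hds := hasSum_norm_coeff_sq hd
  have hp : HasSum (fun l : ℤ => ‖b (l + 1)‖ ^ 2) (‖F‖ ^ 2) :=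
    (Equiv.addRight (1 : ℤ)).hasSum_iff (f := fun l => ‖b l‖ ^ 2) |>.2 hbs
  have hm : HasSum (fun l : ℤ => ‖b (l - 1)‖ ^ 2) (‖F‖ ^ 2) :=
    (Equiv.subRight (1 : ℤ)).hasSum_iff (f := fun l => ‖b l‖ ^ 2) |>.2 hbs
  have h2 : HasSum (fun l : ℤ => 3 * (4 * (‖d l‖ ^ 2 + ‖b l‖ ^ 2 + ‖b (l + 1)‖ ^ 2 +
      ‖b (l - 1)‖ ^ 2))) (3 * (4 * (‖D‖ ^ 2 + ‖F‖ ^ 2 + ‖F‖ ^ 2 + ‖F‖ ^ 2))) :=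
    ((((hds.add hbs).add hp).add hm).mul_left 4).mul_left 3
  have h3 : ∀ l : ℤ, ∑ i ∈ Finset.range n, ‖inner ℂ (cL2 arcMeasure (mono (-l)))
      (cL2 arcMeasure (weightedBlock b T L (a + i + 1)))‖ ^ 2 ≤
      3 * (4 * (‖d l‖ ^ 2 + ‖b l‖ ^ 2 + ‖b (l + 1)‖ ^ 2 + ‖b (l - 1)‖ ^ 2)) := by
    intro l
    have h4 : ∀ i ∈ Finset.range n, ‖inner ℂ (cL2 arcMeasure (mono (-l)))
        (cL2 arcMeasure (weightedBlock b T L (a + i + 1)))‖ ^ 2 ≤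
        (if |(l : ℝ) / L - (a + i + 1 : ℕ)| ≤ 1 then (1 : ℝ) else 0) *
          (4 * (‖d l‖ ^ 2 + ‖b l‖ ^ 2 + ‖b (l + 1)‖ ^ 2 + ‖b (l - 1)‖ ^ 2)) := by
      intro i _
      rw [weightedBlock]
      exact norm_inner_mono_weight_blockPoly_le hL hT hid l
    refine (Finset.sum_le_sum h4).trans ?_
    rw [← Finset.sum_mul]
    exact mul_le_mul_of_nonneg_right (sum_block_indicator_le L a n l) (by positivity)
  have h5 := hasSum_le h3 h1 h2
  linarith

theorem sum_lorentz_nat_le (a n : ℕ) (s : ℝ) :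
    ∑ i ∈ Finset.range n, (1 + (s - (a + i + 1 : ℕ)) ^ 2)⁻¹ ≤ 3 * Real.pi := by
  have h1 := sum_lorentz_le (κ := 1) le_rfl s
    ((Finset.range n).image fun i : ℕ => ((a + i + 1 : ℕ) : ℤ))
  rw [Finset.sum_image fun i _ j _ hij => by simpa using hij] at h1
  refine le_trans (le_of_eq (Finset.sum_congr rfl fun i _ => ?_)) h1
  push_cast
  rw [inv_one, div_one, one_div]
  congr 2
  ring

/-- The blocks of an evolved wave function are spread out over the circle: the square function
`(∑_k |G_k|)²` is bounded in the mean, uniformly in time. -/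
theorem integral_sum_norm_blockPoly_sq_le (hL : 1 ≤ L) (hT : |T| ≤ (L : ℝ) ^ 2)
    (hb : ∀ l, b l = inner ℂ (cL2 arcMeasure (mono (-l))) F)
    (hd : ∀ l, d l = inner ℂ (cL2 arcMeasure (mono (-l))) D)
    (hid : ∀ l : ℤ, (T / 2 : ℝ) * (b (l + 1) - b (l - 1)) = Complex.I * l * b l + d l) (a n : ℕ) :
    ∫ z, (∑ i ∈ Finset.range n, ‖blockPoly b L (a + i + 1) z‖) ^ 2 ∂arcMeasure ≤
      3 * Real.pi * (‖F‖ ^ 2 + 12 * (‖D‖ ^ 2 + 3 * ‖F‖ ^ 2)) := by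
  have hpt : ∀ z : Circle, (∑ i ∈ Finset.range n, ‖blockPoly b L (a + i + 1) z‖) ^ 2 ≤
      3 * Real.pi * ∑ i ∈ Finset.range n, (‖blockPoly b L (a + i + 1) z‖ ^ 2 +
        ‖weightedBlock b T L (a + i + 1) z‖ ^ 2) := by
    intro z
    -- Cauchy–Schwarz with the summable weights `(1 + (T Im z / L - k)²)⁻¹`.
    have h1 := Finset.sum_sq_le_sum_mul_sum_of_sq_le_mul (Finset.range n)
      (r := fun i => ‖blockPoly b L (a + i + 1) z‖)
      (f := fun i => (1 + (T / L * (z : ℂ).im - (a + i + 1 : ℕ)) ^ 2)⁻¹)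
      (g := fun i => ‖blockPoly b L (a + i + 1) z‖ ^ 2 + ‖weightedBlock b T L (a + i + 1) z‖ ^ 2)
      (fun i _ => by positivity) (fun i _ => by positivity) (fun i _ => le_of_eq <| by
        rw [weightedBlock_apply, norm_mul, mul_pow, Complex.norm_real, Real.norm_eq_abs, sq_abs]
        field_simp)
    refine h1.trans (mul_le_mul_of_nonneg_right (sum_lorentz_nat_le a n _)
      (Finset.sum_nonneg fun i _ => by positivity))
  have c1 : ∀ f : C(Circle, ℂ), Integrable (fun z => ‖f z‖ ^ 2) arcMeasure := fun f =>
    integrable_of_continuous _ (f.continuous.norm.pow 2)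
  have c2 : ∀ i ∈ Finset.range n, Integrable (fun z => ‖blockPoly b L (a + i + 1) z‖ ^ 2 +
      ‖weightedBlock b T L (a + i + 1) z‖ ^ 2) arcMeasure := fun i _ => (c1 _).add (c1 _)
  have hl : Continuous fun z => (∑ i ∈ Finset.range n, ‖blockPoly b L (a + i + 1) z‖) ^ 2 :=
    (continuous_finsetSum _ fun i _ => (blockPoly b L (a + i + 1)).continuous.norm).pow 2
  refine (integral_mono (integrable_of_continuous _ hl)
    ((integrable_finsetSum _ c2).const_mul _) hpt).trans ?_
  rw [integral_const_mul, integral_finsetSum _ c2]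
  gcongr ?_ * ?_
  have h3 : ∀ i ∈ Finset.range n, ∫ z, (‖blockPoly b L (a + i + 1) z‖ ^ 2 +
      ‖weightedBlock b T L (a + i + 1) z‖ ^ 2) ∂arcMeasure =
      ‖cL2 arcMeasure (blockPoly b L (a + i + 1))‖ ^ 2 +
        ‖cL2 arcMeasure (weightedBlock b T L (a + i + 1))‖ ^ 2 := fun i _ => by
    rw [integral_add (c1 _) (c1 _), norm_cL2_sq, norm_cL2_sq]
  rw [Finset.sum_congr rfl h3, Finset.sum_add_distrib]
  exact add_le_add (sum_norm_blockPoly_sq_le hL hb a n)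
    (sum_norm_weightedBlock_sq_le hL hT hb hd hid a n)

end Blocks

/-! ### Replacing the index by its value in a block -/

section Telescoping

/-- A sequence of vectors that are orthogonal at distance `4` is almost orthogonal. -/
theorem norm_sum_sq_le_of_inner_eq_zero {H : Type*} [NormedAddCommGroup H] [InnerProductSpace ℂ H]
    {Y : ℕ → H} (hY : ∀ i j, i + 4 ≤ j → inner ℂ (Y i) (Y j) = 0) (n : ℕ) :
    ‖∑ i ∈ Finset.range n, Y i‖ ^ 2 ≤ 7 * ∑ i ∈ Finset.range n, ‖Y i‖ ^ 2 := by
  have h1 : ‖∑ i ∈ Finset.range n, Y i‖ ^ 2 =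
      ∑ i ∈ Finset.range n, ∑ j ∈ Finset.range n, (inner ℂ (Y i) (Y j)).re := by
    have h2 := inner_self_eq_norm_sq_to_K (𝕜 := ℂ) (∑ i ∈ Finset.range n, Y i)
    rw [sum_inner] at h2
    simp only [inner_sum] at h2
    have h3 := congrArg Complex.re h2
    rw [Complex.re_sum] at h3
    simp only [Complex.re_sum] at h3
    rw [h3]
    norm_cast
  have h4 : ∀ i j, (inner ℂ (Y i) (Y j)).re ≤
      (if i < j + 4 ∧ j < i + 4 then 1 else 0) * ((‖Y i‖ ^ 2 + ‖Y j‖ ^ 2) / 2) := by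
    intro i j
    split_ifs with h
    · have h5 := (Complex.re_le_norm _).trans (norm_inner_le_norm (𝕜 := ℂ) (Y i) (Y j))
      nlinarith [sq_nonneg (‖Y i‖ - ‖Y j‖)]
    · rw [not_and_or, not_lt, not_lt] at h
      rcases h with h | h
      · rw [inner_eq_zero_symm.1 (hY j i h)]
        simp
      · rw [hY i j h]
        simp
  have hcount : ∀ i, ∑ j ∈ Finset.range n, (if i < j + 4 ∧ j < i + 4 then (1 : ℝ) else 0) ≤ 7 := by
    intro i
    rw [Finset.sum_boole]
    have h6 : ({j ∈ Finset.range n | i < j + 4 ∧ j < i + 4}).card ≤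
        (Finset.Ico (i - 3) (i + 4)).card := by
      apply Finset.card_le_card
      intro j hj
      have := (Finset.mem_filter.1 hj).2
      rw [Finset.mem_Ico]
      omega
    rw [Nat.card_Ico] at h6
    exact_mod_cast h6.trans (by omega)
  set w : ℕ → ℕ → ℝ := fun i j => if i < j + 4 ∧ j < i + 4 then 1 else 0 with hw
  have hwsymm : ∀ i j, w i j = w j i := fun i j => by
    simp only [hw]
    congr 1
    rw [and_comm]
  rw [h1]
  refine (Finset.sum_le_sum fun i _ => Finset.sum_le_sum fun j _ => h4 i j).trans ?_
  have h7 : ∑ i ∈ Finset.range n, ∑ j ∈ Finset.range n, w i j * ((‖Y i‖ ^ 2 + ‖Y j‖ ^ 2) / 2) =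
      ∑ i ∈ Finset.range n, (∑ j ∈ Finset.range n, w i j) * ‖Y i‖ ^ 2 := by
    have h8 : ∑ i ∈ Finset.range n, ∑ j ∈ Finset.range n, w i j * ‖Y j‖ ^ 2 =
        ∑ i ∈ Finset.range n, ∑ j ∈ Finset.range n, w i j * ‖Y i‖ ^ 2 := by
      rw [Finset.sum_comm]
      simp only [hwsymm]
    have h9 : ∀ i j, w i j * ((‖Y i‖ ^ 2 + ‖Y j‖ ^ 2) / 2) =
        2⁻¹ * (w i j * ‖Y i‖ ^ 2) + 2⁻¹ * (w i j * ‖Y j‖ ^ 2) := fun i j => by ring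
    simp only [h9, Finset.sum_add_distrib, ← Finset.mul_sum, h8]
    rw [← add_mul]
    norm_num
    simp only [Finset.sum_mul]
  rw [h7, Finset.mul_sum]
  exact Finset.sum_le_sum fun i _ => mul_le_mul_of_nonneg_right (hcount i) (sq_nonneg _)

variable {σ : Measure Circle} [IsProbabilityMeasure σ]

/-- The error made in the block around `(k + 1) L` by replacing `φ_{2l}^*` with `φ_{2kL}^*`. -/
noncomputable def blockError (σ : Measure Circle) [IsProbabilityMeasure σ] (b : ℤ → ℂ) (L k : ℕ) :
    Lp ℂ 2 σ :=
  ∑ l ∈ Finset.Icc ((k : ℤ) * L) ((k + 2) * L), ((blockTent L (k + 1) l : ℂ) * b l) •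
    (starVec σ (-l) (2 * l.toNat) - starVec σ (-l) (2 * k * L))

/-- Errors in well separated blocks are orthogonal: between the functions `z^{-l} φ_n^*` that occur
in them, the index `n` grows by at least as much as `l`. -/
theorem inner_blockError (hσ : NonDegenerate σ) (b : ℤ → ℂ) {L : ℕ} (hL : 1 ≤ L) {i j : ℕ}
    (h : i + 4 ≤ j) : inner ℂ (blockError σ b L i) (blockError σ b L j) = 0 := by
  rw [inner_eq_zero_symm, blockError, blockError, sum_inner]
  refine Finset.sum_eq_zero fun m hm => ?_
  rw [inner_sum]
  refine Finset.sum_eq_zero fun l hl => ?_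
  rw [Finset.mem_Icc] at hm hl
  have hij : ((i : ℤ) + 4) * L ≤ j * L := by
    have : (i : ℤ) + 4 ≤ j := by exact_mod_cast h
    gcongr
  have hL' : (1 : ℤ) ≤ L := by exact_mod_cast hL
  have hi0 : 0 ≤ (i : ℤ) * L := by positivity
  have hl0 : ((2 * l.toNat : ℕ) : ℤ) = 2 * l := by
    push_cast
    rw [Int.toNat_of_nonneg (hi0.trans hl.1)]
  have hm0 : ((2 * m.toNat : ℕ) : ℤ) = 2 * m := by
    push_cast
    rw [Int.toNat_of_nonneg (by nlinarith [hm.1])]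
  have hlt : -m < -l := by nlinarith [hm.1, hl.2]
  have hz : ∀ N n : ℕ, (N : ℤ) = 2 * m ∨ (N : ℤ) = 2 * j * L →
      (n : ℤ) = 2 * l ∨ (n : ℤ) = 2 * i * L →
      inner ℂ (starVec σ (-m) N) (starVec σ (-l) n) = 0 := by
    intro N n hN hn
    refine inner_starVec_eq_zero_of_lt hσ hlt ?_
    rcases hN with hN | hN <;> rcases hn with hn | hn <;> rw [hN, hn] <;>
      nlinarith [hm.1, hm.2, hl.1, hl.2]
  rw [inner_smul_left, inner_smul_right, inner_sub_left, inner_sub_right, inner_sub_right,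
    hz _ _ (Or.inl hm0) (Or.inl hl0), hz _ _ (Or.inl hm0) (Or.inr (by push_cast; ring)),
    hz _ _ (Or.inr (by push_cast; ring)) (Or.inl hl0),
    hz _ _ (Or.inr (by push_cast; ring)) (Or.inr (by push_cast; ring))]
  simp

/-- Each of the `2 L + 1` terms of a block error has squared norm at most twice the increment of the
leading coefficients over the block. -/
theorem norm_blockError_sq_le (hσ : NonDegenerate σ) {b : ℤ → ℂ} {L : ℕ} {M : ℝ}
    (hM : ∀ l, ‖b l‖ * (2 * L + 1) ≤ M) (k : ℕ) :
    ‖blockError σ b L k‖ ^ 2 ≤ 2 * M ^ 2 * (lam σ (2 * (k + 2) * L) - lam σ (2 * k * L)) := by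
  set Δ := lam σ (2 * (k + 2) * L) - lam σ (2 * k * L) with hΔ
  have hM0 : 0 ≤ M := le_trans (by positivity) (hM 0)
  have hΔ0 : 0 ≤ Δ := sub_nonneg.2 (lam_mono hσ (by gcongr; omega))
  have h1 : ‖blockError σ b L k‖ ≤ M * Real.sqrt (2 * Δ) := by
    have h2 : ∀ l ∈ Finset.Icc ((k : ℤ) * L) ((k + 2) * L), ‖((blockTent L (k + 1) l : ℂ) * b l) •
        (starVec σ (-l) (2 * l.toNat) - starVec σ (-l) (2 * k * L))‖ ≤
        M / (2 * L + 1) * Real.sqrt (2 * Δ) := by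
      intro l hl
      rw [Finset.mem_Icc] at hl
      have hk0 : 0 ≤ (k : ℤ) * L := by positivity
      have hl0 : (l.toNat : ℤ) = l := Int.toNat_of_nonneg (hk0.trans hl.1)
      have h3 := norm_starVec_sub_sq_le' hσ (-l) (a := 2 * k * L) (n := 2 * k * L)
        (N := 2 * l.toNat) (b := 2 * (k + 2) * L) le_rfl
        (by zify; rw [hl0]; nlinarith [hl.1]) (by zify; rw [hl0]; nlinarith [hl.2])
      have h4' : 0 ≤ blockTent L (k + 1) l := tent_nonneg _
      rw [norm_smul, norm_mul, Complex.norm_real, Real.norm_of_nonneg h4']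
      have h4 : blockTent L (k + 1) l ≤ 1 := tent_le_one _
      have h5 : ‖b l‖ ≤ M / (2 * L + 1) := by
        rw [le_div_iff₀ (by positivity)]
        exact hM l
      refine mul_le_mul ((mul_le_of_le_one_left (norm_nonneg _) h4).trans h5)
        (Real.le_sqrt_of_sq_le h3) (norm_nonneg _) (by positivity)
    refine (norm_sum_le_of_le _ h2).trans_eq ?_
    rw [Finset.sum_const, Int.card_Icc, nsmul_eq_mul]
    have h6 : (((k + 2) * L + 1 - k * L : ℤ).toNat : ℝ) = 2 * L + 1 := by
      rw [show ((k : ℤ) + 2) * L + 1 - k * L = ((2 * L + 1 : ℕ) : ℤ) by push_cast; ring,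
        Int.toNat_natCast]
      push_cast
      ring
    rw [h6]
    field_simp
  calc ‖blockError σ b L k‖ ^ 2 ≤ (M * Real.sqrt (2 * Δ)) ^ 2 := by gcongr
    _ = 2 * M ^ 2 * Δ := by
      rw [mul_pow, Real.sq_sqrt (by positivity)]
      ring

/-- The accumulated block errors are controlled by the remaining variation of the leading
coefficients. -/
theorem norm_sum_blockError_sq_le (hσ : NonDegenerate σ) {b : ℤ → ℂ} {L : ℕ} (hL : 1 ≤ L) {M : ℝ}
    (hM : ∀ l, ‖b l‖ * (2 * L + 1) ≤ M) {B : ℝ} (hB : ∀ n, lam σ n ≤ B) (a n : ℕ) :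
    ‖∑ i ∈ Finset.range n, blockError σ b L (a + i)‖ ^ 2 ≤
      28 * M ^ 2 * (B - lam σ (2 * a * L)) := by
  have h1 := norm_sum_sq_le_of_inner_eq_zero (Y := fun i => blockError σ b L (a + i))
    (fun i j h => inner_blockError hσ b hL (by omega)) n
  refine h1.trans ?_
  have h2 : ∑ i ∈ Finset.range n, ‖blockError σ b L (a + i)‖ ^ 2 ≤
      2 * M ^ 2 * (2 * (B - lam σ (2 * a * L))) := by
    refine (Finset.sum_le_sum fun i _ => norm_blockError_sq_le hσ hM (a + i)).trans ?_
    rw [← Finset.mul_sum]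
    gcongr ?_ * ?_
    set u : ℕ → ℝ := fun i => lam σ (2 * (a + i) * L) with hu
    have h3 : ∑ i ∈ Finset.range n, (lam σ (2 * (a + i + 2) * L) - lam σ (2 * (a + i) * L)) =
        ∑ i ∈ Finset.range n, (u (i + 1) - u i) +
          ∑ i ∈ Finset.range n, (u (i + 1 + 1) - u (i + 1)) := by
      rw [← Finset.sum_add_distrib]
      refine Finset.sum_congr rfl fun i _ => ?_
      simp only [hu]
      rw [show a + (i + 1 + 1) = a + i + 2 by ring]
      ring
    rw [h3, Finset.sum_range_sub, Finset.sum_range_sub (fun i => u (i + 1))]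
    have h4 : u 0 ≤ u (0 + 1) := lam_mono hσ (by gcongr; omega)
    have h5 : u n ≤ B := hB _
    have h6 : u (n + 1) ≤ B := hB _
    have h7 : u 0 = lam σ (2 * a * L) := rfl
    linarith
  linarith

end Telescoping

/-! ### The two asymptotically equal transforms -/

/-- The isometry `e_n ↦ z^{-n}` into `L²(m)`. -/
noncomputable def negMono : L2Seq →ₗᵢ[ℂ] Lp ℂ 2 arcMeasure :=
  (exists_isometry_of_orthonormal
    (orthonormal_mono.comp (fun n : ℕ => -(n : ℤ)) fun i j h => by simpa using h)).choose

theorem negMono_bas (n : ℕ) : negMono (bas n) = cL2 arcMeasure (mono (-n)) :=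
  (exists_isometry_of_orthonormal
    (orthonormal_mono.comp (fun n : ℕ => -(n : ℤ)) fun i j h => by simpa using h)).choose_spec n

/-- The Fourier coefficients of nonpositive index. -/
noncomputable def negCoeff : Lp ℂ 2 arcMeasure →L[ℂ] L2Seq :=
  ContinuousLinearMap.adjoint negMono.toContinuousLinearMap

theorem negCoeff_apply (F : Lp ℂ 2 arcMeasure) (n : ℕ) :
    negCoeff F n = inner ℂ (cL2 arcMeasure (mono (-n))) F := by
  rw [← inner_bas, negCoeff, ContinuousLinearMap.adjoint_inner_right, ← negMono_bas]
  rfl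

theorem norm_negCoeff_le (F : Lp ℂ 2 arcMeasure) : ‖negCoeff F‖ ≤ ‖F‖ :=
  norm_adjoint_isometry_le _ F

theorem norm_negCoeff_sq (F : Lp ℂ 2 arcMeasure) :
    ‖negCoeff F‖ ^ 2 = ∑' n : ℕ, ‖inner ℂ (cL2 arcMeasure (mono (-n))) F‖ ^ 2 := by
  rw [norm_sq_eq]
  simp only [negCoeff_apply]

theorem negCoeff_mono {l : ℤ} (hl : 0 ≤ l) :
    negCoeff (cL2 arcMeasure (mono (-l))) = bas l.toNat := by
  ext n
  rw [negCoeff_apply, orthonormal_iff_ite.1 orthonormal_mono, bas_apply]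
  congr 1
  rw [neg_inj, eq_iff_iff]
  omega

section Blocks
variable {b : ℤ → ℂ} {F : Lp ℂ 2 arcMeasure} {L : ℕ}

/-- The frequencies outside a window contribute little when their coefficients are small. -/
theorem norm_sub_sum_blockPoly_sq_le (hL : 1 ≤ L)
    (hb : ∀ l, b l = inner ℂ (cL2 arcMeasure (mono (-l))) F) {a n : ℕ} {e : ℤ → ℝ} {S : ℝ}
    (he : ∀ l : ℤ, (l : ℝ) < (a + 1) * L ∨ ((a : ℝ) + n) * L < l → ‖b l‖ ^ 2 ≤ e l)
    (he0 : ∀ l, 0 ≤ e l) (hS : HasSum e S) :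
    ‖F - ∑ i ∈ Finset.range n, cL2 arcMeasure (blockPoly b L (a + i + 1))‖ ^ 2 ≤ S := by
  have hL' : (0 : ℝ) < L := by exact_mod_cast hL
  refine hasSum_le (fun l => ?_) (hasSum_norm_inner_mono_sq _) hS
  rw [inner_sub_right, inner_sum, ← hb]
  simp only [inner_mono_blockPoly b hL]
  rw [← Finset.sum_mul, ← Complex.ofReal_sum, sum_blockTent_eq]
  set r := ramp ((l : ℝ) / L - (a + 1)) - ramp ((l : ℝ) / L - (a + 1) - n) with hr
  have h1 : b l - (r : ℂ) * b l = ((1 - r : ℝ) : ℂ) * b l := by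
    push_cast
    ring
  rw [h1, norm_mul, mul_pow, Complex.norm_real, Real.norm_eq_abs, sq_abs]
  by_cases h2 : (l : ℝ) < (a + 1) * L ∨ ((a : ℝ) + n) * L < l
  · have h3 : (1 - r) ^ 2 ≤ 1 := by
      have h4 := sum_blockTent_eq L a n l
      have h5 : 0 ≤ ∑ i ∈ Finset.range n, blockTent L (a + i + 1) l :=
        Finset.sum_nonneg fun i _ => tent_nonneg _
      have h6 := ramp_le_one ((l : ℝ) / L - (a + 1))
      have h7 := ramp_nonneg ((l : ℝ) / L - (a + 1) - n)
      rw [h4] at h5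
      rw [sq_le_one_iff_abs_le_one, abs_le]
      constructor <;> linarith
    exact (mul_le_of_le_one_left (sq_nonneg _) h3).trans (he l h2)
  · rw [not_or, not_lt, not_lt] at h2
    have h3 : r = 1 := by
      rw [hr, ramp_eq_one, ramp_eq_zero, sub_zero]
      · have : (l : ℝ) / L ≤ a + n := (div_le_iff₀ hL').2 h2.2
        linarith
      · have : (a : ℝ) + 1 ≤ l / L := (le_div_iff₀ hL').2 h2.1
        linarith
    rw [h3, sub_self]
    simpa using he0 l

theorem half_blockPoly {σ : Measure Circle} [IsProbabilityMeasure σ] {W : L2Seq →ₗᵢ[ℂ] Lp ℂ 2 σ}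
    (hW : ∀ n, W (bas n) = cL2 σ (halfStar σ n)) (b : ℤ → ℂ) (L k : ℕ) :
    W (negCoeff (cL2 arcMeasure (blockPoly b L (k + 1)))) =
      blockError σ b L k + cL2 σ (phiStarC σ (2 * k * L) * blockPoly b L (k + 1)) := by
  have hI : Finset.Icc ((((k + 1 : ℕ) : ℤ) - 1) * L) ((((k + 1 : ℕ) : ℤ) + 1) * L) =
      Finset.Icc ((k : ℤ) * L) ((k + 2) * L) := by
    congr 1
    all_goals (push_cast; ring_nf)
  rw [blockPoly, hI, blockError, Finset.mul_sum]
  simp only [map_sum, ← Finset.sum_add_distrib]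
  refine Finset.sum_congr rfl fun l hl => ?_
  have hl0 : 0 ≤ l := le_trans (by positivity) (Finset.mem_Icc.1 hl).1
  rw [map_smul, map_smul, map_smul, negCoeff_mono hl0, hW, mul_smul_comm, map_smul, ← smul_add,
    halfStar_eq_starVec, Int.toNat_of_nonneg hl0, mul_comm (phiStarC σ _), ← starVec,
    sub_add_cancel]

end Blocks

theorem measurable_ofReal_norm_sq {σ : Measure Circle} (Ψ : Lp ℂ 2 σ) :
    Measurable fun z => ENNReal.ofReal (‖Ψ z‖ ^ 2) :=
  ((Lp.stronglyMeasurable Ψ).measurable.norm.pow_const 2).ennreal_ofReal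

section Boundary
variable {σ : Measure Circle} {Ψ : Lp ℂ 2 σ}

/-- A property that holds Lebesgue-a.e. holds `σ`-a.e. where `Ψ` does not vanish. -/
theorem ae_of_ae_arcMeasure
    (h : σ.withDensity (fun z => ENNReal.ofReal (‖Ψ z‖ ^ 2)) = arcMeasure) {P : Circle → Prop}
    (hP : ∀ᵐ z ∂arcMeasure, P z) : ∀ᵐ z ∂σ, Ψ z ≠ 0 → P z := by
  rw [← h, ae_withDensity_iff (measurable_ofReal_norm_sq Ψ)] at hP
  filter_upwards [hP] with z hz h0
  apply hz
  have : 0 < ‖Ψ z‖ ^ 2 := by positivity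
  exact (ENNReal.ofReal_pos.2 this).ne'

theorem lintegral_norm_mul_limit
    (h : σ.withDensity (fun z => ENNReal.ofReal (‖Ψ z‖ ^ 2)) = arcMeasure) {f : Circle → ℂ}
    (hf : Measurable f) :
    ∫⁻ z, ENNReal.ofReal (‖Ψ z * f z‖ ^ 2) ∂σ = ∫⁻ z, ENNReal.ofReal (‖f z‖ ^ 2) ∂arcMeasure := by
  rw [← h, lintegral_withDensity_eq_lintegral_mul _ (measurable_ofReal_norm_sq Ψ)
    (hf.norm.pow_const 2).ennreal_ofReal]
  congr 1
  ext z
  rw [Pi.mul_apply, ← ENNReal.ofReal_mul (by positivity), norm_mul, mul_pow]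

theorem eLpNorm_two_eq {μ : Measure Circle} (f : Circle → ℂ) :
    eLpNorm f 2 μ = (∫⁻ z, ENNReal.ofReal (‖f z‖ ^ 2) ∂μ) ^ (1 / 2 : ℝ) := by
  rw [eLpNorm_eq_lintegral_rpow_enorm_toReal (by norm_num) (by norm_num)]
  congr 1
  · apply lintegral_congr
    intro z
    rw [ENNReal.ofReal_pow (norm_nonneg _), ofReal_norm]
    norm_num

theorem eLpNorm_limit_mul
    (h : σ.withDensity (fun z => ENNReal.ofReal (‖Ψ z‖ ^ 2)) = arcMeasure) {f : Circle → ℂ}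
    (hf : Measurable f) : eLpNorm (fun z => Ψ z * f z) 2 σ = eLpNorm f 2 arcMeasure := by
  rw [eLpNorm_two_eq, eLpNorm_two_eq, lintegral_norm_mul_limit h hf]

theorem memLp_limit_mul
    (h : σ.withDensity (fun z => ENNReal.ofReal (‖Ψ z‖ ^ 2)) = arcMeasure)
    (F : Lp ℂ 2 arcMeasure) : MemLp (fun z => Ψ z * F z) 2 σ := by
  have hF := (Lp.stronglyMeasurable F).measurable
  refine ⟨((Lp.stronglyMeasurable Ψ).measurable.mul hF).aestronglyMeasurable, ?_⟩
  rw [eLpNorm_limit_mul h hF]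
  exact (Lp.memLp F).2

/-- Multiplication by `Ψ`, an isometry from `L²(m)` into `L²(σ)`. -/
noncomputable def limitMul (h : σ.withDensity (fun z => ENNReal.ofReal (‖Ψ z‖ ^ 2)) = arcMeasure) :
    Lp ℂ 2 arcMeasure →ₗᵢ[ℂ] Lp ℂ 2 σ where
  toFun F := (memLp_limit_mul h F).toLp _
  map_add' F G := by
    apply Lp.ext
    filter_upwards [(memLp_limit_mul h (F + G)).coeFn_toLp, (memLp_limit_mul h F).coeFn_toLp,
      (memLp_limit_mul h G).coeFn_toLp, ae_of_ae_arcMeasure h (Lp.coeFn_add F G),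
      Lp.coeFn_add ((memLp_limit_mul h F).toLp _) ((memLp_limit_mul h G).toLp _)]
      with z h1 h2 h3 h4 h5
    rw [h5, Pi.add_apply, h1, h2, h3]
    by_cases h0 : Ψ z = 0
    · simp [h0]
    · rw [h4 h0, Pi.add_apply, mul_add]
  map_smul' c F := by
    apply Lp.ext
    filter_upwards [(memLp_limit_mul h (c • F)).coeFn_toLp, (memLp_limit_mul h F).coeFn_toLp,
      ae_of_ae_arcMeasure h (Lp.coeFn_smul c F),
      Lp.coeFn_smul c ((memLp_limit_mul h F).toLp _)] with z h1 h2 h3 h4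
    rw [RingHom.id_apply, h4, Pi.smul_apply, h1, h2]
    by_cases h0 : Ψ z = 0
    · simp [h0]
    · rw [h3 h0, Pi.smul_apply, smul_eq_mul, smul_eq_mul]
      ring
  norm_map' F := by
    change ‖(memLp_limit_mul h F).toLp _‖ = ‖F‖
    rw [Lp.norm_toLp, eLpNorm_limit_mul h (Lp.stronglyMeasurable F).measurable, Lp.norm_def]

variable (h : σ.withDensity (fun z => ENNReal.ofReal (‖Ψ z‖ ^ 2)) = arcMeasure)

theorem coeFn_limitMul (F : Lp ℂ 2 arcMeasure) : limitMul h F =ᵐ[σ] fun z => Ψ z * F z :=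
  (memLp_limit_mul h F).coeFn_toLp

theorem coeFn_limitMul_of_ae {F : Lp ℂ 2 arcMeasure} {f : Circle → ℂ} (hf : F =ᵐ[arcMeasure] f) :
    limitMul h F =ᵐ[σ] fun z => Ψ z * f z := by
  filter_upwards [coeFn_limitMul h F, ae_of_ae_arcMeasure h hf] with z h1 h2
  rw [h1]
  by_cases h0 : Ψ z = 0
  · simp [h0]
  · rw [h2 h0]

theorem limitMul_waveOp [IsFiniteMeasure σ] (T : ℝ) (F : Lp ℂ 2 arcMeasure) :
    limitMul h (waveOp arcMeasure T F) = waveOp σ T (limitMul h F) := by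
  apply Lp.ext
  filter_upwards [coeFn_limitMul_of_ae h (coeFn_waveOp T F), coeFn_waveOp T (limitMul h F),
    coeFn_limitMul h F] with z h1 h2 h3
  rw [h1, h2, h3]
  ring

theorem ae_limit_ne_zero [IsProbabilityMeasure σ]
    (h : σ.withDensity (fun z => ENNReal.ofReal (‖Ψ z‖ ^ 2)) = arcMeasure) :
    ∀ᵐ z ∂arcMeasure, Ψ z ≠ 0 := by
  filter_upwards [norm_limit_sq_mul_acDensity h] with z hz h0
  simp [h0] at hz

/-- Egorov's theorem for `φ_n^* / Ψ → 1`. -/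
theorem exists_uniform_set [IsProbabilityMeasure σ]
    (h : σ.withDensity (fun z => ENNReal.ofReal (‖Ψ z‖ ^ 2)) = arcMeasure)
    (hlim : ∀ᵐ z ∂arcMeasure, Tendsto (fun n => phiStar σ n z) atTop (𝓝 (Ψ z)))
    {δ : ℝ} (hδ : 0 < δ) :
    ∃ A : Set Circle, MeasurableSet A ∧ arcMeasure A ≤ ENNReal.ofReal δ ∧
      ∀ ε > 0, ∃ N, ∀ n ≥ N, ∀ z ∉ A, ‖phiStar σ n z - Ψ z‖ ≤ ε * ‖Ψ z‖ := by
  have hΨ := Lp.stronglyMeasurable Ψ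
  obtain ⟨t, ht, hmt, hu⟩ := tendstoUniformlyOn_of_ae_tendsto' (μ := arcMeasure)
    (f := fun n z => phiStar σ n z / Ψ z) (g := fun _ => (1 : ℂ))
    (fun n => ((continuous_phiStar n).measurable.div hΨ.measurable).stronglyMeasurable)
    stronglyMeasurable_const (by
      filter_upwards [hlim, ae_limit_ne_zero h] with z hz h0
      have := hz.div_const (Ψ z)
      rwa [div_self h0] at this) hδ
  have h0 : MeasurableSet {z | Ψ z = 0} := hΨ.measurable (measurableSet_singleton 0)
  refine ⟨t ∪ {z | Ψ z = 0}, ht.union h0, ?_, fun ε hε => ?_⟩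
  · refine (measure_union_le _ _).trans ?_
    have h1 : arcMeasure {z | Ψ z = 0} = 0 := by
      have := ae_iff.1 (ae_limit_ne_zero h)
      simpa using this
    rwa [h1, add_zero]
  · obtain ⟨N, hN⟩ := eventually_atTop.1 (Metric.tendstoUniformlyOn_iff.1 hu ε hε)
    refine ⟨N, fun n hn z hz => ?_⟩
    rw [Set.mem_union, not_or] at hz
    have h2 := (hN n hn z hz.1).le
    rw [dist_comm, dist_eq_norm] at h2
    have h3 : phiStar σ n z - Ψ z = (phiStar σ n z / Ψ z - 1) * Ψ z := by
      rw [sub_mul, div_mul_cancel₀ _ hz.2, one_mul]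
    rw [h3, norm_mul]
    gcongr

end Boundary

/-! ### Restriction to subsets of the circle -/

section Indicator
variable {μ : Measure Circle} {A : Set Circle}

/-- Multiplication by the indicator function of a measurable set on `L²(μ)`. -/
noncomputable def indL2 (μ : Measure Circle) (hA : MeasurableSet A) : Lp ℂ 2 μ →L[ℂ] Lp ℂ 2 μ :=
  LinearMap.mkContinuous
    { toFun := fun F => ((Lp.memLp F).indicator hA).toLp _
      map_add' := fun F G => by
        apply Lp.ext
        filter_upwards [((Lp.memLp (F + G)).indicator hA).coeFn_toLp,
          ((Lp.memLp F).indicator hA).coeFn_toLp, ((Lp.memLp G).indicator hA).coeFn_toLp,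
          Lp.coeFn_add F G, Lp.coeFn_add (((Lp.memLp F).indicator hA).toLp _)
            (((Lp.memLp G).indicator hA).toLp _)] with z h1 h2 h3 h4 h5
        rw [h5, Pi.add_apply, h1, h2, h3]
        by_cases hz : z ∈ A
        · simp only [Set.indicator_of_mem hz]
          rw [h4, Pi.add_apply]
        · simp only [Set.indicator_of_notMem hz, add_zero]
      map_smul' := fun c F => by
        apply Lp.ext
        filter_upwards [((Lp.memLp (c • F)).indicator hA).coeFn_toLp,
          ((Lp.memLp F).indicator hA).coeFn_toLp,
          Lp.coeFn_smul c F, Lp.coeFn_smul c (((Lp.memLp F).indicator hA).toLp _)]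
            with z h1 h2 h3 h4
        rw [RingHom.id_apply, h4, Pi.smul_apply, h1, h2]
        by_cases hz : z ∈ A
        · simp only [Set.indicator_of_mem hz]
          rw [h3, Pi.smul_apply]
        · simp only [Set.indicator_of_notMem hz, smul_zero] } 1 (fun F => by
    rw [one_mul]
    refine Lp.norm_le_norm_of_ae_le ?_
    filter_upwards [((Lp.memLp F).indicator hA).coeFn_toLp] with z hz
    exact (congrArg norm hz).trans_le (norm_indicator_le_norm_self _ _))

theorem coeFn_indL2 (hA : MeasurableSet A) (F : Lp ℂ 2 μ) :
    indL2 μ hA F =ᵐ[μ] A.indicator F := ((Lp.memLp F).indicator hA).coeFn_toLp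

theorem norm_indL2_le (hA : MeasurableSet A) (F : Lp ℂ 2 μ) : ‖indL2 μ hA F‖ ≤ ‖F‖ := by
  refine Lp.norm_le_norm_of_ae_le ?_
  filter_upwards [coeFn_indL2 hA F] with z hz
  exact (congrArg norm hz).trans_le (norm_indicator_le_norm_self _ _)

theorem inner_indL2_left (hA : MeasurableSet A) (F G : Lp ℂ 2 μ) :
    inner ℂ (indL2 μ hA F) G = inner ℂ F (indL2 μ hA G) := by
  rw [L2.inner_def, L2.inner_def]
  apply integral_congr_ae
  filter_upwards [coeFn_indL2 hA F, coeFn_indL2 hA G] with z h1 h2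
  rw [h1, h2]
  by_cases hz : z ∈ A <;> simp [hz]

theorem indL2_add_indL2_compl (hA : MeasurableSet A) (F : Lp ℂ 2 μ) :
    indL2 μ hA F + indL2 μ hA.compl F = F := by
  apply Lp.ext
  filter_upwards [coeFn_indL2 hA F, coeFn_indL2 hA.compl F,
    Lp.coeFn_add (indL2 μ hA F) (indL2 μ hA.compl F)] with z h1 h2 h3
  rw [h3, Pi.add_apply, h1, h2]
  by_cases hz : z ∈ A <;> simp [hz]

theorem norm_indL2_sq_le [IsFiniteMeasure μ] (hA : MeasurableSet A) {F : Lp ℂ 2 μ} {K : ℝ}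
    (hK : ∀ᵐ z ∂μ, ‖F z‖ ≤ K) : ‖indL2 μ hA F‖ ^ 2 ≤ K ^ 2 * μ.real A := by
  rw [lp_norm_sq]
  have h1 : ∫ z, ‖indL2 μ hA F z‖ ^ 2 ∂μ ≤ ∫ z, A.indicator (fun _ => K ^ 2) z ∂μ := by
    refine integral_mono_ae (integrable_norm_sq _) ((integrable_const _).indicator hA) ?_
    filter_upwards [coeFn_indL2 hA F, hK] with z h1 h2
    simp only [h1]
    by_cases hz : z ∈ A
    · simp only [Set.indicator_of_mem hz]
      gcongr
    · simp [hz]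
  refine h1.trans (le_of_eq ?_)
  rw [integral_indicator_const _ hA, smul_eq_mul, mul_comm]

/-- Two vectors, the first of which is not longer than the second, are close to each other if they
are close on a set that carries most of the second. -/
theorem norm_sub_sq_le_of_indL2 (hA : MeasurableSet A) {X Z : Lp ℂ 2 μ} (h : ‖X‖ ≤ ‖Z‖) :
    ‖X - Z‖ ^ 2 ≤ 2 * ‖indL2 μ hA.compl (X - Z)‖ * ‖Z‖ + 4 * ‖Z‖ * ‖indL2 μ hA Z‖ := by
  have h1 : ‖X‖ ^ 2 = ‖X - Z‖ ^ 2 + 2 * (inner ℂ (X - Z) Z).re + ‖Z‖ ^ 2 := by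
    have := norm_add_sq (𝕜 := ℂ) (X - Z) Z
    rwa [sub_add_cancel] at this
  have h2 : ‖X‖ ^ 2 ≤ ‖Z‖ ^ 2 := by gcongr
  have h3 : inner ℂ (X - Z) Z =
      inner ℂ (indL2 μ hA.compl (X - Z)) Z + inner ℂ (X - Z) (indL2 μ hA Z) := by
    rw [inner_indL2_left, add_comm, ← inner_add_right, indL2_add_indL2_compl]
  have h4 := norm_inner_le_norm (𝕜 := ℂ) (indL2 μ hA.compl (X - Z)) Z
  have h5 := norm_inner_le_norm (𝕜 := ℂ) (X - Z) (indL2 μ hA Z)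
  have h6 := Complex.abs_re_le_norm (inner ℂ (indL2 μ hA.compl (X - Z)) Z)
  have h7 := Complex.abs_re_le_norm (inner ℂ (X - Z) (indL2 μ hA Z))
  have h8 : ‖X - Z‖ ≤ 2 * ‖Z‖ := (norm_sub_le _ _).trans (by linarith)
  have h9 : ‖X - Z‖ * ‖indL2 μ hA Z‖ ≤ 2 * ‖Z‖ * ‖indL2 μ hA Z‖ := by gcongr
  rw [h3, Complex.add_re] at h1
  have h10 := (abs_le.1 h6).1
  have h11 := (abs_le.1 h7).1
  linarith

end Indicator

/-! ### The half-line transform of a packet -/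

section Packet
variable {σ : Measure Circle} [IsProbabilityMeasure σ] {Ψ : Lp ℂ 2 σ} {b d : ℤ → ℂ}
  {F D : Lp ℂ 2 arcMeasure} {L : ℕ}

theorem limitMul_indL2 {σ : Measure Circle} {Ψ : Lp ℂ 2 σ}
    (h : σ.withDensity (fun z => ENNReal.ofReal (‖Ψ z‖ ^ 2)) = arcMeasure)
    {A : Set Circle} (hA : MeasurableSet A) (F : Lp ℂ 2 arcMeasure) :
    limitMul h (indL2 arcMeasure hA F) = indL2 σ hA (limitMul h F) := by
  apply Lp.ext
  filter_upwards [coeFn_limitMul_of_ae h (coeFn_indL2 hA F), coeFn_indL2 hA (limitMul h F),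
    coeFn_limitMul h F] with z h1 h2 h3
  rw [h1, h2]
  by_cases hz : z ∈ A
  · simp only [Set.indicator_of_mem hz]
    rw [h3]
  · simp only [Set.indicator_of_notMem hz, mul_zero]

/-- Off the exceptional set `A`, the half-line transform of a packet whose frequencies form the
blocks `a + 1, …, a + n` is close to the product of the packet with `Ψ`. -/
theorem norm_indL2_half_sub_limitMul_le (hσ : NonDegenerate σ) {W : L2Seq →ₗᵢ[ℂ] Lp ℂ 2 σ}
    (hW : ∀ n, W (bas n) = cL2 σ (halfStar σ n))
    (h : σ.withDensity (fun z => ENNReal.ofReal (‖Ψ z‖ ^ 2)) = arcMeasure)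
    (hL : 1 ≤ L) {T : ℝ} (hT : |T| ≤ (L : ℝ) ^ 2)
    (hb : ∀ l, b l = inner ℂ (cL2 arcMeasure (mono (-l))) F)
    (hd : ∀ l, d l = inner ℂ (cL2 arcMeasure (mono (-l))) D)
    (hid : ∀ l : ℤ, (T / 2 : ℝ) * (b (l + 1) - b (l - 1)) = Complex.I * l * b l + d l) {a n : ℕ}
    {S : ℝ} (hS : ‖F - ∑ i ∈ Finset.range n, cL2 arcMeasure (blockPoly b L (a + i + 1))‖ ^ 2 ≤ S)
    {M : ℝ} (hM : ∀ l, ‖b l‖ * (2 * L + 1) ≤ M) {B : ℝ} (hB : ∀ n, lam σ n ≤ B)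
    {A : Set Circle} (hA : MeasurableSet A) {ε : ℝ} (hε : 0 ≤ ε)
    (hu : ∀ i, ∀ z ∉ A, ‖phiStar σ (2 * (a + i) * L) z - Ψ z‖ ≤ ε * ‖Ψ z‖) :
    ‖indL2 σ hA.compl (W (negCoeff F) - limitMul h F)‖ ≤ 2 * Real.sqrt S +
      Real.sqrt (28 * M ^ 2 * (B - lam σ (2 * a * L))) +
      ε * Real.sqrt (3 * Real.pi * (‖F‖ ^ 2 + 12 * (‖D‖ ^ 2 + 3 * ‖F‖ ^ 2))) := by
  set G : ℕ → C(Circle, ℂ) := fun i => blockPoly b L (a + i + 1) with hG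
  -- Three errors: the frequencies outside the blocks (`R`), the change of index in each block
  -- (`E`), and the distance of `φ_n^*` from `Ψ` on the complement of `A` (`Q`).
  set R := F - ∑ i ∈ Finset.range n, cL2 arcMeasure (G i) with hR
  set E := ∑ i ∈ Finset.range n, blockError σ b L (a + i) with hE
  set Q := ∑ i ∈ Finset.range n,
    (cL2 σ (phiStarC σ (2 * (a + i) * L) * G i) - limitMul h (cL2 arcMeasure (G i))) with hQ
  have hdec : W (negCoeff F) - limitMul h F = (W (negCoeff R) - limitMul h R) + E + Q := by
    have hF : F = R + ∑ i ∈ Finset.range n, cL2 arcMeasure (G i) := by rw [hR]; abel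
    have h1 : W (negCoeff (∑ i ∈ Finset.range n, cL2 arcMeasure (G i))) -
        limitMul h (∑ i ∈ Finset.range n, cL2 arcMeasure (G i)) = E + Q := by
      simp only [map_sum, hE, hQ, ← Finset.sum_add_distrib, ← Finset.sum_sub_distrib]
      refine Finset.sum_congr rfl fun i _ => ?_
      rw [hG, half_blockPoly hW]
      abel
    conv_lhs => rw [hF]
    rw [map_add, map_add, map_add, add_assoc, ← h1]
    abel
  have hRn : ‖R‖ ≤ Real.sqrt S := Real.le_sqrt_of_sq_le hS
  have hEn : ‖E‖ ≤ Real.sqrt (28 * M ^ 2 * (B - lam σ (2 * a * L))) :=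
    Real.le_sqrt_of_sq_le (norm_sum_blockError_sq_le hσ hL hM hB a n)
  set g : C(Circle, ℂ) := ⟨fun z => ((∑ i ∈ Finset.range n, ‖G i z‖ : ℝ) : ℂ), by fun_prop⟩ with hg
  have hgn : ‖cL2 arcMeasure g‖ ≤
      Real.sqrt (3 * Real.pi * (‖F‖ ^ 2 + 12 * (‖D‖ ^ 2 + 3 * ‖F‖ ^ 2))) := by
    refine Real.le_sqrt_of_sq_le ?_
    rw [norm_cL2_sq]
    refine le_trans (le_of_eq (integral_congr_ae (.of_forall fun z => ?_)))
      (integral_sum_norm_blockPoly_sq_le hL hT hb hd hid a n)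
    simp only [hg, ContinuousMap.coe_mk, Complex.norm_real, Real.norm_eq_abs, sq_abs, hG]
  have hQn : ‖indL2 σ hA.compl Q‖ ≤ ε * ‖limitMul h (cL2 arcMeasure g)‖ := by
    have h1 : ∀ᵐ z ∂σ, Q z = ∑ i ∈ Finset.range n,
        (cL2 σ (phiStarC σ (2 * (a + i) * L) * G i) - limitMul h (cL2 arcMeasure (G i))) z := by
      have := Lp.coeFn_finsetSum (p := 2) (μ := σ) (Finset.range n) fun i =>
        (cL2 σ (phiStarC σ (2 * (a + i) * L) * G i) - limitMul h (cL2 arcMeasure (G i)))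
      filter_upwards [this] with z hz
      rw [hQ, hz, Finset.sum_apply]
    have h2 : ∀ᵐ z ∂σ, ∀ i : ℕ,
        (cL2 σ (phiStarC σ (2 * (a + i) * L) * G i) - limitMul h (cL2 arcMeasure (G i))) z =
          (phiStar σ (2 * (a + i) * L) z - Ψ z) * G i z := by
      refine ae_all_iff.2 fun i => ?_
      filter_upwards [Lp.coeFn_sub (cL2 σ (phiStarC σ (2 * (a + i) * L) * G i))
        (limitMul h (cL2 arcMeasure (G i))), coeFn_cL2 σ (phiStarC σ (2 * (a + i) * L) * G i),
        coeFn_limitMul_of_ae h (coeFn_cL2 arcMeasure (G i))] with z h1 h2 h3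
      rw [h1, Pi.sub_apply, h2, h3, ContinuousMap.mul_apply, phiStarC_apply]
      ring
    refine Lp.norm_le_mul_norm_of_ae_le_mul ?_
    filter_upwards [coeFn_indL2 hA.compl Q, h1, h2, coeFn_limitMul_of_ae h (coeFn_cL2 arcMeasure g)]
      with z h3 h4 h5 h6
    rw [h3, h6]
    by_cases hz : z ∈ A
    · rw [Set.indicator_of_notMem (by simpa using hz), norm_zero]
      positivity
    · rw [Set.indicator_of_mem (by simpa using hz), h4, norm_mul, hg, ContinuousMap.coe_mk,
        Complex.norm_real, Real.norm_of_nonneg (by positivity), ← mul_assoc, Finset.mul_sum]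
      refine (norm_sum_le _ _).trans (Finset.sum_le_sum fun i _ => ?_)
      rw [h5, norm_mul]
      exact mul_le_mul_of_nonneg_right (hu i z hz) (norm_nonneg _)
  rw [(limitMul h).norm_map] at hQn
  have h1 : ‖indL2 σ hA.compl (W (negCoeff R) - limitMul h R)‖ ≤ 2 * Real.sqrt S := by
    refine (norm_indL2_le _ _).trans ((norm_sub_le _ _).trans ?_)
    rw [W.norm_map, (limitMul h).norm_map]
    linarith [norm_negCoeff_le R]
  rw [hdec, map_add, map_add]
  refine (norm_add₃_le).trans (add_le_add (add_le_add h1 ((norm_indL2_le _ _).trans hEn)) ?_)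
  exact hQn.trans (mul_le_mul_of_nonneg_left hgn hε)

end Packet

/-! ### Asymptotics of the half-line transform for functions on arcs -/

/-- The objects attached to a Szegő measure with pointwise convergence: the limit `Ψ` of `φ_n^*`,
with `|Ψ|² dσ = dm`, and the half-line transform `W`, which takes the basis of `ℓ²` to the
orthonormal system `z^{-n} φ_{2n}^*`. -/
structure HalfModel (σ : Measure Circle) [IsProbabilityMeasure σ] (Ψ : Lp ℂ 2 σ)
    (W : L2Seq →ₗᵢ[ℂ] Lp ℂ 2 σ) (B : ℝ) : Prop where
  nonDegenerate : NonDegenerate σ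
  tendsto_lam : Tendsto (lam σ) atTop (𝓝 B)
  half : ∀ n, W (bas n) = cL2 σ (halfStar σ n)
  density : σ.withDensity (fun z => ENNReal.ofReal (‖Ψ z‖ ^ 2)) = arcMeasure
  ae_tendsto : ∀ᵐ z ∂arcMeasure, Tendsto (fun n => phiStar σ n z) atTop (𝓝 (Ψ z))

/-- A function supported where `Im z` is bounded away from `0`, on the side `ς`, and where `Re z`
is bounded away from `0`. -/
structure ArcAmplitude.OnSide {φ φ' : ℝ → ℂ} {α β : ℝ} (_ : ArcAmplitude φ φ' α β) (c ς : ℝ) :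
    Prop where
  pos : 0 < c
  sign : ς = 1 ∨ ς = -1
  cos : (∀ t ∈ Set.Icc α β, c ≤ Real.cos t) ∨ (∀ t ∈ Set.Icc α β, Real.cos t ≤ -c)
  sin : ∀ t ∈ Set.Icc α β, c ≤ ς * Real.sin t

section Asymptotics
variable {φ φ' : ℝ → ℂ} {α β c ς : ℝ} {h : ArcAmplitude φ φ' α β}

theorem ArcAmplitude.OnSide.cos_weak (hs : h.OnSide c ς) :
    (∀ t ∈ Set.Icc α β, 0 ≤ Real.cos t) ∨ (∀ t ∈ Set.Icc α β, Real.cos t ≤ 0) :=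
  hs.cos.imp (fun h1 t ht => hs.pos.le.trans (h1 t ht))
    fun h1 t ht => (h1 t ht).trans (neg_nonpos.2 hs.pos.le)

theorem ArcAmplitude.OnSide.abs_sign (hs : h.OnSide c ς) : |ς| = 1 := by
  rcases hs.sign with rfl | rfl <;> norm_num

theorem ArcAmplitude.OnSide.le_one (hs : h.OnSide c ς) : c ≤ 1 := by
  have h1 := hs.sin α ⟨le_rfl, h.le⟩
  refine h1.trans ((le_abs_self _).trans ?_)
  rw [abs_mul, hs.abs_sign, one_mul]
  exact Real.abs_sin_le_one _

theorem ArcAmplitude.OnSide.mul_sin_le (hs : h.OnSide c ς) (t : ℝ) : ς * Real.sin t ≤ 1 := by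
  refine (le_abs_self _).trans ?_
  rw [abs_mul, hs.abs_sign, one_mul]
  exact Real.abs_sin_le_one _

/-- Frequencies away from the range of `T sin t` are not stationary. -/
theorem ArcAmplitude.OnSide.norm_waveCoeff_sq_le (hs : h.OnSide c ς) {s : ℝ} (hs0 : 0 < s) {l : ℤ}
    (hl : (l : ℝ) ≤ c * s / 2 ∨ 2 * s ≤ l) :
    ‖waveCoeff φ (ς * s) l‖ ^ 2 ≤ (16 / c * (∫ t in α..β, ‖φ' t‖)) ^ 2 / (s + |(l : ℝ)|) ^ 2 := by
  have hc := hs.pos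
  have hc1 := hs.le_one
  have hsl : 0 < s + |(l : ℝ)| := by positivity
  have h1 : ‖waveCoeff φ (ς * s) l‖ ≤
      4 / (c / 4 * (s + |(l : ℝ)|)) * ∫ t in α..β, ‖φ' t‖ := by
    refine h.norm_waveCoeff_le_div hs.cos_weak (by positivity) fun t ht => ?_
    have h2 := mul_le_mul_of_nonneg_right (hs.sin t ht) hs0.le
    have h3 := mul_le_mul_of_nonneg_right (hs.mul_sin_le t) hs0.le
    have h4 : ς * s * Real.sin t = ς * Real.sin t * s := by ring
    rw [h4]
    have hcs : c * s ≤ s := mul_le_of_le_one_left hs0.le hc1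
    have hcl : c * |(l : ℝ)| ≤ |(l : ℝ)| := mul_le_of_le_one_left (abs_nonneg _) hc1
    have hcs0 : 0 < c * s := mul_pos hc hs0
    rcases hl with hl | hl
    · rw [abs_sub_comm]
      refine le_trans ?_ (le_abs_self _)
      rcases le_total 0 (l : ℝ) with h5 | h5
      · rw [abs_of_nonneg h5] at hcl ⊢
        nlinarith
      · rw [abs_of_nonpos h5] at hcl ⊢
        nlinarith
    · refine le_trans ?_ (le_abs_self _)
      have h5 : 0 ≤ (l : ℝ) := by linarith
      rw [abs_of_nonneg h5] at hcl ⊢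
      nlinarith
  rw [← div_pow]
  refine pow_le_pow_left₀ (norm_nonneg _) (h1.trans (le_of_eq ?_)) 2
  field_simp
  ring

theorem summable_inv_add_abs_sq {s : ℝ} (hs : 1 ≤ s) :
    Summable fun l : ℤ => 1 / (s + |(l : ℝ)|) ^ 2 := by
  refine summable_of_sum_le (c := 3 * Real.pi) (fun l => by positivity) fun u => ?_
  refine (Finset.sum_le_sum fun l _ => ?_).trans (sum_lorentz_le (κ := 1) le_rfl 0 u)
  rw [inv_one, sub_zero, div_one]
  gcongr
  nlinarith [abs_nonneg (l : ℝ), sq_abs (l : ℝ)]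

theorem tendsto_tsum_inv_add_abs_sq (K : ℝ) :
    Tendsto (fun s : ℝ => ∑' l : ℤ, K ^ 2 / (s + |(l : ℝ)|) ^ 2) atTop (𝓝 0) := by
  have h1 := tendsto_tsum_of_dominated_convergence (𝓕 := (atTop : Filter ℝ))
    (f := fun s (l : ℤ) => K ^ 2 / (s + |(l : ℝ)|) ^ 2) (g := fun _ => (0 : ℝ))
    (bound := fun l : ℤ => K ^ 2 * (1 / (1 + |(l : ℝ)|) ^ 2))
    ((summable_inv_add_abs_sq le_rfl).mul_left _) (fun l => ?_) ?_
  · simpa using h1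
  · refine Tendsto.const_div_atTop ?_ _
    exact (tendsto_pow_atTop two_ne_zero).comp (tendsto_atTop_add_const_right _ _ tendsto_id)
  · filter_upwards [eventually_ge_atTop 1] with s hs l
    rw [Real.norm_of_nonneg (by positivity), mul_one_div]
    gcongr

variable {σ : Measure Circle} [IsProbabilityMeasure σ] {Ψ : Lp ℂ 2 σ} {W : L2Seq →ₗᵢ[ℂ] Lp ℂ 2 σ}
  {B : ℝ}

/-- Off a set `A` outside of which `φ_n^* → Ψ` uniformly, the half-line transform of an evolving
function on an arc is eventually close to its product with `Ψ`. -/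
theorem ArcAmplitude.OnSide.norm_indL2_half_sub_le (hs : h.OnSide c ς) (hM : HalfModel σ Ψ W B)
    {A : Set Circle} (hA : MeasurableSet A)
    (hu : ∀ ε > 0, ∃ N, ∀ n ≥ N, ∀ z ∉ A, ‖phiStar σ n z - Ψ z‖ ≤ ε * ‖Ψ z‖) {ε : ℝ} (hε : 0 < ε) :
    ∀ᶠ s in atTop, ‖indL2 σ hA.compl (W (negCoeff (waveOp arcMeasure (ς * s)
      (arcLp h.continuous))) -
      limitMul hM.density (waveOp arcMeasure (ς * s) (arcLp h.continuous)))‖ ≤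
      ε * (4 + Real.sqrt (3 * Real.pi * (‖arcLp h.continuous‖ ^ 2 +
        12 * (‖arcLp h.continuous_deriv‖ ^ 2 + 3 * ‖arcLp h.continuous‖ ^ 2)))) := by
  have hc := hs.pos
  obtain ⟨N, hN⟩ := hu ε hε
  set I := ∫ t in α..β, ‖φ' t‖ with hI
  have hI0 : 0 ≤ I := intervalIntegral.integral_nonneg h.le fun t _ => norm_nonneg _
  set M := 50 / Real.sqrt c * I with hMdef
  set K := 16 / c * I with hK
  have hB : ∀ n, lam σ n ≤ B := fun n =>
    (lam_mono hM.nonDegenerate).ge_of_tendsto hM.tendsto_lam n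
  -- Blocks of length `L ≈ √s`. With `a ≈ c √s / 8` the first block starts below `c s / 2`, and
  -- about `2 √s` blocks reach beyond `2 s`, so that the frequencies left out are nonstationary.
  set a : ℝ → ℕ := fun s => ⌊c * Real.sqrt s / 8⌋₊ with ha
  set L : ℝ → ℕ := fun s => ⌈Real.sqrt s⌉₊ with hL
  have hsq : Tendsto Real.sqrt atTop atTop := Real.tendsto_sqrt_atTop
  have hat : Tendsto a atTop atTop := by
    refine tendsto_nat_floor_atTop.comp ?_
    exact (hsq.const_mul_atTop hc).atTop_div_const (by norm_num)
  have hLt : Tendsto L atTop atTop := tendsto_nat_ceil_atTop.comp hsq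
  have ev1 : ∀ᶠ s in atTop, ∑' l : ℤ, K ^ 2 / (s + |(l : ℝ)|) ^ 2 ≤ ε ^ 2 :=
    (tendsto_tsum_inv_add_abs_sq K).eventually (eventually_le_nhds (by positivity))
  have ev2 : ∀ᶠ s in atTop, 28 * M ^ 2 * (B - lam σ (2 * a s * L s)) ≤ ε ^ 2 := by
    have h1 : Tendsto (fun s => 2 * a s * L s) atTop atTop :=
      (hat.const_mul_atTop' (by norm_num)).atTop_mul_atTop₀ hLt
    have h2 : Tendsto (fun s => 28 * M ^ 2 * (B - lam σ (2 * a s * L s))) atTop (𝓝 0) := by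
      have := ((hM.tendsto_lam.comp h1).const_sub B).const_mul (28 * M ^ 2)
      rwa [sub_self, mul_zero] at this
    exact h2.eventually (eventually_le_nhds (by positivity))
  filter_upwards [ev1, ev2, hat.eventually_ge_atTop N, eventually_ge_atTop 1,
    hsq.eventually_ge_atTop (8 / c), hsq.eventually_ge_atTop 1] with s h1 h2 h3 h4 h5 h6
  have hs0 : 0 < s := by linarith
  have hss : Real.sqrt s * Real.sqrt s = s := Real.mul_self_sqrt hs0.le
  have habs : |ς * s| = s := by rw [abs_mul, hs.abs_sign, one_mul, abs_of_pos hs0]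
  have hL1 : Real.sqrt s ≤ L s := Nat.le_ceil _
  have hL2 : (L s : ℝ) ≤ 2 * Real.sqrt s := by
    have := (Nat.ceil_lt_add_one (Real.sqrt_nonneg s)).le
    simp only [hL]
    linarith
  have hL3 : 1 ≤ L s := by
    have : (1 : ℝ) ≤ L s := h6.trans hL1
    exact_mod_cast this
  have ha1 : (a s : ℝ) ≤ c * Real.sqrt s / 8 := Nat.floor_le (by positivity)
  have hn : ∀ n : ℕ, (n : ℝ) = ⌈2 * Real.sqrt s⌉₊ → 2 * s ≤ (a s + n) * L s := by
    intro n hn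
    have h7 : 2 * Real.sqrt s ≤ n := by rw [hn]; exact Nat.le_ceil _
    have h8 : 2 * Real.sqrt s * Real.sqrt s ≤ (a s + n) * L s :=
      mul_le_mul (h7.trans (le_add_of_nonneg_left (by positivity))) hL1 (by positivity)
        (by positivity)
    linarith
  have hlow : ((a s : ℝ) + 1) * L s ≤ c * s / 2 := by
    have h7 : ((a s : ℝ) + 1) * L s ≤ (c * Real.sqrt s / 8 + 1) * (2 * Real.sqrt s) := by gcongr
    have h8 : 8 ≤ Real.sqrt s * c := (div_le_iff₀ hc).1 h5
    nlinarith
  have hmain := norm_indL2_half_sub_limitMul_le (n := ⌈2 * Real.sqrt s⌉₊) (a := a s)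
    (b := waveCoeff φ (ς * s)) (d := waveCoeff φ' (ς * s))
    (F := waveOp arcMeasure (ς * s) (arcLp h.continuous))
    (D := waveOp arcMeasure (ς * s) (arcLp h.continuous_deriv))
    hM.nonDegenerate hM.half hM.density hL3 (T := ς * s)
    (by
      rw [habs, sq]
      exact hss.symm.le.trans (by gcongr))
    (fun l => (inner_mono_waveOp h.continuous _ l).symm)
    (fun l => (inner_mono_waveOp h.continuous_deriv _ l).symm)
    (h.waveCoeff_identity (ς * s)) (S := ε ^ 2)
    (by
      refine le_trans (norm_sub_sum_blockPoly_sq_le hL3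
        (fun l => (inner_mono_waveOp h.continuous _ l).symm)
        (e := fun l : ℤ => K ^ 2 / (s + |(l : ℝ)|) ^ 2) (fun l hl => ?_) (fun l => by positivity)
        (Summable.hasSum ?_)) h1
      · refine hs.norm_waveCoeff_sq_le hs0 ?_
        rcases hl with hl | hl
        · exact Or.inl (hl.le.trans hlow)
        · exact Or.inr ((hn _ rfl).trans hl.le)
      · have := (summable_inv_add_abs_sq h4).mul_left (K ^ 2)
        simpa only [mul_one_div] using this)
    (M := M)
    (fun l => by
      have h7 := h.norm_waveCoeff_le_sqrt hc hs.cos (T := ς * s) (by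
        rw [← abs_pos, habs]; exact hs0) l
      rw [habs, Real.sqrt_mul hc.le] at h7
      have h8 : (2 * L s + 1 : ℝ) ≤ 5 * Real.sqrt s := by linarith
      refine (mul_le_mul h7 h8 (by positivity) (by positivity)).trans (le_of_eq ?_)
      rw [hMdef, hI]
      have : 0 < Real.sqrt c := Real.sqrt_pos.2 hc
      have : 0 < Real.sqrt s := Real.sqrt_pos.2 hs0
      field_simp
      ring)
    hB hA hε.le
    (fun i z hz => hN _ (by
      have h7 : a s ≤ 2 * (a s + i) * L s := by nlinarith
      exact h3.trans h7) z hz)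
  rw [norm_waveOp, norm_waveOp] at hmain
  refine hmain.trans ?_
  have h7 : Real.sqrt (ε ^ 2) = ε := Real.sqrt_sq hε.le
  have h8 : Real.sqrt (28 * M ^ 2 * (B - lam σ (2 * a s * L s))) ≤ ε := by
    rw [← h7]
    exact Real.sqrt_le_sqrt h2
  rw [h7, mul_add]
  linarith

/-- On the side of the circle where the phase velocity is positive, the half-line transform of
the freely evolving function `e^{iT Re z} f` is asymptotically its product with `Ψ`. -/
theorem ArcAmplitude.OnSide.tendsto_half_sub_limitMul (hs : h.OnSide c ς) (hM : HalfModel σ Ψ W B) :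
    Tendsto (fun s => W (negCoeff (waveOp arcMeasure (ς * s) (arcLp h.continuous))) -
      limitMul hM.density (waveOp arcMeasure (ς * s) (arcLp h.continuous))) atTop (𝓝 0) := by
  obtain ⟨K, hK⟩ := (isCompact_Icc (a := -Real.pi) (b := Real.pi)).exists_bound_of_continuousOn
    h.continuous.continuousOn
  have hK0 : 0 ≤ K := (norm_nonneg _).trans (hK 0 ⟨by linarith [Real.pi_pos], Real.pi_pos.le⟩)
  set f := arcLp h.continuous with hf
  set C := 4 + Real.sqrt (3 * Real.pi * (‖arcLp h.continuous‖ ^ 2 +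
        12 * (‖arcLp h.continuous_deriv‖ ^ 2 + 3 * ‖arcLp h.continuous‖ ^ 2))) with hC
  have hC0 : 0 ≤ C := by positivity
  have hbd : ∀ s, ∀ᵐ z ∂arcMeasure, ‖waveOp arcMeasure (ς * s) f z‖ ≤ K := fun s => by
    filter_upwards [coeFn_waveOp (ς * s) f, coeFn_arcLp h.continuous] with z h1 h2
    rw [h1, norm_mul, norm_exp_I_mul, one_mul, hf, h2]
    exact hK _ ⟨(Complex.neg_pi_lt_arg _).le, Complex.arg_le_pi _⟩
  rw [tendsto_zero_iff_norm_tendsto_zero]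
  have key : Tendsto (fun s => ‖W (negCoeff (waveOp arcMeasure (ς * s) f)) -
      limitMul hM.density (waveOp arcMeasure (ς * s) f)‖ ^ 2) atTop (𝓝 0) := by
    rw [Metric.tendsto_nhds]
    intro η hη
    set Q := 2 * C * ‖f‖ + 4 * ‖f‖ * K with hQ
    have hQ0 : 0 ≤ Q := by positivity
    -- Off a set of measure `ε²`, `φ_n^* → Ψ` uniformly; on it the target has norm at most `K ε`,
    -- and `‖X‖ ≤ ‖Z‖` leaves no room for the transform to be large there.
    set ε := η / (Q + 1) with hεdef
    have hε : 0 < ε := by positivity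
    obtain ⟨A, hA, hmA, hu⟩ := exists_uniform_set hM.density hM.ae_tendsto
      (δ := ε ^ 2) (by positivity)
    filter_upwards [hs.norm_indL2_half_sub_le hM hA hu hε] with s h1
    set X := W (negCoeff (waveOp arcMeasure (ς * s) f)) with hX
    set Z := limitMul hM.density (waveOp arcMeasure (ς * s) f) with hZ
    have hZn : ‖Z‖ = ‖f‖ := by rw [hZ, (limitMul hM.density).norm_map, norm_waveOp]
    have hXn : ‖X‖ ≤ ‖Z‖ := by
      rw [hZn, hX, W.norm_map]
      exact (norm_negCoeff_le _).trans (norm_waveOp _ _).le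
    have h2 : ‖indL2 σ hA Z‖ ≤ K * ε := by
      rw [hZ, ← limitMul_indL2, (limitMul hM.density).norm_map]
      refine le_of_sq_le_sq ((norm_indL2_sq_le hA (hbd s)).trans ?_) (by positivity)
      rw [mul_pow]
      gcongr
      exact ENNReal.toReal_le_of_le_ofReal (by positivity) hmA
    have h3 := norm_sub_sq_le_of_indL2 hA hXn
    rw [hZn] at h3
    rw [dist_zero_right, Real.norm_of_nonneg (by positivity)]
    have h4 : 2 * ‖indL2 σ hA.compl (X - Z)‖ * ‖f‖ ≤ 2 * (ε * C) * ‖f‖ := by gcongr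
    have h5 : 4 * ‖f‖ * ‖indL2 σ hA Z‖ ≤ 4 * ‖f‖ * (K * ε) := by gcongr
    have h6 : ε * (Q + 1) = η := div_mul_cancel₀ _ (by positivity)
    rw [hQ] at h6
    linarith
  have := key.sqrt
  simpa using this

/-- On the side of the circle where the phase velocity is negative, the evolving function loses
its Fourier coefficients of nonpositive index. -/
theorem ArcAmplitude.OnSide.tendsto_negCoeff (hs : h.OnSide c ς) :
    Tendsto (fun s => negCoeff (waveOp arcMeasure (-ς * s) (arcLp h.continuous))) atTop (𝓝 0) := by
  have hc := hs.pos
  set K := 4 / c * ∫ t in α..β, ‖φ' t‖ with hK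
  rw [tendsto_zero_iff_norm_tendsto_zero]
  have key : Tendsto (fun s => ‖negCoeff (waveOp arcMeasure (-ς * s) (arcLp h.continuous))‖ ^ 2)
      atTop (𝓝 0) := by
    refine squeeze_zero' (.of_forall fun s => by positivity) ?_ (tendsto_tsum_inv_add_abs_sq K)
    filter_upwards [eventually_ge_atTop 1] with s hs1
    have hs0 : 0 < s := by linarith
    have hsum : Summable fun l : ℤ => K ^ 2 / (s + |(l : ℝ)|) ^ 2 := by
      have := (summable_inv_add_abs_sq hs1).mul_left (K ^ 2)
      simpa only [mul_one_div] using this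
    rw [norm_negCoeff_sq]
    refine Summable.tsum_le_tsum_of_inj (fun n : ℕ => (n : ℤ)) Nat.cast_injective
      (fun l _ => by positivity) (fun n => ?_) ?_ hsum
    · rw [inner_mono_waveOp h.continuous, ← div_pow]
      refine pow_le_pow_left₀ (norm_nonneg _) ?_ 2
      have h1 := h.norm_waveCoeff_le_div hs.cos_weak (T := -ς * s) (m := n)
        (lo := c * (s + |((n : ℤ) : ℝ)|)) (by positivity) fun t ht => by
          have h2 := mul_le_mul_of_nonneg_right (hs.sin t ht) hs0.le
          have h3 : c * (n : ℝ) ≤ n := mul_le_of_le_one_left (Nat.cast_nonneg _) hs.le_one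
          refine le_trans ?_ (le_abs_self _)
          push_cast
          rw [Nat.abs_cast]
          linarith
      refine h1.trans (le_of_eq ?_)
      rw [hK]
      field_simp
    · simpa only [negCoeff_apply] using
        summable_normSq (negCoeff (waveOp arcMeasure (-ς * s) (arcLp h.continuous)))
  simpa using key.sqrt

/-- The coefficients of an evolving function tend to zero. -/
theorem ArcAmplitude.OnSide.tendsto_waveCoeff (hs : h.OnSide c ς) {η : ℝ} (hη : |η| = 1) (m : ℤ) :
    Tendsto (fun s => waveCoeff φ (η * s) m) atTop (𝓝 0) := by
  have hc := hs.pos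
  have h1 : Tendsto (fun s => 10 / Real.sqrt (c * s) * ∫ t in α..β, ‖φ' t‖) atTop (𝓝 0) := by
    have h2 : Tendsto (fun s => Real.sqrt (c * s)) atTop atTop :=
      Real.tendsto_sqrt_atTop.comp (tendsto_id.const_mul_atTop hc)
    have := (h2.const_div_atTop 10).mul_const (∫ t in α..β, ‖φ' t‖)
    rwa [zero_mul] at this
  refine squeeze_zero_norm' ?_ h1
  filter_upwards [eventually_gt_atTop 0] with s hs0
  have habs : |η * s| = s := by rw [abs_mul, hη, one_mul, abs_of_pos hs0]
  have := h.norm_waveCoeff_le_sqrt hc hs.cos (T := η * s) (by rw [← abs_pos, habs]; exact hs0) m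
  rwa [habs] at this

end Asymptotics

/-! ### Extension from arcs to all of `L²` -/

/-- A bounded family of operators that tends to zero on a total set tends to zero strongly. -/
theorem tendsto_zero_of_total {ι H K : Type*} [NormedAddCommGroup H] [InnerProductSpace ℂ H]
    [CompleteSpace H] [NormedAddCommGroup K] [NormedSpace ℂ K] {l : Filter ι} {A : ι → H →L[ℂ] K}
    {C : ℝ} (hC : ∀ i F, ‖A i F‖ ≤ C * ‖F‖) {s : Set H}
    (hs : ∀ G : H, (∀ F ∈ s, inner ℂ F G = 0) → G = 0)
    (h : ∀ F ∈ s, Tendsto (fun i => A i F) l (𝓝 0)) (F : H) : Tendsto (fun i => A i F) l (𝓝 0) := by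
  let V : Submodule ℂ H :=
    { carrier := {F | Tendsto (fun i => A i F) l (𝓝 0)}
      add_mem' := fun {x y} hx hy => by
        have := Tendsto.add (Set.mem_ofPred_eq ▸ hx) (Set.mem_ofPred_eq ▸ hy)
        simpa using this
      zero_mem' := by simpa using tendsto_const_nhds
      smul_mem' := fun c x hx => by
        have := Tendsto.const_smul (Set.mem_ofPred_eq ▸ hx) c
        simpa using this }
  have hle : Submodule.span ℂ s ≤ V := Submodule.span_le.2 h
  have htop : V.topologicalClosure = ⊤ := by
    rw [Submodule.topologicalClosure_eq_top_iff, Submodule.eq_bot_iff]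
    intro G hG
    exact hs G fun F hF => (Submodule.mem_orthogonal _ _).1 hG F (hle (Submodule.subset_span hF))
  have hF : F ∈ closure (V : Set H) := by
    rw [← Submodule.topologicalClosure_coe, htop]
    trivial
  rw [Metric.tendsto_nhds]
  intro ε hε
  have hC0 : 0 < |C| + 1 := by positivity
  obtain ⟨G, hG, hd⟩ := Metric.mem_closure_iff.1 hF (ε / (2 * (|C| + 1))) (by positivity)
  have hG' : Tendsto (fun i => A i G) l (𝓝 0) := hG
  filter_upwards [Metric.tendsto_nhds.1 hG' (ε / 2) (by positivity)] with i hi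
  rw [dist_zero_right] at hi ⊢
  rw [dist_eq_norm] at hd
  have h1 : A i F = A i (F - G) + A i G := by rw [map_sub, sub_add_cancel]
  have h2 : ‖A i (F - G)‖ ≤ (|C| + 1) * ‖F - G‖ :=
    (hC i _).trans (by gcongr; linarith [le_abs_self C])
  have h3 : (|C| + 1) * ‖F - G‖ < ε / 2 := by
    have := mul_lt_mul_of_pos_left hd hC0
    rwa [show (|C| + 1) * (ε / (2 * (|C| + 1))) = ε / 2 by field_simp] at this
  rw [h1]
  linarith [norm_add_le (A i (F - G)) (A i G)]

theorem im_circleExp (t : ℝ) : ((Circle.exp t : Circle) : ℂ).im = Real.sin t := by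
  rw [Circle.coe_exp, Complex.exp_ofReal_mul_I_im]

/-- A smooth function with compact support in an arc on which `sin` and `cos` have fixed signs is an
admissible amplitude. -/
theorem exists_arcAmplitude {p q ς τ : ℝ} (hp : -Real.pi ≤ p) (hq : q ≤ Real.pi) (hpq : p < q)
    (hς : ς = 1 ∨ ς = -1) (hτ : τ = 1 ∨ τ = -1)
    (hsign : ∀ t ∈ Set.Ioo p q, 0 < ς * Real.sin t ∧ 0 < τ * Real.cos t) {g : ℝ → ℝ}
    (hg : ContDiff ℝ (⊤ : ℕ∞) g) (hgc : HasCompactSupport g) (hgs : tsupport g ⊆ Set.Ioo p q) :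
    ∃ (α β c : ℝ) (h : ArcAmplitude (fun t => (g t : ℂ)) (fun t => ((deriv g t : ℝ) : ℂ)) α β),
      h.OnSide c ς := by
  obtain ⟨α, β, hα, hαβ, hβ, hsub⟩ : ∃ α β, p < α ∧ α ≤ β ∧ β < q ∧ tsupport g ⊆ Set.Ioo α β := by
    rcases (tsupport g).eq_empty_or_nonempty with h0 | h0
    · obtain ⟨r, hr1, hr2⟩ := exists_between hpq
      exact ⟨r, r, hr1, le_rfl, hr2, by simp [h0]⟩
    · obtain ⟨x, hx, hxmin⟩ := hgc.isCompact.exists_isMinOn h0 continuousOn_id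
      obtain ⟨y, hy, hymax⟩ := hgc.isCompact.exists_isMaxOn h0 continuousOn_id
      obtain ⟨α, hα1, hα2⟩ := exists_between (hgs hx).1
      obtain ⟨β, hβ1, hβ2⟩ := exists_between (hgs hy).2
      have hxy : x ≤ y := hxmin hy
      refine ⟨α, β, hα1, by linarith, hβ2, fun t ht => ⟨?_, ?_⟩⟩
      · exact hα2.trans_le (hxmin ht)
      · exact lt_of_le_of_lt (hymax ht) hβ1
  have hIcc : ∀ t ∈ Set.Icc α β, t ∈ Set.Ioo p q := fun t ht =>
    ⟨hα.trans_le ht.1, ht.2.trans_lt hβ⟩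
  have hd : Differentiable ℝ g := hg.differentiable (by simp)
  have h : ArcAmplitude (fun t => (g t : ℂ)) (fun t => ((deriv g t : ℝ) : ℂ)) α β :=
    { le := hαβ
      left := hp.trans_lt hα
      right := hβ.trans_le hq
      deriv := fun t => (hd t).hasDerivAt.ofReal_comp
      continuous_deriv := Complex.continuous_ofReal.comp (hg.continuous_deriv (by simp))
      supp := fun t ht => by
        have : t ∉ tsupport g := fun h => ht (hsub h)
        rw [image_eq_zero_of_notMem_tsupport this, Complex.ofReal_zero] }
  obtain ⟨x, hx, hmin⟩ := (isCompact_Icc (a := α) (b := β)).exists_isMinOn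
    ⟨α, le_rfl, hαβ⟩ (f := fun t => min (ς * Real.sin t) (τ * Real.cos t)) (by fun_prop)
  have hmin' : ∀ t ∈ Set.Icc α β, min (ς * Real.sin x) (τ * Real.cos x) ≤
      min (ς * Real.sin t) (τ * Real.cos t) := fun t ht => hmin ht
  refine ⟨α, β, min (ς * Real.sin x) (τ * Real.cos x), h, ?_, hς, ?_, ?_⟩
  · exact lt_min (hsign x (hIcc x hx)).1 (hsign x (hIcc x hx)).2
  · rcases hτ with rfl | rfl
    · refine Or.inl fun t ht => ((hmin' t ht).trans (min_le_right _ _)).trans (by simp)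
    · refine Or.inr fun t ht => ?_
      have := (hmin' t ht).trans (min_le_right _ _)
      linarith
  · exact fun t ht => (hmin' t ht).trans (min_le_left _ _)

/-- The functions `φ (arg z)`, with `φ` an amplitude supported on one side. -/
def arcFunctions : Set (Lp ℂ 2 arcMeasure) :=
  {F | ∃ (φ φ' : ℝ → ℂ) (α β c ς : ℝ) (h : ArcAmplitude φ φ' α β),
    h.OnSide c ς ∧ F = arcLp h.continuous}

theorem ae_eq_zero_of_inner_arcFunctions {G : Lp ℂ 2 arcMeasure}
    (hG : ∀ F ∈ arcFunctions, inner ℂ F G = 0) {p q ς τ : ℝ} (hp : -Real.pi ≤ p)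
    (hq : q ≤ Real.pi) (hpq : p < q) (hς : ς = 1 ∨ ς = -1) (hτ : τ = 1 ∨ τ = -1)
    (hsign : ∀ t ∈ Set.Ioo p q, 0 < ς * Real.sin t ∧ 0 < τ * Real.cos t) :
    ∀ᵐ t ∂(volume.restrict (Set.Ioc (-Real.pi) Real.pi)), t ∈ Set.Ioo p q →
      G (Circle.exp t) = 0 := by
  have hint : Integrable (fun t => G (Circle.exp t))
      (volume.restrict (Set.Ioc (-Real.pi) Real.pi)) := by
    have h1 : Integrable G arcMeasure := (Lp.memLp G).integrable (by norm_num)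
    have h2 := (integrable_arcMeasure_iff h1.1).1 h1
    exact (intervalIntegrable_iff_integrableOn_Ioc_of_le (by linarith [Real.pi_pos])).1 h2
  refine isOpen_Ioo.ae_eq_zero_of_integral_contDiff_smul_eq_zero
    (hint.locallyIntegrable.locallyIntegrableOn _) fun g hg hgc hgs => ?_
  obtain ⟨α, β, c, h, hs⟩ := exists_arcAmplitude hp hq hpq hς hτ hsign hg hgc hgs
  have h1 := hG _ ⟨_, _, α, β, c, ς, h, hs, rfl⟩
  rw [L2.inner_def] at h1
  have h2 : ∫ z, inner ℂ (arcLp h.continuous z) (G z) ∂arcMeasure =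
      ∫ z : Circle, (g (Complex.arg (z : ℂ)) : ℝ) • G z ∂arcMeasure := by
    apply integral_congr_ae
    filter_upwards [coeFn_arcLp h.continuous] with z hz
    rw [hz, RCLike.inner_apply, Complex.conj_ofReal, Complex.real_smul, mul_comm]
  have hmeas : AEStronglyMeasurable (fun z : Circle => (g (Complex.arg (z : ℂ)) : ℝ) • G z)
      arcMeasure := by
    have h3 : Measurable fun z : Circle => (z : ℂ) := Continuous.measurable (by fun_prop)
    exact ((hg.continuous.measurable.comp
      (Complex.measurable_arg.comp h3)).aestronglyMeasurable).smul
      (Lp.stronglyMeasurable G).aestronglyMeasurable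
  rw [h2, integral_arcMeasure hmeas, smul_eq_zero] at h1
  have h3 := h1.resolve_left (by positivity)
  rw [intervalIntegral.integral_of_le (by linarith [Real.pi_pos])] at h3
  rw [← h3]
  refine setIntegral_congr_fun measurableSet_Ioc fun t ht => ?_
  simp only [arg_exp_of_mem ht]

/-- The functions on arcs are total: up to null sets the circle consists of four open arcs on which
`sin` and `cos` have fixed signs. -/
theorem eq_zero_of_inner_arcFunctions {G : Lp ℂ 2 arcMeasure}
    (hG : ∀ F ∈ arcFunctions, inner ℂ F G = 0) : G = 0 := by
  have hpi := Real.pi_pos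
  have h1 := ae_eq_zero_of_inner_arcFunctions hG (p := 0) (q := Real.pi / 2) (ς := 1) (τ := 1)
    (by linarith) (by linarith) (by linarith) (Or.inl rfl) (Or.inl rfl) fun t ht => by
      constructor
      · linarith [Real.sin_pos_of_pos_of_lt_pi ht.1 (by linarith [ht.2])]
      · linarith [Real.cos_pos_of_mem_Ioo ⟨by linarith [ht.1], ht.2⟩]
  have h2 := ae_eq_zero_of_inner_arcFunctions hG (p := Real.pi / 2) (q := Real.pi) (ς := 1)
    (τ := -1)
    (by linarith) (by linarith) (by linarith) (Or.inl rfl) (Or.inr rfl) fun t ht => by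
      constructor
      · linarith [Real.sin_pos_of_pos_of_lt_pi (by linarith [ht.1]) ht.2]
      · linarith [Real.cos_neg_of_pi_div_two_lt_of_lt ht.1 (by linarith [ht.2])]
  have h3 := ae_eq_zero_of_inner_arcFunctions hG (p := -(Real.pi / 2)) (q := 0) (ς := -1) (τ := 1)
    (by linarith) (by linarith) (by linarith) (Or.inr rfl) (Or.inl rfl) fun t ht => by
      constructor
      · linarith [Real.sin_neg_of_neg_of_neg_pi_lt ht.2 (by linarith [ht.1])]
      · linarith [Real.cos_pos_of_mem_Ioo ⟨ht.1, by linarith [ht.2]⟩]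
  have h4 := ae_eq_zero_of_inner_arcFunctions hG (p := -Real.pi) (q := -(Real.pi / 2)) (ς := -1)
    (τ := -1) (by linarith) (by linarith) (by linarith) (Or.inr rfl) (Or.inr rfl) fun t ht => by
      constructor
      · linarith [Real.sin_neg_of_neg_of_neg_pi_lt (by linarith [ht.2] : t < 0) ht.1]
      · have := Real.cos_neg_of_pi_div_two_lt_of_lt (x := -t) (by linarith [ht.2])
          (by linarith [ht.1])
        rw [Real.cos_neg] at this
        linarith
  have hfin : ∀ᵐ t ∂(volume.restrict (Set.Ioc (-Real.pi) Real.pi)),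
      t ∉ ({0, Real.pi / 2, Real.pi, -(Real.pi / 2)} : Set ℝ) :=
    ae_restrict_of_ae (Set.Countable.ae_notMem (Set.toFinite _).countable _)
  apply Lp.eq_zero_iff_ae_eq_zero.2
  refine ae_arcMeasure_iff.2 ?_
  filter_upwards [h1, h2, h3, h4, hfin, ae_restrict_mem measurableSet_Ioc] with t g1 g2 g3 g4 hn ht
  simp only [Set.mem_insert_iff, Set.mem_singleton_iff, not_or] at hn
  obtain ⟨n1, n2, n3, n4⟩ := hn
  rcases lt_or_gt_of_ne n1 with k1 | k1
  · rcases lt_or_gt_of_ne n4 with k2 | k2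
    · exact g4 ⟨ht.1, k2⟩
    · exact g3 ⟨k2, k1⟩
  · rcases lt_or_gt_of_ne n2 with k2 | k2
    · exact g1 ⟨k1, k2⟩
    · exact g2 ⟨k2, lt_of_le_of_ne ht.2 n3⟩

/-- The upper (`ς = 1`) or lower (`ς = -1`) open half circle. -/
def side (ς : ℝ) : Set Circle := {z | 0 < ς * (z : ℂ).im}

theorem measurableSet_side (ς : ℝ) : MeasurableSet (side ς) := by
  have h : Continuous fun z : Circle => ς * (z : ℂ).im := by fun_prop
  exact (isOpen_lt continuous_const h).measurableSet

section Side
variable {φ φ' : ℝ → ℂ} {α β c ς : ℝ} {h : ArcAmplitude φ φ' α β}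

theorem ArcAmplitude.OnSide.mem_side (hs : h.OnSide c ς) {z : Circle}
    (hz : φ (Complex.arg (z : ℂ)) ≠ 0) : z ∈ side ς := by
  have h1 : Complex.arg (z : ℂ) ∈ Set.Ioo α β := by
    by_contra h2
    exact hz (h.supp _ h2)
  have h2 := hs.sin _ ⟨h1.1.le, h1.2.le⟩
  have h3 : Real.sin (Complex.arg (z : ℂ)) = (z : ℂ).im := by
    rw [← im_circleExp, Circle.exp_arg]
  rw [h3] at h2
  exact hs.pos.trans_le h2

theorem ArcAmplitude.OnSide.indL2_side (hs : h.OnSide c ς) :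
    indL2 arcMeasure (measurableSet_side ς) (arcLp h.continuous) = arcLp h.continuous := by
  apply Lp.ext
  filter_upwards [coeFn_indL2 (measurableSet_side ς) (arcLp h.continuous),
    coeFn_arcLp h.continuous] with z h1 h2
  rw [h1]
  by_cases hz : z ∈ side ς
  · rw [Set.indicator_of_mem hz]
  · rw [Set.indicator_of_notMem hz, h2]
    by_contra h3
    exact hz (hs.mem_side (Ne.symm h3))

theorem ArcAmplitude.OnSide.indL2_side_neg (hs : h.OnSide c ς) :
    indL2 arcMeasure (measurableSet_side (-ς)) (arcLp h.continuous) = 0 := by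
  apply Lp.ext
  filter_upwards [coeFn_indL2 (measurableSet_side (-ς)) (arcLp h.continuous),
    coeFn_arcLp h.continuous, Lp.coeFn_zero ℂ 2 arcMeasure] with z h1 h2 h3
  rw [h1, h3, Pi.zero_apply]
  by_cases hz : z ∈ side (-ς)
  · rw [Set.indicator_of_mem hz, h2]
    by_contra h4
    have h5 := hs.mem_side h4
    simp only [side, Set.mem_ofPred_eq] at hz h5
    linarith
  · rw [Set.indicator_of_notMem hz]

end Side

section Total
variable {σ : Measure Circle} [IsProbabilityMeasure σ] {Ψ : Lp ℂ 2 σ} {W : L2Seq →ₗᵢ[ℂ] Lp ℂ 2 σ}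
  {B : ℝ}

/-- The half-line transform of `e^{iT Re z} F` is asymptotically `Ψ e^{iT Re z} F` on the half
circle where `T Im z > 0`, and vanishes asymptotically on the other one. -/
theorem HalfModel.tendsto_half_sub (hM : HalfModel σ Ψ W B) {ς : ℝ} (hς : ς = 1 ∨ ς = -1)
    (F : Lp ℂ 2 arcMeasure) :
    Tendsto (fun s => W (negCoeff (waveOp arcMeasure (ς * s) F)) - limitMul hM.density
      (waveOp arcMeasure (ς * s) (indL2 arcMeasure (measurableSet_side ς) F))) atTop (𝓝 0) := by
  have key := tendsto_zero_of_total (l := (atTop : Filter ℝ)) (C := 2) (s := arcFunctions)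
    (A := fun s : ℝ => W.toContinuousLinearMap ∘L negCoeff ∘L waveOp arcMeasure (ς * s) -
      (limitMul hM.density).toContinuousLinearMap ∘L waveOp arcMeasure (ς * s) ∘L
        indL2 arcMeasure (measurableSet_side ς)) ?_ (fun G hG => eq_zero_of_inner_arcFunctions hG)
      ?_ F
  · exact key
  · intro s F
    change ‖W (negCoeff (waveOp arcMeasure (ς * s) F)) - limitMul hM.density
      (waveOp arcMeasure (ς * s) (indL2 arcMeasure (measurableSet_side ς) F))‖ ≤ _
    refine (norm_sub_le _ _).trans ?_
    rw [W.norm_map, (limitMul hM.density).norm_map, norm_waveOp]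
    have h1 := norm_negCoeff_le (waveOp arcMeasure (ς * s) F)
    rw [norm_waveOp] at h1
    have h2 := norm_indL2_le (measurableSet_side ς) F
    linarith
  · rintro _ ⟨φ, φ', α, β, c, τ, h, hs, rfl⟩
    change Tendsto (fun s : ℝ => W (negCoeff (waveOp arcMeasure (ς * s) (arcLp h.continuous))) -
      limitMul hM.density (waveOp arcMeasure (ς * s) (indL2 arcMeasure (measurableSet_side ς)
        (arcLp h.continuous)))) atTop (𝓝 0)
    have hcases : τ = ς ∨ τ = -ς := by
      rcases hς with rfl | rfl <;> rcases hs.sign with rfl | rfl <;> simp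
    rcases hcases with rfl | rfl
    · rw [hs.indL2_side]
      exact hs.tendsto_half_sub_limitMul hM
    · have h1 := hs.indL2_side_neg
      have h2 := (W.continuous.tendsto _).comp hs.tendsto_negCoeff
      simp only [neg_neg] at h1 h2
      rw [h1]
      simpa [Function.comp_def] using h2

/-- The free evolution tends weakly to zero. -/
theorem tendsto_inner_mono_waveOp {ς : ℝ} (hς : ς = 1 ∨ ς = -1) (F : Lp ℂ 2 arcMeasure) (m : ℤ) :
    Tendsto (fun s => inner ℂ (cL2 arcMeasure (mono m)) (waveOp arcMeasure (ς * s) F)) atTop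
      (𝓝 0) := by
  refine tendsto_zero_of_total (l := (atTop : Filter ℝ)) (C := 1) (s := arcFunctions)
    (A := fun s : ℝ => innerSL ℂ (cL2 arcMeasure (mono m)) ∘L waveOp arcMeasure (ς * s)) ?_
    (fun G hG => eq_zero_of_inner_arcFunctions hG) ?_ F
  · intro s F
    change ‖inner ℂ (cL2 arcMeasure (mono m)) (waveOp arcMeasure (ς * s) F)‖ ≤ _
    refine (norm_inner_le_norm _ _).trans ?_
    rw [norm_waveOp, orthonormal_mono.1]
  · rintro _ ⟨φ, φ', α, β, c, τ, h, hs, rfl⟩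
    have h1 := hs.tendsto_waveCoeff (η := ς) (by rcases hς with rfl | rfl <;> norm_num) (-m)
    simp only [← inner_mono_waveOp h.continuous, neg_neg] at h1
    exact h1

end Total

/-! ### Reflection and conjugation -/

section Reflect
variable {μ : Measure Circle} (hev : μ.map (fun z => z⁻¹) = μ)

/-- The reflection `F(z) ↦ F(z⁻¹)` on `L²(μ)` for an even measure `μ`. -/
noncomputable def reflect : Lp ℂ 2 μ →ₗᵢ[ℂ] Lp ℂ 2 μ :=
  Lp.compMeasurePreservingₗᵢ ℂ (fun z => z⁻¹) ⟨continuous_inv.measurable, hev⟩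

theorem ae_inv {μ : Measure Circle} (hev : μ.map (fun z => z⁻¹) = μ) {P : Circle → Prop}
    (h : ∀ᵐ z ∂μ, P z) : ∀ᵐ z ∂μ, P z⁻¹ :=
  (MeasurePreserving.quasiMeasurePreserving ⟨continuous_inv.measurable, hev⟩).ae h

theorem coeFn_reflect (F : Lp ℂ 2 μ) : reflect hev F =ᵐ[μ] fun z => F z⁻¹ :=
  Lp.coeFn_compMeasurePreserving F ⟨continuous_inv.measurable, hev⟩

theorem reflect_cL2 [IsFiniteMeasure μ] {f g : C(Circle, ℂ)} (h : ∀ z, f z⁻¹ = g z) :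
    reflect hev (cL2 μ f) = cL2 μ g := by
  apply Lp.ext
  filter_upwards [coeFn_reflect hev (cL2 μ f), ae_inv hev (coeFn_cL2 μ f), coeFn_cL2 μ g]
    with z h1 h2 h3
  rw [h1, h2, h3, h]

theorem reflect_mono [IsFiniteMeasure μ] (m : ℤ) :
    reflect hev (cL2 μ (mono m)) = cL2 μ (mono (-m)) :=
  reflect_cL2 hev fun z => by rw [mono_apply, mono_apply, Circle.coe_inv, inv_zpow, zpow_neg]

theorem re_inv_circle (z : Circle) : ((z⁻¹ : Circle) : ℂ).re = (z : ℂ).re := by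
  rw [Circle.coe_inv_eq_conj, Complex.conj_re]

theorem reflect_waveOp [IsFiniteMeasure μ] (T : ℝ) (F : Lp ℂ 2 μ) :
    reflect hev (waveOp μ T F) = waveOp μ T (reflect hev F) := by
  apply Lp.ext
  filter_upwards [coeFn_reflect hev (waveOp μ T F), ae_inv hev (coeFn_waveOp T F),
    coeFn_waveOp T (reflect hev F), coeFn_reflect hev F] with z h1 h2 h3 h4
  rw [h1, h2, h3, h4, re_inv_circle]

theorem inv_mem_side {z : Circle} {ς : ℝ} : z⁻¹ ∈ side ς ↔ z ∈ side (-ς) := by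
  simp only [side, Set.mem_ofPred_eq, Circle.coe_inv_eq_conj, Complex.conj_im]
  rw [mul_neg, neg_mul]

theorem reflect_indL2_side (ς : ℝ) (F : Lp ℂ 2 μ) :
    reflect hev (indL2 μ (measurableSet_side ς) F) =
      indL2 μ (measurableSet_side (-ς)) (reflect hev F) := by
  apply Lp.ext
  filter_upwards [coeFn_reflect hev (indL2 μ (measurableSet_side ς) F),
    ae_inv hev (coeFn_indL2 (measurableSet_side ς) F),
    coeFn_indL2 (measurableSet_side (-ς)) (reflect hev F), coeFn_reflect hev F] with z h1 h2 h3 h4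
  rw [h1, h2, h3]
  by_cases hz : z ∈ side (-ς)
  · rw [Set.indicator_of_mem hz, Set.indicator_of_mem (inv_mem_side.2 hz), h4]
  · rw [Set.indicator_of_notMem hz, Set.indicator_of_notMem fun h => hz (inv_mem_side.1 h)]

theorem IsTransform.reflect {J : JacobiParams} [IsFiniteMeasure μ] {U : L2Seq →ₗᵢ[ℂ] Lp ℂ 2 μ}
    (hU : IsTransform J μ U) (ψ : L2Seq) : reflect hev (U ψ) = U ψ := by
  have h : (WaveOPUC.reflect hev).toContinuousLinearMap ∘L U.toContinuousLinearMap =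
      U.toContinuousLinearMap := clm_ext_bas fun n => by
    simp only [ContinuousLinearMap.comp_apply, LinearIsometry.coe_toContinuousLinearMap]
    rw [hU]
    exact reflect_cL2 hev fun z => by rw [polyRe_apply, polyRe_apply, re_inv_circle]
  exact DFunLike.congr_fun h ψ

end Reflect

section Conj
variable {μ : Measure Circle}

theorem coeFn_conjL2 (F : Lp ℂ 2 μ) : conjL2 μ F =ᵐ[μ] fun z => (starRingEnd ℂ) (F z) :=
  Lp.coeFn_star F

theorem conjL2_waveOp [IsFiniteMeasure μ] (T : ℝ) (F : Lp ℂ 2 μ) :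
    conjL2 μ (waveOp μ T F) = waveOp μ (-T) (conjL2 μ F) := by
  apply Lp.ext
  filter_upwards [coeFn_conjL2 (waveOp μ T F), coeFn_waveOp T F, coeFn_waveOp (-T) (conjL2 μ F),
    coeFn_conjL2 F] with z h1 h2 h3 h4
  rw [h1, h2, h3, h4, map_mul, ← Complex.exp_conj, map_mul, Complex.conj_I, Complex.conj_ofReal]
  push_cast
  ring_nf

end Conj

/-! ### Odd functions and the free transform -/

theorem reflect_freeU (ψ : L2Seq) : reflect map_inv_arcMeasure (freeU ψ) = -freeU ψ := by
  have h : (reflect map_inv_arcMeasure).toContinuousLinearMap ∘L freeU.toContinuousLinearMap =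
      -freeU.toContinuousLinearMap := clm_ext_bas fun n => by
    simp only [ContinuousLinearMap.comp_apply, LinearIsometry.coe_toContinuousLinearMap,
      neg_apply]
    rw [freeU_bas, sinC, map_smul, map_smul, map_sub, map_sub, reflect_mono, reflect_mono, neg_neg,
      ← smul_neg, neg_sub]
  exact DFunLike.congr_fun h ψ

theorem freeS_freeU (ψ : L2Seq) : freeS (freeU ψ) = ψ :=
  ext_inner_left ℂ fun φ => by rw [inner_freeS, freeU.inner_map_map]

theorem freeS_apply_eq (F : Lp ℂ 2 arcMeasure) (n : ℕ) : freeS F n =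
    (Real.sqrt 2 / 2 : ℂ) * Complex.I * (inner ℂ (cL2 arcMeasure (mono (n + 1))) F -
      inner ℂ (cL2 arcMeasure (mono (-(n + 1)))) F) := by
  rw [freeS_apply, sinC, map_smul, map_sub, inner_smul_left, inner_sub_left]
  congr 1
  simp only [map_mul, map_neg, Complex.conj_I, Complex.conj_ofReal]
  push_cast
  ring

theorem freeS_reflect (F : Lp ℂ 2 arcMeasure) :
    freeS (reflect map_inv_arcMeasure F) = -freeS F :=
  ext_inner_left ℂ fun φ => by
    have h := (reflect map_inv_arcMeasure).inner_map_map (freeU φ) F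
    rw [reflect_freeU, inner_neg_left] at h
    rw [inner_freeS, inner_neg_right, inner_freeS, ← h, neg_neg]

theorem mulL2_mono_waveOp (T : ℝ) (F : Lp ℂ 2 arcMeasure) :
    mulL2 arcMeasure (mono 1) (waveOp arcMeasure T F) =
      waveOp arcMeasure T (mulL2 arcMeasure (mono 1) F) := by
  apply Lp.ext
  filter_upwards [coeFn_mulL2 (mono 1) (waveOp arcMeasure T F), coeFn_waveOp T F,
    coeFn_waveOp T (mulL2 arcMeasure (mono 1) F), coeFn_mulL2 (mono 1) F] with z h1 h2 h3 h4
  rw [h1, h2, h3, h4]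
  ring

/-- The sine coefficients of an odd function are its shifted Fourier coefficients. -/
theorem freeS_eq_negCoeff {F : Lp ℂ 2 arcMeasure} (hF : reflect map_inv_arcMeasure F = -F) :
    freeS F = (-(Real.sqrt 2 : ℂ) * Complex.I) • negCoeff (mulL2 arcMeasure (mono 1) F) := by
  ext n
  have h1 := (reflect map_inv_arcMeasure).inner_map_map (cL2 arcMeasure (mono (n + 1))) F
  rw [hF, reflect_mono, inner_neg_right] at h1
  rw [freeS_apply_eq, ← h1, L2Seq_smul_apply, negCoeff_apply, ← star_star (mono 1),
    ← inner_mulL2_left, star_mono, mulL2_cL2, mono_mul_mono,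
    show (-1 : ℤ) + -n = -(n + 1) by ring]
  ring

theorem star_freeS (F : Lp ℂ 2 arcMeasure) : star (freeS F) = freeS (conjL2 arcMeasure F) := by
  ext n
  have h : ∀ m : ℤ, inner ℂ (cL2 arcMeasure (mono m)) (conjL2 arcMeasure F) =
      (starRingEnd ℂ) (inner ℂ (cL2 arcMeasure (mono (-m))) F) := fun m => by
    rw [inner_cL2_left, inner_cL2_left, ← integral_conj]
    apply integral_congr_ae
    filter_upwards [coeFn_conjL2 F] with z hz
    rw [hz, ← star_mono, map_mul, ContinuousMap.star_apply, Complex.star_def, Complex.conj_conj]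
  rw [lp.star_apply, freeS_apply_eq, freeS_apply_eq, h, h, neg_neg, Complex.star_def]
  simp only [map_mul, map_sub, map_div₀, Complex.conj_I, Complex.conj_ofReal]
  rw [show (starRingEnd ℂ) 2 = 2 from map_ofNat _ 2]
  ring

section Wave
variable {σ : Measure Circle} [IsProbabilityMeasure σ] {Ψ : Lp ℂ 2 σ} {W : L2Seq →ₗᵢ[ℂ] Lp ℂ 2 σ}
  {B : ℝ}

/-- The spectral representation of the wave operator: `f ↦ -i (z Ψ f 1_ς - conj (z Ψ) f 1_{-ς})`. -/
noncomputable def waveLimit (hM : HalfModel σ Ψ W B) (ς : ℝ) (f : Lp ℂ 2 arcMeasure) : Lp ℂ 2 σ :=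
  (-Complex.I) • (limitMul hM.density (indL2 arcMeasure (measurableSet_side ς)
      (mulL2 arcMeasure (mono 1) f)) -
    conjL2 σ (limitMul hM.density (indL2 arcMeasure (measurableSet_side (-ς))
      (mulL2 arcMeasure (mono 1) (conjL2 arcMeasure f)))))

/-- The half-line transform of the free evolution. -/
theorem HalfModel.tendsto_half_freeS (hM : HalfModel σ Ψ W B) {ς : ℝ} (hς : ς = 1 ∨ ς = -1)
    {f : Lp ℂ 2 arcMeasure} (hf : reflect map_inv_arcMeasure f = -f) :
    Tendsto (fun s => W (freeS (waveOp arcMeasure (ς * s) f)) -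
      (-(Real.sqrt 2 : ℂ) * Complex.I) • waveOp σ (ς * s) (limitMul hM.density
        (indL2 arcMeasure (measurableSet_side ς) (mulL2 arcMeasure (mono 1) f)))) atTop (𝓝 0) := by
  have h := (hM.tendsto_half_sub hς (mulL2 arcMeasure (mono 1) f)).const_smul
    (-(Real.sqrt 2 : ℂ) * Complex.I)
  rw [smul_zero] at h
  refine h.congr fun s => ?_
  have h1 : reflect map_inv_arcMeasure (waveOp arcMeasure (ς * s) f) =
      -waveOp arcMeasure (ς * s) f := by rw [reflect_waveOp, hf, map_neg]
  rw [freeS_eq_negCoeff h1, map_smul, mulL2_mono_waveOp, limitMul_waveOp, smul_sub]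

/-- In the spectral representation of `J`, the interaction picture of the free evolution
converges. -/
theorem HalfModel.tendsto_transform (hM : HalfModel σ Ψ W B) {ς : ℝ} (hς : ς = 1 ∨ ς = -1)
    {J : JacobiParams} {U : L2Seq →ₗᵢ[ℂ] Lp ℂ 2 σ} (hU : IsTransform J σ U) {c : ℕ → ℝ}
    (hc : ∃ C, ∀ n, |c n| ≤ C) (hct : Tendsto c atTop (𝓝 (Real.sqrt 2)⁻¹))
    (hdec : ∀ ψ, U ψ = W (diagOp c hc ψ) + conjIsometry W (diagOp c hc ψ)) (ψ : L2Seq) :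
    Tendsto (fun s => U (evolution J.op (-(ς * s)) (evolution freeJacobi.op (ς * s) ψ))) atTop
      (𝓝 (waveLimit hM ς (freeU ψ))) := by
  set f := freeU ψ with hfdef
  have hf : reflect map_inv_arcMeasure f = -f := reflect_freeU ψ
  have hf' : reflect map_inv_arcMeasure (conjL2 arcMeasure f) = -conjL2 arcMeasure f := by
    rw [← map_neg, ← hf]
    apply Lp.ext
    filter_upwards [coeFn_reflect map_inv_arcMeasure (conjL2 arcMeasure f),
      ae_inv map_inv_arcMeasure (coeFn_conjL2 f), coeFn_conjL2 (reflect map_inv_arcMeasure f),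
      coeFn_reflect map_inv_arcMeasure f] with z h1 h2 h3 h4
    rw [h1, h2, h3, h4]
  set a : ℝ → L2Seq := fun s => freeS (waveOp arcMeasure (ς * s) f) with ha
  set P := limitMul hM.density (indL2 arcMeasure (measurableSet_side ς)
    (mulL2 arcMeasure (mono 1) f)) with hP
  set Q := limitMul hM.density (indL2 arcMeasure (measurableSet_side (-ς))
    (mulL2 arcMeasure (mono 1) (conjL2 arcMeasure f))) with hQ
  -- `k` normalizes the sine coefficients and `r` is the limit of the `c n`, so that `r k = -i`.
  set k : ℂ := -(Real.sqrt 2 : ℂ) * Complex.I with hk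
  set r : ℝ := (Real.sqrt 2)⁻¹ with hr
  have hev : ∀ s, U (evolution J.op (-(ς * s)) (evolution freeJacobi.op (ς * s) ψ)) =
      waveOp σ (-(ς * s)) (U (a s)) := fun s => by
    rw [hU.evolution_apply]
    conv_lhs => rw [← freeS_freeU ψ, evolution_freeS]
    rfl
  have hweak : ∀ n, Tendsto (fun s => a s n) atTop (𝓝 0) := fun n => by
    have h := ((tendsto_inner_mono_waveOp hς f (n + 1)).sub
      (tendsto_inner_mono_waveOp hς f (-(n + 1)))).const_mul ((Real.sqrt 2 / 2 : ℂ) * Complex.I)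
    rw [sub_zero, mul_zero] at h
    exact h.congr fun s => (freeS_apply_eq _ n).symm
  have hE := tendsto_diagOp_sub (l := atTop) (B := ‖f‖)
    (fun s => (norm_freeS_le _).trans (norm_waveOp (ς * s) f).le) hweak hc hct
  have hX := hM.tendsto_half_freeS hς hf
  have hY := hM.tendsto_half_freeS (ς := -ς) (by rcases hς with rfl | rfl <;> simp) hf'
  set E : ℝ → L2Seq := fun s => diagOp c hc (a s) - (r : ℂ) • a s with hEdef
  set X : ℝ → Lp ℂ 2 σ := fun s => W (a s) - k • waveOp σ (ς * s) P with hXdef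
  set Y : ℝ → Lp ℂ 2 σ := fun s => W (freeS (waveOp arcMeasure (-ς * s) (conjL2 arcMeasure f))) -
    k • waveOp σ (-ς * s) Q with hYdef
  have hrk : (r : ℂ) * k = -Complex.I := by
    have h0 : (Real.sqrt 2 : ℂ) ≠ 0 := by simp
    rw [hr, hk]
    push_cast
    field_simp
  have hkey : ∀ s, waveOp σ (-(ς * s)) (U (a s)) - waveLimit hM ς f =
      waveOp σ (-(ς * s)) ((r : ℂ) • X s + (r : ℂ) • conjL2 σ (Y s) + W (E s) +
        conjIsometry W (E s)) := fun s => by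
    have h1 : W (a s) = X s + k • waveOp σ (ς * s) P := by simp [hXdef]
    -- Conjugation reverses time, which moves the surviving part to the other side of the circle.
    have h2 : conjIsometry W (a s) =
        conjL2 σ (Y s) + (starRingEnd ℂ) k • waveOp σ (ς * s) (conjL2 σ Q) := by
      have h3 : W (star (a s)) = Y s + k • waveOp σ (-ς * s) Q := by
        simp only [ha, star_freeS, conjL2_waveOp, hYdef, sub_add_cancel, neg_mul]
      rw [conjIsometry_apply]
      change conjL2 σ (W (star (a s))) = _
      rw [h3, map_add, map_smulₛₗ, conjL2_waveOp, neg_mul, neg_neg]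
    have h3 : diagOp c hc (a s) = (r : ℂ) • a s + E s := by simp [hEdef]
    have h4 : waveLimit hM ς f = waveOp σ (-(ς * s)) (((r : ℂ) * k) • waveOp σ (ς * s) P +
        ((r : ℂ) * (starRingEnd ℂ) k) • waveOp σ (ς * s) (conjL2 σ Q)) := by
      have h5 : (r : ℂ) * (starRingEnd ℂ) k = Complex.I := by
        have := congrArg (starRingEnd ℂ) hrk
        rwa [map_mul, Complex.conj_ofReal, map_neg, Complex.conj_I, neg_neg] at this
      rw [hrk, h5, map_add, map_smul, map_smul, waveOp_neg_waveOp, waveOp_neg_waveOp, waveLimit,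
        smul_sub, neg_smul, neg_smul, sub_neg_eq_add]
    rw [h4, ← map_sub, hdec, h3, map_add, map_add, map_smul, map_smul, h1, h2]
    congr 1
    module
  simp only [hev]
  rw [← tendsto_sub_nhds_zero_iff, tendsto_zero_iff_norm_tendsto_zero]
  simp only [hkey, norm_waveOp]
  rw [← tendsto_zero_iff_norm_tendsto_zero]
  have hYc : Tendsto (fun s => conjL2 σ (Y s)) atTop (𝓝 0) := by
    have := ((conjL2 σ).continuous.tendsto 0).comp hY
    rwa [map_zero] at this
  have hW1 : Tendsto (fun s => W (E s)) atTop (𝓝 0) := by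
    have := (W.continuous.tendsto 0).comp hE
    rwa [map_zero] at this
  have hW2 : Tendsto (fun s => conjIsometry W (E s)) atTop (𝓝 0) := by
    have := ((conjIsometry W).continuous.tendsto 0).comp hE
    rwa [map_zero] at this
  have := (((hX.const_smul (r : ℂ)).add (hYc.const_smul (r : ℂ))).add hW1).add hW2
  simpa only [smul_zero, add_zero] using this

end Wave

/-! ### The range of the wave operators -/

section Sides
variable {μ : Measure Circle} {ς : ℝ}

theorem notMem_side_neg {z : Circle} (hz : z ∈ side ς) : z ∉ side (-ς) := fun h => by
  simp only [side, Set.mem_ofPred_eq] at hz h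
  linarith

theorem indL2_side_indL2_side (F : Lp ℂ 2 μ) :
    indL2 μ (measurableSet_side ς) (indL2 μ (measurableSet_side ς) F) =
      indL2 μ (measurableSet_side ς) F := by
  apply Lp.ext
  filter_upwards [coeFn_indL2 (measurableSet_side ς) (indL2 μ (measurableSet_side ς) F),
    coeFn_indL2 (measurableSet_side ς) F] with z h1 h2
  rw [h1, h2]
  by_cases hz : z ∈ side ς
  · rw [Set.indicator_of_mem hz, h2]
  · rw [Set.indicator_of_notMem hz, Set.indicator_of_notMem hz]

theorem indL2_side_indL2_side_neg (F : Lp ℂ 2 μ) :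
    indL2 μ (measurableSet_side ς) (indL2 μ (measurableSet_side (-ς)) F) = 0 := by
  apply Lp.ext
  filter_upwards [coeFn_indL2 (measurableSet_side ς) (indL2 μ (measurableSet_side (-ς)) F),
    coeFn_indL2 (measurableSet_side (-ς)) F, Lp.coeFn_zero ℂ 2 μ] with z h1 h2 h3
  rw [h1, h3, Pi.zero_apply]
  by_cases hz : z ∈ side ς
  · have hz' := notMem_side_neg hz
    rw [Set.indicator_of_mem hz, h2, Set.indicator_of_notMem hz']
  · rw [Set.indicator_of_notMem hz]

theorem conjL2_indL2_side (F : Lp ℂ 2 μ) : conjL2 μ (indL2 μ (measurableSet_side ς) F) =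
    indL2 μ (measurableSet_side ς) (conjL2 μ F) := by
  apply Lp.ext
  filter_upwards [coeFn_conjL2 (indL2 μ (measurableSet_side ς) F),
    coeFn_indL2 (measurableSet_side ς) F, coeFn_indL2 (measurableSet_side ς) (conjL2 μ F),
    coeFn_conjL2 F] with z h1 h2 h3 h4
  rw [h1, h2, h3]
  by_cases hz : z ∈ side ς
  · rw [Set.indicator_of_mem hz, Set.indicator_of_mem hz, h4]
  · rw [Set.indicator_of_notMem hz, Set.indicator_of_notMem hz, map_zero]

theorem mulL2_indL2_side [IsFiniteMeasure μ] (g : C(Circle, ℂ)) (F : Lp ℂ 2 μ) :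
    indL2 μ (measurableSet_side ς) (mulL2 μ g F) =
      mulL2 μ g (indL2 μ (measurableSet_side ς) F) := by
  apply Lp.ext
  filter_upwards [coeFn_mulL2 g (indL2 μ (measurableSet_side ς) F), coeFn_mulL2 g F,
    coeFn_indL2 (measurableSet_side ς) (mulL2 μ g F), coeFn_indL2 (measurableSet_side ς) F]
    with z h1 h2 h3 h4
  rw [h1, h3, h4]
  by_cases hz : z ∈ side ς
  · rw [Set.indicator_of_mem hz, Set.indicator_of_mem hz, h2]
  · rw [Set.indicator_of_notMem hz, Set.indicator_of_notMem hz, mul_zero]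

theorem ae_im_ne_zero : ∀ᵐ z : Circle ∂arcMeasure, (z : ℂ).im ≠ 0 := by
  refine ae_arcMeasure_iff.2 ?_
  have hfin : ∀ᵐ t ∂(volume.restrict (Set.Ioc (-Real.pi) Real.pi)),
      t ∉ ({0, Real.pi} : Set ℝ) :=
    ae_restrict_of_ae (Set.Countable.ae_notMem (Set.toFinite _).countable _)
  filter_upwards [hfin, ae_restrict_mem measurableSet_Ioc] with t hn ht
  simp only [Set.mem_insert_iff, Set.mem_singleton_iff, not_or] at hn
  rw [im_circleExp]
  rcases lt_or_gt_of_ne hn.1 with h | h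
  · exact (Real.sin_neg_of_neg_of_neg_pi_lt h ht.1).ne
  · exact (Real.sin_pos_of_pos_of_lt_pi h (lt_of_le_of_ne ht.2 hn.2)).ne'

theorem indL2_side_add (hς : ς = 1 ∨ ς = -1) (F : Lp ℂ 2 arcMeasure) :
    indL2 arcMeasure (measurableSet_side ς) F +
      indL2 arcMeasure (measurableSet_side (-ς)) F = F := by
  apply Lp.ext
  filter_upwards [ae_im_ne_zero, coeFn_indL2 (measurableSet_side ς) F,
    coeFn_indL2 (measurableSet_side (-ς)) F,
    Lp.coeFn_add (indL2 arcMeasure (measurableSet_side ς) F)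
      (indL2 arcMeasure (measurableSet_side (-ς)) F)] with z h1 h2 h3 h4
  have h5 : ς * (z : ℂ).im ≠ 0 := mul_ne_zero (by rcases hς with rfl | rfl <;> norm_num) h1
  have h6 : (-ς) * (z : ℂ).im = -(ς * (z : ℂ).im) := by ring
  rw [h4, Pi.add_apply, h2, h3]
  by_cases hz : z ∈ side ς
  · have hz' := notMem_side_neg hz
    rw [Set.indicator_of_mem hz, Set.indicator_of_notMem hz', add_zero]
  · have hz' : z ∈ side (-ς) := by
      simp only [side, Set.mem_ofPred_eq, not_lt] at hz ⊢
      rw [h6]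
      exact neg_pos.2 (lt_of_le_of_ne hz h5)
    rw [Set.indicator_of_notMem hz, Set.indicator_of_mem hz', zero_add]

/-- A function supported on one side with vanishing sine coefficients is zero: its odd part
vanishes, so it is even. -/
theorem eq_zero_of_freeS_eq_zero {F : Lp ℂ 2 arcMeasure}
    (h1 : indL2 arcMeasure (measurableSet_side ς) F = F) (h2 : freeS F = 0) : F = 0 := by
  set R := reflect map_inv_arcMeasure with hR
  have hRR : R (R F) = F := by
    apply Lp.ext
    filter_upwards [coeFn_reflect map_inv_arcMeasure (R F),
      ae_inv map_inv_arcMeasure (coeFn_reflect map_inv_arcMeasure F)] with z h3 h4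
    rw [hR, h3, h4, inv_inv]
  have hodd : F - R F = 0 := by
    have h3 : freeS (F - R F) = 0 := by rw [map_sub, hR, freeS_reflect, h2, neg_zero, sub_zero]
    have h4 : ∀ m : ℤ, inner ℂ (cL2 arcMeasure (mono (-m))) (F - R F) =
        -inner ℂ (cL2 arcMeasure (mono m)) (F - R F) := fun m => by
      have := R.inner_map_map (cL2 arcMeasure (mono m)) (F - R F)
      rw [map_sub, hRR, hR, reflect_mono, ← hR, ← neg_sub F (R F), inner_neg_right] at this
      rw [← this, neg_neg]
    have h5 : ∀ n : ℕ, inner ℂ (cL2 arcMeasure (mono (n + 1))) (F - R F) = 0 := fun n => by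
      have h6 := freeS_apply_eq (F - R F) n
      rw [h3, h4 (n + 1), sub_neg_eq_add, ← two_mul] at h6
      have h7 : (Real.sqrt 2 / 2 : ℂ) * Complex.I ≠ 0 := by simp
      have h8 := (mul_eq_zero.1 h6.symm).resolve_left h7
      exact (mul_eq_zero.1 h8).resolve_left two_ne_zero
    refine L2_eq_zero_of_moments fun m => ?_
    rcases lt_trichotomy m 0 with h | h | h
    · have h6 := h4 (-m)
      obtain ⟨n, hn⟩ : ∃ n : ℕ, -m = n + 1 := ⟨(-m - 1).toNat, by omega⟩
      rwa [neg_neg, hn, h5, neg_zero] at h6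
    · have h6 := h4 0
      rw [neg_zero] at h6
      rw [h]
      exact CharZero.eq_neg_self_iff.1 h6
    · obtain ⟨n, hn⟩ : ∃ n : ℕ, m = n + 1 := ⟨(m - 1).toNat, by omega⟩
      rw [hn, h5]
  have h3 : R (indL2 arcMeasure (measurableSet_side ς) F) = 0 := by
    rw [hR, reflect_indL2_side, ← hR, ← sub_eq_zero.1 hodd, ← h1]
    have := indL2_side_indL2_side_neg (μ := arcMeasure) (ς := -ς) F
    rwa [neg_neg] at this
  rw [h1] at h3
  exact (map_eq_zero_iff _ R.injective).1 h3

end Sides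

section Range
variable {σ : Measure Circle} [IsProbabilityMeasure σ] {Ψ : Lp ℂ 2 σ} {W : L2Seq →ₗᵢ[ℂ] Lp ℂ 2 σ}
  {B : ℝ}

/-- The range of multiplication by `Ψ` consists of the functions that vanish where `Ψ` does. -/
theorem exists_limitMul_eq {σ : Measure Circle} {Ψ : Lp ℂ 2 σ}
    (h : σ.withDensity (fun z => ENNReal.ofReal (‖Ψ z‖ ^ 2)) = arcMeasure) {G : Lp ℂ 2 σ}
    (hG : ∀ᵐ z ∂σ, Ψ z = 0 → G z = 0) : ∃ F, limitMul h F = G := by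
  have hm : Measurable fun z => G z / Ψ z :=
    (Lp.stronglyMeasurable G).measurable.div (Lp.stronglyMeasurable Ψ).measurable
  have hae : (fun z => Ψ z * (G z / Ψ z)) =ᵐ[σ] G := by
    filter_upwards [hG] with z hz
    by_cases h0 : Ψ z = 0
    · rw [h0, hz h0, zero_mul]
    · exact mul_div_cancel₀ _ h0
  have hmem : MemLp (fun z => G z / Ψ z) 2 arcMeasure := by
    refine ⟨hm.aestronglyMeasurable, ?_⟩
    rw [← eLpNorm_limit_mul h hm, eLpNorm_congr_ae hae]
    exact (Lp.memLp G).2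
  refine ⟨hmem.toLp _, Lp.ext ?_⟩
  exact (coeFn_limitMul_of_ae h hmem.coeFn_toLp).trans hae

theorem limitMul_ae_eq_zero {σ : Measure Circle} {Ψ : Lp ℂ 2 σ}
    (h : σ.withDensity (fun z => ENNReal.ofReal (‖Ψ z‖ ^ 2)) = arcMeasure) (F : Lp ℂ 2 arcMeasure) :
    ∀ᵐ z ∂σ, Ψ z = 0 → limitMul h F z = 0 := by
  filter_upwards [coeFn_limitMul h F] with z h1 h2
  rw [h1, h2, zero_mul]

theorem waveLimit_ae_eq_zero (hM : HalfModel σ Ψ W B) (ς : ℝ) (f : Lp ℂ 2 arcMeasure) :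
    ∀ᵐ z ∂σ, Ψ z = 0 → waveLimit hM ς f z = 0 := by
  set P := limitMul hM.density (indL2 arcMeasure (measurableSet_side ς)
    (mulL2 arcMeasure (mono 1) f)) with hP
  set Q := limitMul hM.density (indL2 arcMeasure (measurableSet_side (-ς))
    (mulL2 arcMeasure (mono 1) (conjL2 arcMeasure f))) with hQ
  filter_upwards [Lp.coeFn_smul (-Complex.I) (P - conjL2 σ Q), Lp.coeFn_sub P (conjL2 σ Q),
    coeFn_conjL2 Q, limitMul_ae_eq_zero hM.density (indL2 arcMeasure (measurableSet_side ς)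
    (mulL2 arcMeasure (mono 1) f)), limitMul_ae_eq_zero hM.density
      (indL2 arcMeasure (measurableSet_side (-ς))
    (mulL2 arcMeasure (mono 1) (conjL2 arcMeasure f)))] with z h1 h2 h3 h4 h5 h0
  rw [waveLimit, ← hP, ← hQ, h1, Pi.smul_apply, h2, Pi.sub_apply, h3, hP, h4 h0, hQ, h5 h0]
  simp

theorem indL2_side_waveLimit (hM : HalfModel σ Ψ W B) (ς : ℝ) (f : Lp ℂ 2 arcMeasure) :
    indL2 σ (measurableSet_side ς) (waveLimit hM ς f) = (-Complex.I) • limitMul hM.density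
      (indL2 arcMeasure (measurableSet_side ς) (mulL2 arcMeasure (mono 1) f)) := by
  rw [waveLimit, map_smul, map_sub, ← conjL2_indL2_side, ← limitMul_indL2, ← limitMul_indL2,
    indL2_side_indL2_side, indL2_side_indL2_side_neg, map_zero, map_zero, sub_zero]

theorem waveLimit_eq_add (hM : HalfModel σ Ψ W B) (ς : ℝ) (f : Lp ℂ 2 arcMeasure) :
    waveLimit hM ς f = indL2 σ (measurableSet_side ς) (waveLimit hM ς f) +
      indL2 σ (measurableSet_side (-ς)) (waveLimit hM ς f) := by
  have h : ∀ F : Lp ℂ 2 arcMeasure, indL2 arcMeasure (measurableSet_side (-ς))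
      (indL2 arcMeasure (measurableSet_side ς) F) = 0 := fun F => by
    have := indL2_side_indL2_side_neg (μ := arcMeasure) (ς := -ς) F
    rwa [neg_neg] at this
  rw [indL2_side_waveLimit, waveLimit, map_smul, map_sub, ← conjL2_indL2_side, ← limitMul_indL2,
    ← limitMul_indL2, indL2_side_indL2_side, h, map_zero, zero_sub, ← smul_add, ← sub_eq_add_neg]

/-- The wave operator is onto the functions that vanish where `Ψ` does: among the even ones only
zero is orthogonal to its range. -/
theorem eq_zero_of_inner_waveLimit (hM : HalfModel σ Ψ W B) (hev : σ.map (fun z => z⁻¹) = σ)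
    {ς : ℝ} (hς : ς = 1 ∨ ς = -1) {G : Lp ℂ 2 σ} (hG : ∀ᵐ z ∂σ, Ψ z = 0 → G z = 0)
    (hGe : reflect hev G = G)
    (hwe : ∀ ψ, reflect hev (waveLimit hM ς (freeU ψ)) = waveLimit hM ς (freeU ψ))
    (h0 : ∀ ψ, inner ℂ (waveLimit hM ς (freeU ψ)) G = 0) : G = 0 := by
  obtain ⟨k, rfl⟩ := exists_limitMul_eq hM.density hG
  have h1 : ∀ ψ, inner ℂ (freeU ψ) (mulL2 arcMeasure (mono (-1))
      (indL2 arcMeasure (measurableSet_side ς) k)) = 0 := fun ψ => by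
    set w := waveLimit hM ς (freeU ψ) with hw
    have h2 : inner ℂ (indL2 σ (measurableSet_side (-ς)) w) (limitMul hM.density k) =
        inner ℂ (indL2 σ (measurableSet_side ς) w) (limitMul hM.density k) := by
      have h3 := (reflect hev).inner_map_map (indL2 σ (measurableSet_side ς) w)
        (limitMul hM.density k)
      rwa [reflect_indL2_side, hGe, hwe] at h3
    have h3 := h0 ψ
    rw [waveLimit_eq_add, inner_add_left, ← hw, h2, ← two_mul, hw, indL2_side_waveLimit,
      inner_smul_left, (limitMul hM.density).inner_map_map] at h3
    have h4 := (mul_eq_zero.1 ((mul_eq_zero.1 h3).resolve_left two_ne_zero)).resolve_left (by simp)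
    rw [← star_mono, ← inner_mulL2_left, ← inner_indL2_left]
    exact h4
  have h2 : freeS (mulL2 arcMeasure (mono (-1)) (indL2 arcMeasure (measurableSet_side ς) k)) = 0 :=
    ext_inner_left ℂ fun ψ => by rw [inner_freeS, h1, inner_zero_right]
  have h3 := eq_zero_of_freeS_eq_zero (ς := ς) (by rw [mulL2_indL2_side, indL2_side_indL2_side]) h2
  have h4 : indL2 arcMeasure (measurableSet_side ς) k = 0 := by
    apply Lp.eq_zero_iff_ae_eq_zero.2
    filter_upwards [coeFn_mulL2 (mono (-1)) (indL2 arcMeasure (measurableSet_side ς) k),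
      Lp.eq_zero_iff_ae_eq_zero.1 h3] with z h5 h6
    rw [h5, mono_apply] at h6
    exact (mul_eq_zero.1 h6).resolve_left (zpow_ne_zero _ (Circle.coe_ne_zero z))
  have h5 : indL2 arcMeasure (measurableSet_side (-ς)) k = 0 := by
    rw [← map_eq_zero_iff _ (limitMul hM.density).injective, limitMul_indL2, ← hGe,
      ← reflect_indL2_side,
      ← limitMul_indL2, h4, map_zero, map_zero]
  rw [← indL2_side_add hς k, h4, h5, add_zero, map_zero]

end Range

/-! ### The absolutely continuous subspace -/

theorem measurable_re_circle : Measurable fun z : Circle => (z : ℂ).re :=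
  Continuous.measurable (by fun_prop)

theorem map_re_arcMeasure_ac :
    arcMeasure.map (fun z : Circle => (z : ℂ).re) ≪ (volume : Measure ℝ) := by
  refine Measure.AbsolutelyContinuous.mk fun s hs h0 => ?_
  rw [Measure.map_apply measurable_re_circle hs, measure_eq_zero_iff_ae_notMem]
  refine ae_arcMeasure_iff.2 ?_
  set V := Real.arccos '' (s ∩ Set.Ioo (-1) 1) with hV
  have hV0 : volume V = 0 := addHaar_image_eq_zero_of_differentiableOn_of_addHaar_eq_zero _
    (fun x hx => (Real.differentiableAt_arccos.2 ⟨hx.2.1.ne', hx.2.2.ne⟩).differentiableWithinAt)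
    (measure_mono_null Set.inter_subset_left h0)
  have hV1 : volume ((fun t => -t) '' V) = 0 :=
    addHaar_image_eq_zero_of_differentiableOn_of_addHaar_eq_zero _
      differentiable_neg.differentiableOn
      hV0
  filter_upwards [ae_arcMeasure_iff.1 ae_im_ne_zero, ae_restrict_mem measurableSet_Ioc,
    ae_restrict_of_ae (measure_eq_zero_iff_ae_notMem.1 hV0),
    ae_restrict_of_ae (measure_eq_zero_iff_ae_notMem.1 hV1)] with t hsin ht h1 h2 h3
  rw [im_circleExp] at hsin
  rw [Set.mem_preimage, re_circleExp] at h3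
  have hcos : Real.cos t ∈ Set.Ioo (-1 : ℝ) 1 := by
    have h4 : 0 < Real.sin t ^ 2 := by positivity
    have h5 := Real.sin_sq_add_cos_sq t
    exact abs_lt.1 ((sq_lt_one_iff_abs_lt_one _).1 (by linarith))
  rcases le_total 0 t with h | h
  · exact h1 ⟨_, ⟨h3, hcos⟩, Real.arccos_cos h ht.2⟩
  · refine h2 ⟨-t, ⟨_, ⟨h3, hcos⟩, ?_⟩, neg_neg t⟩
    rw [← Real.cos_neg, Real.arccos_cos (by linarith) (by linarith [ht.1])]

theorem volume_arccos_preimage_eq_zero {N : Set Circle} (h : arcMeasure N = 0) :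
    volume {x | x ∈ Set.Icc (-1 : ℝ) 1 ∧ Circle.exp (Real.arccos x) ∈ N} = 0 := by
  have h1 := (ae_restrict_iff' measurableSet_Ioc).1
    (ae_arcMeasure_iff.1 (measure_eq_zero_iff_ae_notMem.1 h))
  have h2 : volume {t | ¬(t ∈ Set.Ioc (-Real.pi) Real.pi → Circle.exp t ∉ N)} = 0 := ae_iff.1 h1
  refine measure_mono_null ?_ (addHaar_image_eq_zero_of_differentiableOn_of_addHaar_eq_zero _
    Real.differentiable_cos.differentiableOn h2)
  rintro x ⟨hx, hN⟩
  refine ⟨Real.arccos x, fun h3 => h3 ⟨?_, Real.arccos_le_pi x⟩ hN, Real.cos_arccos hx.1 hx.2⟩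
  linarith [Real.arccos_nonneg x, Real.pi_pos]

theorem exp_arccos_re (z : Circle) :
    Circle.exp (Real.arccos (z : ℂ).re) = z ∨ Circle.exp (Real.arccos (z : ℂ).re) = z⁻¹ := by
  have h : (z : ℂ).re = Real.cos (Complex.arg (z : ℂ)) := by
    rw [← re_circleExp, Circle.exp_arg]
  have h1 := Complex.neg_pi_lt_arg (z : ℂ)
  have h2 := Complex.arg_le_pi (z : ℂ)
  rcases le_total 0 (Complex.arg (z : ℂ)) with h3 | h3
  · left
    rw [h, Real.arccos_cos h3 h2, Circle.exp_arg]
  · right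
    rw [h, ← Real.cos_neg, Real.arccos_cos (by linarith) (by linarith), Circle.exp_neg,
      Circle.exp_arg]

section AC
variable {σ : Measure Circle} [IsProbabilityMeasure σ] {Ψ : Lp ℂ 2 σ} {W : L2Seq →ₗᵢ[ℂ] Lp ℂ 2 σ}
  {B : ℝ} {J : JacobiParams} {U : L2Seq →ₗᵢ[ℂ] Lp ℂ 2 σ}

/-- The set `{Ψ = 0}` carries the singular part of `σ`, and vectors of the absolutely continuous
subspace are those whose transform vanishes there. -/
theorem HalfModel.mem_acSubspace_iff (hM : HalfModel σ Ψ W B) (hU : IsTransform J σ U) (ψ : L2Seq) :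
    ψ ∈ acSubspace J.op ↔ ∀ᵐ z ∂σ, Ψ z = 0 → U ψ z = 0 := by
  have hre := measurable_re_circle
  have hg := measurable_ofReal_norm_sq (U ψ)
  have hg0 : ∀ z, ENNReal.ofReal (‖U ψ z‖ ^ 2) ≠ 0 ↔ U ψ z ≠ 0 := fun z => by
    rw [Ne, ENNReal.ofReal_eq_zero, not_le]
    exact ⟨fun h h0 => by simp [h0] at h, fun h => by positivity⟩
  change spectralMeasure J.op ψ ≪ volume ↔ _
  rw [spectralMeasure_eq_map J.op_isSelfAdjoint hU.op_apply]
  constructor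
  · intro h
    set N : Set Circle := {z | Ψ z = 0 ∨ Ψ z⁻¹ = 0} with hN
    have hΨ := (Lp.stronglyMeasurable Ψ).measurable
    have hNm : MeasurableSet N := (hΨ (measurableSet_singleton 0)).union
      ((hΨ.comp continuous_inv.measurable) (measurableSet_singleton 0))
    have hN0 : arcMeasure N = 0 := by
      rw [measure_eq_zero_iff_ae_notMem]
      filter_upwards [ae_limit_ne_zero hM.density,
        ae_inv map_inv_arcMeasure (ae_limit_ne_zero hM.density)] with z h1 h2
      exact not_or.2 ⟨h1, h2⟩
    have hB := measure_eq_zero_iff_ae_notMem.1 (h (volume_arccos_preimage_eq_zero hN0))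
    have hB' := (ae_withDensity_iff hg).1 (ae_of_ae_map hre.aemeasurable hB)
    filter_upwards [hB'] with z h1 h2
    by_contra h3
    refine h1 ((hg0 z).2 h3) ⟨abs_le.1 ((Complex.abs_re_le_norm _).trans (Circle.norm_coe z).le),
      ?_⟩
    rcases exp_arccos_re z with h4 | h4
    · rw [h4]
      exact Or.inl h2
    · rw [h4]
      exact Or.inr (by rwa [inv_inv])
  · intro h
    refine (Measure.AbsolutelyContinuous.map ?_ hre).trans map_re_arcMeasure_ac
    refine Measure.AbsolutelyContinuous.mk fun s _ h0 => ?_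
    rw [measure_eq_zero_iff_ae_notMem, ae_withDensity_iff hg]
    filter_upwards [h, ae_of_ae_arcMeasure hM.density (measure_eq_zero_iff_ae_notMem.1 h0)]
      with z h1 h2 h3
    exact h2 fun h4 => (hg0 z).1 h3 (h1 h4)

/-- Existence and completeness of the wave operator in the direction `ς`. -/
theorem HalfModel.exists_waveOperator (hM : HalfModel σ Ψ W B) (hev : σ.map (fun z => z⁻¹) = σ)
    {ς : ℝ} (hς : ς = 1 ∨ ς = -1) (hU : IsTransform J σ U) {c : ℕ → ℝ}
    (hc : ∃ C, ∀ n, |c n| ≤ C) (hct : Tendsto c atTop (𝓝 (Real.sqrt 2)⁻¹))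
    (hdec : ∀ ψ, U ψ = W (diagOp c hc ψ) + conjIsometry W (diagOp c hc ψ)) :
    ∃ Ω : L2Seq →L[ℂ] L2Seq, (∀ ψ, Tendsto (fun s : ℝ => evolution J.op (-(ς * s))
      (evolution freeJacobi.op (ς * s) ψ)) atTop (𝓝 (Ω ψ))) ∧ Set.range Ω = acSubspace J.op := by
  set E : ℝ → L2Seq →L[ℂ] L2Seq := fun s =>
    evolution J.op (-(ς * s)) ∘L evolution freeJacobi.op (ς * s) with hE
  have hlim : ∀ ψ, Tendsto (fun s => U (E s ψ)) atTop (𝓝 (waveLimit hM ς (freeU ψ))) :=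
    hM.tendsto_transform hς hU hc hct hdec
  have hmem : ∀ ψ, ∃ φ, U φ = waveLimit hM ς (freeU ψ) := fun ψ =>
    U.isometry.isClosedEmbedding.isClosed_range.mem_of_tendsto (hlim ψ)
      (.of_forall fun s => ⟨_, rfl⟩)
  choose O hO using hmem
  have hlim' : ∀ ψ, Tendsto (fun s => E s ψ) atTop (𝓝 (O ψ)) := fun ψ => by
    rw [U.isometry.isEmbedding.tendsto_nhds_iff, hO]
    exact hlim ψ
  have hnorm : ∀ s ψ, ‖E s ψ‖ = ‖ψ‖ := fun s ψ => by
    have h1 : ∀ t φ, ‖evolution J.op t φ‖ = ‖φ‖ := fun t φ => by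
      rw [← U.norm_map, hU.evolution_apply]
      exact (norm_waveOp _ _).trans (U.norm_map _)
    have h2 : ∀ t φ, freeU (evolution freeJacobi.op t φ) = waveOp arcMeasure t (freeU φ) :=
      fun t φ => intertwine_exp (U := freeU.toContinuousLinearMap) freeU_op _ φ
    rw [hE, ContinuousLinearMap.comp_apply, h1, ← freeU.norm_map, h2, norm_waveOp, freeU.norm_map]
  let Ω : L2Seq →ₗᵢ[ℂ] L2Seq :=
    { linearMapOfTendsto O (fun s => (E s).toLinearMap) (tendsto_pi_nhds.2 hlim') with
      norm_map' := fun ψ => tendsto_nhds_unique (hlim' ψ).norm (by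
        simp only [hnorm]
        exact tendsto_const_nhds) }
  have hΩ : ∀ ψ, U (Ω ψ) = waveLimit hM ς (freeU ψ) := hO
  refine ⟨Ω.toContinuousLinearMap, hlim', ?_⟩
  ext ψ
  rw [hM.mem_acSubspace_iff hU]
  constructor
  · rintro ⟨φ, rfl⟩
    exact (congrArg (fun F : Lp ℂ 2 σ => ∀ᵐ z ∂σ, Ψ z = 0 → F z = 0) (hΩ φ)).mpr
      (waveLimit_ae_eq_zero hM ς _)
  · intro h
    -- The component of `ψ` orthogonal to the range is absolutely continuous as well.
    set η := ContinuousLinearMap.adjoint Ω.toContinuousLinearMap ψ with hη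
    set χ := ψ - Ω η with hχ
    have horth : ∀ φ, inner ℂ (Ω φ) χ = 0 := fun φ => by
      rw [hχ, inner_sub_right, Ω.inner_map_map, hη, ContinuousLinearMap.adjoint_inner_right]
      exact sub_self _
    have hχ0 : ∀ᵐ z ∂σ, Ψ z = 0 → U χ z = 0 := by
      rw [hχ, map_sub, hΩ]
      filter_upwards [h, waveLimit_ae_eq_zero hM ς (freeU η),
        Lp.coeFn_sub (U ψ) (waveLimit hM ς (freeU η))] with z h1 h2 h3 h4
      rw [h3, Pi.sub_apply, h1 h4, h2 h4, sub_zero]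
    have hU0 : U χ = 0 := eq_zero_of_inner_waveLimit hM hev hς hχ0 (hU.reflect hev χ)
      (fun φ => by rw [← hΩ, hU.reflect]) fun φ => by rw [← hΩ, U.inner_map_map, horth]
    have h1 : χ = 0 := (map_eq_zero_iff _ U.injective).1 hU0
    exact ⟨η, (sub_eq_zero.1 h1).symm⟩

end AC

theorem exists_halfModel {σ : Measure Circle} [IsProbabilityMeasure σ] (hs : SzegoClass σ)
    (hpca : PCA σ) : ∃ (Ψ : Lp ℂ 2 σ) (W : L2Seq →ₗᵢ[ℂ] Lp ℂ 2 σ) (B : ℝ),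
      HalfModel σ Ψ W B ∧ Tendsto (starVec σ 0) atTop (𝓝 Ψ) := by
  have hσ := hs.nonDegenerate
  obtain ⟨B, hB⟩ := exists_tendsto_lam hσ hs.bddAbove_lam
  obtain ⟨Ψ, hΨ⟩ := exists_tendsto_starVec hσ hs.bddAbove_lam
  obtain ⟨W, hW⟩ := exists_halfTransform hσ
  exact ⟨Ψ, W, B, ⟨hσ, hB, hW, withDensity_limit hσ hs.bddAbove_lam hΨ,
    hpca.ae_tendsto hΨ hs.arcMeasure_ac⟩, hΨ⟩

theorem exists_isWaveOperator {J : JacobiParams} (hJ : J.rho (Set.Icc (-1) 1)ᶜ = 0)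
    (hs : SzegoClass (szegoInv J.rho)) (hpca : PCA (szegoInv J.rho)) :
    (∃ Ω : L2Seq →L[ℂ] L2Seq, IsWaveOperator J.op freeJacobi.op atTop Ω ∧
      Set.range Ω = acSubspace J.op) ∧
    (∃ Ω : L2Seq →L[ℂ] L2Seq, IsWaveOperator J.op freeJacobi.op atBot Ω ∧
      Set.range Ω = acSubspace J.op) := by
  have := isProbabilityMeasure_rho hJ
  have : IsProbabilityMeasure (szegoInv J.rho) := isProbabilityMeasure_szegoInv
  have hev := map_inv_szegoInv J.rho
  obtain ⟨Ψ, W, B, hM, hΨ⟩ := exists_halfModel hs hpca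
  obtain ⟨U, hU⟩ := exists_isTransform hJ
  obtain ⟨c, hc, hct, hdec⟩ := hU.exists_decomposition hev hM.nonDegenerate hΨ hM.half
  constructor
  · obtain ⟨Ω, h1, h2⟩ := hM.exists_waveOperator hev (Or.inl rfl) hU hc hct hdec
    refine ⟨Ω, fun ψ => ?_, h2⟩
    simpa using h1 ψ
  · obtain ⟨Ω, h1, h2⟩ := hM.exists_waveOperator hev (Or.inr rfl) hU hc hct hdec
    refine ⟨Ω, fun ψ => ?_, h2⟩
    simpa [Function.comp_def] using (h1 ψ).comp tendsto_neg_atBot_atTop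

end WaveOPUC

theorem mainTheorem6 :
    (∀ σ : MeasureTheory.Measure Circle, MeasureTheory.IsProbabilityMeasure σ →
      WaveOPUC.SzegoClass σ → WaveOPUC.PCA σ →
      ∀ E : Set Circle, WaveOPUC.IsACCarrier σ E →
      ∀ h : ℝ → ℝ, WaveOPUC.IsProfile h →
      ∀ f : ℕ → ℕ → ℂ, (∃ C : ℝ, ∀ κ j : ℕ, j < κ → ‖f j κ‖ ≤ C) →
        WaveOPUC.LocalizedConvergence σ E h f) ∧
    (∀ J : WaveOPUC.JacobiParams,
      J.rho (Set.Icc (-1) 1)ᶜ = 0 →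
      WaveOPUC.SzegoClass (WaveOPUC.szegoInv J.rho) →
      WaveOPUC.PCA (WaveOPUC.szegoInv J.rho) →
      (∃ Ω : WaveOPUC.L2Seq →L[ℂ] WaveOPUC.L2Seq,
        WaveOPUC.IsWaveOperator J.op WaveOPUC.freeJacobi.op Filter.atTop Ω ∧
        Set.range Ω = WaveOPUC.acSubspace J.op) ∧
      (∃ Ω : WaveOPUC.L2Seq →L[ℂ] WaveOPUC.L2Seq,
        WaveOPUC.IsWaveOperator J.op WaveOPUC.freeJacobi.op Filter.atBot Ω ∧
        Set.range Ω = WaveOPUC.acSubspace J.op)) := by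
  refine ⟨fun σ hσ hs hpca E hE h hh f hf => WaveOPUC.localizedConvergence hs hpca hE hh hf,
    fun J hJ hs hpca => WaveOPUC.exists_isWaveOperator hJ hs hpca⟩
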